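/- Let $m\ge 1$, $n\ge 0$, $K=\mathbb C(q^{1/2})$, $N=m+n$, $\zeta=q^{2m-2n-1}$. Let $\varepsilon_1,\dots,\varepsilon_N$ be an orthogonal basis with $d_a=(\varepsilon_a,\varepsilon_a)=-1$ and $\varepsilon_a$ odd for $a\le n$, $d_a=1$ and $\varepsilon_a$ even for $n<a\le N$; $\varepsilon_{N+1}=0$. Put $\alpha_i=\varepsilon_i-\varepsilon_{i+1}$ ($1\le i\le N$; these are the simple roots of $\mathfrak{osp}(2m+1|2n)$, and only $\alpha_n$ is odd), $\nu_i=d_1+\dots+d_i$, $A_{ij}=(\alpha_i,\alpha_j)$ for $i<N$, $A_{Nj}=2(\alpha_N,\alpha_j)$, $q_i=q^{|(\alpha_i,\alpha_i)|/2}$ if $(\alpha_i,\alpha_i)\ne0$ and $q_i=q$ otherwise, $[k]_i=\frac{q_i^k-q_i^{-k}}{q_i-q_i^{-1}}$. For homogeneous $X,Y$ put $[X,Y]_a=XY-(-1)^{[X][Y]}a\,YX$, $[X,Y]=[X,Y]_1$, and, for products of generators of weights $\alpha,\beta$ (the generators with index $i$ below having weight $\alpha_i$), $[\![X,Y]\!]=[X,Y]_{q^{-(\alpha,\beta)}}$.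 $\mathrm{Sym}$ is the sum over all permutations of the indicated indices. The superalgebra $\mathcal U_q(\hat{\mathfrak g})$, $\hat{\mathfrak g}=\mathfrak{osp}(2m+1|2n)^{(1)}$, is the $K$-superalgebra with generators $x^\pm_{i,k}$ ($k\in\mathbb Z$, parity $[\alpha_i]$), and even generators $a_{i,r}$ ($r\in\mathbb Z\setminus\{0\}$), $k_i^{\pm1}$ ($1\le i\le N$) and the invertible central $q^{\pm c/2}$, with relations $$k_ik_i^{-1}=k_i^{-1}k_i=1,\quad k_ik_j=k_jk_i,\quad k_ia_{j,r}=a_{j,r}k_i,\quad k_ix^\pm_{j,k}k_i^{-1}=q_i^{\pm A_{ij}}x^\pm_{j,k},$$ $$[a_{i,r},a_{j,s}]=\delta_{r,-s}\tfrac{[rA_{ij}]_i}{r}\tfrac{q^{rc}-q^{-rc}}{q_j-q_j^{-1}},\qquad [a_{i,r},x^\pm_{j,k}]=\pm\tfrac{[rA_{ij}]_i}{r}q^{\mp|r|c/2}x^\pm_{j,r+k},$$ $$[x^+_{i,k},x^-_{j,l}]=\delta_{ij}\frac{q^{\frac{k-l}2c}\Phi^+_{i,k+l}-q^{\frac{l-k}2c}\Phi^-_{i,k+l}}{q_i-q_i^{-1}},\quad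 \Phi^\pm_i(z)=\sum_{r\ge0}\Phi^\pm_{i,\pm r}z^{\pm r}=k_i^{\pm1}\exp\Bigl(\pm(q_i-q_i^{-1})\sum_{r>0}a_{i,\pm r}z^{\pm r}\Bigr)$$ (all other $\Phi^\pm_{i,r}$ are $0$), $$[x^\pm_{i,k+1},x^\pm_{j,l}]_{q_i^{\pm A_{ij}}}+(-1)^{[\alpha_i][\alpha_j]}[x^\pm_{j,l+1},x^\pm_{i,k}]_{q_i^{\pm A_{ij}}}=0\ (A_{ij}\ne0),\qquad [x^\pm_{i,k},x^\pm_{j,l}]=0\ (A_{ij}=0),$$ and the Serre relations: (S1) $\mathrm{Sym}_{k_1,k_2}[\![x^\pm_{i,k_1},[\![x^\pm_{i,k_2},x^\pm_{j,l}]\!]]\!]=0$ for $i\ne n,N$, $j=i\pm1$; (S2) $\mathrm{Sym}_{k_1,k_2,k_3}[\![x^\pm_{N,k_1},[\![x^\pm_{N,k_2},[\![x^\pm_{N,k_3},x^\pm_{N-1,l}]\!]]\!]]\!]=0$ if $N\ge2$; (S3) $\mathrm{Sym}_{l_1,l_2}[[\![[\![x^\pm_{n-1,r},x^\pm_{n,l_1}]\!],x^\pm_{n+1,k}]\!],x^\pm_{n,l_2}]=0$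 if $n>1$. Let $g(z)=f(z)(z-q^2)(z-\zeta)$, where $f\in K[[z]]$ is determined by $f(0)=1$ and $f(z)f(z\zeta)=\bigl((1-zq^2)(1-zq^{-2})(1-z\zeta^{-1})(1-z\zeta)\bigr)^{-1}$. Write $z_\pm=zq^{\pm c/2}$. The superalgebra $\mathcal A_q$ is the $K$-superalgebra generated by the invertible central even element $q^{c/2}$, by the coefficients of the even series $h_i^\pm(z)=\sum_{p\ge0}h^\pm_{i,\pm p}z^{\pm p}$ ($1\le i\le N+1$) and of the series $X_j^\pm(z)=\sum_{k\in\mathbb Z}X^\pm_{j,k}z^k$ of parity $[\alpha_j]$ ($1\le j\le N$), with relations $h^+_{i,0}h^-_{i,0}=h^-_{i,0}h^+_{i,0}=1$, $h_i^\pm(z)h_j^\pm(w)=h_j^\pm(w)h_i^\pm(z)$, $$g\bigl((zq^c/w)^{\pm1}\bigr)\,\theta_{ij}(z_\pm,w_\mp)\,h_i^\pm(z)h_j^\mp(w)=g\bigl((zq^{-c}/w)^{\pm1}\bigr)\,\theta_{ij}(z_\mp,w_\pm)\,h_j^\mp(w)h_i^\pm(z)\qquad(i\le j),$$ where $\theta_{ii}(z,w)=\frac{qz-q^{-1}w}{q^{-1}z-qw}$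 for $i\le n$, $\theta_{ii}=1$ for $n<i\le N$, $\theta_{ij}(z,w)=\frac{z-w}{q^{-1}z-qw}$ for $i<j$, $\theta_{N+1,N+1}(z,w)=\frac{(qz-q^{-1}w)(q^{-1/2}z-q^{1/2}w)}{(q^{-1}z-qw)(q^{1/2}z-q^{-1/2}w)}$; $$h_i^\pm(z)X_j^+(w)=\phi_{ij}(z_\pm,w)X_j^+(w)h_i^\pm(z),\qquad h_i^\pm(z)X_j^-(w)=\phi_{ij}(z_\mp,w)^{-1}X_j^-(w)h_i^\pm(z),$$ where $\phi_{ij}(z,w)=\frac{q^{-(\varepsilon_i,\alpha_j)}z-q^{(\varepsilon_i,\alpha_j)}w}{z-w}$ for $i\le N$, $\phi_{N+1,j}=1$ for $j<N$, $\phi_{N+1,N}(z,w)=\frac{(z-q^{-1}w)(q^{-1}z-qw)}{(q^{-1}z-w)(z-w)}$; $$(z-wq^{\pm(\alpha_i,\alpha_j)})X_i^\pm(zq^{-\nu_i})X_j^\pm(wq^{-\nu_j})=(zq^{\pm(\alpha_i,\alpha_j)}-w)X_j^\pm(wq^{-\nu_j})X_i^\pm(zq^{-\nu_i})\quad\text{if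 }(\alpha_i,\alpha_j)\ne0,$$ $$[X_i^\pm(z),X_j^\pm(w)]=0\quad\text{if }(\alpha_i,\alpha_j)=0,$$ $$[X_i^+(z),X_j^-(w)]=\delta_{ij}(q_i-q_i^{-1})\Bigl(\delta\bigl(\tfrac{zq^{-c}}w\bigr)h^+_{i+1}(w_+)h^+_i(w_+)^{-1}-\delta\bigl(\tfrac{zq^c}w\bigr)h^-_{i+1}(z_+)h^-_i(z_+)^{-1}\Bigr),\quad\delta(z)=\sum_{p\in\mathbb Z}z^p,$$ and the Serre relations (S1)–(S3) with $x^\pm_{i,k}$ replaced by $X^\pm_{i,k}$. (Rational functions multiplying products with $h^+(z)$, resp. $h^-(z)$, are expanded at $z=0$, resp. $z=\infty$.) Let $$c^\pm(z)=\prod_{i=1}^n\frac{h_i^\pm(z\zeta q^{2i-2})}{h_i^\pm(z\zeta q^{2i})}\prod_{i=1}^m\frac{h_{n+i}^\pm(zq^{2m-2i+1})}{h_{n+i}^\pm(zq^{2m-2i-1})}\,h_{N+1}^\pm(z)h_{N+1}^\pm(q^{-1}z),$$ and let $\mathfrak C\subset\mathcal A_q$ be the $K$-subalgebra generated by the coefficients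 of $c^+(z)$ and $c^-(z)$ (it is even). Then there is an isomorphism of superalgebras $$\Psi\colon\ \mathcal U_q(\hat{\mathfrak g})\otimes_K\mathfrak C\ \xrightarrow{\ \sim\ }\ \mathcal A_q .$$ It can be chosen so that $\Psi(q^{c/2}\otimes1)=q^{c/2}$, $\Psi(x_i^+(z)\otimes1)=(q_i-q_i^{-1})^{-1}X_i^-(zq^{-\nu_i})$, $\Psi(x_i^-(z)\otimes1)=-(-1)^{[\alpha_i]}(q_i-q_i^{-1})^{-1}X_i^+(zq^{-\nu_i})$, where $x_i^\pm(z)=\sum_kx^\pm_{i,k}z^k$, $\Psi(\Phi_i^\pm(z)\otimes1)=h^\pm_{i+1}(zq^{-\nu_i})h^\pm_i(zq^{-\nu_i})^{-1}$, and $\Psi(1\otimes c^\pm(z))=(h^{\pm}_{N+1,0})^{-1}c^\pm(z)$. Thus $\Psi(u\otimes y)=\tau(u)y$ up to the normalisation of $\mathfrak C$ by the invertible central element $h^+_{N+1,0}$, with $\tau=\Psi(\,\cdot\otimes1)$ the embedding of $\mathcal U_q(\hat{\mathfrak g})$ into $\mathcal A_q$. -/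

import Mathlib

open scoped TensorProduct

noncomputable section

namespace OspAffine

/-! Ground field `K = ℂ(q^{1/2})`. -/

/-- The field of rational functions over `ℂ` in the variable `q^{1/2}`. -/
abbrev K : Type := RatFunc ℂ

/-- The variable `q^{1/2}`. -/
def qHalf : K := RatFunc.X

/-- The parameter `q = (q^{1/2})^2`. -/
def q : K := qHalf ^ 2

/-! Root data of `osp(2m+1|2n)`.  All indices are shifted to start at `0`: the element `i` of
`Fin (m+n)` is the node usually numbered `i+1`, and `eps a` is the vector usually written
`ε_{a+1}`; thus `eps (m+n) = 0`. -/

/-- The lattice spanned by `ε_1, …, ε_{m+n}`. -/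
abbrev Wt (m n : ℕ) : Type := Fin (m + n) → ℤ

/-- `d_{a+1} = (ε_{a+1}, ε_{a+1})`. -/
def dNorm (n a : ℕ) : ℤ := if a < n then -1 else 1

/-- The bilinear form on the lattice. -/
def form {m n : ℕ} (x y : Wt m n) : ℤ := ∑ a : Fin (m + n), dNorm n a * x a * y a

/-- The vector `ε_{a+1}`; it is zero for `a = m+n`. -/
def eps (m n a : ℕ) : Wt m n := fun b => if (b : ℕ) = a then 1 else 0

/-- The simple root `α_{i+1} = ε_{i+1} - ε_{i+2}`; the last one is `ε_{m+n}`. -/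
def root {m n : ℕ} (i : Fin (m + n)) : Wt m n := eps m n i - eps m n (i + 1)

/-- An integer whose class modulo `2` is the parity of a weight: `ε_1, …, ε_n` are odd,
`ε_{n+1}, …, ε_{n+m}` are even. -/
def par {m n : ℕ} (x : Wt m n) : ℤ := ∑ a : Fin (m + n), if (a : ℕ) < n then x a else 0

/-- The sign `(-1)^{[x][y]}`. -/
def superSign {m n : ℕ} (x y : Wt m n) : K := if Even (par x * par y) then 1 else -1

/-- The Cartan matrix: `(α_i, α_j)`, doubled in the last row. -/
def cartan {m n : ℕ} (i j : Fin (m + n)) : ℤ :=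
  if (i : ℕ) + 1 = m + n then 2 * form (root i) (root j) else form (root i) (root j)

/-- `q_i = q^{|(α_i,α_i)|/2}` if `(α_i,α_i) ≠ 0`, and `q_i = q` otherwise. -/
def qNode {m n : ℕ} (i : Fin (m + n)) : K :=
  if form (root i) (root i) = 0 then q else qHalf ^ (form (root i) (root i)).natAbs

/-- The quantum integer `[k]_i`. -/
def qInt {m n : ℕ} (i : Fin (m + n)) (k : ℤ) : K :=
  (qNode i ^ k - qNode i ^ (-k)) / (qNode i - (qNode i)⁻¹)

/-- `ν_{i+1} = d_1 + ⋯ + d_{i+1}`. -/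
def nu (n i : ℕ) : ℤ := ∑ a ∈ Finset.range (i + 1), dNorm n a

/-- `ζ = q^{2m-2n-1}`. -/
def zeta (m n : ℕ) : K := q ^ (2 * (m : ℤ) - 2 * (n : ℤ) - 1)

/-! Elements with a weight, and their (super, and `q`-super) commutators. -/

/-- An element of an algebra together with a weight. -/
structure Weighted (m n : ℕ) (B : Type*) where
  wt : Wt m n
  val : B

/-- `[X, Y] = XY - (-1)^{[X][Y]} YX`. -/
def sBr {m n : ℕ} {B : Type*} [Ring B] [Algebra K B] (X Y : Weighted m n B) : Weighted m n B :=
  ⟨X.wt + Y.wt, X.val * Y.val - superSign X.wt Y.wt • (Y.val * X.val)⟩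

/-- `[[X, Y]] = XY - (-1)^{[X][Y]} q^{-(wt X, wt Y)} YX`. -/
def qBr {m n : ℕ} {B : Type*} [Ring B] [Algebra K B] (X Y : Weighted m n B) : Weighted m n B :=
  ⟨X.wt + Y.wt,
    X.val * Y.val - (superSign X.wt Y.wt * q ^ (-form X.wt Y.wt)) • (Y.val * X.val)⟩

/-! Formal series. -/

/-- The formal exponential of a power series without constant term: powers above the `k`-th do
not contribute to the coefficient of degree `k`. -/
def fExp {B : Type*} [Ring B] [Algebra K B] (S : PowerSeries B) : PowerSeries B :=
  PowerSeries.mk fun k =>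
    ∑ r ∈ Finset.range (k + 1), ((r.factorial : K)⁻¹) • PowerSeries.coeff k (S ^ r)

/-- The coefficients, indexed by all integers, of a power series in the variable `z^ε`. -/
def modes {B : Type*} [Ring B] (ε : ℤˣ) (S : PowerSeries B) (k : ℤ) : B :=
  if 0 ≤ (ε : ℤ) * k then PowerSeries.coeff k.natAbs S else 0

/-- For `S` a power series in `z^ε`, the series obtained by replacing `z` by `c z`. -/
def dilate {B : Type*} [Ring B] [Algebra K B] (ε : ℤˣ) (c : K) (S : PowerSeries B) :
    PowerSeries B :=
  PowerSeries.mk fun p => (c ^ ((ε : ℤ) * (p : ℤ))) • PowerSeries.coeff p S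

/-- The inverse of a power series `S` whose constant term is invertible with inverse `b`. -/
def seriesInv {B : Type*} [Ring B] (b : B) (S : PowerSeries B) : PowerSeries B :=
  PowerSeries.inv.aux b S

/-! Superalgebras given by generators and relations. -/

/-- The even (`p = 0`) or odd (`p = 1`) part of an algebra generated by homogeneous elements
`gen x` of parity `deg x`: the span of the monomials of parity `p`. -/
def superPart {X B : Type*} [Ring B] [Algebra K B] (gen : X → B) (deg : X → ℤ) (p : ZMod 2) :
    Submodule K B :=
  Submodule.span K {b | ∃ L : List X, (((L.map deg).sum : ℤ) : ZMod 2) = p ∧ b = (L.map gen).prod}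

/-! The Drinfeld presentation of the quantum affine superalgebra. -/

/-- Generators `x_{i,k}^ε`, `a_{i,r}` (`r ≠ 0`), `k_i^{±1}`, `q^{±c/2}`. -/
inductive UGen (m n : ℕ) : Type
  | x (ε : ℤˣ) (i : Fin (m + n)) (k : ℤ)
  | a (i : Fin (m + n)) (r : {r : ℤ // r ≠ 0})
  | k (i : Fin (m + n))
  | kInv (i : Fin (m + n))
  | c
  | cInv

/-- The free algebra on the Drinfeld generators. -/
abbrev UFree (m n : ℕ) : Type := FreeAlgebra K (UGen m n)

namespace UFree

def x {m n : ℕ} (ε : ℤˣ) (i : Fin (m + n)) (k : ℤ) : UFree m n := FreeAlgebra.ι K (.x ε i k)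

/-- `a_{i,r}`, with `a_{i,0} = 0`. -/
def a {m n : ℕ} (i : Fin (m + n)) (r : ℤ) : UFree m n :=
  if h : r ≠ 0 then FreeAlgebra.ι K (.a i ⟨r, h⟩) else 0

def k {m n : ℕ} (i : Fin (m + n)) : UFree m n := FreeAlgebra.ι K (.k i)

def kInv {m n : ℕ} (i : Fin (m + n)) : UFree m n := FreeAlgebra.ι K (.kInv i)

/-- `q^{kc/2}`. -/
def cPow {m n : ℕ} (k : ℤ) : UFree m n :=
  if 0 ≤ k then FreeAlgebra.ι K .c ^ k.toNat else FreeAlgebra.ι K .cInv ^ (-k).toNat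

/-- The series `Φ_i^ε(z) = k_i^ε exp(ε (q_i - q_i^{-1}) ∑_{r>0} a_{i,εr} z^{εr})`, as a power
series in `z^ε`. -/
def Phi {m n : ℕ} (ε : ℤˣ) (i : Fin (m + n)) : PowerSeries (UFree m n) :=
  PowerSeries.C (if ε = 1 then k i else kInv i) *
    fExp (PowerSeries.mk fun r =>
      (((ε : ℤ) : K) * (qNode i - (qNode i)⁻¹)) • a i ((ε : ℤ) * (r : ℤ)))

/-- `x_{i,k}^ε` with its weight (up to the sign `ε`, which does not affect parities and
pairings). -/
def xw {m n : ℕ} (ε : ℤˣ) (i : Fin (m + n)) (k : ℤ) : Weighted m n (UFree m n) := ⟨root i, x ε i k⟩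

end UFree

open UFree in
/-- The defining relations of the Drinfeld presentation. -/
inductive URel (m n : ℕ) : UFree m n → UFree m n → Prop
  | c_cInv : URel m n (FreeAlgebra.ι K .c * FreeAlgebra.ι K .cInv) 1
  | cInv_c : URel m n (FreeAlgebra.ι K .cInv * FreeAlgebra.ι K .c) 1
  | c_central (y : UGen m n) :
      URel m n (FreeAlgebra.ι K .c * FreeAlgebra.ι K y) (FreeAlgebra.ι K y * FreeAlgebra.ι K .c)
  | k_kInv (i : Fin (m + n)) : URel m n (k i * kInv i) 1
  | kInv_k (i : Fin (m + n)) : URel m n (kInv i * k i) 1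
  | k_k (i j : Fin (m + n)) : URel m n (k i * k j) (k j * k i)
  | k_a (i j : Fin (m + n)) (r : ℤ) : URel m n (k i * a j r) (a j r * k i)
  | k_x (ε : ℤˣ) (i j : Fin (m + n)) (l : ℤ) :
      URel m n (k i * x ε j l * kInv i) ((qNode i ^ ((ε : ℤ) * cartan i j)) • x ε j l)
  | a_a (i j : Fin (m + n)) (r s : ℤ) (hr : r ≠ 0) (hs : s ≠ 0) :
      URel m n (a i r * a j s - a j s * a i r)
        (if r = -s then
          (qInt i (r * cartan i j) / (r : K) / (qNode j - (qNode j)⁻¹)) •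
            (cPow (2 * r) - cPow (-(2 * r)))
        else 0)
  | a_x (ε : ℤˣ) (i j : Fin (m + n)) (r l : ℤ) (hr : r ≠ 0) :
      URel m n (a i r * x ε j l - x ε j l * a i r)
        ((((ε : ℤ) : K) * (qInt i (r * cartan i j) / (r : K))) •
          (cPow (-((ε : ℤ) * |r|)) * x ε j (r + l)))
  | x_plus_minus (i j : Fin (m + n)) (k l : ℤ) :
      URel m n (sBr (xw 1 i k) (xw (-1) j l)).val
        (if i = j then
          (qNode i - (qNode i)⁻¹)⁻¹ •
            (cPow (k - l) * modes 1 (Phi 1 i) (k + l)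
              - cPow (l - k) * modes (-1) (Phi (-1) i) (k + l))
        else 0)
  | x_x (ε : ℤˣ) (i j : Fin (m + n)) (k l : ℤ) (h : cartan i j ≠ 0) :
      URel m n
        (x ε i (k + 1) * x ε j l
            - (superSign (root i) (root j) * qNode i ^ ((ε : ℤ) * cartan i j)) •
              (x ε j l * x ε i (k + 1))
          + superSign (root i) (root j) •
            (x ε j (l + 1) * x ε i k
              - (superSign (root i) (root j) * qNode i ^ ((ε : ℤ) * cartan i j)) •
                (x ε i k * x ε j (l + 1))))
        0
  | x_x_zero (ε : ℤˣ) (i j : Fin (m + n)) (k l : ℤ) (h : cartan i j = 0) :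
      URel m n (sBr (xw ε i k) (xw ε j l)).val 0
  | serre_two (ε : ℤˣ) (i j : Fin (m + n)) (hn : (i : ℕ) + 1 ≠ n) (hl : (i : ℕ) + 1 ≠ m + n)
      (hij : (j : ℕ) = i + 1 ∨ (j : ℕ) + 1 = i) (k₁ k₂ l : ℤ) :
      URel m n
        ((qBr (xw ε i k₁) (qBr (xw ε i k₂) (xw ε j l))).val
          + (qBr (xw ε i k₂) (qBr (xw ε i k₁) (xw ε j l))).val)
        0
  | serre_three (ε : ℤˣ) (i j : Fin (m + n)) (hi : (i : ℕ) + 1 = m + n) (hj : (j : ℕ) + 1 = i)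
      (k : Fin 3 → ℤ) (l : ℤ) :
      URel m n
        (∑ σ : Equiv.Perm (Fin 3),
          (qBr (xw ε i (k (σ 0))) (qBr (xw ε i (k (σ 1)))
            (qBr (xw ε i (k (σ 2))) (xw ε j l)))).val)
        0
  | serre_four (ε : ℤˣ) (i j i' : Fin (m + n)) (hj : (j : ℕ) + 1 = n) (hi : (i : ℕ) + 1 = j)
      (hi' : (i' : ℕ) = j + 1) (r k l₁ l₂ : ℤ) :
      URel m n
        ((sBr (qBr (qBr (xw ε i r) (xw ε j l₁)) (xw ε i' k)) (xw ε j l₂)).val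
          + (sBr (qBr (qBr (xw ε i r) (xw ε j l₂)) (xw ε i' k)) (xw ε j l₁)).val)
        0

/-- The quantum affine superalgebra of `osp(2m+1|2n)^{(1)}` in the Drinfeld presentation. -/
abbrev Uq (m n : ℕ) : Type := RingQuot (URel m n)

namespace Uq

/-- The projection from the free algebra. -/
def proj (m n : ℕ) : UFree m n →ₐ[K] Uq m n := RingQuot.mkAlgHom K (URel m n)

/-- Parities of the generators. -/
def deg {m n : ℕ} : UGen m n → ℤ
  | .x _ i _ => par (root i)
  | _ => 0

/-- The even and odd parts. -/
def part (m n : ℕ) (p : ZMod 2) : Submodule K (Uq m n) :=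
  superPart (fun y => proj m n (FreeAlgebra.ι K y)) deg p

def x {m n : ℕ} (ε : ℤˣ) (i : Fin (m + n)) (k : ℤ) : Uq m n := proj m n (UFree.x ε i k)

/-- The central element `q^{c/2}`. -/
def c (m n : ℕ) : Uq m n := proj m n (FreeAlgebra.ι K .c)

/-- The coefficient of `z^{εp}` in `Φ_i^ε(z)`. -/
def Phi {m n : ℕ} (ε : ℤˣ) (i : Fin (m + n)) (p : ℕ) : Uq m n :=
  proj m n (PowerSeries.coeff p (UFree.Phi ε i))

end Uq

/-! The function `g(z)`. -/

/-- The power series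
`f(z) = exp(∑_{k≥1} (q^{2k} + q^{-2k} + ζ^k + ζ^{-k}) / (k (1 + ζ^k)) z^k)`, which is the unique
power series over `K` with `f(0) = 1` and
`f(z) f(zζ) (1 - zq^2) (1 - zq^{-2}) (1 - zζ^{-1}) (1 - zζ) = 1`. -/
def fSeries (m n : ℕ) : PowerSeries K :=
  fExp (PowerSeries.mk fun k =>
    if k = 0 then 0 else
      (q ^ (2 * (k : ℤ)) + q ^ (-(2 * (k : ℤ))) + zeta m n ^ (k : ℤ) + zeta m n ^ (-(k : ℤ))) /
        ((k : K) * (1 + zeta m n ^ (k : ℤ))))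

/-- `g(z) = f(z) (z - q^2) (z - ζ)`. -/
def gSeries (m n : ℕ) : PowerSeries K :=
  fSeries m n * (PowerSeries.X - PowerSeries.C (q ^ 2)) *
    (PowerSeries.X - PowerSeries.C (zeta m n))

/-! The superalgebra `A_q`. -/

/-- Generators: `h ε i p` is the coefficient of `z^{εp}` in `h_{i+1}^ε(z)`, `X ε j k` is the
coefficient of `z^k` in `X_{j+1}^ε(z)`, and `c`, `cInv` are `q^{±c/2}`. -/
inductive AGen (m n : ℕ) : Type
  | h (ε : ℤˣ) (i : Fin (m + n + 1)) (p : ℕ)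
  | X (ε : ℤˣ) (j : Fin (m + n)) (k : ℤ)
  | c
  | cInv

/-- The free algebra on these generators. -/
abbrev AFree (m n : ℕ) : Type := FreeAlgebra K (AGen m n)

namespace AFree

/-- `h_i^ε(z)` as a power series in `z^ε`. -/
def hPS {m n : ℕ} (ε : ℤˣ) (i : Fin (m + n + 1)) : PowerSeries (AFree m n) :=
  PowerSeries.mk fun p => FreeAlgebra.ι K (.h ε i p)

/-- All integer modes of `h_i^ε(z)`. -/
def h {m n : ℕ} (ε : ℤˣ) (i : Fin (m + n + 1)) : ℤ → AFree m n := modes ε (hPS ε i)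

/-- All integer modes of `X_j^ε(z)`. -/
def X {m n : ℕ} (ε : ℤˣ) (j : Fin (m + n)) : ℤ → AFree m n := fun k => FreeAlgebra.ι K (.X ε j k)

/-- `q^{kc/2}`. -/
def cPow {m n : ℕ} (k : ℤ) : AFree m n :=
  if 0 ≤ k then FreeAlgebra.ι K .c ^ k.toNat else FreeAlgebra.ι K .cInv ^ (-k).toNat

/-- The modes of `h_{j+1}^ε(z) h_j^ε(z)^{-1}`; the constant term of `h_j^ε(z)` is inverse to that
of `h_j^{-ε}(z)`. -/
def hRatio {m n : ℕ} (ε : ℤˣ) (j : Fin (m + n)) : ℤ → AFree m n :=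
  modes ε (hPS ε j.succ * seriesInv (FreeAlgebra.ι K (.h (-ε) j.castSucc 0)) (hPS ε j.castSucc))

/-- `X_{j,k}^ε` with its weight, up to sign. -/
def Xw {m n : ℕ} (ε : ℤˣ) (j : Fin (m + n)) (k : ℤ) : Weighted m n (AFree m n) :=
  ⟨root j, X ε j k⟩

/-- Formal series `∑ S k l z^k w^l` in two variables. -/
abbrev Ser (m n : ℕ) : Type := ℤ → ℤ → AFree m n

/-- `a(z) b(w)`. -/
def zw {m n : ℕ} (a b : ℤ → AFree m n) : Ser m n := fun k l => a k * b l

/-- `b(w) a(z)`. -/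
def wz {m n : ℕ} (b a : ℤ → AFree m n) : Ser m n := fun k l => b l * a k

/-- Multiplication by `u q^{κc/2} z - v q^{κ'c/2} w`. -/
def lin {m n : ℕ} (u v : K) (κ κ' : ℤ) (S : Ser m n) : Ser m n := fun k l =>
  u • (cPow κ * S (k - 1) l) - v • (cPow κ' * S k (l - 1))

/-- Multiplication by `g((z q^{κc} / w)^ε)` of a series in `z^ε` and `w^{-ε}` (for such a series
the terms with `s > |k|` vanish). -/
def gMul {m n : ℕ} (κ : ℤ) (ε : ℤˣ) (S : Ser m n) : Ser m n := fun k l =>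
  ∑ s ∈ Finset.range (k.natAbs + 1),
    PowerSeries.coeff s (gSeries m n) •
      (cPow (2 * ((ε : ℤ) * κ * (s : ℤ))) * S (k - (ε : ℤ) * (s : ℤ)) (l + (ε : ℤ) * (s : ℤ)))

/-- For `a(z)` with modes `a k`, the modes of `a(u z)`. -/
def shift {m n : ℕ} (u : K) (a : ℤ → AFree m n) : ℤ → AFree m n := fun k => u ^ k • a k

end AFree

open AFree in
/-- The defining relations of `A_q`, mode by mode.  With `z_{±} = z q^{±c/2}`, denominators have
been cleared: a relation `(A/B) S = (C/D) T` between series is written `A D S = C B T`.  This is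
equivalent to reading the quotients as expansions in the region that is forced by the
power series `h_i^{ε}(z)` in `z^ε`, as all the denominators have invertible leading terms there. -/
inductive ARel (m n : ℕ) : AFree m n → AFree m n → Prop
  | c_cInv : ARel m n (FreeAlgebra.ι K .c * FreeAlgebra.ι K .cInv) 1
  | cInv_c : ARel m n (FreeAlgebra.ι K .cInv * FreeAlgebra.ι K .c) 1
  | c_central (y : AGen m n) :
      ARel m n (FreeAlgebra.ι K .c * FreeAlgebra.ι K y) (FreeAlgebra.ι K y * FreeAlgebra.ι K .c)
  | h_zero (ε : ℤˣ) (i : Fin (m + n + 1)) : ARel m n (h ε i 0 * h (-ε) i 0) 1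
  | h_h_same (ε : ℤˣ) (i j : Fin (m + n + 1)) (k l : ℤ) :
      ARel m n (h ε i k * h ε j l) (h ε j l * h ε i k)
  | h_h_odd (ε : ℤˣ) (i : Fin (m + n + 1)) (hi : (i : ℕ) < n) (k l : ℤ) :
      ARel m n
        (lin q q⁻¹ ε (-ε) (lin q⁻¹ q (-ε) ε (gMul 1 ε (zw (h ε i) (h (-ε) i)))) k l)
        (lin q q⁻¹ (-ε) ε (lin q⁻¹ q ε (-ε) (gMul (-1) ε (wz (h (-ε) i) (h ε i)))) k l)
  | h_h_even (ε : ℤˣ) (i : Fin (m + n + 1)) (hi : n ≤ (i : ℕ)) (hi' : (i : ℕ) < m + n) (k l : ℤ) :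
      ARel m n
        (gMul 1 ε (zw (h ε i) (h (-ε) i)) k l)
        (gMul (-1) ε (wz (h (-ε) i) (h ε i)) k l)
  | h_h_lt (ε : ℤˣ) (i j : Fin (m + n + 1)) (hij : i < j) (k l : ℤ) :
      ARel m n
        (lin 1 1 ε (-ε) (lin q⁻¹ q (-ε) ε (gMul 1 ε (zw (h ε i) (h (-ε) j)))) k l)
        (lin 1 1 (-ε) ε (lin q⁻¹ q ε (-ε) (gMul (-1) ε (wz (h (-ε) j) (h ε i)))) k l)
  | h_h_last (ε : ℤˣ) (k l : ℤ) :
      ARel m n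
        (lin q q⁻¹ ε (-ε) (lin qHalf⁻¹ qHalf ε (-ε)
          (lin q⁻¹ q (-ε) ε (lin qHalf qHalf⁻¹ (-ε) ε
            (gMul 1 ε (zw (h ε (Fin.last _)) (h (-ε) (Fin.last _))))))) k l)
        (lin q q⁻¹ (-ε) ε (lin qHalf⁻¹ qHalf (-ε) ε
          (lin q⁻¹ q ε (-ε) (lin qHalf qHalf⁻¹ ε (-ε)
            (gMul (-1) ε (wz (h (-ε) (Fin.last _)) (h ε (Fin.last _))))))) k l)
  | h_X_minus (ε : ℤˣ) (i : Fin (m + n + 1)) (hi : i ≠ Fin.last _) (j : Fin (m + n)) (k l : ℤ) :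
      ARel m n
        (lin (q ^ (-form (eps m n i) (root j))) (q ^ form (eps m n i) (root j)) (-ε) 0
          (zw (h ε i) (X (-1) j)) k l)
        (lin 1 1 (-ε) 0 (wz (X (-1) j) (h ε i)) k l)
  | h_X_plus (ε : ℤˣ) (i : Fin (m + n + 1)) (hi : i ≠ Fin.last _) (j : Fin (m + n)) (k l : ℤ) :
      ARel m n
        (lin 1 1 ε 0 (zw (h ε i) (X 1 j)) k l)
        (lin (q ^ (-form (eps m n i) (root j))) (q ^ form (eps m n i) (root j)) ε 0
          (wz (X 1 j) (h ε i)) k l)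
  | h_last_X_minus (ε : ℤˣ) (j : Fin (m + n)) (hj : (j : ℕ) + 1 = m + n) (k l : ℤ) :
      ARel m n
        (lin 1 q⁻¹ (-ε) 0 (lin q⁻¹ q (-ε) 0 (zw (h ε (Fin.last _)) (X (-1) j))) k l)
        (lin q⁻¹ 1 (-ε) 0 (lin 1 1 (-ε) 0 (wz (X (-1) j) (h ε (Fin.last _)))) k l)
  | h_last_X_plus (ε : ℤˣ) (j : Fin (m + n)) (hj : (j : ℕ) + 1 = m + n) (k l : ℤ) :
      ARel m n
        (lin q⁻¹ 1 ε 0 (lin 1 1 ε 0 (zw (h ε (Fin.last _)) (X 1 j))) k l)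
        (lin 1 q⁻¹ ε 0 (lin q⁻¹ q ε 0 (wz (X 1 j) (h ε (Fin.last _)))) k l)
  | h_last_X_comm (ε ε' : ℤˣ) (j : Fin (m + n)) (hj : (j : ℕ) + 1 ≠ m + n) (k l : ℤ) :
      ARel m n (h ε (Fin.last _) k * X ε' j l) (X ε' j l * h ε (Fin.last _) k)
  | X_X (ε : ℤˣ) (i j : Fin (m + n)) (hij : form (root i) (root j) ≠ 0) (k l : ℤ) :
      ARel m n
        (lin 1 (q ^ ((ε : ℤ) * form (root i) (root j))) 0 0
          (zw (shift (q ^ (-nu n i)) (X ε i)) (shift (q ^ (-nu n j)) (X ε j))) k l)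
        (lin (q ^ ((ε : ℤ) * form (root i) (root j))) 1 0 0
          (wz (shift (q ^ (-nu n j)) (X ε j)) (shift (q ^ (-nu n i)) (X ε i))) k l)
  | X_X_zero (ε : ℤˣ) (i j : Fin (m + n)) (hij : form (root i) (root j) = 0) (k l : ℤ) :
      ARel m n (sBr (Xw ε i k) (Xw ε j l)).val 0
  | X_plus_minus (i j : Fin (m + n)) (k l : ℤ) :
      -- the coefficient of `z^k w^l` in
      -- `(q_i - q_i⁻¹) (δ(z q^{-c} / w) H_i^+(w_+) - δ(z q^c / w) H_i^-(z_+))`, `H_i = h_{i+1} h_i⁻¹`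
      ARel m n (sBr (Xw 1 i k) (Xw (-1) j l)).val
        (if i = j then
          (qNode i - (qNode i)⁻¹) •
            (cPow (l - k) * hRatio 1 i (k + l) - cPow (k - l) * hRatio (-1) i (k + l))
        else 0)
  | serre_two (ε : ℤˣ) (i j : Fin (m + n)) (hn : (i : ℕ) + 1 ≠ n) (hl : (i : ℕ) + 1 ≠ m + n)
      (hij : (j : ℕ) = i + 1 ∨ (j : ℕ) + 1 = i) (k₁ k₂ l : ℤ) :
      ARel m n
        ((qBr (Xw ε i k₁) (qBr (Xw ε i k₂) (Xw ε j l))).val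
          + (qBr (Xw ε i k₂) (qBr (Xw ε i k₁) (Xw ε j l))).val)
        0
  | serre_three (ε : ℤˣ) (i j : Fin (m + n)) (hi : (i : ℕ) + 1 = m + n) (hj : (j : ℕ) + 1 = i)
      (k : Fin 3 → ℤ) (l : ℤ) :
      ARel m n
        (∑ σ : Equiv.Perm (Fin 3),
          (qBr (Xw ε i (k (σ 0))) (qBr (Xw ε i (k (σ 1)))
            (qBr (Xw ε i (k (σ 2))) (Xw ε j l)))).val)
        0
  | serre_four (ε : ℤˣ) (i j i' : Fin (m + n)) (hj : (j : ℕ) + 1 = n) (hi : (i : ℕ) + 1 = j)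
      (hi' : (i' : ℕ) = j + 1) (r k l₁ l₂ : ℤ) :
      ARel m n
        ((sBr (qBr (qBr (Xw ε i r) (Xw ε j l₁)) (Xw ε i' k)) (Xw ε j l₂)).val
          + (sBr (qBr (qBr (Xw ε i r) (Xw ε j l₂)) (Xw ε i' k)) (Xw ε j l₁)).val)
        0

/-- The superalgebra `A_q`. -/
abbrev Aq (m n : ℕ) : Type := RingQuot (ARel m n)

namespace Aq

/-- The projection from the free algebra. -/
def proj (m n : ℕ) : AFree m n →ₐ[K] Aq m n := RingQuot.mkAlgHom K (ARel m n)

/-- Parities of the generators. -/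
def deg {m n : ℕ} : AGen m n → ℤ
  | .X _ j _ => par (root j)
  | _ => 0

/-- The even and odd parts. -/
def part (m n : ℕ) (p : ZMod 2) : Submodule K (Aq m n) :=
  superPart (fun y => proj m n (FreeAlgebra.ι K y)) deg p

/-- The coefficient of `z^{εp}` in `h_{i+1}^ε(z)`. -/
def hCoeff {m n : ℕ} (ε : ℤˣ) (i : Fin (m + n + 1)) (p : ℕ) : Aq m n :=
  proj m n (FreeAlgebra.ι K (.h ε i p))

def X {m n : ℕ} (ε : ℤˣ) (j : Fin (m + n)) (k : ℤ) : Aq m n := proj m n (AFree.X ε j k)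

/-- The central element `q^{c/2}`. -/
def c (m n : ℕ) : Aq m n := proj m n (FreeAlgebra.ι K .c)

/-- `h_{i+1}^ε(z)` as a power series in `z^ε`. -/
def h {m n : ℕ} (ε : ℤˣ) (i : Fin (m + n + 1)) : PowerSeries (Aq m n) :=
  PowerSeries.mk fun p => hCoeff ε i p

/-- `h_{i+1}^ε(z)^{-1}`. -/
def hInv {m n : ℕ} (ε : ℤˣ) (i : Fin (m + n + 1)) : PowerSeries (Aq m n) :=
  seriesInv (hCoeff (-ε) i 0) (h ε i)

/-- The series `c^ε(z)`, the product of
`∏_{i=1}^n h_i^ε(z ζ q^{2i-2}) h_i^ε(z ζ q^{2i})⁻¹`,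
`∏_{i=1}^m h_{n+i}^ε(z q^{2m-2i+1}) h_{n+i}^ε(z q^{2m-2i-1})⁻¹` and
`h_{m+n+1}^ε(z) h_{m+n+1}^ε(q⁻¹ z)`, as a power series in `z^ε`. -/
def cSer (m n : ℕ) (ε : ℤˣ) : PowerSeries (Aq m n) :=
  ((List.finRange n).map fun i : Fin n =>
    dilate ε (zeta m n * q ^ (2 * (i : ℤ))) (h ε ⟨i, by omega⟩) *
      dilate ε (zeta m n * q ^ (2 * (i : ℤ) + 2)) (hInv ε ⟨i, by omega⟩)).prod *
  ((List.finRange m).map fun i : Fin m =>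
    dilate ε (q ^ (2 * (m : ℤ) - 2 * (i : ℤ) - 1)) (h ε ⟨n + i, by omega⟩) *
      dilate ε (q ^ (2 * (m : ℤ) - 2 * (i : ℤ) - 3)) (hInv ε ⟨n + i, by omega⟩)).prod *
  (h ε (Fin.last _) * dilate ε q⁻¹ (h ε (Fin.last _)))

/-- The subalgebra `𝔠` generated by all coefficients of `c^+(z)` and `c^-(z)`. -/
def cAlg (m n : ℕ) : Subalgebra K (Aq m n) :=
  Algebra.adjoin K {b | ∃ (ε : ℤˣ) (p : ℕ), b = PowerSeries.coeff p (cSer m n ε)}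

/-- The coefficient of `z^{εp}` in `c^ε(z)`, as an element of `𝔠`. -/
def cCoeff (m n : ℕ) (ε : ℤˣ) (p : ℕ) : cAlg m n :=
  ⟨PowerSeries.coeff p (cSer m n ε), Algebra.subset_adjoin ⟨ε, p, rfl⟩⟩

end Aq

end OspAffine

end

/-! In characteristic 0 a power series h with invertible constant term and mutually commuting
coefficients is the same thing as its constant term together with its logarithmic derivative l = (z
dh/dz) h⁻¹. In this language all relations that involve the h_i become brackets. The exchange
relations of h_i^± with h_j^∓ are Heisenberg relations, with structure constants `lam` at t = q^r in
degree r. Those of h_i with X_j say that [l_{i,r}, X_{j,k}] is a multiple of a shifted mode of X_j,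
with constants `chi`. The relations of U_q have the same shape, with constants q^{r(α_i,α_j)} -
q^{-r(α_i,α_j)}. The translation rests on `kills_exchange_iff`: an exchange relation is a
first-order linear differential equation in disguise, and such an equation is determined by its
initial value.

From A_q to U_q. The logarithm of Φ_i is the difference l_{i+1} - l_i, with z rescaled by q^{-ν_i}.
The constants match by `chi_succ_sub_chi` and `lam_double_difference`; the series g contributes the
same amount to every pair (i,j), so it disappears from the double differences. This yields τ
(`AData.uData`).

From U_q to A_q. The N+1 logarithms l_i have to be recovered from their N differences, and one
linear combination is missing. It is supplied by c: its logarithmic derivative is ∑ w_i l_i with the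
weights `wt` (`Aq.cSer_eq`). Three facts make this work. By `sum_wt_mul_chi` it commutes with the
X_j. By `sum_wt_mul_lam` it commutes with the l_j; this is where the choice of f enters. And ∑ w_i =
1 + ζ^r (`sum_wt`) does not vanish (`one_add_zeta_zpow_ne_zero`), so the differences and the
weighted sum determine the l_i, while the weighted sum may be prescribed as an arbitrary central
element. Brackets with the l_i are likewise determined by brackets with the differences
(`Extends.bracket_eq`), so the relations of A_q follow from those of U_q (`UData.aData`).

Let `ZRing` be the free commutative algebra on an invertible element, standing for h^+_{N+1,0}, and
on the coefficients of the logarithmic derivatives of c^±. The two constructions give homomorphisms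
between A_q and the tensor product of U_q with `ZRing`, and they are mutually inverse because the
logarithmic data determine everything (`thetaEquiv`).

It remains to compare `ZRing` with 𝔠. The constant term of c^± is the square of that of h^±_{N+1},
so inside A_q the algebra 𝔠 is the image of `ZRing` under squaring the invertible generator.
Squaring is injective, and `ZRing` embeds in A_q because U_q is not zero; hence 𝔠 is again
isomorphic to `ZRing` (`cEquiv`). Transport along this abstract isomorphism replaces the constant
term h² by h, which is the factor (h^±_{N+1,0})⁻¹ in the value of Ψ on c^±. Parity is respected
since both homomorphisms send generators to homogeneous elements of the same parity. -/

noncomputable section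

namespace OspAffine

open PowerSeries Finset

/-! ### Power series over a noncommutative ring and their logarithmic derivatives -/

section Series

variable {B : Type*} [Ring B]

/-- The Euler operator `z d/dz`. -/
def eulerD (f : PowerSeries B) : PowerSeries B := PowerSeries.mk fun p => p • coeff p f

@[simp] theorem coeff_eulerD (f : PowerSeries B) (p : ℕ) : coeff p (eulerD f) = p • coeff p f := by
  simp [eulerD]

theorem eulerD_sub (f g : PowerSeries B) : eulerD (f - g) = eulerD f - eulerD g := by
  ext p; simp [smul_sub]

@[simp] theorem eulerD_C (b : B) : eulerD (C b) = 0 := by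
  ext p
  rcases Nat.eq_zero_or_pos p with rfl | hp
  · simp
  · simp [PowerSeries.coeff_C, hp.ne']

@[simp] theorem eulerD_one : eulerD (1 : PowerSeries B) = 0 := by
  simpa using eulerD_C (1 : B)

theorem eulerD_zero : eulerD (0 : PowerSeries B) = 0 := by
  ext p; simp

theorem eulerD_mul (f g : PowerSeries B) : eulerD (f * g) = eulerD f * g + f * eulerD g := by
  ext p
  simp only [coeff_eulerD, map_add, coeff_mul, ← sum_add_distrib, smul_sum]
  refine sum_congr rfl fun x hx => ?_
  rw [← mem_antidiagonal.mp hx, add_smul, smul_mul_assoc, mul_smul_comm]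

theorem eulerD_smul {k : Type*} [CommSemiring k] [Algebra k B] (c : k) (f : PowerSeries B) :
    eulerD (c • f) = c • eulerD f := by
  ext p; simp [smul_comm]

theorem eulerD_map {A : Type*} [Ring A] (φ : B →+* A) (f : PowerSeries B) :
    PowerSeries.map φ (eulerD f) = eulerD (PowerSeries.map φ f) := by
  ext p; simp

theorem commute_of_coeff {f g : PowerSeries B} (h : ∀ a b, Commute (coeff a f) (coeff b g)) :
    Commute f g := by
  ext p
  rw [coeff_mul, coeff_mul, ← Finset.Nat.sum_antidiagonal_swap]
  exact sum_congr rfl fun x _ => h _ _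

theorem commute_C_of_coeff {b : B} {g : PowerSeries B} (h : ∀ p, Commute b (coeff p g)) :
    Commute (C b) g := by
  ext p
  simpa using (h p).eq

theorem eq_zero_of_nsmul [Algebra K B] {p : ℕ} (hp : p ≠ 0) {b : B} (h : p • b = 0) : b = 0 := by
  rw [← Nat.cast_smul_eq_nsmul K] at h
  exact (smul_eq_zero_iff_right (Nat.cast_ne_zero.mpr hp)).mp h

/-- In degree p the equation reads p Y_p = ∑_{a>0} M_a Y_{p-a}, since M has no constant term.
Division by p is possible over K, so the coefficients vanish one after another. This uniqueness
principle is used throughout in place of taking logarithms. -/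
theorem eq_zero_of_eulerD [Algebra K B] {Y M : PowerSeries B} (hY : eulerD Y = M * Y)
    (hM : coeff 0 M = 0) (h0 : coeff 0 Y = 0) : Y = 0 := by
  ext p
  induction p using Nat.strong_induction_on with
  | _ p ih =>
    rcases Nat.eq_zero_or_pos p with rfl | hp
    · simpa using h0
    refine eq_zero_of_nsmul hp.ne' ?_
    rw [← coeff_eulerD, hY, coeff_mul]
    refine sum_eq_zero fun x hx => ?_
    have := mem_antidiagonal.mp hx
    rcases Nat.eq_zero_or_pos x.1 with h1 | h1
    · rw [h1, hM, zero_mul]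
    · rw [ih x.2 (by omega)]; simp

theorem eq_of_eulerD [Algebra K B] {Y Z M : PowerSeries B} (hY : eulerD Y = M * Y)
    (hZ : eulerD Z = M * Z) (hM : coeff 0 M = 0) (h0 : coeff 0 Y = coeff 0 Z) : Y = Z := by
  rw [← sub_eq_zero]
  refine eq_zero_of_eulerD (M := M) ?_ hM ?_
  · rw [eulerD_sub, hY, hZ, mul_sub]
  · rw [map_sub, h0, sub_self]

theorem coeff_pow_eq_zero {S : PowerSeries B} (hS : coeff 0 S = 0) {k r : ℕ} (h : k < r) :
    coeff k (S ^ r) = 0 := by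
  induction r generalizing k with
  | zero => omega
  | succ r ih =>
    rw [pow_succ, coeff_mul]
    refine sum_eq_zero fun x hx => ?_
    have := mem_antidiagonal.mp hx
    rcases Nat.eq_zero_or_pos x.2 with h1 | h1
    · rw [h1, hS, mul_zero]
    · rw [ih (by omega), zero_mul]

theorem eulerD_pow {S : PowerSeries B} (h : Commute S (eulerD S)) (r : ℕ) :
    eulerD (S ^ (r + 1)) = (r + 1) • (eulerD S * S ^ r) := by
  induction r with
  | zero => simp
  | succ r ih =>
    rw [pow_succ, eulerD_mul, ih, smul_mul_assoc, mul_assoc, ← pow_succ,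
      (h.pow_left (r + 1)).eq, succ_nsmul _ (r + 1)]

variable [Algebra K B]

theorem coeff_fExp {S : PowerSeries B} (hS : coeff 0 S = 0) {k n : ℕ} (h : k < n) :
    coeff k (fExp S) = ∑ r ∈ range n, ((r.factorial : K)⁻¹) • coeff k (S ^ r) := by
  rw [fExp, coeff_mk]
  refine sum_subset (fun x hx => ?_) fun x _ hx' => ?_
  · simp only [mem_range] at *; omega
  · rw [coeff_pow_eq_zero hS (by simp only [mem_range] at hx'; omega), smul_zero]

theorem coeff_zero_fExp (S : PowerSeries B) : coeff 0 (fExp S) = 1 := by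
  simp [fExp]

/-- Over a noncommutative ring the usual rule for the derivative of an exponential needs the
exponent to commute with its own derivative; then it follows term by term from `eulerD_pow`. -/
theorem eulerD_fExp {S : PowerSeries B} (hS : coeff 0 S = 0) (h : Commute S (eulerD S)) :
    eulerD (fExp S) = eulerD S * fExp S := by
  ext k
  -- The sum is extended to k + 2 terms, which changes nothing. After splitting off the power 0
  -- there remain k + 1 terms, enough for every coefficient of degree at most k on the other side.
  rw [coeff_eulerD, coeff_fExp hS (Nat.lt_succ_of_lt (Nat.lt_succ_self k)), coeff_mul, smul_sum,
    sum_range_succ']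
  have h1 : ∀ r ∈ range (k + 1), k • (((r + 1).factorial : K)⁻¹ • coeff k (S ^ (r + 1))) =
      ∑ x ∈ antidiagonal k, coeff x.1 (eulerD S) * ((r.factorial : K)⁻¹ • coeff x.2 (S ^ r)) := by
    intro r _
    rw [smul_comm, ← coeff_eulerD, eulerD_pow h, map_nsmul, ← Nat.cast_smul_eq_nsmul K, smul_smul,
      Nat.factorial_succ, Nat.cast_mul, mul_inv, mul_comm _ ((r + 1 : ℕ) : K), ← mul_assoc,
      mul_inv_cancel₀ (by exact_mod_cast Nat.succ_ne_zero r), one_mul, coeff_mul, smul_sum]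
    exact sum_congr rfl fun x _ => (mul_smul_comm _ _ _).symm
  have h2 : k • (((Nat.factorial 0 : ℕ) : K)⁻¹ • coeff k (S ^ 0)) = 0 := by
    rcases Nat.eq_zero_or_pos k with rfl | hk
    · simp
    · simp [PowerSeries.coeff_one, hk.ne']
  rw [sum_congr rfl h1, h2, add_zero, sum_comm]
  refine sum_congr rfl fun x hx => ?_
  have := mem_antidiagonal.mp hx
  rw [← mul_sum, ← coeff_fExp hS (by omega)]

theorem map_fExp {A : Type*} [Ring A] [Algebra K A] (φ : B →ₐ[K] A) (S : PowerSeries B) :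
    PowerSeries.map (φ : B →+* A) (fExp S) = fExp (PowerSeries.map (φ : B →+* A) S) := by
  ext k
  simp [fExp, ← map_pow]

/-- The series with constant term `1` and logarithmic derivative `l`. -/
def expL (l : PowerSeries B) : PowerSeries B :=
  -- For r = 0 the factor is 0⁻¹ = 0, so the exponent never has a constant term.
  fExp (PowerSeries.mk fun r => (r : K)⁻¹ • coeff r l)

theorem coeff_zero_expL (l : PowerSeries B) : coeff 0 (expL l) = 1 := coeff_zero_fExp _

theorem eulerD_expL {l : PowerSeries B} (h0 : coeff 0 l = 0)
    (hc : ∀ a b, Commute (coeff a l) (coeff b l)) : eulerD (expL l) = l * expL l := by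
  have hD : eulerD (PowerSeries.mk fun r => (r : K)⁻¹ • coeff r l) = l := by
    ext r
    rcases Nat.eq_zero_or_pos r with rfl | hr
    · simp [h0]
    · rw [coeff_eulerD, coeff_mk, ← Nat.cast_smul_eq_nsmul K, smul_smul,
        mul_inv_cancel₀ (Nat.cast_ne_zero.mpr hr.ne'), one_smul]
  rw [expL, eulerD_fExp, hD]
  · simp
  · rw [hD]
    refine commute_of_coeff fun a b => ?_
    rw [coeff_mk]
    exact (hc a b).smul_left _

theorem commute_coeff_fExp {S : PowerSeries B} {b : B} (h : ∀ p, Commute b (coeff p S)) (p : ℕ) :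
    Commute b (coeff p (fExp S)) := by
  have h1 : ∀ r p, Commute b (coeff p (S ^ r)) := by
    intro r
    induction r with
    | zero =>
      intro p
      rw [pow_zero, PowerSeries.coeff_one]
      split_ifs
      · exact Commute.one_right b
      · exact Commute.zero_right b
    | succ r ih =>
      intro p
      rw [pow_succ, coeff_mul]
      exact Commute.sum_right _ _ _ fun x _ => (ih _).mul_right (h _)
  rw [fExp, coeff_mk]
  exact Commute.sum_right _ _ _ fun r _ => (h1 r p).smul_right _

theorem commute_coeff_expL {l : PowerSeries B} {b : B} (h : ∀ p, Commute b (coeff p l)) (p : ℕ) :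
    Commute b (coeff p (expL l)) :=
  commute_coeff_fExp (fun p => by rw [coeff_mk]; exact (h p).smul_right _) p

theorem map_expL {A : Type*} [Ring A] [Algebra K A] (φ : B →ₐ[K] A) (l : PowerSeries B) :
    PowerSeries.map (φ : B →+* A) (expL l) = expL (PowerSeries.map (φ : B →+* A) l) := by
  rw [expL, map_fExp, expL]
  congr 1
  ext r; simp

end Series

/-! ### Inverses of series and rescaling of the variable -/

section Inverse

variable {B : Type*} [Ring B]

theorem mul_seriesInv {b : B} {S : PowerSeries B} (h1 : coeff 0 S * b = 1)
    (h2 : b * coeff 0 S = 1) : S * seriesInv b S = 1 :=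
  PowerSeries.mul_invOfUnit S ⟨coeff 0 S, b, h1, h2⟩
    (coeff_zero_eq_constantCoeff_apply S).symm

theorem seriesInv_mul {b : B} {S : PowerSeries B} (h1 : coeff 0 S * b = 1)
    (h2 : b * coeff 0 S = 1) : seriesInv b S * S = 1 :=
  PowerSeries.invOfUnit_mul S ⟨coeff 0 S, b, h1, h2⟩
    (coeff_zero_eq_constantCoeff_apply S).symm

theorem coeff_zero_seriesInv (b : B) (S : PowerSeries B) : coeff 0 (seriesInv b S) = b := by
  rw [seriesInv, PowerSeries.coeff_inv_aux, if_pos rfl]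

theorem map_seriesInv {A : Type*} [Ring A] (φ : B →+* A) (b : B) (S : PowerSeries B) :
    PowerSeries.map φ (seriesInv b S) = seriesInv (φ b) (PowerSeries.map φ S) := by
  ext p
  induction p using Nat.strong_induction_on with
  | _ p ih =>
    simp only [seriesInv, PowerSeries.coeff_map] at ih ⊢
    rw [PowerSeries.coeff_inv_aux, PowerSeries.coeff_inv_aux]
    split_ifs with h
    · rfl
    · rw [map_mul, map_neg, map_sum]
      congr 1
      refine sum_congr rfl fun x _ => ?_
      split_ifs with hx
      · rw [map_mul, ih _ hx, PowerSeries.coeff_map]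
      · simp

theorem commute_coeff_seriesInv {b c : B} {S : PowerSeries B} (hb : Commute c b)
    (h : ∀ p, Commute c (coeff p S)) (p : ℕ) : Commute c (coeff p (seriesInv b S)) := by
  induction p using Nat.strong_induction_on with
  | _ p ih =>
    simp only [seriesInv] at ih ⊢
    rw [PowerSeries.coeff_inv_aux]
    split_ifs
    · exact hb
    · refine hb.neg_right.mul_right (Commute.sum_right _ _ _ fun x _ => ?_)
      split_ifs with hx
      · exact (h _).mul_right (ih _ hx)
      · exact Commute.zero_right c

/-- The logarithmic derivative of an inverse. -/
theorem eulerD_inverse {h g l : PowerSeries B} (hg : h * g = 1) (gh : g * h = 1)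
    (hl : eulerD h = l * h) (hc : Commute l h) : eulerD g = -l * g := by
  have h1 : eulerD h * g + h * eulerD g = 0 := by rw [← eulerD_mul, hg, eulerD_one]
  have h2 : g * (eulerD h * g + h * eulerD g) = 0 := by rw [h1, mul_zero]
  rw [hl, mul_add, ← mul_assoc g h, gh, one_mul, hc.eq] at h2
  have h3 : g * (h * l * g) = l * g := by rw [mul_assoc h, ← mul_assoc g h, gh, one_mul]
  rw [h3] at h2
  rw [neg_mul]; exact (neg_eq_of_add_eq_zero_right h2).symm

variable [Algebra K B]

theorem coeff_dilate (ε : ℤˣ) (c : K) (S : PowerSeries B) (p : ℕ) :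
    coeff p (dilate ε c S) = c ^ ((ε : ℤ) * (p : ℤ)) • coeff p S := by
  simp [dilate]

theorem dilate_mul (ε : ℤˣ) {c : K} (hc : c ≠ 0) (f g : PowerSeries B) :
    dilate ε c (f * g) = dilate ε c f * dilate ε c g := by
  ext p
  rw [coeff_dilate, coeff_mul, coeff_mul, smul_sum]
  refine sum_congr rfl fun x hx => ?_
  rw [coeff_dilate, coeff_dilate, smul_mul_smul_comm, ← zpow_add₀ hc, ← mul_add,
    ← mem_antidiagonal.mp hx, Nat.cast_add]

theorem coeff_zero_dilate (ε : ℤˣ) (c : K) (f : PowerSeries B) :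
    coeff 0 (dilate ε c f) = coeff 0 f := by
  simp [coeff_dilate]

theorem map_dilate {A : Type*} [Ring A] [Algebra K A] (φ : B →ₐ[K] A) (ε : ℤˣ) (c : K)
    (S : PowerSeries B) : PowerSeries.map (φ : B →+* A) (dilate ε c S) =
      dilate ε c (PowerSeries.map (φ : B →+* A) S) := by
  ext p; simp [coeff_dilate]

end Inverse

end OspAffine

end

noncomputable section

namespace OspAffine

open PowerSeries Finset

/-! ### Exchange relations as series of operators on sequences -/

section Operators

variable {B : Type*} [Ring B] [Algebra K B]

/-- Pointwise left multiplication on sequences. -/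
def opL : B →ₐ[K] Module.End K (ℤ → B) := Algebra.lsmul K K (ℤ → B)

/-- Pointwise right multiplication on sequences. -/
def opR (b : B) : Module.End K (ℤ → B) where
  toFun v := fun l => v l * b
  map_add' v w := by ext l; simp [add_mul]
  map_smul' c v := by ext l; simp

/-- Translation of sequences. -/
def opS (e : ℤ) : Module.End K (ℤ → B) where
  toFun v := fun l => v (l + e)
  map_add' _ _ := rfl
  map_smul' _ _ := rfl

@[simp] theorem opL_apply (b : B) (v : ℤ → B) (l : ℤ) : opL b v l = b * v l := rfl
@[simp] theorem opR_apply (b : B) (v : ℤ → B) (l : ℤ) : opR b v l = v l * b := rfl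
@[simp] theorem opS_apply (e : ℤ) (v : ℤ → B) (l : ℤ) : opS e v l = v (l + e) := rfl

theorem commute_opL_opR (a b : B) : Commute (opL a) (opR b) := by
  ext v l; simp [mul_assoc]

/-- The operator `q^{κc/2}` followed by a translation, where `q^{c/2}` acts by `c`. -/
def theta (c : Bˣ) (κ e : ℤ) : Module.End K (ℤ → B) := opL ((c ^ κ : Bˣ) : B) * opS e

@[simp] theorem theta_apply (c : Bˣ) (κ e : ℤ) (v : ℤ → B) (l : ℤ) :
    theta c κ e v l = ((c ^ κ : Bˣ) : B) * v (l + e) := rfl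

theorem theta_mul (c : Bˣ) (κ e κ' e' : ℤ) :
    theta c κ e * theta c κ' e' = theta c (κ + κ') (e + e') := by
  ext v l
  simp [zpow_add, mul_assoc, add_assoc]

theorem theta_zero (c : Bˣ) : theta c 0 0 = 1 := by
  ext v l; simp

theorem theta_pow (c : Bˣ) (κ e : ℤ) (r : ℕ) : theta c κ e ^ r = theta c (r * κ) (r * e) := by
  induction r with
  | zero => simp [theta_zero]
  | succ r ih =>
    rw [pow_succ, ih, theta_mul]
    congr 1 <;> push_cast <;> ring

omit [Algebra K B] in
theorem commute_zpow_unit {c : Bˣ} (hc : ∀ b : B, Commute (c : B) b) (κ : ℤ) (b : B) :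
    Commute ((c ^ κ : Bˣ) : B) b := by
  have h := hc b
  rcases κ with n | n
  · simpa using h.pow_left n
  · simpa [zpow_negSucc] using (Commute.units_inv_left h).pow_left (n + 1)

theorem commute_theta_opL {c : Bˣ} (hc : ∀ b : B, Commute (c : B) b) (κ e : ℤ) (b : B) :
    Commute (theta c κ e) (opL b) := by
  ext v l
  simp only [Module.End.mul_apply, theta_apply, opL_apply]
  rw [← mul_assoc, (commute_zpow_unit hc κ b).eq, mul_assoc]

theorem commute_theta_opR (c : Bˣ) (κ e : ℤ) (b : B) : Commute (theta c κ e) (opR b) := by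
  ext v l; simp [mul_assoc]

theorem commute_theta (c : Bˣ) (κ e κ' e' : ℤ) : Commute (theta c κ e) (theta c κ' e') := by
  rw [Commute, SemiconjBy, theta_mul, theta_mul, add_comm, add_comm e]

/-- The commutative algebra generated by central scalars and translations. -/
def opT (c : Bˣ) : Subalgebra K (Module.End K (ℤ → B)) :=
  Algebra.adjoin K (Set.range fun p : ℤ × ℤ => theta c p.1 p.2)

theorem theta_mem (c : Bˣ) (κ e : ℤ) : theta c κ e ∈ opT c :=
  Algebra.subset_adjoin ⟨(κ, e), rfl⟩

theorem commute_opT_of {c : Bˣ} {Z Y : Module.End K (ℤ → B)} (hY : Y ∈ opT c)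
    (h : ∀ κ e, Commute Z (theta c κ e)) : Commute Z Y :=
  Algebra.commute_of_mem_adjoin_of_forall_mem_commute hY (by rintro _ ⟨p, rfl⟩; exact h _ _)

/-- Series whose coefficients lie in `opT c`. -/
def IsT (c : Bˣ) (Y : PowerSeries (Module.End K (ℤ → B))) : Prop := ∀ p, coeff p Y ∈ opT c

theorem IsT.mul {c : Bˣ} {Y Z : PowerSeries (Module.End K (ℤ → B))} (hY : IsT c Y)
    (hZ : IsT c Z) : IsT c (Y * Z) := fun p => by
  rw [coeff_mul]
  exact sum_mem fun x _ => mul_mem (hY _) (hZ _)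

theorem IsT.add {c : Bˣ} {Y Z : PowerSeries (Module.End K (ℤ → B))} (hY : IsT c Y)
    (hZ : IsT c Z) : IsT c (Y + Z) := fun p => by
  rw [map_add]; exact add_mem (hY p) (hZ p)

theorem IsT.smul {c : Bˣ} {Y : PowerSeries (Module.End K (ℤ → B))} (hY : IsT c Y)
    (s : K) : IsT c (s • Y) := fun p => by
  rw [coeff_smul]; exact Subalgebra.smul_mem _ (hY p) s

theorem IsT.commute {c : Bˣ} {Y Z : PowerSeries (Module.End K (ℤ → B))} (hY : IsT c Y)
    (hZ : IsT c Z) : Commute Y Z :=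
  commute_of_coeff fun a b => commute_opT_of (hZ b) fun κ e =>
    (commute_opT_of (hY a) fun κ' e' => commute_theta c κ e κ' e').symm

/-- Left multiplication by the coefficients of a series. -/
def serL (h : PowerSeries B) : PowerSeries (Module.End K (ℤ → B)) :=
  PowerSeries.map (opL : B →ₐ[K] Module.End K (ℤ → B)).toRingHom h

/-- Right multiplication by the coefficients of a series. -/
def serR (h : PowerSeries B) : PowerSeries (Module.End K (ℤ → B)) :=
  PowerSeries.mk fun p => opR (coeff p h)

@[simp] theorem coeff_serL (h : PowerSeries B) (p : ℕ) :
    coeff p (serL h) = opL (coeff p h) := by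
  simp [serL]

@[simp] theorem coeff_serR (h : PowerSeries B) (p : ℕ) :
    coeff p (serR h) = opR (coeff p h) := by simp [serR]

theorem serL_mul (f g : PowerSeries B) : serL (f * g) = serL f * serL g := map_mul _ _ _

/-- Right multiplication is an anti-homomorphism, so the factors change places. Thus h * g = 1 makes
`serR g` a left inverse of `serR h`. -/
theorem serR_mul (f g : PowerSeries B) : serR (f * g) = serR g * serR f := by
  ext p v l
  rw [coeff_serR, opR_apply, coeff_mul, coeff_mul, ← Finset.Nat.sum_antidiagonal_swap, mul_sum,
    LinearMap.sum_apply, Finset.sum_apply]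
  refine sum_congr rfl fun x _ => ?_
  simp [mul_assoc]

theorem serR_one : serR (1 : PowerSeries B) = 1 := by
  ext p v l
  rw [coeff_serR, opR_apply, PowerSeries.coeff_one, PowerSeries.coeff_one]
  split_ifs <;> simp

theorem eulerD_serL (f : PowerSeries B) : eulerD (serL f) = serL (eulerD f) :=
  (eulerD_map _ _).symm

theorem eulerD_serR (f : PowerSeries B) : eulerD (serR f) = serR (eulerD f) := by
  ext p v l
  simp only [coeff_eulerD, coeff_serR, LinearMap.smul_apply, Pi.smul_apply, opR_apply,
    mul_smul_comm]

theorem commute_serL_serR (f g : PowerSeries B) : Commute (serL f) (serR g) :=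
  commute_of_coeff fun a b => by
    rw [coeff_serL, coeff_serR]; exact commute_opL_opR _ _

theorem IsT.commute_serL {c : Bˣ} (hc : ∀ b : B, Commute (c : B) b)
    {Y : PowerSeries (Module.End K (ℤ → B))} (hY : IsT c Y) (f : PowerSeries B) :
    Commute (serL f) Y :=
  commute_of_coeff fun a b => commute_opT_of (hY b) fun κ e => by
    rw [coeff_serL]; exact (commute_theta_opL hc κ e _).symm

theorem IsT.commute_serR {c : Bˣ} {Y : PowerSeries (Module.End K (ℤ → B))} (hY : IsT c Y)
    (f : PowerSeries B) : Commute (serR f) Y :=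
  commute_of_coeff fun a b => commute_opT_of (hY b) fun κ e => by
    rw [coeff_serR]; exact (commute_theta_opR c κ e _).symm

/-! ### Evaluation of scalar series at an operator -/

/-- The series `G(θ y)` in `y`. -/
def evS {E : Type*} [Ring E] [Algebra K E] (θ : E) (G : PowerSeries K) : PowerSeries E :=
  PowerSeries.mk fun s => coeff s G • θ ^ s

@[simp] theorem coeff_evS {E : Type*} [Ring E] [Algebra K E] (θ : E) (G : PowerSeries K) (p : ℕ) :
    coeff p (evS θ G) = coeff p G • θ ^ p := by simp [evS]

theorem evS_mul {E : Type*} [Ring E] [Algebra K E] (θ : E) (F G : PowerSeries K) :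
    evS θ (F * G) = evS θ F * evS θ G := by
  ext p
  rw [coeff_evS, coeff_mul, coeff_mul, sum_smul]
  refine sum_congr rfl fun x hx => ?_
  rw [coeff_evS, coeff_evS, smul_mul_smul_comm, ← pow_add, mem_antidiagonal.mp hx]

theorem evS_one {E : Type*} [Ring E] [Algebra K E] (θ : E) : evS θ 1 = 1 := by
  ext p
  rw [coeff_evS, PowerSeries.coeff_one, PowerSeries.coeff_one]
  split_ifs with h
  · simp [h]
  · simp

theorem eulerD_evS {E : Type*} [Ring E] [Algebra K E] (θ : E) (G : PowerSeries K) :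
    eulerD (evS θ G) = evS θ (eulerD G) := by
  ext p; simp only [coeff_eulerD, coeff_evS, smul_assoc]

theorem isT_evS (c : Bˣ) (κ e : ℤ) (G : PowerSeries K) : IsT c (evS (theta c κ e) G) := fun p => by
  rw [coeff_evS]
  exact Subalgebra.smul_mem _ (pow_mem (theta_mem c κ e) p) _

/-! ### Series annihilating a sequence -/

/-- All coefficients of `Y` annihilate `x`. -/
def Kills (Y : PowerSeries (Module.End K (ℤ → B))) (x : ℤ → B) : Prop := ∀ p, coeff p Y x = 0

theorem Kills.mul {Y : PowerSeries (Module.End K (ℤ → B))} {x : ℤ → B} (h : Kills Y x)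
    (Z : PowerSeries (Module.End K (ℤ → B))) : Kills (Z * Y) x := fun p => by
  rw [coeff_mul, LinearMap.sum_apply]
  refine sum_eq_zero fun a _ => ?_
  rw [Module.End.mul_apply, h, map_zero]

theorem Kills.sub {Y Z : PowerSeries (Module.End K (ℤ → B))} {x : ℤ → B} (h : Kills Y x)
    (h' : Kills Z x) : Kills (Y - Z) x := fun p => by
  rw [map_sub, LinearMap.sub_apply, h, h', sub_zero]

theorem Kills.eulerD {Y : PowerSeries (Module.End K (ℤ → B))} {x : ℤ → B} (h : Kills Y x) :
    Kills (eulerD Y) x := fun p => by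
  rw [coeff_eulerD, LinearMap.smul_apply, h, smul_zero]

/-- The recursion of `eq_zero_of_eulerD` for a single vector: p W_p x is a combination of operators
applied to W_b x with b < p, because N has no constant term. -/
theorem kills_of_eulerD {W N : PowerSeries (Module.End K (ℤ → B))} {x : ℤ → B}
    (h : Kills (OspAffine.eulerD W - N * W) x) (hN : coeff 0 N = 0) (h0 : coeff 0 W x = 0) :
    Kills W x := by
  intro p
  induction p using Nat.strong_induction_on with
  | _ p ih =>
    rcases Nat.eq_zero_or_pos p with rfl | hp
    · exact h0
    have h1 := h p
    rw [map_sub, LinearMap.sub_apply, coeff_eulerD, LinearMap.smul_apply, coeff_mul,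
      LinearMap.sum_apply, sum_eq_zero, sub_zero] at h1
    · funext l
      exact eq_zero_of_nsmul hp.ne' (by simpa using congrFun h1 l)
    · intro a ha
      have := mem_antidiagonal.mp ha
      rcases Nat.eq_zero_or_pos a.1 with h2 | h2
      · rw [h2, hN, zero_mul, LinearMap.zero_apply]
      · rw [Module.End.mul_apply, ih a.2 (by omega), map_zero]

/-- The exchange relation `P(z) h(z) x(w) = Q(z) x(w) h(z)` in terms of logarithmic derivatives. -/
theorem kills_exchange_iff {c : Bˣ} (hc : ∀ b : B, Commute (c : B) b)
    {h g l : PowerSeries B} (hg : h * g = 1) (hl : eulerD h = l * h) (hl0 : coeff 0 l = 0)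
    {P Q Q' pi ka : PowerSeries (Module.End K (ℤ → B))}
    (tP : IsT c P) (tQ : IsT c Q) (tpi : IsT c pi) (tka : IsT c ka)
    (hP : eulerD P = pi * P) (hQ : eulerD Q = ka * Q) (hQ' : Q' * Q = 1)
    (hpi0 : coeff 0 pi = 0) (x : ℤ → B) :
    Kills (P * serL h - Q * serR h) x ↔
      coeff 0 (P * serL h - Q * serR h) x = 0 ∧ Kills (serL l - serR l - (ka - pi)) x := by
  set W := P * serL h - Q * serR h with hW
  -- Left multiplications, right multiplications and the series in translations commute with each
  -- other. Hence the terms containing P cancel, and what is left over is Q times right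
  -- multiplication by h times the bracket to be studied.
  have key : eulerD W - (pi + serL l) * W = (Q * serR h) * (serL l - serR l - (ka - pi)) := by
    rw [hW, eulerD_sub, eulerD_mul, eulerD_mul, eulerD_serL, eulerD_serR, hl, serL_mul, serR_mul,
      hP, hQ]
    have e1 := (tP.commute_serL hc l).eq
    have e2 : serL l * (Q * serR h) = (Q * serR h) * serL l := by
      rw [← mul_assoc, (tQ.commute_serL hc l).eq, mul_assoc, (commute_serL_serR l h).eq, mul_assoc]
    have e3 : pi * (Q * serR h) = (Q * serR h) * pi := by
      rw [← mul_assoc, (tpi.commute tQ).eq, mul_assoc, (tpi.commute_serR h).symm.eq, mul_assoc]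
    have e4 : ka * (Q * serR h) = (Q * serR h) * ka := by
      rw [← mul_assoc, (tka.commute tQ).eq, mul_assoc, (tka.commute_serR h).symm.eq, mul_assoc]
    have e5 : serL l * (P * serL h) = P * (serL l * serL h) := by
      rw [← mul_assoc, e1, mul_assoc]
    rw [add_mul, mul_sub, mul_sub, mul_sub, mul_sub, mul_sub, e2, e3, e5, mul_assoc ka, e4]
    simp only [mul_assoc]
    abel
  -- The factor in front of the bracket has a left inverse, so it does not enlarge the set of
  -- sequences that are killed.
  have hinv : (serR g * Q') * (Q * serR h) = 1 := by
    rw [mul_assoc, ← mul_assoc Q', hQ', one_mul, ← serR_mul, hg, serR_one]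
  constructor
  · intro hk
    refine ⟨hk 0, ?_⟩
    have h1 : Kills ((Q * serR h) * (serL l - serR l - (ka - pi))) x := by
      rw [← key]; exact hk.eulerD.sub (hk.mul _)
    have h2 := h1.mul (serR g * Q')
    rwa [← mul_assoc, hinv, one_mul] at h2
  · rintro ⟨h0, hk⟩
    refine kills_of_eulerD (N := pi + serL l) ?_ ?_ h0
    · rw [key]; exact hk.mul _
    · rw [map_add, hpi0, coeff_serL, hl0, map_zero, add_zero]

/-! ### From modes to operators -/

/-- The family of modes obtained by applying `Y`, a series in `z^ε`, to the sequence `x`. -/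
def serE (ε : ℤˣ) (Y : PowerSeries (Module.End K (ℤ → B))) (x : ℤ → B) : ℤ → ℤ → B :=
  fun k l => if 0 ≤ (ε : ℤ) * k then coeff k.natAbs Y x l else 0

theorem serE_serL (ε : ℤˣ) (h : PowerSeries B) (x : ℤ → B) :
    serE ε (serL h) x = fun k l => modes ε h k * x l := by
  funext k l
  simp only [serE, modes]
  split_ifs <;> simp

theorem serE_serR (ε : ℤˣ) (h : PowerSeries B) (x : ℤ → B) :
    serE ε (serR h) x = fun k l => x l * modes ε h k := by
  funext k l
  simp only [serE, modes]
  split_ifs <;> simp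

theorem serE_sub_smul_eq_zero_iff (ε : ℤˣ) (s s' : K)
    (Y Y' : PowerSeries (Module.End K (ℤ → B))) (x : ℤ → B) :
    (∀ k l, s • serE ε Y x k l = s' • serE ε Y' x k l) ↔ Kills (s • Y - s' • Y') x := by
  constructor
  · intro h p
    funext l
    have h1 := h ((ε : ℤ) * p) l
    have h2 : (0 : ℤ) ≤ (ε : ℤ) * ((ε : ℤ) * p) := by
      rw [← mul_assoc, ← Units.val_mul, Int.units_mul_self]; simp
    have h3 : ((ε : ℤ) * (p : ℤ)).natAbs = p := by
      rw [Int.natAbs_mul, Int.units_natAbs, one_mul, Int.natAbs_natCast]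
    simp only [serE, if_pos h2, h3] at h1
    simp [h1]
  · intro h k l
    simp only [serE]
    split_ifs
    · have h1 := congrFun (h k.natAbs) l
      simpa [sub_eq_zero] using h1
    · simp

/-- Multiplication by `s q^{κc/2} z^a w^b`. -/
def monoMul (c : Bˣ) (s : K) (κ a b : ℤ) (S : ℤ → ℤ → B) : ℤ → ℤ → B := fun k l =>
  s • (((c ^ κ : Bˣ) : B) * S (k - a) (l - b))

/-- Multiplication by `u q^{κc/2} z - v q^{κ'c/2} w`. -/
def linMul (c : Bˣ) (u v : K) (κ κ' : ℤ) (S : ℤ → ℤ → B) : ℤ → ℤ → B := fun k l =>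
  u • (((c ^ κ : Bˣ) : B) * S (k - 1) l) - v • (((c ^ κ' : Bˣ) : B) * S k (l - 1))

/-- Multiplication by `G((z q^{κc} / w)^ε)`. -/
def serMul (c : Bˣ) (G : PowerSeries K) (κ : ℤ) (ε : ℤˣ) (S : ℤ → ℤ → B) : ℤ → ℤ → B := fun k l =>
  ∑ s ∈ Finset.range (k.natAbs + 1), coeff s G •
    (((c ^ (2 * ((ε : ℤ) * κ * (s : ℤ))) : Bˣ) : B) *
      S (k - (ε : ℤ) * (s : ℤ)) (l + (ε : ℤ) * (s : ℤ)))

/-- `s q^{κc/2} z^a w^b P₁(q^{κ₁c/2} (z/w)^ε) P₂(q^{κ₂c/2} (z/w)^ε) Y`. -/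
def state (c : Bˣ) (ε : ℤˣ) (κ₁ κ₂ : ℤ) (s : K) (κ a b : ℤ) (P₁ P₂ : PowerSeries K)
    (Y : PowerSeries (Module.End K (ℤ → B))) (x : ℤ → B) : ℤ → ℤ → B :=
  monoMul c s κ a b (serE ε (evS (theta c κ₁ ε) P₁ * evS (theta c κ₂ ε) P₂ * Y) x)

theorem state_init (c : Bˣ) (ε : ℤˣ) (κ₁ κ₂ : ℤ) (Y : PowerSeries (Module.End K (ℤ → B)))
    (x : ℤ → B) : serE ε Y x = state c ε κ₁ κ₂ 1 0 0 0 1 1 Y x := by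
  funext k l
  simp [state, monoMul, evS_one]

/-- The s-th coefficient of G lowers the degree to be read off in z^ε by s and moves the index of w
by εs, which is the action of the s-th power of `theta`. The cutoff s ≤ |k| is exactly the range of
the product formula for coefficients, since Y is a series in z^ε. -/
theorem serMul_serE (c : Bˣ) (G : PowerSeries K) (κ : ℤ) (ε : ℤˣ)
    (Y : PowerSeries (Module.End K (ℤ → B))) (x : ℤ → B) :
    serMul c G κ ε (serE ε Y x) = serE ε (evS (theta c (2 * ((ε : ℤ) * κ)) ε) G * Y) x := by
  funext k l
  by_cases hk : 0 ≤ (ε : ℤ) * k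
  · simp only [serE, if_pos hk, serMul]
    rw [coeff_mul, LinearMap.sum_apply, Finset.sum_apply,
      Finset.Nat.sum_antidiagonal_eq_sum_range_succ_mk]
    refine sum_congr rfl fun s hs => ?_
    rw [mem_range] at hs
    have h1 : 0 ≤ (ε : ℤ) * (k - (ε : ℤ) * s) ∧ (k - (ε : ℤ) * s).natAbs = k.natAbs - s := by
      rcases Int.units_eq_one_or ε with rfl | rfl
      · simp at hk ⊢; omega
      · simp at hk ⊢; omega
    rw [if_pos h1.1, h1.2, coeff_evS, theta_pow, smul_mul_assoc, LinearMap.smul_apply,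
      Pi.smul_apply, Module.End.mul_apply, theta_apply, mul_comm (s : ℤ) (ε : ℤ)]
    have e : (s : ℤ) * (2 * ((ε : ℤ) * κ)) = 2 * ((ε : ℤ) * κ * s) := by ring
    rw [e]
  · simp only [serE, if_neg hk, serMul]
    refine sum_eq_zero fun s _ => ?_
    have h1 : ¬ 0 ≤ (ε : ℤ) * (k - (ε : ℤ) * s) := by
      rcases Int.units_eq_one_or ε with rfl | rfl
      · simp at hk ⊢; omega
      · simp at hk ⊢; omega
    rw [if_neg h1, mul_zero, smul_zero]

theorem coeff_one_sub_mul (a : K) (θ : Module.End K (ℤ → B))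
    (Y : PowerSeries (Module.End K (ℤ → B))) (p : ℕ) :
    coeff p (evS θ (1 - C a * X) * Y) =
      coeff p Y - if p = 0 then 0 else a • (θ * coeff (p - 1) Y) := by
  have h : evS θ (1 - C a * X) = 1 - C (a • θ) * X := by
    ext1 s
    rw [coeff_evS]
    rcases s with _ | _ | s
    · simp
    · simp [PowerSeries.coeff_one]
    · simp [PowerSeries.coeff_one]
  rw [h, sub_mul, one_mul, map_sub, mul_assoc, coeff_C_mul]
  rcases p with _ | p
  · simp
  · simp [PowerSeries.coeff_succ_X_mul]

/-- For series in z the leading term of a linear factor is the one with w. Extracting it leaves 1 -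
(u/v) q^{(κ-κ')c/2} z/w, an invertible series at z = 0. -/
theorem linMul_monoMul_one {c : Bˣ} {u v : K} (hv : v ≠ 0) (κ κ' : ℤ)
    (s : K) (κ₀ a b : ℤ) (Y : PowerSeries (Module.End K (ℤ → B))) (x : ℤ → B) :
    linMul c u v κ κ' (monoMul c s κ₀ a b (serE 1 Y x)) =
      monoMul c (-v * s) (κ' + κ₀) a (b + 1)
        (serE 1 (evS (theta c (κ - κ') 1) (1 - C (u / v) * X) * Y) x) := by
  funext k l
  simp only [linMul, monoMul, serE, Units.val_one, one_mul, coeff_one_sub_mul]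
  have e1 : l - b - 1 = l - (b + 1) := by ring
  have e2 : l - 1 - b = l - (b + 1) := by ring
  by_cases h1 : 0 ≤ k - a
  · rw [if_pos h1, if_pos h1, LinearMap.sub_apply, Pi.sub_apply]
    by_cases h2 : 0 ≤ k - 1 - a
    · have h3 : ¬ (k - a).natAbs = 0 := by omega
      have h4 : (k - a).natAbs - 1 = (k - 1 - a).natAbs := by omega
      rw [if_pos h2, if_neg h3, h4, LinearMap.smul_apply, Pi.smul_apply, Module.End.mul_apply,
        theta_apply, e2]
      have h5 : ((c ^ (κ' + κ₀) : Bˣ) : B) * ((c ^ (κ - κ') : Bˣ) : B) =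
          ((c ^ κ : Bˣ) : B) * ((c ^ κ₀ : Bˣ) : B) := by
        rw [← Units.val_mul, ← Units.val_mul, ← zpow_add, ← zpow_add]; congr 2; ring
      rw [mul_sub, smul_sub, mul_smul_comm (u / v), ← mul_assoc _ _ (coeff _ Y x _), h5,
        smul_smul, zpow_add, Units.val_mul, mul_smul_comm, mul_smul_comm, smul_smul, smul_smul]
      have e3 : l - (b + 1) + 1 = l - b := by ring
      have e4 : -v * s * (u / v) = -(u * s) := by field_simp
      rw [e3, e4, neg_mul, neg_smul, neg_smul]
      simp only [mul_assoc]
      abel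
    · have h3 : (k - a).natAbs = 0 := by omega
      rw [if_neg h2, if_pos h3, e2, zpow_add, Units.val_mul, LinearMap.zero_apply, Pi.zero_apply]
      simp [mul_assoc, smul_smul]
  · have h2 : ¬ 0 ≤ k - 1 - a := by omega
    simp only [if_neg h1, if_neg h2, mul_zero, smul_zero, sub_zero]

/-- For series in z⁻¹ the leading term is the one with z. Extracting it leaves 1 - (v/u)
q^{(κ'-κ)c/2} w/z, an invertible series at z = ∞. -/
theorem linMul_monoMul_neg_one {c : Bˣ} {u v : K} (hu : u ≠ 0) (κ κ' : ℤ)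
    (s : K) (κ₀ a b : ℤ) (Y : PowerSeries (Module.End K (ℤ → B))) (x : ℤ → B) :
    linMul c u v κ κ' (monoMul c s κ₀ a b (serE (-1) Y x)) =
      monoMul c (u * s) (κ + κ₀) (a + 1) b
        (serE (-1) (evS (theta c (κ' - κ) (-1)) (1 - C (v / u) * X) * Y) x) := by
  funext k l
  simp only [linMul, monoMul, serE, Units.val_one, Units.val_neg, neg_mul, one_mul,
    coeff_one_sub_mul]
  have e1 : k - 1 - a = k - (a + 1) := by ring
  rw [e1]
  by_cases h1 : 0 ≤ -(k - (a + 1))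
  · rw [if_pos h1, if_pos h1, LinearMap.sub_apply, Pi.sub_apply]
    by_cases h2 : 0 ≤ -(k - a)
    · have h3 : ¬ (k - (a + 1)).natAbs = 0 := by omega
      have h4 : (k - (a + 1)).natAbs - 1 = (k - a).natAbs := by omega
      rw [if_pos h2, if_neg h3, h4, LinearMap.smul_apply, Pi.smul_apply, Module.End.mul_apply,
        theta_apply]
      have h5 : ((c ^ (κ + κ₀) : Bˣ) : B) * ((c ^ (κ' - κ) : Bˣ) : B) =
          ((c ^ κ' : Bˣ) : B) * ((c ^ κ₀ : Bˣ) : B) := by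
        rw [← Units.val_mul, ← Units.val_mul, ← zpow_add, ← zpow_add]; congr 2; ring
      rw [mul_sub, smul_sub, mul_smul_comm (v / u), ← mul_assoc _ _ (coeff _ Y x _), h5,
        smul_smul, zpow_add, Units.val_mul, mul_smul_comm, mul_smul_comm, smul_smul, smul_smul]
      have e3 : l - b + -1 = l - 1 - b := by ring
      have e4 : u * s * (v / u) = v * s := by field_simp
      rw [e3, e4]
      simp only [mul_assoc]
    · have h3 : (k - (a + 1)).natAbs = 0 := by omega
      rw [if_neg h2, if_pos h3, zpow_add, Units.val_mul, LinearMap.zero_apply, Pi.zero_apply]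
      simp [mul_assoc, smul_smul]
  · have h2 : ¬ 0 ≤ -(k - a) := by omega
    simp only [if_neg h1, if_neg h2, mul_zero, smul_zero, sub_zero]

/-- In each relation the ratio (z/w)^ε occurs with at most two different powers of q^{c/2}. A linear
factor is absorbed into P₁ or P₂ according to the difference of its exponents; the four versions
cover the two expansions and the two slots. -/
theorem linMul_state_one_left {c : Bˣ} {u v : K} (hv : v ≠ 0) {κ κ' κ₁ : ℤ} (hκ : κ - κ' = κ₁)
    (κ₂ : ℤ) (s : K) (κ₀ a b : ℤ) (P₁ P₂ : PowerSeries K)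
    (Y : PowerSeries (Module.End K (ℤ → B))) (x : ℤ → B) :
    linMul c u v κ κ' (state c 1 κ₁ κ₂ s κ₀ a b P₁ P₂ Y x) =
      state c 1 κ₁ κ₂ (-v * s) (κ' + κ₀) a (b + 1) ((1 - C (u / v) * X) * P₁) P₂ Y x := by
  rw [state, linMul_monoMul_one hv, state, hκ, evS_mul, Units.val_one]
  simp only [mul_assoc]

theorem linMul_state_one_right {c : Bˣ} {u v : K} (hv : v ≠ 0) {κ κ' κ₂ : ℤ} (hκ : κ - κ' = κ₂)
    (κ₁ : ℤ) (s : K) (κ₀ a b : ℤ) (P₁ P₂ : PowerSeries K)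
    (Y : PowerSeries (Module.End K (ℤ → B))) (x : ℤ → B) :
    linMul c u v κ κ' (state c 1 κ₁ κ₂ s κ₀ a b P₁ P₂ Y x) =
      state c 1 κ₁ κ₂ (-v * s) (κ' + κ₀) a (b + 1) P₁ ((1 - C (u / v) * X) * P₂) Y x := by
  rw [state, linMul_monoMul_one hv, state, hκ, evS_mul, Units.val_one, ← mul_assoc, ← mul_assoc,
    ((isT_evS c κ₂ 1 _).commute (isT_evS c κ₁ 1 _)).eq]
  simp only [mul_assoc]

theorem linMul_state_neg_one_left {c : Bˣ} {u v : K} (hu : u ≠ 0) {κ κ' κ₁ : ℤ}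
    (hκ : κ' - κ = κ₁) (κ₂ : ℤ) (s : K) (κ₀ a b : ℤ) (P₁ P₂ : PowerSeries K)
    (Y : PowerSeries (Module.End K (ℤ → B))) (x : ℤ → B) :
    linMul c u v κ κ' (state c (-1) κ₁ κ₂ s κ₀ a b P₁ P₂ Y x) =
      state c (-1) κ₁ κ₂ (u * s) (κ + κ₀) (a + 1) b ((1 - C (v / u) * X) * P₁) P₂ Y x := by
  rw [state, linMul_monoMul_neg_one hu, state, hκ, evS_mul, Units.val_neg, Units.val_one]
  simp only [mul_assoc]

theorem linMul_state_neg_one_right {c : Bˣ} {u v : K} (hu : u ≠ 0) {κ κ' κ₂ : ℤ}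
    (hκ : κ' - κ = κ₂) (κ₁ : ℤ) (s : K) (κ₀ a b : ℤ) (P₁ P₂ : PowerSeries K)
    (Y : PowerSeries (Module.End K (ℤ → B))) (x : ℤ → B) :
    linMul c u v κ κ' (state c (-1) κ₁ κ₂ s κ₀ a b P₁ P₂ Y x) =
      state c (-1) κ₁ κ₂ (u * s) (κ + κ₀) (a + 1) b P₁ ((1 - C (v / u) * X) * P₂) Y x := by
  rw [state, linMul_monoMul_neg_one hu, state, hκ, evS_mul, Units.val_neg, Units.val_one,
    ← mul_assoc, ← mul_assoc, ((isT_evS c κ₂ (-1) _).commute (isT_evS c κ₁ (-1) _)).eq]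
  simp only [mul_assoc]

theorem serMul_state_left {c : Bˣ} (G : PowerSeries K) {κ : ℤ} {ε : ℤˣ} {κ₁ : ℤ}
    (hκ : 2 * ((ε : ℤ) * κ) = κ₁) (κ₂ : ℤ) (Y : PowerSeries (Module.End K (ℤ → B))) (x : ℤ → B) :
    serMul c G κ ε (serE ε Y x) = state c ε κ₁ κ₂ 1 0 0 0 G 1 Y x := by
  rw [serMul_serE, hκ]
  funext k l
  simp [state, monoMul, evS_one]

theorem serMul_state_right {c : Bˣ} (G : PowerSeries K) {κ : ℤ} {ε : ℤˣ} {κ₂ : ℤ}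
    (hκ : 2 * ((ε : ℤ) * κ) = κ₂) (κ₁ : ℤ) (Y : PowerSeries (Module.End K (ℤ → B))) (x : ℤ → B) :
    serMul c G κ ε (serE ε Y x) = state c ε κ₁ κ₂ 1 0 0 0 1 G Y x := by
  rw [serMul_serE, hκ]
  funext k l
  simp [state, monoMul, evS_one]

/-- The monomial prefactors are invertible and agree on the two sides up to scalars, so they cancel
and `kills_exchange_iff` applies. The logarithmic derivative of a product of two evaluated series is
the sum of the two, which gives the two summands on the right. -/
theorem state_eq_iff {c : Bˣ} (hc : ∀ b : B, Commute (c : B) b) {ε : ℤˣ} {κ₁ κ₂ : ℤ}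
    {h g l : PowerSeries B} (hg : h * g = 1) (hl : eulerD h = l * h) (hl0 : coeff 0 l = 0)
    {P₁ P₂ Q₁ Q₂ p₁ p₂ q₁ q₂ : PowerSeries K}
    (hP₁ : eulerD P₁ = p₁ * P₁) (hP₂ : eulerD P₂ = p₂ * P₂) (hQ₁ : eulerD Q₁ = q₁ * Q₁)
    (hQ₂ : eulerD Q₂ = q₂ * Q₂) (zp₁ : coeff 0 p₁ = 0) (zp₂ : coeff 0 p₂ = 0)
    (nQ₁ : coeff 0 Q₁ ≠ 0) (nQ₂ : coeff 0 Q₂ ≠ 0) {s s' : K} (hs' : s' ≠ 0)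
    {κ a b κ' a' b' : ℤ} (hκ : κ = κ') (ha : a = a') (hb : b = b') (x : ℤ → B) :
    (∀ k j, state c ε κ₁ κ₂ s κ a b P₁ P₂ (serL h) x k j =
        state c ε κ₁ κ₂ s' κ' a' b' Q₁ Q₂ (serR h) x k j) ↔
      (∀ j, (s * coeff 0 P₁ * coeff 0 P₂) • (coeff 0 h * x j) =
        (s' * coeff 0 Q₁ * coeff 0 Q₂) • (x j * coeff 0 h)) ∧
      ∀ (r : ℕ) (j : ℤ), coeff r l * x j - x j * coeff r l =
        (coeff r q₁ - coeff r p₁) • (((c ^ ((r : ℤ) * κ₁) : Bˣ) : B) * x (j + (r : ℤ) * ε)) +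
        (coeff r q₂ - coeff r p₂) • (((c ^ ((r : ℤ) * κ₂) : Bˣ) : B) * x (j + (r : ℤ) * ε)) := by
  subst hκ ha hb
  set θ₁ := theta c κ₁ ε
  set θ₂ := theta c κ₂ ε
  have hcomm : Commute (evS θ₁ P₁) (evS θ₂ p₂) := (isT_evS c κ₁ ε P₁).commute (isT_evS c κ₂ ε p₂)
  have hcomm' : Commute (evS θ₁ Q₁) (evS θ₂ q₂) := (isT_evS c κ₁ ε Q₁).commute (isT_evS c κ₂ ε q₂)
  have key := kills_exchange_iff hc hg hl hl0 (x := x)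
    (P := s • (evS θ₁ P₁ * evS θ₂ P₂)) (Q := s' • (evS θ₁ Q₁ * evS θ₂ Q₂))
    (pi := evS θ₁ p₁ + evS θ₂ p₂) (ka := evS θ₁ q₁ + evS θ₂ q₂)
    (Q' := s'⁻¹ • (evS θ₂ Q₂⁻¹ * evS θ₁ Q₁⁻¹))
    (((isT_evS c κ₁ ε P₁).mul (isT_evS c κ₂ ε P₂)).smul s)
    (((isT_evS c κ₁ ε Q₁).mul (isT_evS c κ₂ ε Q₂)).smul s')
    ((isT_evS c κ₁ ε p₁).add (isT_evS c κ₂ ε p₂))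
    ((isT_evS c κ₁ ε q₁).add (isT_evS c κ₂ ε q₂))
    (by
      rw [eulerD_smul, eulerD_mul, eulerD_evS, eulerD_evS, hP₁, hP₂, evS_mul, evS_mul, ← mul_assoc,
        hcomm.eq, add_mul, mul_smul_comm, mul_smul_comm, smul_add]
      simp only [mul_assoc])
    (by
      rw [eulerD_smul, eulerD_mul, eulerD_evS, eulerD_evS, hQ₁, hQ₂, evS_mul, evS_mul, ← mul_assoc,
        hcomm'.eq, add_mul, mul_smul_comm, mul_smul_comm, smul_add]
      simp only [mul_assoc])
    (by
      have e1 : evS θ₁ Q₁⁻¹ * evS θ₁ Q₁ = 1 := by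
        rw [← evS_mul, PowerSeries.inv_mul_cancel _ (by simpa using nQ₁), evS_one]
      have e2 : evS θ₂ Q₂⁻¹ * evS θ₂ Q₂ = 1 := by
        rw [← evS_mul, PowerSeries.inv_mul_cancel _ (by simpa using nQ₂), evS_one]
      rw [smul_mul_smul_comm, inv_mul_cancel₀ hs', one_smul, mul_assoc, ← mul_assoc (evS θ₁ Q₁⁻¹),
        e1, one_mul, e2])
    (by simp [coeff_evS, -coeff_zero_eq_constantCoeff, zp₁, zp₂])
  -- Cancellation of the common unit q^{κc/2} and of the translation by (a, b).
  have h1 : (∀ k j, state c ε κ₁ κ₂ s κ a b P₁ P₂ (serL h) x k j =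
        state c ε κ₁ κ₂ s' κ a b Q₁ Q₂ (serR h) x k j) ↔
      ∀ k j, s • serE ε (evS θ₁ P₁ * evS θ₂ P₂ * serL h) x k j =
        s' • serE ε (evS θ₁ Q₁ * evS θ₂ Q₂ * serR h) x k j := by
    constructor
    · intro hh k j
      have h2 := hh (k + a) (j + b)
      simp only [state, monoMul, add_sub_cancel_right, ← mul_smul_comm] at h2
      exact (Units.mul_right_inj _).mp h2
    · intro hh k j
      simp only [state, monoMul, ← mul_smul_comm]
      rw [hh]
  rw [h1, serE_sub_smul_eq_zero_iff,
    ← smul_mul_assoc s (evS θ₁ P₁ * evS θ₂ P₂), ← smul_mul_assoc s' (evS θ₁ Q₁ * evS θ₂ Q₂), key]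
  refine and_congr ?_ ?_
  · have h2 : coeff 0 (s • (evS θ₁ P₁ * evS θ₂ P₂) * serL h - s' • (evS θ₁ Q₁ * evS θ₂ Q₂) *
        serR h) x = fun j => (s * coeff 0 P₁ * coeff 0 P₂) • (coeff 0 h * x j) -
        (s' * coeff 0 Q₁ * coeff 0 Q₂) • (x j * coeff 0 h) := by
      funext j
      simp only [map_sub, smul_mul_assoc, coeff_smul, coeff_mul, mul_smul_comm,
        Finset.Nat.antidiagonal_zero, sum_singleton,
        coeff_evS, coeff_serL, coeff_serR, pow_zero, LinearMap.sub_apply, Pi.sub_apply,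
        LinearMap.smul_apply, Pi.smul_apply, one_mul, opL_apply, opR_apply, smul_smul, mul_assoc,
        mul_comm (coeff 0 P₁), mul_comm (coeff 0 Q₁)]
    rw [h2]
    simp only [funext_iff, Pi.zero_apply, sub_eq_zero]
  · refine forall_congr' fun r => ?_
    rw [funext_iff]
    refine forall_congr' fun j => ?_
    simp only [map_sub, map_add, coeff_serL, coeff_serR, coeff_evS, LinearMap.sub_apply,
      LinearMap.add_apply, LinearMap.smul_apply, Pi.sub_apply, Pi.add_apply, Pi.smul_apply,
      opL_apply, opR_apply, θ₁, θ₂, theta_pow, theta_apply, Pi.zero_apply]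
    rw [sub_eq_zero, sub_smul, sub_smul]
    constructor
    · intro h; rw [h]; abel
    · intro h; rw [h]; abel

end Operators

end OspAffine

end

noncomputable section

namespace OspAffine

open PowerSeries Finset

/-! ### Root data -/

section RootData

variable {m n : ℕ}

/-- The condition i < m + n is needed because the vector with index m + n is zero, so the last root
pairs only with its own first term. -/
theorem form_eps_root (i : ℕ) (j : Fin (m + n)) : form (eps m n i) (root j) =
    if i = j then dNorm n i else if i = j + 1 ∧ i < m + n then -dNorm n i else 0 := by
  by_cases hi : i < m + n
  · rw [form, sum_eq_single (⟨i, hi⟩ : Fin (m + n))]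
    · simp only [eps, root, Pi.sub_apply, if_true, mul_one]
      split_ifs <;> omega
    · intro b _ hb
      have : (b : ℕ) ≠ i := fun h => hb (Fin.ext h)
      simp [eps, this]
    · simp
  · rw [form, sum_eq_zero]
    · have := j.2
      rw [if_neg (by omega), if_neg (by omega)]
    · intro b _
      have : (b : ℕ) ≠ i := by have := b.2; omega
      simp [eps, this]

theorem form_root_left (i j : Fin (m + n)) : form (root i) (root j) =
    form (eps m n i) (root j) - form (eps m n (i + 1)) (root j) := by
  rw [form, form, form, ← sum_sub_distrib]
  refine sum_congr rfl fun a _ => ?_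
  simp only [root, Pi.sub_apply]
  ring

theorem dNorm_cases (n a : ℕ) : (a < n ∧ dNorm n a = -1) ∨ (n ≤ a ∧ dNorm n a = 1) := by
  rw [dNorm]
  split_ifs with h
  · exact Or.inl ⟨h, rfl⟩
  · exact Or.inr ⟨not_lt.mp h, rfl⟩

theorem nu_succ (n i : ℕ) : nu n (i + 1) = nu n i + dNorm n (i + 1) := by
  rw [nu, sum_range_succ, nu]

theorem form_root_root (i j : Fin (m + n)) : form (root i) (root j) =
    if (i : ℕ) = j then (if (i : ℕ) + 1 < m + n then dNorm n i + dNorm n (i + 1) else dNorm n i)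
    else if (j : ℕ) = i + 1 then -dNorm n (i + 1)
    else if (i : ℕ) = j + 1 then -dNorm n i else 0 := by
  have := i.2
  have := j.2
  rw [form_root_left, form_eps_root, form_eps_root]
  split_ifs <;> omega

theorem form_root_comm (i j : Fin (m + n)) : form (root i) (root j) = form (root j) (root i) := by
  rw [form, form]
  exact sum_congr rfl fun a _ => by ring

theorem cartan_eq_zero_iff (i j : Fin (m + n)) : cartan i j = 0 ↔ form (root i) (root j) = 0 := by
  rw [cartan]
  split_ifs <;> omega

end RootData

/-! ### The ground field -/

theorem qHalf_ne_zero : qHalf ≠ 0 := RatFunc.X_ne_zero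

theorem q_ne_zero : q ≠ 0 := pow_ne_zero 2 qHalf_ne_zero

/-- Comparison of degrees of polynomials. The non-vanishing of q_i - q_i⁻¹ and of 1 + ζ^r both come
from this. -/
theorem qHalf_zpow_eq_C {a : ℤ} {b : ℂ} (h : qHalf ^ a = RatFunc.C b) : a = 0 := by
  have key : ∀ (k : ℕ) (b : ℂ), qHalf ^ k = RatFunc.C b → k = 0 := by
    intro k b h
    have h1 : algebraMap (Polynomial ℂ) (RatFunc ℂ) (Polynomial.X ^ k) =
        algebraMap (Polynomial ℂ) (RatFunc ℂ) (Polynomial.C b) := by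
      rw [map_pow, RatFunc.algebraMap_X, RatFunc.algebraMap_C]; exact h
    have h2 := congrArg Polynomial.natDegree (RatFunc.algebraMap_injective ℂ h1)
    simpa using h2
  rcases a with k | k
  · have := key k b (by simpa using h)
    simp [this]
  · have h1 : qHalf ^ (k + 1) = RatFunc.C b⁻¹ := by
      rw [zpow_negSucc] at h
      rw [map_inv₀, ← h, inv_inv]
    exact absurd (key _ _ h1) (Nat.succ_ne_zero k)

theorem qNode_sub_inv_ne_zero {m n : ℕ} (i : Fin (m + n)) : qNode i - (qNode i)⁻¹ ≠ 0 := by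
  have key : ∀ k : ℕ, k ≠ 0 → qHalf ^ k - (qHalf ^ k)⁻¹ ≠ 0 := by
    intro k hk h
    have h' : qHalf ^ k * qHalf ^ k = 1 := by
      rw [sub_eq_zero] at h
      nth_rewrite 2 [h]
      exact mul_inv_cancel₀ (pow_ne_zero k qHalf_ne_zero)
    rw [← pow_add] at h'
    have := qHalf_zpow_eq_C (a := ((k + k : ℕ) : ℤ)) (b := 1) (by rw [zpow_natCast, h', map_one])
    omega
  rw [qNode]
  split_ifs with h
  · exact key 2 two_ne_zero
  · exact key _ (Int.natAbs_ne_zero.mpr h)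

/-- In the last row q_i is q^{1/2}, because m > 0 makes the last root of square length 1; the
doubled Cartan entry compensates for this. In all other rows the square length is 0 or ±2, so q_i =
q. Hence both presentations only involve powers q^{(α_i,α_j)}. -/
theorem qNode_zpow_cartan {m n : ℕ} (hm : 0 < m) (i j : Fin (m + n)) (r : ℤ) :
    qNode i ^ (r * cartan i j) = q ^ (r * form (root i) (root j)) := by
  have hi := form_root_root i i
  rw [if_pos rfl] at hi
  rw [cartan]
  by_cases h : (i : ℕ) + 1 = m + n
  · rw [if_neg (by omega), show dNorm n i = 1 from if_neg (by omega)] at hi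
    rw [if_pos h, qNode, hi, if_neg one_ne_zero, q]
    simp only [Int.natAbs_one, pow_one]
    rw [← zpow_natCast qHalf 2, ← zpow_mul]
    congr 1
    push_cast; ring
  · have h1 := i.2
    have h2 : qNode i = q := by
      rw [qNode]
      split_ifs with h3
      · rfl
      · rw [q]
        congr 1
        rw [if_pos (by omega)] at hi
        rcases dNorm_cases n i with ⟨_, e1⟩ | ⟨_, e1⟩ <;>
          rcases dNorm_cases n (i + 1) with ⟨_, e2⟩ | ⟨_, e2⟩ <;> rw [e1, e2] at hi <;> omega
    rw [if_neg h, h2]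

theorem zeta_zpow (m n : ℕ) (r : ℤ) :
    zeta m n ^ r = (q ^ r) ^ (2 * (m : ℤ) - 2 * (n : ℤ) - 1) := by
  rw [zeta, ← zpow_mul, ← zpow_mul, mul_comm]

/-- The exponent 2m - 2n - 1 is odd, hence not zero, so ζ^r is a nontrivial power of q^{1/2} and
cannot be the constant -1. This makes the denominators in f harmless and the total weight `sum_wt`
invertible. -/
theorem one_add_zeta_zpow_ne_zero (m n : ℕ) {r : ℤ} (hr : r ≠ 0) : 1 + zeta m n ^ r ≠ 0 := by
  intro h
  have h1 : qHalf ^ (2 * ((2 * (m : ℤ) - 2 * (n : ℤ) - 1) * r)) = RatFunc.C (-1) := by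
    rw [map_neg, map_one, ← eq_neg_of_add_eq_zero_right h, zeta, q, ← zpow_mul, ← zpow_natCast,
      ← zpow_mul]
    rfl
  have h2 := qHalf_zpow_eq_C h1
  have h3 : 2 * (m : ℤ) - 2 * (n : ℤ) - 1 ≠ 0 := by omega
  simp [h3, hr] at h2

/-! ### Structure constants -/

section Constants

variable (m n : ℕ)

/-- The structure constants of the action of the logarithm of `h_i` on `X_j`, at `t = q^r`. -/
def chi (i j : ℕ) (t : K) : K :=
  if i = m + n then (if j + 1 = m + n then 1 + t⁻¹ - t - t⁻¹ ^ 2 else 0)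
  else if i = j then 1 - t ^ (-2 * dNorm n i)
  else if i = j + 1 then 1 - t ^ (2 * dNorm n i) else 0

/-- The contribution of `θ_{ij}` to the brackets of logarithms. -/
def lamT (i j : ℕ) (t : K) : K :=
  if i < j then t⁻¹ ^ 2 - 1 else if j < i then 1 - t ^ 2
  else if i < n then t⁻¹ ^ 2 - t ^ 2 else if i < m + n then 0
  else t⁻¹ ^ 2 - t ^ 2 + t - t⁻¹

/-- The power of `t` that specializes to a power of `ζ`. -/
def zetaT (t : K) : K := t ^ (2 * (m : ℤ) - 2 * (n : ℤ) - 1)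

/-- The contribution of `g` to the brackets of logarithms. -/
def lamG (t : K) : K :=
  (t ^ 2 + t⁻¹ ^ 2 + zetaT m n t + (zetaT m n t)⁻¹) / (1 + zetaT m n t) - t⁻¹ ^ 2 - (zetaT m n t)⁻¹

/-- The structure constants of the brackets of logarithms of `h_i^+` and `h_j^-`. -/
def lam (i j : ℕ) (t : K) : K := lamG m n t + lamT m n i j t

/-- The exponents expressing the logarithm of `c` through those of the `h_i`. -/
def wt (i : ℕ) (t : K) : K :=
  if i < n then zetaT m n t * t ^ (2 * (i : ℤ)) - zetaT m n t * t ^ (2 * (i : ℤ) + 2)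
  else if i < m + n then
    t ^ (2 * (m : ℤ) - 2 * ((i : ℤ) - n) - 1) - t ^ (2 * (m : ℤ) - 2 * ((i : ℤ) - n) - 3)
  else 1 + t⁻¹

variable {m n}

theorem chi_self {i : ℕ} (h : i < m + n) (t : K) :
    chi m n i i t = 1 - t ^ (-2 * dNorm n i) := by
  rw [chi, if_neg h.ne, if_pos rfl]

theorem chi_succ {i : ℕ} (h : i + 1 < m + n) (t : K) :
    chi m n (i + 1) i t = 1 - t ^ (2 * dNorm n (i + 1)) := by
  rw [chi, if_neg h.ne, if_neg (Nat.succ_ne_self i), if_pos rfl]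

theorem chi_last_last {j : ℕ} (h : j + 1 = m + n) (t : K) :
    chi m n (m + n) j t = 1 + t⁻¹ - t - t⁻¹ ^ 2 := by
  rw [chi, if_pos rfl, if_pos h]

theorem chi_eq_zero {i j : ℕ} (h : i ≠ j) (h' : i ≠ j + 1) (t : K) : chi m n i j t = 0 := by
  rw [chi]
  split_ifs <;> first | omega | rfl

theorem lamT_lt {i j : ℕ} (h : i < j) (t : K) : lamT m n i j t = t⁻¹ ^ 2 - 1 := if_pos h

theorem lamT_gt {i j : ℕ} (h : j < i) (t : K) : lamT m n i j t = 1 - t ^ 2 := by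
  rw [lamT, if_neg h.not_gt, if_pos h]

theorem lamT_odd {i : ℕ} (h : i < n) (t : K) : lamT m n i i t = t⁻¹ ^ 2 - t ^ 2 := by
  rw [lamT, if_neg (lt_irrefl i), if_neg (lt_irrefl i), if_pos h]

theorem lamT_even {i : ℕ} (h : n ≤ i) (h' : i < m + n) (t : K) : lamT m n i i t = 0 := by
  rw [lamT, if_neg (lt_irrefl i), if_neg (lt_irrefl i), if_neg h.not_gt, if_pos h']

theorem lamT_last {i : ℕ} (h : i = m + n) (t : K) :
    lamT m n i i t = t⁻¹ ^ 2 - t ^ 2 + t - t⁻¹ := by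
  rw [lamT, if_neg (lt_irrefl i), if_neg (lt_irrefl i), if_neg (by omega), if_neg (by omega)]

/-- The weights of both ranges telescope, and the two telescopes meet because ζ q^{2n} = q^{2m-1}.
-/
theorem sum_range_wt {t : K} (ht : t ≠ 0) :
    ∑ i ∈ range (m + n), wt m n i t = zetaT m n t - t⁻¹ := by
  rw [add_comm m n, sum_range_add]
  have h1 : ∀ i ∈ range n, wt m n i t =
      zetaT m n t * t ^ (2 * (i : ℤ)) - zetaT m n t * t ^ (2 * ((i + 1 : ℕ) : ℤ)) := by
    intro i hi
    rw [wt, if_pos (mem_range.mp hi)]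
    congr 3
  have h2 : ∀ i ∈ range m, wt m n (n + i) t =
      t ^ (2 * (m : ℤ) - 2 * (i : ℤ) - 1) - t ^ (2 * (m : ℤ) - 2 * ((i + 1 : ℕ) : ℤ) - 1) := by
    intro i hi
    rw [wt, if_neg (by omega), if_pos (by have := mem_range.mp hi; omega)]
    congr 2 <;> push_cast <;> ring
  rw [sum_congr rfl h1, sum_congr rfl h2,
    sum_range_sub' (fun i : ℕ => zetaT m n t * t ^ (2 * (i : ℤ))),
    sum_range_sub' (fun i : ℕ => t ^ (2 * (m : ℤ) - 2 * (i : ℤ) - 1)), zetaT, ← zpow_add₀ ht,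
    ← zpow_add₀ ht]
  have e1 : 2 * (m : ℤ) - 2 * n - 1 + 2 * (n : ℤ) = 2 * (m : ℤ) - 2 * ((0 : ℕ) : ℤ) - 1 := by
    push_cast; ring
  have e2 : 2 * (m : ℤ) - 2 * (m : ℤ) - 1 = -1 := by ring
  rw [e1, e2]
  simp

theorem wt_last (t : K) : wt m n (m + n) t = 1 + t⁻¹ := by
  rw [wt, if_neg (by omega), if_neg (by omega)]

/-- At t = q^r this is 1 + ζ^r. Since it is not zero, the logarithms of the h_i can be recovered
from their differences and from the logarithm of c. -/
theorem sum_wt {t : K} (ht : t ≠ 0) :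
    ∑ i ∈ range (m + n + 1), wt m n i t = 1 + zetaT m n t := by
  rw [sum_range_succ, sum_range_wt ht, wt_last]
  ring

/-- Consecutive weights have ratio t² among the odd ε_a, -1 across the odd root, and t⁻² among the
even ones. These are the ratios forced by ∑ w_i χ_{ij} = 0, where only i = j and i = j + 1
contribute. -/
theorem wt_succ_of_lt {t : K} (ht : t ≠ 0) {i : ℕ} (h : i + 1 < n) :
    wt m n (i + 1) t = t ^ 2 * wt m n i t := by
  rw [wt, wt, if_pos h, if_pos (by omega)]
  have e1 : t ^ (2 * ((i + 1 : ℕ) : ℤ)) = t ^ (2 * (i : ℤ)) * t ^ 2 := by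
    rw [← zpow_natCast t 2, ← zpow_add₀ ht]; congr 1
  have e2 : t ^ (2 * ((i + 1 : ℕ) : ℤ) + 2) = t ^ (2 * (i : ℤ) + 2) * t ^ 2 := by
    rw [← zpow_natCast t 2, ← zpow_add₀ ht]; congr 1
  rw [e1, e2]; ring

theorem wt_succ_eq {t : K} (ht : t ≠ 0) (hm : 0 < m) {i : ℕ} (h : i + 1 = n) :
    wt m n (i + 1) t = -wt m n i t := by
  rw [wt, wt, if_neg (by omega), if_pos (by omega), if_pos (by omega), zetaT, ← zpow_add₀ ht,
    ← zpow_add₀ ht, neg_sub]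
  subst h
  congr 2 <;> push_cast <;> ring

theorem wt_succ_of_ge {t : K} (ht : t ≠ 0) {i : ℕ} (h : n ≤ i) (h' : i + 1 < m + n) :
    t ^ 2 * wt m n (i + 1) t = wt m n i t := by
  rw [wt, wt, if_neg (by omega), if_pos h', if_neg (by omega), if_pos (by omega), mul_sub,
    ← zpow_natCast t 2, ← zpow_add₀ ht, ← zpow_add₀ ht]
  congr 2 <;> push_cast <;> ring

theorem wt_penultimate (t : K) (hm : 0 < m) {i : ℕ} (h : i + 1 = m + n) :
    wt m n i t = t - t⁻¹ := by
  rw [wt, if_neg (by omega), if_pos (by omega)]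
  have e1 : 2 * (m : ℤ) - 2 * ((i : ℤ) - n) - 1 = 1 := by omega
  have e2 : 2 * (m : ℤ) - 2 * ((i : ℤ) - n) - 3 = -1 := by omega
  rw [e1, e2]; simp

theorem sum_range_eq_two {f : ℕ → K} {j N : ℕ} (hj : j < N)
    (h : ∀ i, i ≤ N → i ≠ j → i ≠ j + 1 → f i = 0) :
    ∑ i ∈ range (N + 1), f i = f j + f (j + 1) := by
  refine sum_eq_add_of_mem j (j + 1) (by simp; omega) (by simp; omega) (by omega) ?_
  intro i hi hne
  exact h i (by simp at hi; omega) hne.1 hne.2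

theorem zpow_dNorm_cases {t : K} (a : ℕ) :
    (a < n ∧ t ^ (-2 * dNorm n a) = t ^ 2 ∧ t ^ (2 * dNorm n a) = t⁻¹ ^ 2) ∨
    (n ≤ a ∧ t ^ (-2 * dNorm n a) = t⁻¹ ^ 2 ∧ t ^ (2 * dNorm n a) = t ^ 2) := by
  rcases dNorm_cases n a with ⟨h, e⟩ | ⟨h, e⟩
  · refine Or.inl ⟨h, ?_, ?_⟩ <;> rw [e]
    · exact zpow_natCast t 2
    · rw [inv_pow, ← zpow_natCast, ← zpow_neg]; rfl
  · refine Or.inr ⟨h, ?_, ?_⟩ <;> rw [e]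
    · rw [inv_pow, ← zpow_natCast, ← zpow_neg]; rfl
    · exact zpow_natCast t 2

/-- Column j of χ has just two nonzero entries, and the ratio of the two weights makes them cancel.
It says that the logarithm of c commutes with X_j. -/
theorem sum_wt_mul_chi {t : K} (ht : t ≠ 0) (hm : 0 < m) {j : ℕ} (hj : j < m + n) :
    ∑ i ∈ range (m + n + 1), wt m n i t * chi m n i j t = 0 := by
  rw [sum_range_eq_two hj]
  · rcases eq_or_ne (j + 1) (m + n) with h | h
    · rw [wt_penultimate t hm h, chi_self hj, h, wt_last, chi_last_last h]
      rcases zpow_dNorm_cases (n := n) (t := t) j with ⟨h1, _⟩ | ⟨_, e, _⟩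
      · omega
      rw [e]
      field_simp
      ring
    · rw [chi_self hj, chi_succ (by omega)]
      rcases zpow_dNorm_cases (n := n) (t := t) j with ⟨h1, e1, e2⟩ | ⟨h1, e1, e2⟩ <;>
        rcases zpow_dNorm_cases (n := n) (t := t) (j + 1) with ⟨h2, e3, e4⟩ | ⟨h2, e3, e4⟩
      · rw [wt_succ_of_lt ht h2, e1, e4]
        field_simp
        ring
      · rw [wt_succ_eq ht hm (by omega), e1, e4]
        ring
      · omega
      · rw [← wt_succ_of_ge ht h1 (by omega), e1, e4]
        field_simp
        ring
  · intro i hi h1 h2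
    rw [chi_eq_zero h1 h2, mul_zero]

theorem zetaT_ne_zero {t : K} (ht : t ≠ 0) : zetaT m n t ≠ 0 := zpow_ne_zero _ ht

theorem zetaT_inv (t : K) : zetaT m n t⁻¹ = (zetaT m n t)⁻¹ := inv_zpow _ _

/-- Since 1/(1+ζ) + 1/(1+ζ⁻¹) = 1, the two fractions add up to their common numerator, whose four
terms are cancelled by the remaining ones. It is used to pass between t and t⁻¹ in the weighted
sums. -/
theorem lamG_inv {t : K} (ht : t ≠ 0) (hz : 1 + zetaT m n t ≠ 0) :
    lamG m n t⁻¹ = -lamG m n t := by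
  have h1 := zetaT_ne_zero (m := m) (n := n) ht
  rw [lamG, lamG, zetaT_inv]
  simp only [inv_inv]
  have h2 : 1 + (zetaT m n t)⁻¹ = (1 + zetaT m n t) * (zetaT m n t)⁻¹ := by
    rw [add_mul, mul_inv_cancel₀ h1]; ring
  rw [h2]
  generalize zetaT m n t = z at *
  field_simp
  ring

theorem lam_inv {t : K} (ht : t ≠ 0) (hz : 1 + zetaT m n t ≠ 0) (i j : ℕ) :
    lam m n i j t⁻¹ = -lam m n j i t := by
  rw [lam, lam, lamG_inv ht hz, lamT, lamT]
  rcases lt_trichotomy i j with h | rfl | h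
  · rw [if_pos h, if_neg (by omega), if_pos h, inv_inv]; ring
  · simp only [lt_irrefl, if_false, inv_inv]
    split_ifs <;> ring
  · rw [if_neg (by omega), if_pos h, if_pos h]; ring

/-- The sum does not depend on j: two neighbouring columns differ only in the rows j and j + 1,
where the ratio of the weights cancels the difference. In the last column all rows but the last
carry the same constant, so the sum is (1 + ζ) times the contribution of g plus an explicit term,
and the shape of f makes this vanish. -/
theorem sum_wt_mul_lam {t : K} (ht : t ≠ 0) (hm : 0 < m) (hz : 1 + zetaT m n t ≠ 0) {j : ℕ}
    (hj : j ≤ m + n) : ∑ i ∈ range (m + n + 1), wt m n i t * lam m n i j t = 0 := by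
  have hstep : ∀ j, j < m + n → ∑ i ∈ range (m + n + 1), wt m n i t * lam m n i (j + 1) t =
      ∑ i ∈ range (m + n + 1), wt m n i t * lam m n i j t := by
    intro j hj
    rw [← sub_eq_zero, ← sum_sub_distrib, sum_range_eq_two hj]
    · simp only [lam]
      rw [lamT_lt (Nat.lt_succ_self j), lamT_gt (Nat.lt_succ_self j)]
      rcases eq_or_ne (j + 1) (m + n) with h | h
      · rw [wt_penultimate t hm h, lamT_even (by omega) hj, lamT_last h, h, wt_last]
        field_simp
        ring
      · by_cases h1 : j + 1 < n
        · rw [wt_succ_of_lt ht h1, lamT_odd h1, lamT_odd (by omega)]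
          field_simp
          ring
        · by_cases h2 : j + 1 = n
          · rw [wt_succ_eq ht hm h2, lamT_odd (by omega), lamT_even (by omega) (by omega)]
            ring
          · rw [← wt_succ_of_ge ht (i := j) (by omega) (by omega), lamT_even (by omega) (by omega),
              lamT_even (by omega) (by omega)]
            field_simp
            ring
    · intro i hi h1 h2
      rcases Nat.lt_or_gt_of_ne h1 with h3 | h3
      · rw [lam, lam, lamT_lt h3, lamT_lt (by omega), sub_self]
      · rw [lam, lam, lamT_gt h3, lamT_gt (by omega), sub_self]
  have hlast : ∑ i ∈ range (m + n + 1), wt m n i t * lam m n i (m + n) t = 0 := by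
    have h1 : ∀ i ∈ range (m + n), wt m n i t * lam m n i (m + n) t =
        wt m n i t * (lamG m n t + (t⁻¹ ^ 2 - 1)) := by
      intro i hi
      rw [lam, lamT, if_pos (mem_range.mp hi)]
    rw [sum_range_succ, sum_congr rfl h1, ← sum_mul, sum_range_wt ht, wt_last, lam, lamT,
      if_neg (lt_irrefl _), if_neg (lt_irrefl _), if_neg (by omega), if_neg (lt_irrefl _), lamG]
    have h2 := zetaT_ne_zero (m := m) (n := n) ht
    generalize zetaT m n t = z at *
    field_simp
    ring
  -- Descent from the last column, where the value is known, by induction on the distance to it.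
  have hdesc : ∀ d j, j + d = m + n → ∑ i ∈ range (m + n + 1), wt m n i t * lam m n i j t = 0 := by
    intro d
    induction d with
    | zero => intro j h; rw [add_zero] at h; rw [h, hlast]
    | succ d ih =>
      intro j h
      rw [← hstep j (by omega)]
      exact ih (j + 1) (by omega)
  exact hdesc (m + n - j) j (by omega)

theorem sum_wt_inv_mul_lam {t : K} (ht : t ≠ 0) (hm : 0 < m) (hz : 1 + zetaT m n t ≠ 0) {i : ℕ}
    (hi : i ≤ m + n) : ∑ j ∈ range (m + n + 1), wt m n j t⁻¹ * lam m n i j t = 0 := by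
  have hz' : 1 + zetaT m n t⁻¹ ≠ 0 := by
    rw [zetaT_inv]
    have h1 := zetaT_ne_zero (m := m) (n := n) ht
    intro h
    apply hz
    have : (1 + (zetaT m n t)⁻¹) * zetaT m n t = 0 := by rw [h, zero_mul]
    rwa [add_mul, inv_mul_cancel₀ h1, one_mul, add_comm] at this
  have h := sum_wt_mul_lam (inv_ne_zero ht) hm hz' hi
  rw [← neg_eq_zero, ← sum_neg_distrib, ← h]
  refine sum_congr rfl fun j _ => ?_
  rw [lam_inv ht hz]; ring

theorem zpow_one_two (t : K) : t ^ (1 : ℤ) = t ∧ t ^ (-1 : ℤ) = t⁻¹ ∧ t ^ (2 : ℤ) = t ^ 2 ∧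
    t ^ (-2 : ℤ) = t⁻¹ ^ 2 :=
  ⟨zpow_one t, zpow_neg_one t, zpow_natCast t 2, by
    rw [inv_pow, ← zpow_natCast, ← zpow_neg]; rfl⟩

/-- The shift by ν symmetrises the constants: for neighbouring roots the difference is ±(1 -
t^{±2}), and the factor t^{±1} coming from ν_j - ν_i turns it into a multiple of t - t⁻¹. -/
theorem chi_succ_sub_chi {t : K} (ht : t ≠ 0) (hm : 0 < m) (i j : Fin (m + n)) :
    t ^ (nu n j - nu n i) * (chi m n (i + 1) j t - chi m n i j t) =
      -(t ^ form (root i) (root j) - t ^ (-form (root i) (root j))) := by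
  have hi := i.2
  have hj := j.2
  obtain ⟨z1, z2, z3, z4⟩ := zpow_one_two t
  rw [form_root_root]
  by_cases h1 : (i : ℕ) = j
  · rw [if_pos h1, ← h1, sub_self, zpow_zero, one_mul, chi_self hi]
    by_cases h2 : (i : ℕ) + 1 = m + n
    · rw [h2, chi_last_last h2, if_neg (lt_irrefl _), show dNorm n i = 1 from if_neg (by omega)]
      norm_num [z4]
      ring
    · rw [chi_succ (by omega), if_pos (by omega)]
      rcases dNorm_cases n i with ⟨_, e1⟩ | ⟨_, e1⟩ <;>
        rcases dNorm_cases n (i + 1) with ⟨_, e2⟩ | ⟨_, e2⟩ <;> rw [e1, e2] <;> norm_num [z3, z4]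
  · rw [if_neg h1]
    by_cases h2 : (j : ℕ) = i + 1
    · rw [if_pos h2, h2, nu_succ, add_sub_cancel_left, chi_self (by omega),
        chi_eq_zero (by omega) (by omega)]
      rcases dNorm_cases n (i + 1) with ⟨_, e2⟩ | ⟨_, e2⟩ <;> rw [e2] <;> norm_num [z3, z4, z2] <;>
        field_simp
    · rw [if_neg h2]
      by_cases h3 : (i : ℕ) = j + 1
      · rw [if_pos h3, h3, nu_succ, sub_add_cancel_left, chi_succ (by omega),
          chi_eq_zero (by omega) (by omega)]
        rcases dNorm_cases n (j + 1) with ⟨_, e2⟩ | ⟨_, e2⟩ <;> rw [e2] <;>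
          norm_num [z3, z4, z2] <;> field_simp
      · rw [if_neg h3, chi_eq_zero (by omega) (by omega), chi_eq_zero (by omega) (by omega)]
        simp

/-- The contribution of g is the same for all pairs and drops out, so the brackets of the logarithms
of the Φ_i do not see f. What remains of the θ_{ij} is symmetrised by the shift by ν as in
`chi_succ_sub_chi`. -/
theorem lam_double_difference {t : K} (ht : t ≠ 0) (hm : 0 < m) (i j : Fin (m + n)) :
    t ^ (nu n j - nu n i) * (lam m n (i + 1) (j + 1) t - lam m n i (j + 1) t -
      (lam m n (i + 1) j t - lam m n i j t)) =
      t ^ form (root i) (root j) - t ^ (-form (root i) (root j)) := by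
  have hi := i.2
  have hj := j.2
  obtain ⟨z1, z2, z3, z4⟩ := zpow_one_two t
  simp only [lam]
  rw [form_root_root]
  by_cases h1 : (i : ℕ) = j
  · rw [if_pos h1, ← h1, sub_self, zpow_zero, one_mul, lamT_lt (Nat.lt_succ_self _),
      lamT_gt (Nat.lt_succ_self _)]
    by_cases h2 : (i : ℕ) + 1 = m + n
    · rw [lamT_last h2, lamT_even (by omega) hi, if_neg (by omega),
        show dNorm n i = 1 from if_neg (by omega)]
      simp only [z1, z2]
      ring
    · rw [if_pos (by omega)]
      rcases dNorm_cases n i with ⟨h3, e1⟩ | ⟨h3, e1⟩ <;>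
        rcases dNorm_cases n (i + 1) with ⟨h4, e2⟩ | ⟨h4, e2⟩
      · rw [e1, e2, lamT_odd h3, lamT_odd h4]; norm_num [z3, z4]
      · rw [e1, e2, lamT_odd h3, lamT_even h4 (by omega)]; norm_num
      · omega
      · rw [e1, e2, lamT_even h3 hi, lamT_even h4 (by omega)]; norm_num [z3, z4]
  · rw [if_neg h1]
    by_cases h2 : (j : ℕ) = i + 1
    · rw [if_pos h2, h2, nu_succ, add_sub_cancel_left, lamT_lt (i := i) (j := i + 1) (by omega),
        lamT_lt (i := i) (j := i + 1 + 1) (by omega), lamT_lt (i := i + 1) (j := i + 1 + 1) (by omega)]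
      rcases dNorm_cases n (i + 1) with ⟨h4, e2⟩ | ⟨h4, e2⟩
      · rw [e2, lamT_odd h4]; norm_num [z3, z4, z2]; field_simp
      · rw [e2, lamT_even h4 (by omega)]; norm_num [z3, z4, z2]; field_simp
    · rw [if_neg h2]
      by_cases h3 : (i : ℕ) = j + 1
      · rw [if_pos h3, h3, nu_succ, sub_add_cancel_left, lamT_gt (i := j + 1) (j := j) (by omega),
          lamT_gt (i := j + 1 + 1) (j := j) (by omega),
          lamT_gt (i := j + 1 + 1) (j := j + 1) (by omega)]
        rcases dNorm_cases n (j + 1) with ⟨h4, e2⟩ | ⟨h4, e2⟩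
        · rw [e2, lamT_odd h4]; norm_num [z3, z4, z2]; field_simp
        · rw [e2, lamT_even h4 (by omega)]; norm_num [z3, z4, z2]; field_simp
      · rw [if_neg h3]
        rcases Nat.lt_or_gt_of_ne h1 with h4 | h4
        · rw [lamT_lt (by omega), lamT_lt (by omega), lamT_lt (by omega), lamT_lt (by omega)]
          simp
        · rw [lamT_gt (by omega), lamT_gt (by omega), lamT_gt (by omega), lamT_gt (by omega)]
          simp

end Constants

end OspAffine

end

noncomputable section

namespace OspAffine

open PowerSeries Finset

/-! ### Logarithmic derivatives of scalar series -/

/-- Minus the logarithmic derivative of `1 - a z`. -/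
def geomS (a : K) : PowerSeries K := PowerSeries.mk fun r => if r = 0 then 0 else a ^ r

theorem coeff_geomS (a : K) (r : ℕ) : coeff r (geomS a) = if r = 0 then 0 else a ^ r := by
  simp [geomS]

theorem coeff_zero_geomS (a : K) : coeff 0 (geomS a) = 0 := by simp [geomS]

theorem eulerD_one_sub (a : K) : eulerD (1 - C a * X) = -geomS a * (1 - C a * X) := by
  have h : geomS a * (1 - C a * X) = C a * X := by
    rw [mul_sub, mul_one, ← mul_assoc, mul_comm _ (C a), mul_assoc]
    ext r
    rw [map_sub, coeff_C_mul, coeff_C_mul, coeff_geomS]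
    rcases r with _ | _ | r
    · simp
    · rw [PowerSeries.coeff_succ_mul_X, coeff_geomS]; simp
    · rw [PowerSeries.coeff_succ_mul_X, coeff_geomS, PowerSeries.coeff_X]
      simp [pow_succ]; ring
  rw [neg_mul, h, eulerD_sub, eulerD_one, zero_sub, eulerD_mul, eulerD_C, zero_mul, zero_add]
  congr 2
  ext r
  rw [coeff_eulerD, PowerSeries.coeff_X]
  split_ifs with hr <;> simp [hr]

theorem eulerD_one_sub_mul (a : K) {G L : PowerSeries K} (hG : eulerD G = L * G) :
    eulerD ((1 - C a * X) * G) = (L - geomS a) * ((1 - C a * X) * G) := by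
  rw [eulerD_mul, eulerD_one_sub, hG]; ring

theorem eulerD_one_scalar : eulerD (1 : PowerSeries K) = 0 * 1 := by simp

/-- The logarithmic derivative of `g`. -/
def gLog (m n : ℕ) : PowerSeries K :=
  PowerSeries.mk fun r => if r = 0 then 0 else lamG m n (q ^ r)

theorem coeff_gLog (m n r : ℕ) : coeff r (gLog m n) = if r = 0 then 0 else lamG m n (q ^ r) := by
  simp [gLog]

theorem zetaT_q_pow (m n r : ℕ) : zetaT m n (q ^ r) = zeta m n ^ r := by
  rw [← zpow_natCast, ← zpow_natCast (zeta m n), zeta_zpow, zetaT]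

theorem eulerD_X_sub_C {b : K} (hb : b ≠ 0) :
    eulerD (X - C b : PowerSeries K) = -geomS b⁻¹ * (X - C b) := by
  have h : (X - C b : PowerSeries K) = C (-b) * (1 - C b⁻¹ * X) := by
    rw [mul_sub, mul_one, ← mul_assoc, ← map_mul, neg_mul, mul_inv_cancel₀ hb]
    simp; ring
  rw [h, eulerD_mul, eulerD_C, eulerD_one_sub]; ring

theorem zeta_ne_zero (m n : ℕ) : zeta m n ≠ 0 := zpow_ne_zero _ q_ne_zero

/-- The exponential f contributes the derivative of its exponent, in which the factor 1/k is
cancelled. The linear factors z - q² and z - ζ subtract the geometric series in q⁻² and ζ⁻¹. In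
degree r this is `lamG` at t = q^r. -/
theorem eulerD_gSeries (m n : ℕ) : eulerD (gSeries m n) = gLog m n * gSeries m n := by
  have h0 : ∀ S : PowerSeries K, Commute S (eulerD S) := fun S => Commute.all _ _
  rw [gSeries, eulerD_mul, eulerD_mul, eulerD_X_sub_C (pow_ne_zero 2 q_ne_zero),
    eulerD_X_sub_C (zeta_ne_zero m n), fSeries, eulerD_fExp (by simp) (h0 _)]
  set S : PowerSeries K := PowerSeries.mk fun k => if k = 0 then 0 else
      (q ^ (2 * (k : ℤ)) + q ^ (-(2 * (k : ℤ))) + zeta m n ^ (k : ℤ) + zeta m n ^ (-(k : ℤ))) /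
        ((k : K) * (1 + zeta m n ^ (k : ℤ)))
  have h1 : gLog m n = eulerD S - geomS (q ^ 2)⁻¹ - geomS (zeta m n)⁻¹ := by
    ext r
    rw [map_sub, map_sub, coeff_geomS, coeff_geomS, coeff_eulerD, coeff_mk, coeff_gLog]
    split_ifs with hr
    · simp
    · have hz : 1 + zeta m n ^ r ≠ 0 := by
        simpa using one_add_zeta_zpow_ne_zero m n (r := r) (by exact_mod_cast hr)
      have hr' : (r : K) ≠ 0 := Nat.cast_ne_zero.mpr hr
      rw [lamG, zetaT_q_pow, nsmul_eq_mul]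
      have e1 : q ^ (2 * (r : ℤ)) = (q ^ r) ^ 2 := by
        rw [← pow_mul, ← zpow_natCast]; congr 1; push_cast; ring
      rw [zpow_neg, zpow_neg, e1, zpow_natCast, inv_pow, inv_pow, inv_pow, ← pow_mul, ← pow_mul,
        mul_comm 2 r]
      congr 2
      field_simp
  rw [h1]; ring

theorem coeff_zero_gSeries (m n : ℕ) : coeff 0 (gSeries m n) ≠ 0 := by
  rw [gSeries, fSeries]
  simp only [coeff_zero_eq_constantCoeff, map_mul, map_sub, constantCoeff_X, constantCoeff_C]
  rw [← coeff_zero_eq_constantCoeff_apply, coeff_zero_fExp]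
  simp [q_ne_zero, zeta_ne_zero]

theorem coeff_zero_one_sub_mul (a : K) (G : PowerSeries K) :
    coeff 0 ((1 - C a * X) * G) = coeff 0 G := by
  simp

theorem chi_eq {m n : ℕ} {i : ℕ} (hi : i < m + n) (j : Fin (m + n)) (t : K) :
    chi m n i j t = 1 - t ^ (-2 * form (eps m n i) (root j)) := by
  rw [form_eps_root]
  by_cases h1 : i = j
  · rw [if_pos h1, ← h1, chi_self hi]
  · rw [if_neg h1]
    by_cases h2 : i = j + 1
    · rw [if_pos ⟨h2, hi⟩, h2, chi_succ (by omega)]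
      congr 2; ring
    · rw [if_neg (by omega), chi_eq_zero h1 h2]; simp

theorem form_eps_last {m n : ℕ} (j : Fin (m + n)) : form (eps m n (m + n)) (root j) = 0 := by
  rw [form_eps_root, if_neg (by omega), if_neg (by omega)]

/-! ### Brackets with a series and with its logarithmic derivative -/

section Brackets

variable {B : Type*} [Ring B] [Algebra K B]

/-- With W = [a,h] - μh one has D W - l W = ([a,l] - D μ) h for the Euler operator D. As h has a
right inverse, W = 0 forces the equation for l; conversely W is then determined by its constant
term, the commutator of a with that of h. -/
theorem bracket_log_iff {h g l : PowerSeries B} (hg : h * g = 1) (hl : eulerD h = l * h)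
    (hl0 : coeff 0 l = 0) {a : B} {mu : PowerSeries B} (hmu : Commute mu l)
    (hmu0 : coeff 0 mu = 0) :
    C a * h - h * C a = mu * h ↔
      C a * l - l * C a = eulerD mu ∧ Commute a (coeff 0 h) := by
  set W := C a * h - h * C a - mu * h with hW
  have key : eulerD W - l * W = (C a * l - l * C a - eulerD mu) * h := by
    rw [hW]
    simp only [eulerD_sub, eulerD_mul, eulerD_C, hl, zero_mul, zero_add, mul_zero, add_zero]
    have e : mu * (l * h) = l * (mu * h) := by rw [← mul_assoc, hmu.eq, mul_assoc]
    rw [e]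
    simp only [sub_mul, mul_sub, mul_assoc]
    abel
  have h0 : coeff 0 W = a * coeff 0 h - coeff 0 h * a := by
    simp only [coeff_zero_eq_constantCoeff] at hmu0
    simp [hW, hmu0]
  have hW0 : C a * h - h * C a = mu * h ↔ W = 0 := by rw [hW, sub_eq_zero]
  rw [hW0]
  constructor
  · intro hz
    refine ⟨?_, ?_⟩
    · rw [hz] at key
      have h1 : (C a * l - l * C a - eulerD mu) * h * g = 0 := by
        rw [← key, mul_zero, sub_zero, eulerD_zero, zero_mul]
      rw [mul_assoc, hg, mul_one, sub_eq_zero] at h1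
      exact h1
    · rw [hz, map_zero] at h0
      exact (sub_eq_zero.mp h0.symm)
  · rintro ⟨h1, h2⟩
    refine eq_zero_of_eulerD (M := l) ?_ hl0 ?_
    · rw [← sub_eq_zero, key, h1, sub_self, zero_mul]
    · rw [h0, h2.eq, sub_self]

omit [Algebra K B] in
-- For a series in w^{-ε}, reading the mode l + rε amounts to multiplying by the r-th power of the
-- variable w^{-ε}. Modes on the wrong side vanish on both sides.
theorem modes_bracket_iff (ε : ℤˣ) (h : PowerSeries B) (a z : B) (r : ℕ) :
    (∀ l : ℤ, a * modes (-ε) h l - modes (-ε) h l * a = z * modes (-ε) h (l + (r : ℤ) * ε)) ↔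
      C a * h - h * C a = PowerSeries.monomial r z * h := by
  have hcoeff : ∀ p, coeff p (PowerSeries.monomial r z * h) =
      if r ≤ p then z * coeff (p - r) h else 0 := by
    intro p
    have : (PowerSeries.monomial r z : PowerSeries B) = C z * X ^ r := by
      ext k; simp [PowerSeries.coeff_monomial, PowerSeries.coeff_X_pow]
    rw [this, mul_assoc, coeff_C_mul, PowerSeries.coeff_X_pow_mul']
    split_ifs <;> simp
  have hm : ∀ p : ℕ, modes (-ε) h (-(ε : ℤ) * p) = coeff p h := by
    intro p
    rw [modes]
    rcases Int.units_eq_one_or ε with rfl | rfl <;> simp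
  have hm' : ∀ p : ℕ, modes (-ε) h (-(ε : ℤ) * p + (r : ℤ) * ε) =
      if r ≤ p then coeff (p - r) h else 0 := by
    intro p
    split_ifs with hp
    · rw [← hm]
      congr 1
      rw [Nat.cast_sub hp]; ring
    · rw [modes, if_neg]
      rcases Int.units_eq_one_or ε with rfl | rfl <;> simp <;> omega
  have hneg : ∀ l : ℤ, (∃ p : ℕ, l = -(ε : ℤ) * p) ∨
      (modes (-ε) h l = 0 ∧ modes (-ε) h (l + (r : ℤ) * ε) = 0) := by
    intro l
    by_cases hl : 0 ≤ ((-ε : ℤˣ) : ℤ) * l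
    · left
      refine ⟨l.natAbs, ?_⟩
      rcases Int.units_eq_one_or ε with rfl | rfl <;>
        simp only [Units.val_one, Units.val_neg, neg_mul, one_mul, neg_neg] at hl ⊢ <;> omega
    · right
      refine ⟨if_neg hl, if_neg ?_⟩
      rcases Int.units_eq_one_or ε with rfl | rfl <;> simp at hl ⊢ <;> omega
  constructor
  · intro hh
    ext p
    have h1 := hh (-(ε : ℤ) * p)
    rw [hm, hm'] at h1
    rw [map_sub, coeff_C_mul, coeff_mul_C, h1, hcoeff]
    split_ifs <;> simp
  · intro hh l
    rcases hneg l with ⟨p, rfl⟩ | ⟨h1, h2⟩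
    · have h1 := congrArg (coeff p) hh
      rw [map_sub, coeff_C_mul, coeff_mul_C, hcoeff] at h1
      rw [hm, hm', h1]
      split_ifs <;> simp
    · rw [h1, h2]; simp

end Brackets

end OspAffine

end

noncomputable section

namespace OspAffine

open PowerSeries Finset

/-! ### Exchange relations as brackets of logarithms -/

/-- `p` is the logarithmic derivative of the scalar series `P`. -/
structure IsLog (P p : PowerSeries K) : Prop where
  euler : eulerD P = p * P
  zero : coeff 0 p = 0
  ne_zero : coeff 0 P ≠ 0

theorem IsLog.one : IsLog 1 0 := ⟨eulerD_one_scalar, by simp, by simp⟩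

theorem IsLog.one_sub_mul (a : K) {G L : PowerSeries K} (h : IsLog G L) :
    IsLog ((1 - C a * X) * G) (L - geomS a) :=
  ⟨eulerD_one_sub_mul a h.euler, by rw [map_sub, h.zero, coeff_zero_geomS, sub_zero],
    by rw [coeff_zero_one_sub_mul]; exact h.ne_zero⟩

theorem isLog_gSeries (m n : ℕ) : IsLog (gSeries m n) (gLog m n) :=
  ⟨eulerD_gSeries m n, by simp [gLog], coeff_zero_gSeries m n⟩

section Exchange

variable {B : Type*} [Ring B] [Algebra K B]

/-- The exchange relation of `h`, with logarithmic derivative `l`, and a sequence `x`, in terms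
of brackets. -/
def HBracket (c : Bˣ) (ε : ℤˣ) (h l : PowerSeries B) (x : ℤ → B) (Λ : ℕ → K) : Prop :=
  (∀ j, coeff 0 h * x j = x j * coeff 0 h) ∧
  ∀ (r : ℕ) (j : ℤ), coeff r l * x j - x j * coeff r l =
    (((ε : ℤ) : K) * Λ r) • ((((c ^ (-2 * (r : ℤ)) : Bˣ) : B) - ((c ^ (2 * (r : ℤ)) : Bˣ) : B)) *
      x (j + (r : ℤ) * ε))

/-- The exchange relation of `h`, with logarithmic derivative `l`, and a sequence `x` of modes of a
current, in terms of brackets. -/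
def XBracket (c : Bˣ) (κ : ℤ) (ε : ℤˣ) (h l : PowerSeries B) (x : ℤ → B) (a : K) (χ : ℕ → K) :
    Prop :=
  (∀ j, coeff 0 h * x j = a • (x j * coeff 0 h)) ∧
  ∀ (r : ℕ) (j : ℤ), coeff r l * x j - x j * coeff r l =
    (((κ : ℤ) : K) * χ r) • (((c ^ (κ * (r : ℤ)) : Bˣ) : B) * x (j + (r : ℤ) * ε))

variable {c : Bˣ} (hc : ∀ b : B, Commute (c : B) b) {h g l : PowerSeries B}
  (hg : h * g = 1) (hl : eulerD h = l * h) (hl0 : coeff 0 l = 0)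

include hc hg hl hl0

/-- Between h^± and h^∓ the two slots carry q^{c} and q^{-c}. The relation exchanges the two slots
from one side to the other, so their contributions are opposite and combine to the difference of
central elements in the bracket. -/
theorem state_iff_hBracket {ε : ℤˣ} {P₁ P₂ Q₁ Q₂ p₁ p₂ q₁ q₂ : PowerSeries K}
    (hP₁ : IsLog P₁ p₁) (hP₂ : IsLog P₂ p₂) (hQ₁ : IsLog Q₁ q₁) (hQ₂ : IsLog Q₂ q₂) {s s' : K}
    (hs' : s' ≠ 0) (hs : s * coeff 0 P₁ * coeff 0 P₂ = s' * coeff 0 Q₁ * coeff 0 Q₂)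
    {κ a b κ' a' b' : ℤ} (hκ : κ = κ') (ha : a = a') (hb : b = b') (x : ℤ → B) {Λ : ℕ → K}
    (h1 : ∀ r, r ≠ 0 → coeff r q₁ - coeff r p₁ = -(((ε : ℤ) : K) * Λ r) ∧
      coeff r q₂ - coeff r p₂ = ((ε : ℤ) : K) * Λ r) :
    (∀ k j, state c ε 2 (-2) s κ a b P₁ P₂ (serL h) x k j =
        state c ε 2 (-2) s' κ' a' b' Q₁ Q₂ (serR h) x k j) ↔ HBracket c ε h l x Λ := by
  rw [state_eq_iff hc hg hl hl0 hP₁.euler hP₂.euler hQ₁.euler hQ₂.euler hP₁.zero hP₂.zero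
    hQ₁.ne_zero hQ₂.ne_zero hs' hκ ha hb, HBracket, hs]
  refine and_congr (forall_congr' fun j => ?_) (forall_congr' fun r => forall_congr' fun j => ?_)
  · exact smul_right_inj (M := B) (mul_ne_zero (mul_ne_zero hs' hQ₁.ne_zero) hQ₂.ne_zero)
  · rcases Nat.eq_zero_or_pos r with rfl | hr
    · rw [hl0, hQ₁.zero, hQ₂.zero, hP₁.zero, hP₂.zero]
      simp
    · rw [(h1 r hr.ne').1, (h1 r hr.ne').2, sub_mul, smul_sub, neg_smul, mul_comm (r : ℤ) 2,
        mul_comm (r : ℤ) (-2), neg_add_eq_sub]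

/-- Only one slot is occupied, since X(w) carries no shift by the central element. The scalar t
compares the leading coefficients of the two sides and tells how the constant term of h conjugates
the modes of X. -/
theorem state_iff_xBracket {ε : ℤˣ} {κ₁ : ℤ} {P Q p q' : PowerSeries K}
    (hP : IsLog P p) (hQ : IsLog Q q') {s s' t : K}
    (hs' : s' ≠ 0) (ht : s * coeff 0 P * t = s' * coeff 0 Q)
    {κ a b κ' a' b' : ℤ} (hκ : κ = κ') (ha : a = a') (hb : b = b') (x : ℤ → B) {χ : ℕ → K}
    (hχ : χ 0 = 0)
    (h1 : ∀ r, r ≠ 0 → coeff r q' - coeff r p = (κ₁ : K) * χ r) :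
    (∀ k j, state c ε κ₁ 0 s κ a b P 1 (serL h) x k j =
        state c ε κ₁ 0 s' κ' a' b' Q 1 (serR h) x k j) ↔ XBracket c κ₁ ε h l x t χ := by
  have hs : s * coeff 0 P ≠ 0 := fun h0 => by
    rw [h0, zero_mul] at ht
    exact mul_ne_zero hs' hQ.ne_zero ht.symm
  rw [state_eq_iff hc hg hl hl0 hP.euler eulerD_one_scalar hQ.euler eulerD_one_scalar hP.zero
    (by simp) hQ.ne_zero (by simp) hs' hκ ha hb, XBracket, ← ht]
  refine and_congr (forall_congr' fun j => ?_) (forall_congr' fun r => forall_congr' fun j => ?_)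
  · simp only [PowerSeries.coeff_one, if_true, mul_one]
    rw [mul_smul (s * coeff 0 P)]
    exact smul_right_inj (M := B) hs
  · rcases Nat.eq_zero_or_pos r with rfl | hr
    · rw [hl0, hP.zero, hQ.zero, hχ]
      simp
    · rw [h1 r hr.ne', map_zero, sub_zero, zero_smul, add_zero, mul_comm (r : ℤ)]

end Exchange

theorem div_pow_specializations (r : ℕ) : ((1 : K) / 1) ^ r = 1 ∧
    (q⁻¹ / q) ^ r = (q ^ r)⁻¹ ^ 2 ∧ (q / q⁻¹) ^ r = (q ^ r) ^ 2 ∧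
    (qHalf / qHalf⁻¹) ^ r = q ^ r ∧ (qHalf⁻¹ / qHalf) ^ r = (q ^ r)⁻¹ ∧
    (1 / q⁻¹) ^ r = q ^ r ∧ (q⁻¹ / 1) ^ r = (q ^ r)⁻¹ := by
  refine ⟨by simp, ?_, ?_, ?_, ?_, by simp, by simp⟩
  · rw [div_eq_mul_inv, mul_pow, inv_pow, sq]
  · rw [div_inv_eq_mul, mul_pow, sq]
  · rw [div_inv_eq_mul, q, sq]
  · rw [div_eq_mul_inv, ← mul_inv, inv_pow, q, sq]

theorem q_zpow_div_zpow_pow (e : ℤ) (r : ℕ) :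
    (q ^ (-e) / q ^ e) ^ r = (q ^ (1 * (r : ℤ))) ^ (-2 * e) ∧
      (q ^ e / q ^ (-e)) ^ r = (q ^ (-1 * (r : ℤ))) ^ (-2 * e) := by
  rw [← zpow_sub₀ q_ne_zero, ← zpow_sub₀ q_ne_zero, ← zpow_natCast, ← zpow_natCast, ← zpow_mul,
    ← zpow_mul, ← zpow_mul, ← zpow_mul]
  constructor <;> congr 1 <;> ring

/-! ### The exchange relations of A_q, one by one -/

section Relations

variable {B : Type*} [Ring B] [Algebra K B]
variable {c : Bˣ} (hc : ∀ b : B, Commute (c : B) b) {h g l : PowerSeries B}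
  (hg : h * g = 1) (hl : eulerD h = l * h) (hl0 : coeff 0 l = 0)

include hc hg hl hl0

/-- Each linear factor becomes 1 - a y with a the quotient of its coefficients and contributes -a^r
to the logarithmic derivative; g contributes `lamG`. Summing up gives `lam`. The following
statements follow the same pattern with other lists of factors; for series in z⁻¹ the quotients are
inverted and the slots exchanged, which is why i and j change places. -/
theorem exchange_lt_one (m n : ℕ) {i j : ℕ} (hij : i < j) (x : ℤ → B) :
    (∀ k p,
      linMul c 1 1 1 (-1) (linMul c q⁻¹ q (-1) 1 (serMul c (gSeries m n) 1 1 (serE 1 (serL h) x))) k p =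
      linMul c 1 1 (-1) 1 (linMul c q⁻¹ q 1 (-1) (serMul c (gSeries m n) (-1) 1 (serE 1 (serR h) x))) k p) ↔
    HBracket c 1 h l x (fun r => lam m n i j (q ^ r)) := by
  have hq := q_ne_zero
  rw [serMul_state_left (κ₁ := 2) _ (by simp) (-2),
    linMul_state_one_right hq (by norm_num),
    linMul_state_one_left one_ne_zero (by norm_num),
    serMul_state_right (κ₂ := -2) _ (by simp) 2,
    linMul_state_one_left hq (by norm_num),
    linMul_state_one_right one_ne_zero (by norm_num)]
  refine state_iff_hBracket hc hg hl hl0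
    (IsLog.one_sub_mul _ (isLog_gSeries m n))
    (IsLog.one_sub_mul _ IsLog.one)
    (IsLog.one_sub_mul _ IsLog.one)
    (IsLog.one_sub_mul _ (isLog_gSeries m n))
    ?_ ?_ ?_ ?_ ?_ x fun r hr => ?_
  · simp [q_ne_zero]
  · simp only [coeff_zero_one_sub_mul, PowerSeries.coeff_one, if_true]; ring
  · norm_num
  · norm_num
  · norm_num
  · obtain ⟨e1, e2, e3, e4, e5, e6, e7⟩ := div_pow_specializations r
    simp only [map_sub, coeff_geomS, coeff_gLog, if_neg hr, e1, e2, lam, lamT_lt hij, map_zero,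
      Units.val_one, Int.cast_one]
    constructor <;> ring

theorem exchange_lt_neg_one (m n : ℕ) {i j : ℕ} (hij : i < j) (x : ℤ → B) :
    (∀ k p,
      linMul c 1 1 (-1) 1 (linMul c q⁻¹ q 1 (-1) (serMul c (gSeries m n) 1 (-1) (serE (-1) (serL h) x))) k p =
      linMul c 1 1 1 (-1) (linMul c q⁻¹ q (-1) 1 (serMul c (gSeries m n) (-1) (-1) (serE (-1) (serR h) x))) k p) ↔
    HBracket c (-1) h l x (fun r => lam m n j i (q ^ r)) := by
  have hq := q_ne_zero
  have hq1 := inv_ne_zero q_ne_zero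
  rw [serMul_state_right (κ₂ := -2) _ (by simp) 2,
    linMul_state_neg_one_right hq1 (by norm_num),
    linMul_state_neg_one_left one_ne_zero (by norm_num),
    serMul_state_left (κ₁ := 2) _ (by simp) (-2),
    linMul_state_neg_one_left hq1 (by norm_num),
    linMul_state_neg_one_right one_ne_zero (by norm_num)]
  refine state_iff_hBracket hc hg hl hl0
    (IsLog.one_sub_mul _ IsLog.one)
    (IsLog.one_sub_mul _ (isLog_gSeries m n))
    (IsLog.one_sub_mul _ (isLog_gSeries m n))
    (IsLog.one_sub_mul _ IsLog.one)
    ?_ ?_ ?_ ?_ ?_ x fun r hr => ?_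
  · simp [q_ne_zero]
  · simp only [coeff_zero_one_sub_mul, PowerSeries.coeff_one, if_true]; ring
  · norm_num
  · norm_num
  · norm_num
  · obtain ⟨e1, e2, e3, e4, e5, e6, e7⟩ := div_pow_specializations r
    simp only [map_sub, coeff_geomS, coeff_gLog, if_neg hr, e1, e3, lam, lamT_gt hij, map_zero,
      Units.val_one, Units.val_neg, Int.cast_one, Int.cast_neg]
    constructor <;> ring

theorem exchange_odd_one (m n : ℕ) {i : ℕ} (hi : i < n) (x : ℤ → B) :
    (∀ k p,
      linMul c q q⁻¹ 1 (-1) (linMul c q⁻¹ q (-1) 1 (serMul c (gSeries m n) 1 1 (serE 1 (serL h) x))) k p =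
      linMul c q q⁻¹ (-1) 1 (linMul c q⁻¹ q 1 (-1) (serMul c (gSeries m n) (-1) 1 (serE 1 (serR h) x))) k p) ↔
    HBracket c 1 h l x (fun r => lam m n i i (q ^ r)) := by
  have hq := q_ne_zero
  have hq1 := inv_ne_zero q_ne_zero
  rw [serMul_state_left (κ₁ := 2) _ (by simp) (-2),
    linMul_state_one_right hq (by norm_num),
    linMul_state_one_left hq1 (by norm_num),
    serMul_state_right (κ₂ := -2) _ (by simp) 2,
    linMul_state_one_left hq (by norm_num),
    linMul_state_one_right hq1 (by norm_num)]
  refine state_iff_hBracket hc hg hl hl0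
    (IsLog.one_sub_mul _ (isLog_gSeries m n))
    (IsLog.one_sub_mul _ IsLog.one)
    (IsLog.one_sub_mul _ IsLog.one)
    (IsLog.one_sub_mul _ (isLog_gSeries m n))
    ?_ ?_ ?_ ?_ ?_ x fun r hr => ?_
  · simp [q_ne_zero]
  · simp only [coeff_zero_one_sub_mul, PowerSeries.coeff_one, if_true]; ring
  · norm_num
  · norm_num
  · norm_num
  · obtain ⟨e1, e2, e3, e4, e5, e6, e7⟩ := div_pow_specializations r
    simp only [map_sub, coeff_geomS, coeff_gLog, if_neg hr, e2, e3, lam, lamT_odd hi, map_zero,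
      Units.val_one, Int.cast_one]
    constructor <;> ring

theorem exchange_odd_neg_one (m n : ℕ) {i : ℕ} (hi : i < n) (x : ℤ → B) :
    (∀ k p,
      linMul c q q⁻¹ (-1) 1 (linMul c q⁻¹ q 1 (-1) (serMul c (gSeries m n) 1 (-1) (serE (-1) (serL h) x))) k p =
      linMul c q q⁻¹ 1 (-1) (linMul c q⁻¹ q (-1) 1 (serMul c (gSeries m n) (-1) (-1) (serE (-1) (serR h) x))) k p) ↔
    HBracket c (-1) h l x (fun r => lam m n i i (q ^ r)) := by
  have hq := q_ne_zero
  have hq1 := inv_ne_zero q_ne_zero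
  rw [serMul_state_right (κ₂ := -2) _ (by simp) 2,
    linMul_state_neg_one_right hq1 (by norm_num),
    linMul_state_neg_one_left hq (by norm_num),
    serMul_state_left (κ₁ := 2) _ (by simp) (-2),
    linMul_state_neg_one_left hq1 (by norm_num),
    linMul_state_neg_one_right hq (by norm_num)]
  refine state_iff_hBracket hc hg hl hl0
    (IsLog.one_sub_mul _ IsLog.one)
    (IsLog.one_sub_mul _ (isLog_gSeries m n))
    (IsLog.one_sub_mul _ (isLog_gSeries m n))
    (IsLog.one_sub_mul _ IsLog.one)
    ?_ ?_ ?_ ?_ ?_ x fun r hr => ?_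
  · simp [q_ne_zero]
  · simp only [coeff_zero_one_sub_mul, PowerSeries.coeff_one, if_true]; ring
  · norm_num
  · norm_num
  · norm_num
  · obtain ⟨e1, e2, e3, e4, e5, e6, e7⟩ := div_pow_specializations r
    simp only [map_sub, coeff_geomS, coeff_gLog, if_neg hr, e2, e3, lam, lamT_odd hi, map_zero,
      Units.val_one, Units.val_neg, Int.cast_one, Int.cast_neg]
    constructor <;> ring

theorem exchange_even_one (m n : ℕ) {i : ℕ} (hi : n ≤ i) (hi' : i < m + n) (x : ℤ → B) :
    (∀ k p,
      serMul c (gSeries m n) 1 1 (serE 1 (serL h) x) k p =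
      serMul c (gSeries m n) (-1) 1 (serE 1 (serR h) x) k p) ↔
    HBracket c 1 h l x (fun r => lam m n i i (q ^ r)) := by
  rw [serMul_state_left (κ₁ := 2) _ (by simp) (-2),
    serMul_state_right (κ₂ := -2) _ (by simp) 2]
  refine state_iff_hBracket hc hg hl hl0
    (isLog_gSeries m n)
    IsLog.one
    IsLog.one
    (isLog_gSeries m n)
    ?_ ?_ ?_ ?_ ?_ x fun r hr => ?_
  · simp
  · simp only [PowerSeries.coeff_one, if_true]; ring
  · norm_num
  · norm_num
  · norm_num
  · obtain ⟨e1, e2, e3, e4, e5, e6, e7⟩ := div_pow_specializations r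
    simp only [coeff_gLog, if_neg hr, lam, lamT_even hi hi', map_zero,
      Units.val_one, Int.cast_one]
    constructor <;> ring

theorem exchange_even_neg_one (m n : ℕ) {i : ℕ} (hi : n ≤ i) (hi' : i < m + n) (x : ℤ → B) :
    (∀ k p,
      serMul c (gSeries m n) 1 (-1) (serE (-1) (serL h) x) k p =
      serMul c (gSeries m n) (-1) (-1) (serE (-1) (serR h) x) k p) ↔
    HBracket c (-1) h l x (fun r => lam m n i i (q ^ r)) := by
  rw [serMul_state_right (κ₂ := -2) _ (by simp) 2,
    serMul_state_left (κ₁ := 2) _ (by simp) (-2)]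
  refine state_iff_hBracket hc hg hl hl0
    IsLog.one
    (isLog_gSeries m n)
    (isLog_gSeries m n)
    IsLog.one
    ?_ ?_ ?_ ?_ ?_ x fun r hr => ?_
  · simp
  · simp only [PowerSeries.coeff_one, if_true]; ring
  · norm_num
  · norm_num
  · norm_num
  · obtain ⟨e1, e2, e3, e4, e5, e6, e7⟩ := div_pow_specializations r
    simp only [coeff_gLog, if_neg hr, lam, lamT_even hi hi', map_zero,
      Units.val_one, Units.val_neg, Int.cast_one, Int.cast_neg]
    constructor <;> ring

theorem exchange_last_one (m n : ℕ)  (x : ℤ → B) :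
    (∀ k p,
      linMul c q q⁻¹ 1 (-1) (linMul c qHalf⁻¹ qHalf 1 (-1) (linMul c q⁻¹ q (-1) 1 (linMul c qHalf qHalf⁻¹ (-1) 1 (serMul c (gSeries m n) 1 1 (serE 1 (serL h) x))))) k p =
      linMul c q q⁻¹ (-1) 1 (linMul c qHalf⁻¹ qHalf (-1) 1 (linMul c q⁻¹ q 1 (-1) (linMul c qHalf qHalf⁻¹ 1 (-1) (serMul c (gSeries m n) (-1) 1 (serE 1 (serR h) x))))) k p) ↔
    HBracket c 1 h l x (fun r => lam m n (m + n) (m + n) (q ^ r)) := by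
  have hq := q_ne_zero
  have hq1 := inv_ne_zero q_ne_zero
  have hh := qHalf_ne_zero
  have hh1 := inv_ne_zero qHalf_ne_zero
  rw [serMul_state_left (κ₁ := 2) _ (by simp) (-2),
    linMul_state_one_right hh1 (by norm_num),
    linMul_state_one_right hq (by norm_num),
    linMul_state_one_left hh (by norm_num),
    linMul_state_one_left hq1 (by norm_num),
    serMul_state_right (κ₂ := -2) _ (by simp) 2,
    linMul_state_one_left hh1 (by norm_num),
    linMul_state_one_left hq (by norm_num),
    linMul_state_one_right hh (by norm_num),
    linMul_state_one_right hq1 (by norm_num)]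
  refine state_iff_hBracket hc hg hl hl0
    (IsLog.one_sub_mul _ (IsLog.one_sub_mul _ (isLog_gSeries m n)))
    (IsLog.one_sub_mul _ (IsLog.one_sub_mul _ IsLog.one))
    (IsLog.one_sub_mul _ (IsLog.one_sub_mul _ IsLog.one))
    (IsLog.one_sub_mul _ (IsLog.one_sub_mul _ (isLog_gSeries m n)))
    ?_ ?_ ?_ ?_ ?_ x fun r hr => ?_
  · simp [q_ne_zero, qHalf_ne_zero]
  · simp only [coeff_zero_one_sub_mul, PowerSeries.coeff_one, if_true]; ring
  · norm_num
  · norm_num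
  · norm_num
  · obtain ⟨e1, e2, e3, e4, e5, e6, e7⟩ := div_pow_specializations r
    simp only [map_sub, coeff_geomS, coeff_gLog, if_neg hr, e2, e3, e4, e5, lam, lamT_last rfl, map_zero,
      Units.val_one, Int.cast_one]
    constructor <;> ring

theorem exchange_last_neg_one (m n : ℕ)  (x : ℤ → B) :
    (∀ k p,
      linMul c q q⁻¹ (-1) 1 (linMul c qHalf⁻¹ qHalf (-1) 1 (linMul c q⁻¹ q 1 (-1) (linMul c qHalf qHalf⁻¹ 1 (-1) (serMul c (gSeries m n) 1 (-1) (serE (-1) (serL h) x))))) k p =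
      linMul c q q⁻¹ 1 (-1) (linMul c qHalf⁻¹ qHalf 1 (-1) (linMul c q⁻¹ q (-1) 1 (linMul c qHalf qHalf⁻¹ (-1) 1 (serMul c (gSeries m n) (-1) (-1) (serE (-1) (serR h) x))))) k p) ↔
    HBracket c (-1) h l x (fun r => lam m n (m + n) (m + n) (q ^ r)) := by
  have hq := q_ne_zero
  have hq1 := inv_ne_zero q_ne_zero
  have hh := qHalf_ne_zero
  have hh1 := inv_ne_zero qHalf_ne_zero
  rw [serMul_state_right (κ₂ := -2) _ (by simp) 2,
    linMul_state_neg_one_right hh (by norm_num),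
    linMul_state_neg_one_right hq1 (by norm_num),
    linMul_state_neg_one_left hh1 (by norm_num),
    linMul_state_neg_one_left hq (by norm_num),
    serMul_state_left (κ₁ := 2) _ (by simp) (-2),
    linMul_state_neg_one_left hh (by norm_num),
    linMul_state_neg_one_left hq1 (by norm_num),
    linMul_state_neg_one_right hh1 (by norm_num),
    linMul_state_neg_one_right hq (by norm_num)]
  refine state_iff_hBracket hc hg hl hl0
    (IsLog.one_sub_mul _ (IsLog.one_sub_mul _ IsLog.one))
    (IsLog.one_sub_mul _ (IsLog.one_sub_mul _ (isLog_gSeries m n)))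
    (IsLog.one_sub_mul _ (IsLog.one_sub_mul _ (isLog_gSeries m n)))
    (IsLog.one_sub_mul _ (IsLog.one_sub_mul _ IsLog.one))
    ?_ ?_ ?_ ?_ ?_ x fun r hr => ?_
  · simp [q_ne_zero, qHalf_ne_zero]
  · simp only [coeff_zero_one_sub_mul, PowerSeries.coeff_one, if_true]; ring
  · norm_num
  · norm_num
  · norm_num
  · obtain ⟨e1, e2, e3, e4, e5, e6, e7⟩ := div_pow_specializations r
    simp only [map_sub, coeff_geomS, coeff_gLog, if_neg hr, e2, e3, e4, e5, lam, lamT_last rfl, map_zero,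
      Units.val_one, Units.val_neg, Int.cast_one, Int.cast_neg]
    constructor <;> ring

/-- The factors 1 - y and 1 - q^{-2e} y give the constant 1 - t^{-2e} with t = q^r. The extracted
leading terms -1 and -q^e give the scalar q^e for the constant term of h. -/
theorem exchange_plus_one (e : ℤ) (x : ℤ → B) :
    (∀ k p,
      linMul c 1 1 1 0 (serE 1 (serL h) x) k p =
      linMul c (q ^ (-e)) (q ^ e) 1 0 (serE 1 (serR h) x) k p) ↔
    XBracket c 1 1 h l x (q ^ (1 * e)) (fun r => 1 - (q ^ (1 * (r : ℤ))) ^ (-2 * e)) := by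
  have hq := q_ne_zero
  rw [state_init c 1 1 0 (serL h),
    linMul_state_one_left one_ne_zero (by norm_num),
    state_init c 1 1 0 (serR h),
    linMul_state_one_left (zpow_ne_zero _ hq) (by norm_num)]
  refine state_iff_xBracket hc hg hl hl0 (IsLog.one_sub_mul _ IsLog.one) (IsLog.one_sub_mul _ IsLog.one)
    ?_ ?_ ?_ ?_ ?_ x ?_ fun r hr => ?_
  · simp [zpow_ne_zero _ hq]
  · simp only [coeff_zero_one_sub_mul, PowerSeries.coeff_one, if_true]
    simp
  · norm_num
  · norm_num
  · norm_num
  · simp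
  · obtain ⟨e1, -⟩ := div_pow_specializations r
    obtain ⟨e2, e3⟩ := q_zpow_div_zpow_pow e r
    simp only [map_sub, coeff_geomS, if_neg hr, e1, e2, map_zero,
      Int.cast_one]
    ring

/-- The leading terms of the two quadratic factors agree, so the constant term of h_{N+1} commutes
with X_N although its logarithm does not. -/
theorem exchange_last_plus_one (m n : ℕ) {j : ℕ} (hj : j + 1 = m + n) (x : ℤ → B) :
    (∀ k p,
      linMul c q⁻¹ 1 1 0 (linMul c 1 1 1 0 (serE 1 (serL h) x)) k p =
      linMul c 1 q⁻¹ 1 0 (linMul c q⁻¹ q 1 0 (serE 1 (serR h) x)) k p) ↔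
    XBracket c 1 1 h l x 1 (fun r => chi m n (m + n) j (q ^ (1 * (r : ℤ)))) := by
  have hq := q_ne_zero
  have hq1 := inv_ne_zero q_ne_zero
  rw [state_init c 1 1 0 (serL h),
    linMul_state_one_left one_ne_zero (by norm_num),
    linMul_state_one_left one_ne_zero (by norm_num),
    state_init c 1 1 0 (serR h),
    linMul_state_one_left hq (by norm_num),
    linMul_state_one_left hq1 (by norm_num)]
  refine state_iff_xBracket hc hg hl hl0 (IsLog.one_sub_mul _ (IsLog.one_sub_mul _ IsLog.one)) (IsLog.one_sub_mul _ (IsLog.one_sub_mul _ IsLog.one))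
    ?_ ?_ ?_ ?_ ?_ x ?_ fun r hr => ?_
  · simp [q_ne_zero]
  · simp only [coeff_zero_one_sub_mul, PowerSeries.coeff_one, if_true]
    simp [q_ne_zero]
  · norm_num
  · norm_num
  · norm_num
  · simp [chi_last_last hj]
  · obtain ⟨e1, e2, e3, e4, e5, e6, e7⟩ := div_pow_specializations r
    simp only [map_sub, coeff_geomS, if_neg hr, e1, e2, e6, e7, chi_last_last hj, map_zero,
      Int.cast_one, one_mul, zpow_natCast]
    ring

theorem exchange_plus_neg_one (e : ℤ) (x : ℤ → B) :
    (∀ k p,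
      linMul c 1 1 (-1) 0 (serE (-1) (serL h) x) k p =
      linMul c (q ^ (-e)) (q ^ e) (-1) 0 (serE (-1) (serR h) x) k p) ↔
    XBracket c 1 (-1) h l x (q ^ (-1 * e)) (fun r => 1 - (q ^ (-1 * (r : ℤ))) ^ (-2 * e)) := by
  have hq := q_ne_zero
  rw [state_init c (-1) 1 0 (serL h),
    linMul_state_neg_one_left one_ne_zero (by norm_num),
    state_init c (-1) 1 0 (serR h),
    linMul_state_neg_one_left (zpow_ne_zero _ hq) (by norm_num)]
  refine state_iff_xBracket hc hg hl hl0 (IsLog.one_sub_mul _ IsLog.one) (IsLog.one_sub_mul _ IsLog.one)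
    ?_ ?_ ?_ ?_ ?_ x ?_ fun r hr => ?_
  · simp [zpow_ne_zero _ hq]
  · simp only [coeff_zero_one_sub_mul, PowerSeries.coeff_one, if_true]
    simp
  · norm_num
  · norm_num
  · norm_num
  · simp
  · obtain ⟨e1, -⟩ := div_pow_specializations r
    obtain ⟨e2, e3⟩ := q_zpow_div_zpow_pow e r
    simp only [map_sub, coeff_geomS, if_neg hr, e1, e3, map_zero,
      Int.cast_one]
    ring

theorem exchange_last_plus_neg_one (m n : ℕ) {j : ℕ} (hj : j + 1 = m + n) (x : ℤ → B) :
    (∀ k p,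
      linMul c q⁻¹ 1 (-1) 0 (linMul c 1 1 (-1) 0 (serE (-1) (serL h) x)) k p =
      linMul c 1 q⁻¹ (-1) 0 (linMul c q⁻¹ q (-1) 0 (serE (-1) (serR h) x)) k p) ↔
    XBracket c 1 (-1) h l x 1 (fun r => chi m n (m + n) j (q ^ (-1 * (r : ℤ)))) := by
  have hq := q_ne_zero
  have hq1 := inv_ne_zero q_ne_zero
  rw [state_init c (-1) 1 0 (serL h),
    linMul_state_neg_one_left one_ne_zero (by norm_num),
    linMul_state_neg_one_left hq1 (by norm_num),
    state_init c (-1) 1 0 (serR h),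
    linMul_state_neg_one_left hq1 (by norm_num),
    linMul_state_neg_one_left one_ne_zero (by norm_num)]
  refine state_iff_xBracket hc hg hl hl0 (IsLog.one_sub_mul _ (IsLog.one_sub_mul _ IsLog.one)) (IsLog.one_sub_mul _ (IsLog.one_sub_mul _ IsLog.one))
    ?_ ?_ ?_ ?_ ?_ x ?_ fun r hr => ?_
  · simp [q_ne_zero]
  · simp only [coeff_zero_one_sub_mul, PowerSeries.coeff_one, if_true]
    simp
  · norm_num
  · norm_num
  · norm_num
  · simp [chi_last_last hj]
  · obtain ⟨e1, e2, e3, e4, e5, e6, e7⟩ := div_pow_specializations r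
    simp only [map_sub, coeff_geomS, if_neg hr, e1, e3, e6, e7, chi_last_last hj, map_zero,
      Int.cast_one, one_mul, neg_mul, zpow_neg, inv_inv, zpow_natCast]
    ring

theorem exchange_minus_one (e : ℤ) (x : ℤ → B) :
    (∀ k p,
      linMul c (q ^ (-e)) (q ^ e) (-1) 0 (serE 1 (serL h) x) k p =
      linMul c 1 1 (-1) 0 (serE 1 (serR h) x) k p) ↔
    XBracket c (-1) 1 h l x (q ^ (-1 * e)) (fun r => 1 - (q ^ (1 * (r : ℤ))) ^ (-2 * e)) := by
  have hq := q_ne_zero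
  rw [state_init c 1 (-1) 0 (serL h),
    linMul_state_one_left (zpow_ne_zero _ hq) (by norm_num),
    state_init c 1 (-1) 0 (serR h),
    linMul_state_one_left one_ne_zero (by norm_num)]
  refine state_iff_xBracket hc hg hl hl0 (IsLog.one_sub_mul _ IsLog.one) (IsLog.one_sub_mul _ IsLog.one)
    ?_ ?_ ?_ ?_ ?_ x ?_ fun r hr => ?_
  · simp
  · simp only [coeff_zero_one_sub_mul, PowerSeries.coeff_one, if_true]
    simp [zpow_ne_zero _ hq]
  · norm_num
  · norm_num
  · norm_num
  · simp
  · obtain ⟨e1, -⟩ := div_pow_specializations r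
    obtain ⟨e2, e3⟩ := q_zpow_div_zpow_pow e r
    simp only [map_sub, coeff_geomS, if_neg hr, e1, e2, map_zero,
      Int.cast_one, Int.cast_neg]
    ring

theorem exchange_last_minus_one (m n : ℕ) {j : ℕ} (hj : j + 1 = m + n) (x : ℤ → B) :
    (∀ k p,
      linMul c 1 q⁻¹ (-1) 0 (linMul c q⁻¹ q (-1) 0 (serE 1 (serL h) x)) k p =
      linMul c q⁻¹ 1 (-1) 0 (linMul c 1 1 (-1) 0 (serE 1 (serR h) x)) k p) ↔
    XBracket c (-1) 1 h l x 1 (fun r => chi m n (m + n) j (q ^ (1 * (r : ℤ)))) := by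
  have hq := q_ne_zero
  have hq1 := inv_ne_zero q_ne_zero
  rw [state_init c 1 (-1) 0 (serL h),
    linMul_state_one_left hq (by norm_num),
    linMul_state_one_left hq1 (by norm_num),
    state_init c 1 (-1) 0 (serR h),
    linMul_state_one_left one_ne_zero (by norm_num),
    linMul_state_one_left one_ne_zero (by norm_num)]
  refine state_iff_xBracket hc hg hl hl0 (IsLog.one_sub_mul _ (IsLog.one_sub_mul _ IsLog.one)) (IsLog.one_sub_mul _ (IsLog.one_sub_mul _ IsLog.one))
    ?_ ?_ ?_ ?_ ?_ x ?_ fun r hr => ?_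
  · simp
  · simp only [coeff_zero_one_sub_mul, PowerSeries.coeff_one, if_true]
    simp [q_ne_zero]
  · norm_num
  · norm_num
  · norm_num
  · simp [chi_last_last hj]
  · obtain ⟨e1, e2, e3, e4, e5, e6, e7⟩ := div_pow_specializations r
    simp only [map_sub, coeff_geomS, if_neg hr, e1, e2, e6, e7, chi_last_last hj, map_zero,
      Int.cast_one, Int.cast_neg, one_mul, zpow_natCast]
    ring

theorem exchange_minus_neg_one (e : ℤ) (x : ℤ → B) :
    (∀ k p,
      linMul c (q ^ (-e)) (q ^ e) 1 0 (serE (-1) (serL h) x) k p =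
      linMul c 1 1 1 0 (serE (-1) (serR h) x) k p) ↔
    XBracket c (-1) (-1) h l x (q ^ (1 * e)) (fun r => 1 - (q ^ (-1 * (r : ℤ))) ^ (-2 * e)) := by
  have hq := q_ne_zero
  rw [state_init c (-1) (-1) 0 (serL h),
    linMul_state_neg_one_left (zpow_ne_zero _ hq) (by norm_num),
    state_init c (-1) (-1) 0 (serR h),
    linMul_state_neg_one_left one_ne_zero (by norm_num)]
  refine state_iff_xBracket hc hg hl hl0 (IsLog.one_sub_mul _ IsLog.one) (IsLog.one_sub_mul _ IsLog.one)
    ?_ ?_ ?_ ?_ ?_ x ?_ fun r hr => ?_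
  · simp
  · simp only [coeff_zero_one_sub_mul, PowerSeries.coeff_one, if_true]
    simp [zpow_ne_zero _ hq]
  · norm_num
  · norm_num
  · norm_num
  · simp
  · obtain ⟨e1, -⟩ := div_pow_specializations r
    obtain ⟨e2, e3⟩ := q_zpow_div_zpow_pow e r
    simp only [map_sub, coeff_geomS, if_neg hr, e1, e3, map_zero,
      Int.cast_one, Int.cast_neg]
    ring

theorem exchange_last_minus_neg_one (m n : ℕ) {j : ℕ} (hj : j + 1 = m + n) (x : ℤ → B) :
    (∀ k p,
      linMul c 1 q⁻¹ 1 0 (linMul c q⁻¹ q 1 0 (serE (-1) (serL h) x)) k p =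
      linMul c q⁻¹ 1 1 0 (linMul c 1 1 1 0 (serE (-1) (serR h) x)) k p) ↔
    XBracket c (-1) (-1) h l x 1 (fun r => chi m n (m + n) j (q ^ (-1 * (r : ℤ)))) := by
  have hq := q_ne_zero
  have hq1 := inv_ne_zero q_ne_zero
  rw [state_init c (-1) (-1) 0 (serL h),
    linMul_state_neg_one_left hq1 (by norm_num),
    linMul_state_neg_one_left one_ne_zero (by norm_num),
    state_init c (-1) (-1) 0 (serR h),
    linMul_state_neg_one_left one_ne_zero (by norm_num),
    linMul_state_neg_one_left hq1 (by norm_num)]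
  refine state_iff_xBracket hc hg hl hl0 (IsLog.one_sub_mul _ (IsLog.one_sub_mul _ IsLog.one)) (IsLog.one_sub_mul _ (IsLog.one_sub_mul _ IsLog.one))
    ?_ ?_ ?_ ?_ ?_ x ?_ fun r hr => ?_
  · simp [q_ne_zero]
  · simp only [coeff_zero_one_sub_mul, PowerSeries.coeff_one, if_true]
    simp
  · norm_num
  · norm_num
  · norm_num
  · simp [chi_last_last hj]
  · obtain ⟨e1, e2, e3, e4, e5, e6, e7⟩ := div_pow_specializations r
    simp only [map_sub, coeff_geomS, if_neg hr, e1, e3, e6, e7, chi_last_last hj, map_zero,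
      Int.cast_one, Int.cast_neg, one_mul, neg_mul, zpow_neg, inv_inv, zpow_natCast]
    ring

end Relations

end OspAffine

end

noncomputable section

namespace OspAffine

open PowerSeries Finset

variable {m n : ℕ} {B : Type*} [Ring B] [Algebra K B]

/-! ### Evaluation of the free algebra -/

/-- The images of the generators of `A_q`. -/
def aGenEval (c : Bˣ) (h : ℤˣ → Fin (m + n + 1) → PowerSeries B)
    (X : ℤˣ → Fin (m + n) → ℤ → B) : AGen m n → B
  | .h ε i p => coeff p (h ε i)
  | .X ε j k => X ε j k
  | .c => c
  | .cInv => ((c⁻¹ : Bˣ) : B)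

/-- The homomorphism from the free algebra with given values on the generators of `A_q`. -/
def aEval (c : Bˣ) (h : ℤˣ → Fin (m + n + 1) → PowerSeries B)
    (X : ℤˣ → Fin (m + n) → ℤ → B) : AFree m n →ₐ[K] B :=
  FreeAlgebra.lift K (aGenEval c h X)

section Eval

variable (c : Bˣ) (h : ℤˣ → Fin (m + n + 1) → PowerSeries B) (X : ℤˣ → Fin (m + n) → ℤ → B)

@[simp] theorem aEval_ι (y : AGen m n) : aEval c h X (FreeAlgebra.ι K y) = aGenEval c h X y :=
  FreeAlgebra.lift_ι_apply _ _

theorem aEval_cPow (k : ℤ) : aEval c h X (AFree.cPow k) = ((c ^ k : Bˣ) : B) := by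
  rw [AFree.cPow]
  split_ifs with hk
  · rw [map_pow, aEval_ι, aGenEval, ← Units.val_pow_eq_pow_val, ← zpow_natCast, Int.toNat_of_nonneg hk]
  · rw [map_pow, aEval_ι, aGenEval, ← Units.val_pow_eq_pow_val, inv_pow, ← zpow_natCast,
      Int.toNat_of_nonneg (by omega), ← zpow_neg, neg_neg]

theorem map_modes {A A' : Type*} [Ring A] [Ring A'] (φ : A →+* A') (ε : ℤˣ) (S : PowerSeries A)
    (k : ℤ) : φ (modes ε S k) = modes ε (PowerSeries.map φ S) k := by
  rw [modes, modes]
  split_ifs <;> simp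

theorem map_hPS (ε : ℤˣ) (i : Fin (m + n + 1)) :
    PowerSeries.map (aEval c h X : AFree m n →+* B) (AFree.hPS ε i) = h ε i := by
  ext p
  simp [AFree.hPS, aGenEval]

theorem aEval_h (ε : ℤˣ) (i : Fin (m + n + 1)) (k : ℤ) :
    aEval c h X (AFree.h ε i k) = modes ε (h ε i) k := by
  rw [AFree.h, ← map_hPS c h X ε i]
  exact map_modes (aEval c h X : AFree m n →+* B) ε _ k

theorem aEval_X (ε : ℤˣ) (j : Fin (m + n)) (k : ℤ) : aEval c h X (AFree.X ε j k) = X ε j k := by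
  rw [AFree.X, aEval_ι, aGenEval]

theorem aEval_lin (u v : K) (κ κ' : ℤ) (S : AFree.Ser m n) (k l : ℤ) :
    aEval c h X (AFree.lin u v κ κ' S k l) =
      linMul c u v κ κ' (fun k l => aEval c h X (S k l)) k l := by
  simp only [AFree.lin, linMul, map_sub, map_smul, map_mul, aEval_cPow]

theorem aEval_gMul (κ : ℤ) (ε : ℤˣ) (S : AFree.Ser m n) (k l : ℤ) :
    aEval c h X (AFree.gMul κ ε S k l) =
      serMul c (gSeries m n) κ ε (fun k l => aEval c h X (S k l)) k l := by
  simp only [AFree.gMul, serMul, map_sum, map_smul, map_mul, aEval_cPow]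

theorem aEval_zw (ε : ℤˣ) (i : Fin (m + n + 1)) (x : ℤ → AFree m n) :
    (fun k l => aEval c h X (AFree.zw (AFree.h ε i) x k l)) =
      serE ε (serL (h ε i)) (fun l => aEval c h X (x l)) := by
  funext k l
  rw [AFree.zw, map_mul, aEval_h, serE_serL]

theorem aEval_wz (ε : ℤˣ) (i : Fin (m + n + 1)) (x : ℤ → AFree m n) :
    (fun k l => aEval c h X (AFree.wz x (AFree.h ε i) k l)) =
      serE ε (serR (h ε i)) (fun l => aEval c h X (x l)) := by
  funext k l
  rw [AFree.wz, map_mul, aEval_h, serE_serR]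

end Eval

/-- The structure constants for the brackets of logarithms of `h_i^ε` and `h_j^{-ε}`. -/
def lamS (m n : ℕ) (ε : ℤˣ) (i j r : ℕ) : K :=
  if ε = 1 then lam m n i j (q ^ r) else lam m n j i (q ^ r)

/-- The structure constants for the action of logarithms of `h_i^ε` on `X_j`. -/
def chiS (m n : ℕ) (ε : ℤˣ) (i j r : ℕ) : K := chi m n i j (q ^ ((ε : ℤ) * (r : ℤ)))

/-! ### The defining relations of A_q evaluated in an arbitrary algebra -/

section Iff

variable {c : Bˣ} (hc : ∀ b : B, Commute (c : B) b)
  {h l : ℤˣ → Fin (m + n + 1) → PowerSeries B} {X : ℤˣ → Fin (m + n) → ℤ → B}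
  (hzero : ∀ ε i, coeff 0 (h ε i) * coeff 0 (h (-ε) i) = 1)
  (hl : ∀ ε i, eulerD (h ε i) = l ε i * h ε i) (hl0 : ∀ ε i, coeff 0 (l ε i) = 0)

omit [Algebra K B] in
include hzero in
theorem h_mul_inv (ε : ℤˣ) (i : Fin (m + n + 1)) :
    h ε i * seriesInv (coeff 0 (h (-ε) i)) (h ε i) = 1 :=
  mul_seriesInv (hzero ε i) (by simpa using hzero (-ε) i)

omit [Algebra K B] in
include hzero in
theorem h_inv_mul (ε : ℤˣ) (i : Fin (m + n + 1)) :
    seriesInv (coeff 0 (h (-ε) i)) (h ε i) * h ε i = 1 :=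
  seriesInv_mul (hzero ε i) (by simpa using hzero (-ε) i)

include hc hzero hl hl0

/-- This equivalence and its companions are used in both directions: from left to right with values
in A_q itself, to find the relations of the logarithms there, and from right to left to construct
homomorphisms out of A_q. -/
theorem h_h_lt_iff (ε : ℤˣ) {i j : Fin (m + n + 1)} (hij : i < j) :
    (∀ k p, aEval c h X (AFree.lin 1 1 ε (-ε) (AFree.lin q⁻¹ q (-ε) ε (AFree.gMul 1 ε
        (AFree.zw (AFree.h ε i) (AFree.h (-ε) j)))) k p) =
      aEval c h X (AFree.lin 1 1 (-ε) ε (AFree.lin q⁻¹ q ε (-ε) (AFree.gMul (-1) ε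
        (AFree.wz (AFree.h (-ε) j) (AFree.h ε i)))) k p)) ↔
    HBracket c ε (h ε i) (l ε i) (modes (-ε) (h (-ε) j)) (lamS m n ε i j) := by
  simp only [aEval_lin, aEval_gMul, aEval_zw, aEval_wz, aEval_h]
  rcases Int.units_eq_one_or ε with rfl | rfl
  · exact exchange_lt_one hc (h_mul_inv hzero 1 i) (hl 1 i) (hl0 1 i) m n hij _
  · exact exchange_lt_neg_one hc (h_mul_inv hzero (-1) i) (hl (-1) i) (hl0 (-1) i) m n hij _

theorem h_h_odd_iff (ε : ℤˣ) {i : Fin (m + n + 1)} (hi : (i : ℕ) < n) :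
    (∀ k p, aEval c h X (AFree.lin q q⁻¹ ε (-ε) (AFree.lin q⁻¹ q (-ε) ε (AFree.gMul 1 ε
        (AFree.zw (AFree.h ε i) (AFree.h (-ε) i)))) k p) =
      aEval c h X (AFree.lin q q⁻¹ (-ε) ε (AFree.lin q⁻¹ q ε (-ε) (AFree.gMul (-1) ε
        (AFree.wz (AFree.h (-ε) i) (AFree.h ε i)))) k p)) ↔
    HBracket c ε (h ε i) (l ε i) (modes (-ε) (h (-ε) i)) (lamS m n ε i i) := by
  simp only [aEval_lin, aEval_gMul, aEval_zw, aEval_wz, aEval_h]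
  rcases Int.units_eq_one_or ε with rfl | rfl
  · exact exchange_odd_one hc (h_mul_inv hzero 1 i) (hl 1 i) (hl0 1 i) m n hi _
  · exact exchange_odd_neg_one hc (h_mul_inv hzero (-1) i) (hl (-1) i) (hl0 (-1) i) m n hi _

theorem h_h_even_iff (ε : ℤˣ) {i : Fin (m + n + 1)} (hi : n ≤ (i : ℕ)) (hi' : (i : ℕ) < m + n) :
    (∀ k p, aEval c h X (AFree.gMul 1 ε (AFree.zw (AFree.h ε i) (AFree.h (-ε) i)) k p) =
      aEval c h X (AFree.gMul (-1) ε (AFree.wz (AFree.h (-ε) i) (AFree.h ε i)) k p)) ↔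
    HBracket c ε (h ε i) (l ε i) (modes (-ε) (h (-ε) i)) (lamS m n ε i i) := by
  simp only [aEval_gMul, aEval_zw, aEval_wz, aEval_h]
  rcases Int.units_eq_one_or ε with rfl | rfl
  · exact exchange_even_one hc (h_mul_inv hzero 1 i) (hl 1 i) (hl0 1 i) m n hi hi' _
  · exact exchange_even_neg_one hc (h_mul_inv hzero (-1) i) (hl (-1) i) (hl0 (-1) i) m n hi hi' _

theorem h_h_last_iff (ε : ℤˣ) :
    (∀ k p, aEval c h X (AFree.lin q q⁻¹ ε (-ε) (AFree.lin qHalf⁻¹ qHalf ε (-ε)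
          (AFree.lin q⁻¹ q (-ε) ε (AFree.lin qHalf qHalf⁻¹ (-ε) ε
            (AFree.gMul 1 ε (AFree.zw (AFree.h ε (Fin.last (m + n)))
              (AFree.h (-ε) (Fin.last (m + n)))))))) k p) =
      aEval c h X (AFree.lin q q⁻¹ (-ε) ε (AFree.lin qHalf⁻¹ qHalf (-ε) ε
          (AFree.lin q⁻¹ q ε (-ε) (AFree.lin qHalf qHalf⁻¹ ε (-ε)
            (AFree.gMul (-1) ε (AFree.wz (AFree.h (-ε) (Fin.last (m + n)))
              (AFree.h ε (Fin.last (m + n)))))))) k p)) ↔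
    HBracket c ε (h ε (Fin.last (m + n))) (l ε (Fin.last (m + n)))
      (modes (-ε) (h (-ε) (Fin.last (m + n)))) (lamS m n ε (m + n) (m + n)) := by
  simp only [aEval_lin, aEval_gMul, aEval_zw, aEval_wz, aEval_h]
  rcases Int.units_eq_one_or ε with rfl | rfl
  · exact exchange_last_one hc (h_mul_inv hzero 1 _) (hl 1 _) (hl0 1 _) m n _
  · exact exchange_last_neg_one hc (h_mul_inv hzero (-1) _) (hl (-1) _) (hl0 (-1) _) m n _

theorem h_X_plus_iff (ε : ℤˣ) {i : Fin (m + n + 1)} (hi : i ≠ Fin.last _) (j : Fin (m + n)) :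
    (∀ k p, aEval c h X (AFree.lin 1 1 ε 0 (AFree.zw (AFree.h ε i) (AFree.X 1 j)) k p) =
      aEval c h X (AFree.lin (q ^ (-form (eps m n i) (root j))) (q ^ form (eps m n i) (root j)) ε 0
          (AFree.wz (AFree.X 1 j) (AFree.h ε i)) k p)) ↔
    XBracket c 1 ε (h ε i) (l ε i) (X 1 j) (q ^ ((ε : ℤ) * form (eps m n i) (root j)))
      (chiS m n ε i j) := by
  have hi' : (i : ℕ) < m + n := Fin.val_lt_last hi
  simp only [aEval_lin, aEval_zw, aEval_wz, aEval_X]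
  have hchi : chiS m n ε i j = fun r : ℕ =>
      1 - (q ^ ((ε : ℤ) * (r : ℤ))) ^ (-2 * form (eps m n i) (root j)) := by
    funext r
    rw [chiS, chi_eq hi']
  rw [hchi]
  rcases Int.units_eq_one_or ε with rfl | rfl
  · exact exchange_plus_one hc (h_mul_inv hzero 1 _) (hl 1 _) (hl0 1 _) _ _
  · exact exchange_plus_neg_one hc (h_mul_inv hzero (-1) _) (hl (-1) _) (hl0 (-1) _) _ _

theorem h_X_minus_iff (ε : ℤˣ) {i : Fin (m + n + 1)} (hi : i ≠ Fin.last _) (j : Fin (m + n)) :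
    (∀ k p, aEval c h X (AFree.lin (q ^ (-form (eps m n i) (root j)))
          (q ^ form (eps m n i) (root j)) (-ε) 0
          (AFree.zw (AFree.h ε i) (AFree.X (-1) j)) k p) =
      aEval c h X (AFree.lin 1 1 (-ε) 0 (AFree.wz (AFree.X (-1) j) (AFree.h ε i)) k p)) ↔
    XBracket c (-1) ε (h ε i) (l ε i) (X (-1) j) (q ^ (-(ε : ℤ) * form (eps m n i) (root j)))
      (chiS m n ε i j) := by
  have hi' : (i : ℕ) < m + n := Fin.val_lt_last hi
  simp only [aEval_lin, aEval_zw, aEval_wz, aEval_X]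
  have hchi : chiS m n ε i j = fun r : ℕ =>
      1 - (q ^ ((ε : ℤ) * (r : ℤ))) ^ (-2 * form (eps m n i) (root j)) := by
    funext r
    rw [chiS, chi_eq hi']
  rw [hchi]
  rcases Int.units_eq_one_or ε with rfl | rfl
  · exact exchange_minus_one hc (h_mul_inv hzero 1 _) (hl 1 _) (hl0 1 _) _ _
  · exact exchange_minus_neg_one hc (h_mul_inv hzero (-1) _) (hl (-1) _) (hl0 (-1) _) _ _

theorem h_last_X_plus_iff (ε : ℤˣ) {j : Fin (m + n)} (hj : (j : ℕ) + 1 = m + n) :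
    (∀ k p, aEval c h X (AFree.lin q⁻¹ 1 ε 0 (AFree.lin 1 1 ε 0
          (AFree.zw (AFree.h ε (Fin.last (m + n))) (AFree.X 1 j))) k p) =
      aEval c h X (AFree.lin 1 q⁻¹ ε 0 (AFree.lin q⁻¹ q ε 0
          (AFree.wz (AFree.X 1 j) (AFree.h ε (Fin.last (m + n))))) k p)) ↔
    XBracket c 1 ε (h ε (Fin.last (m + n))) (l ε (Fin.last (m + n))) (X 1 j) 1
      (chiS m n ε (m + n) j) := by
  simp only [aEval_lin, aEval_zw, aEval_wz, aEval_X]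
  rcases Int.units_eq_one_or ε with rfl | rfl
  · exact exchange_last_plus_one hc (h_mul_inv hzero 1 _) (hl 1 _) (hl0 1 _) m n hj _
  · exact exchange_last_plus_neg_one hc (h_mul_inv hzero (-1) _) (hl (-1) _) (hl0 (-1) _) m n hj _

theorem h_last_X_minus_iff (ε : ℤˣ) {j : Fin (m + n)} (hj : (j : ℕ) + 1 = m + n) :
    (∀ k p, aEval c h X (AFree.lin 1 q⁻¹ (-ε) 0 (AFree.lin q⁻¹ q (-ε) 0
          (AFree.zw (AFree.h ε (Fin.last (m + n))) (AFree.X (-1) j))) k p) =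
      aEval c h X (AFree.lin q⁻¹ 1 (-ε) 0 (AFree.lin 1 1 (-ε) 0
          (AFree.wz (AFree.X (-1) j) (AFree.h ε (Fin.last (m + n))))) k p)) ↔
    XBracket c (-1) ε (h ε (Fin.last (m + n))) (l ε (Fin.last (m + n))) (X (-1) j) 1
      (chiS m n ε (m + n) j) := by
  simp only [aEval_lin, aEval_zw, aEval_wz, aEval_X]
  rcases Int.units_eq_one_or ε with rfl | rfl
  · exact exchange_last_minus_one hc (h_mul_inv hzero 1 _) (hl 1 _) (hl0 1 _) m n hj _
  · exact exchange_last_minus_neg_one hc (h_mul_inv hzero (-1) _) (hl (-1) _) (hl0 (-1) _) m n hj _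

omit hzero hl0 in
-- Commutation is the exchange relation with trivial factors, and the corresponding `chi` is zero.
theorem h_last_X_comm_iff (ε ε' : ℤˣ) {j : Fin (m + n)} (hj : (j : ℕ) + 1 ≠ m + n)
    (hzero : ∀ ε i, coeff 0 (h ε i) * coeff 0 (h (-ε) i) = 1) (hl0 : ∀ ε i, coeff 0 (l ε i) = 0) :
    (∀ k p, aEval c h X (AFree.h ε (Fin.last _) k * AFree.X ε' j p) =
      aEval c h X (AFree.X ε' j p * AFree.h ε (Fin.last _) k)) ↔
    XBracket c ε' ε (h ε (Fin.last (m + n))) (l ε (Fin.last (m + n))) (X ε' j) 1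
      (chiS m n ε (m + n) j) := by
  have h1 := state_iff_xBracket hc (h_mul_inv hzero ε (Fin.last _)) (hl ε (Fin.last _))
    (hl0 ε (Fin.last _)) (ε := ε) (κ₁ := ε') IsLog.one IsLog.one (s := 1) (s' := 1) (t := 1)
    one_ne_zero (by simp) (κ := 0) (a := 0) (b := 0) rfl rfl rfl (X ε' j) (χ := chiS m n ε (m + n) j)
    (by rw [chiS, chi, if_pos rfl, if_neg hj])
    (fun r _ => by rw [chiS, chi, if_pos rfl, if_neg hj]; simp)
  rw [← h1, ← state_init, ← state_init]
  simp only [map_mul, aEval_h, aEval_X, serE_serL, serE_serR]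

end Iff

end OspAffine

end

noncomputable section

namespace OspAffine

open PowerSeries Finset

variable {m n : ℕ} {B : Type*} [Ring B]

/-! ### Heisenberg relations among logarithms -/

section Modes

theorem modes_natCast (ε : ℤˣ) (S : PowerSeries B) (p : ℕ) :
    modes ε S ((ε : ℤ) * p) = coeff p S := by
  rw [modes]
  rcases Int.units_eq_one_or ε with rfl | rfl <;> simp

theorem forall_modes {ε : ℤˣ} {S : PowerSeries B} {P : B → Prop} (h0 : P 0) :
    (∀ k, P (modes ε S k)) ↔ ∀ p, P (coeff p S) := by
  refine ⟨fun h p => modes_natCast ε S p ▸ h _, fun h k => ?_⟩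
  rw [modes]
  split_ifs
  · exact h _
  · exact h0

theorem modes_zero (ε : ℤˣ) (S : PowerSeries B) : modes ε S 0 = coeff 0 S := by
  simp [modes]

theorem units_central {c : Bˣ} (hc : ∀ b : B, Commute (c : B) b) (k : ℤ) (b : B) :
    Commute ((c ^ k : Bˣ) : B) b :=
  commute_zpow_unit hc k b

variable [Algebra K B]

/-- The bracket of a logarithm with the modes of a series, in terms of logarithms. -/
theorem hBracket_modes_iff {c : Bˣ} (hc : ∀ b : B, Commute (c : B) b) {ε : ℤˣ}
    {h l h₂ g₂ l₂ : PowerSeries B} (hg : h₂ * g₂ = 1)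
    (hl₂ : eulerD h₂ = l₂ * h₂) (hl₂0 : coeff 0 l₂ = 0) (Λ : ℕ → K) :
    HBracket c ε h l (modes (-ε) h₂) Λ ↔ (∀ p, Commute (coeff 0 h) (coeff p h₂)) ∧
      (∀ r s, coeff r l * coeff s l₂ - coeff s l₂ * coeff r l =
        if r = s then (((ε : ℤ) : K) * (r : K) * Λ r) •
          (((c ^ (-2 * (r : ℤ)) : Bˣ) : B) - ((c ^ (2 * (r : ℤ)) : Bˣ) : B)) else 0) ∧
      ∀ r, Commute (coeff r l) (coeff 0 h₂) := by
  rw [HBracket, ← forall_and]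
  refine and_congr (forall_modes (P := fun b => Commute (coeff 0 h) b) (Commute.zero_right _))
    (forall_congr' fun r => ?_)
  set z : B := (((ε : ℤ) : K) * Λ r) •
    (((c ^ (-2 * (r : ℤ)) : Bˣ) : B) - ((c ^ (2 * (r : ℤ)) : Bˣ) : B)) with hz
  have hzc : ∀ b : B, Commute z b := fun b =>
    ((units_central hc _ b).sub_left (units_central hc _ b)).smul_left _
  -- Bracketing with all modes of h₂ is the equation [a, h₂] = μ h₂ with μ a central monomial of
  -- degree r. Its Euler derivative produces the factor r and the restriction to r = s.
  have h1 := modes_bracket_iff ε h₂ (coeff r l) z r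
  have h2 := bracket_log_iff (a := coeff r l) (mu := PowerSeries.monomial r z) hg hl₂ hl₂0
    (commute_of_coeff fun a b => by
      rw [PowerSeries.coeff_monomial]
      split_ifs
      · exact hzc _
      · exact Commute.zero_left _)
    (by
      rw [PowerSeries.coeff_monomial]
      split_ifs with h0
      · rw [hz, ← h0]; simp
      · rfl)
  rw [h2] at h1
  simp only [hz, smul_mul_assoc] at h1
  rw [h1, ← hz]
  refine and_congr ?_ Iff.rfl
  rw [PowerSeries.ext_iff]
  refine forall_congr' fun s => ?_
  rw [map_sub, coeff_C_mul, coeff_mul_C, coeff_eulerD, PowerSeries.coeff_monomial]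
  have h3 : (s • if s = r then z else 0) = if r = s then (((ε : ℤ) : K) * (r : K) * Λ r) •
          (((c ^ (-2 * (r : ℤ)) : Bˣ) : B) - ((c ^ (2 * (r : ℤ)) : Bˣ) : B)) else 0 := by
    by_cases hrs : r = s
    · subst hrs
      rw [if_pos rfl, if_pos rfl, hz, ← Nat.cast_smul_eq_nsmul K, smul_smul]
      congr 1; ring
    · rw [if_neg hrs, if_neg (Ne.symm hrs), smul_zero]
  rw [h3]

end Modes

variable [Algebra K B]

/-- The relations of `A_q` that involve the `h_i`, in terms of their constant terms `h₀` and their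
logarithmic derivatives `l`. -/
structure HRel (c : Bˣ) (h₀ : ℤˣ → Fin (m + n + 1) → B)
    (l : ℤˣ → Fin (m + n + 1) → PowerSeries B) (X : ℤˣ → Fin (m + n) → ℤ → B) : Prop where
  central (b : B) : Commute (c : B) b
  zero (ε : ℤˣ) (i : Fin (m + n + 1)) : h₀ ε i * h₀ (-ε) i = 1
  zero_zero (ε ε' : ℤˣ) (i j : Fin (m + n + 1)) : Commute (h₀ ε i) (h₀ ε' j)
  zero_log (ε ε' : ℤˣ) (i j : Fin (m + n + 1)) (p : ℕ) : Commute (h₀ ε i) (coeff p (l ε' j))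
  log_zero (ε : ℤˣ) (i : Fin (m + n + 1)) : coeff 0 (l ε i) = 0
  log_log (ε : ℤˣ) (i j : Fin (m + n + 1)) (r s : ℕ) :
    Commute (coeff r (l ε i)) (coeff s (l ε j))
  heis (ε : ℤˣ) (i j : Fin (m + n + 1)) (r s : ℕ) :
    coeff r (l ε i) * coeff s (l (-ε) j) - coeff s (l (-ε) j) * coeff r (l ε i) =
      if r = s then (((ε : ℤ) : K) * (r : K) * lamS m n ε i j r) •
        (((c ^ (-2 * (r : ℤ)) : Bˣ) : B) - ((c ^ (2 * (r : ℤ)) : Bˣ) : B)) else 0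
  zero_X (s ε : ℤˣ) (i : Fin (m + n + 1)) (j : Fin (m + n)) (k : ℤ) :
    h₀ ε i * X s j k = q ^ ((s : ℤ) * ε * form (eps m n i) (root j)) • (X s j k * h₀ ε i)
  log_X (s ε : ℤˣ) (i : Fin (m + n + 1)) (j : Fin (m + n)) (r : ℕ) (k : ℤ) :
    coeff r (l ε i) * X s j k - X s j k * coeff r (l ε i) =
      (((s : ℤ) : K) * chiS m n ε i j r) •
        (((c ^ ((s : ℤ) * (r : ℤ)) : Bˣ) : B) * X s j (k + (r : ℤ) * ε))

/-- The series with constant term `h₀` and logarithmic derivative `l`. -/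
def hSer (h₀ : ℤˣ → Fin (m + n + 1) → B) (l : ℤˣ → Fin (m + n + 1) → PowerSeries B) (ε : ℤˣ)
    (i : Fin (m + n + 1)) : PowerSeries B := C (h₀ ε i) * expL (l ε i)

theorem coeff_zero_hSer (h₀ : ℤˣ → Fin (m + n + 1) → B)
    (l : ℤˣ → Fin (m + n + 1) → PowerSeries B) (ε : ℤˣ) (i : Fin (m + n + 1)) :
    coeff 0 (hSer h₀ l ε i) = h₀ ε i := by
  rw [hSer, coeff_C_mul, coeff_zero_expL, mul_one]

theorem commute_coeff_hSer {h₀ : ℤˣ → Fin (m + n + 1) → B}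
    {l : ℤˣ → Fin (m + n + 1) → PowerSeries B} {ε : ℤˣ} {i : Fin (m + n + 1)} {b : B}
    (h0 : Commute b (h₀ ε i)) (hl : ∀ p, Commute b (coeff p (l ε i))) (p : ℕ) :
    Commute b (coeff p (hSer h₀ l ε i)) := by
  rw [hSer, coeff_C_mul]
  exact h0.mul_right (commute_coeff_expL hl p)

theorem lamS_neg (ε : ℤˣ) (i j r : ℕ) : lamS m n (-ε) i j r = lamS m n ε j i r := by
  rcases Int.units_eq_one_or ε with rfl | rfl
  · rw [lamS, lamS, if_pos rfl, if_neg (by decide)]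
  · rw [lamS, lamS, neg_neg, if_pos rfl, if_neg (by decide)]

/-- Antisymmetry of the commutator, in the form that exchanges ε with -ε and i with j. -/
theorem heis_swap {c : Bˣ} {l : ℤˣ → Fin (m + n + 1) → PowerSeries B} {ε : ℤˣ}
    {i j : Fin (m + n + 1)}
    (h : ∀ r s, coeff r (l ε i) * coeff s (l (-ε) j) - coeff s (l (-ε) j) * coeff r (l ε i) =
      if r = s then (((ε : ℤ) : K) * (r : K) * lamS m n ε i j r) •
        (((c ^ (-2 * (r : ℤ)) : Bˣ) : B) - ((c ^ (2 * (r : ℤ)) : Bˣ) : B)) else 0) (r s : ℕ) :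
    coeff r (l (-ε) j) * coeff s (l ε i) - coeff s (l ε i) * coeff r (l (-ε) j) =
      if r = s then ((((-ε : ℤˣ) : ℤ) : K) * (r : K) * lamS m n (-ε) j i r) •
        (((c ^ (-2 * (r : ℤ)) : Bˣ) : B) - ((c ^ (2 * (r : ℤ)) : Bˣ) : B)) else 0 := by
  rw [← neg_sub, h s r, lamS_neg]
  by_cases hrs : r = s
  · subst hrs
    simp only [if_true, Units.val_neg, Int.cast_neg, neg_mul, neg_smul]
  · rw [if_neg hrs, if_neg (Ne.symm hrs), neg_zero]

namespace HRel

variable {c : Bˣ} {h₀ : ℤˣ → Fin (m + n + 1) → B} {l : ℤˣ → Fin (m + n + 1) → PowerSeries B}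
  {X : ℤˣ → Fin (m + n) → ℤ → B} (H : HRel c h₀ l X)
include H

theorem euler (ε : ℤˣ) (i : Fin (m + n + 1)) : eulerD (hSer h₀ l ε i) = l ε i * hSer h₀ l ε i := by
  rw [hSer, eulerD_mul, eulerD_C, zero_mul, zero_add, eulerD_expL (H.log_zero ε i)
    (fun a b => H.log_log ε i i a b), ← mul_assoc, ← mul_assoc]
  congr 1
  exact commute_C_of_coeff fun p => H.zero_log ε ε i i p

theorem zero_coeff (ε : ℤˣ) (i : Fin (m + n + 1)) :
    coeff 0 (hSer h₀ l ε i) * coeff 0 (hSer h₀ l (-ε) i) = 1 := by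
  rw [coeff_zero_hSer, coeff_zero_hSer, H.zero]

theorem commute_hSer (ε : ℤˣ) (i j : Fin (m + n + 1)) (p p' : ℕ) :
    Commute (coeff p (hSer h₀ l ε i)) (coeff p' (hSer h₀ l ε j)) :=
  commute_coeff_hSer
    (commute_coeff_hSer (H.zero_zero ε ε j i) (fun s => H.zero_log ε ε j i s) p).symm
    (fun r => (commute_coeff_hSer (H.zero_log ε ε i j r).symm
      (fun s => H.log_log ε j i r s) p).symm) p'

theorem hBracket (ε : ℤˣ) (i j : Fin (m + n + 1)) :
    HBracket c ε (hSer h₀ l ε i) (l ε i) (modes (-ε) (hSer h₀ l (-ε) j)) (lamS m n ε i j) := by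
  rw [hBracket_modes_iff H.central (h_mul_inv H.zero_coeff (-ε) j)
    (H.euler (-ε) j) (H.log_zero (-ε) j)]
  refine ⟨fun p => ?_, H.heis ε i j, fun r => ?_⟩
  · rw [coeff_zero_hSer]
    exact commute_coeff_hSer (H.zero_zero ε (-ε) i j) (fun s => H.zero_log ε (-ε) i j s) p
  · rw [coeff_zero_hSer]
    exact (H.zero_log (-ε) ε j i r).symm

theorem xBracket (s ε : ℤˣ) (i : Fin (m + n + 1)) (j : Fin (m + n)) :
    XBracket c s ε (hSer h₀ l ε i) (l ε i) (X s j)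
      (q ^ ((s : ℤ) * ε * form (eps m n i) (root j))) (chiS m n ε i j) :=
  ⟨fun k => by rw [coeff_zero_hSer]; exact H.zero_X s ε i j k, fun r k => H.log_X s ε i j r k⟩

end HRel

/-- The relations of the logarithms of the `h_i` follow from those of `A_q`. -/
theorem HRel.of_relations {c : Bˣ} (hc : ∀ b : B, Commute (c : B) b)
    {h l : ℤˣ → Fin (m + n + 1) → PowerSeries B} {X : ℤˣ → Fin (m + n) → ℤ → B}
    (hzero : ∀ ε i, coeff 0 (h ε i) * coeff 0 (h (-ε) i) = 1)
    (hcomm : ∀ ε i j p p', Commute (coeff p (h ε i)) (coeff p' (h ε j)))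
    (hl : ∀ ε i, l ε i = eulerD (h ε i) * seriesInv (coeff 0 (h (-ε) i)) (h ε i))
    (hb : ∀ ε i j, i ≤ j → HBracket c ε (h ε i) (l ε i) (modes (-ε) (h (-ε) j)) (lamS m n ε i j))
    (xb : ∀ (s ε : ℤˣ) i j, XBracket c s ε (h ε i) (l ε i) (X s j)
      (q ^ ((s : ℤ) * (ε : ℤ) * form (eps m n i) (root j))) (chiS m n ε i j)) :
    HRel c (fun ε i => coeff 0 (h ε i)) l X := by
  have hzero' : ∀ ε i, coeff 0 (h (-ε) i) * coeff 0 (h ε i) = 1 := fun ε i => by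
    simpa using hzero (-ε) i
  -- The constant terms of h^ε and h^{-ε} are inverse to each other, so they commute with the same
  -- elements.
  have inv : ∀ ε i (b : B), Commute b (coeff 0 (h ε i)) → Commute b (coeff 0 (h (-ε) i)) := by
    intro ε i b hb
    have : Commute b ((⟨coeff 0 (h ε i), coeff 0 (h (-ε) i), hzero ε i, hzero' ε i⟩ : Bˣ) : B) := hb
    exact this.units_inv_right
  have hl0 : ∀ ε i, coeff 0 (l ε i) = 0 := by
    intro ε i
    rw [hl, coeff_mul]; simp
  have hle : ∀ ε i, eulerD (h ε i) = l ε i * h ε i := fun ε i => by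
    rw [hl, mul_assoc, h_inv_mul hzero, mul_one]
  have lcomm : ∀ ε i (b : B), (∀ p, Commute b (coeff p (h ε i))) →
      ∀ p, Commute b (coeff p (l ε i)) := by
    intro ε i b hb p
    rw [hl, coeff_mul]
    refine Commute.sum_right _ _ _ fun x _ => Commute.mul_right ?_ ?_
    · rw [coeff_eulerD]; exact (hb _).smul_right _
    · exact commute_coeff_seriesInv (inv ε i b (hb 0)) hb _
  have hz : ∀ ε ε' i j p, Commute (coeff 0 (h ε i)) (coeff p (h ε' j)) := by
    intro ε ε' i j p
    by_cases he : ε = ε'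
    · subst he; exact hcomm ε i j 0 p
    · have he' : ε = -ε' := Int.units_ne_iff_eq_neg.mp he
      rw [he']
      exact (inv ε' i _ (hcomm ε' j i p 0)).symm
  have heis := fun ε (i j : Fin (m + n + 1)) hij => ((hBracket_modes_iff hc (h_mul_inv hzero (-ε) j)
    (hle (-ε) j) (hl0 (-ε) j) (lamS m n ε i j)).mp (hb ε i j hij)).2.1
  refine ⟨hc, hzero, fun ε ε' i j => hz ε ε' i j 0, fun ε ε' i j => lcomm ε' j _ (hz ε ε' i j),
    hl0, fun ε i j r s => ?_, fun ε i j => ?_, fun s ε i j => (xb s ε i j).1,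
    fun s ε i j => (xb s ε i j).2⟩
  · exact lcomm ε j _ (fun p => (lcomm ε i _ (fun p' => hcomm ε j i p p') r).symm) s
  -- Relations between h^+ and h^- are imposed only for i ≤ j, but for both signs; the pairs with i
  -- > j are obtained from the other sign.
  · rcases le_total i j with hij | hij
    · exact heis ε i j hij
    · have h1 := heis (-ε) j i hij
      have h2 := heis_swap (l := l) (ε := -ε) (i := j) (j := i) h1
      simpa only [neg_neg] using h2

/-- A series is determined by its constant term and its logarithmic derivative. -/
theorem eq_C_mul_expL {h l : PowerSeries B} (hl : eulerD h = l * h) (hl0 : coeff 0 l = 0)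
    (hcomm : ∀ r s, Commute (coeff r l) (coeff s l)) (h0 : ∀ p, Commute (coeff 0 h) (coeff p l)) :
    h = C (coeff 0 h) * expL l := by
  refine eq_of_eulerD hl ?_ hl0 (by rw [coeff_C_mul, coeff_zero_expL, mul_one])
  rw [eulerD_mul, eulerD_C, zero_mul, zero_add, eulerD_expL hl0 hcomm, ← mul_assoc, ← mul_assoc]
  congr 1
  exact commute_C_of_coeff h0

end OspAffine

end

noncomputable section

namespace OspAffine

open PowerSeries Finset

variable {m n : ℕ} {B A : Type*} [Ring B] [Algebra K B] [Ring A] [Algebra K A]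

/-! ### Brackets of weighted elements -/

/-- The image of a weighted element. -/
def Weighted.map (φ : B →ₐ[K] A) (x : Weighted m n B) : Weighted m n A := ⟨x.wt, φ x.val⟩

/-- A multiple of a weighted element. -/
def Weighted.scale (a : K) (x : Weighted m n B) : Weighted m n B := ⟨x.wt, a • x.val⟩

theorem Weighted.map_val (φ : B →ₐ[K] A) (x : Weighted m n B) : φ x.val = (x.map φ).val := rfl

theorem map_sBr (φ : B →ₐ[K] A) (x y : Weighted m n B) :
    (sBr x y).map φ = sBr (x.map φ) (y.map φ) := by
  simp [sBr, Weighted.map]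

theorem map_qBr (φ : B →ₐ[K] A) (x y : Weighted m n B) :
    (qBr x y).map φ = qBr (x.map φ) (y.map φ) := by
  simp [qBr, Weighted.map]

theorem sBr_scale (a b : K) (x y : Weighted m n B) :
    sBr (x.scale a) (y.scale b) = (sBr x y).scale (a * b) := by
  simp only [sBr, Weighted.scale, smul_mul_smul_comm, smul_sub, Weighted.mk.injEq, true_and]
  rw [mul_comm b a, smul_comm (a * b)]

theorem qBr_scale (a b : K) (x y : Weighted m n B) :
    qBr (x.scale a) (y.scale b) = (qBr x y).scale (a * b) := by
  simp only [qBr, Weighted.scale, smul_mul_smul_comm, smul_sub, Weighted.mk.injEq, true_and]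
  rw [mul_comm b a, smul_comm (a * b)]

/-- The mode `k` of the `i`-th current with its weight. -/
def wtd (y : Fin (m + n) → ℤ → B) (i : Fin (m + n)) (k : ℤ) : Weighted m n B := ⟨root i, y i k⟩

/-- The relations among currents of one sign, except the quadratic ones for non-orthogonal
roots. -/
structure SerreRel (y : Fin (m + n) → ℤ → B) : Prop where
  zero (i j : Fin (m + n)) (hij : form (root i) (root j) = 0) (k l : ℤ) :
    (sBr (wtd y i k) (wtd y j l)).val = 0
  two (i j : Fin (m + n)) (hn : (i : ℕ) + 1 ≠ n) (hl : (i : ℕ) + 1 ≠ m + n)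
    (hij : (j : ℕ) = i + 1 ∨ (j : ℕ) + 1 = i) (k₁ k₂ l : ℤ) :
    (qBr (wtd y i k₁) (qBr (wtd y i k₂) (wtd y j l))).val
      + (qBr (wtd y i k₂) (qBr (wtd y i k₁) (wtd y j l))).val = 0
  three (i j : Fin (m + n)) (hi : (i : ℕ) + 1 = m + n) (hj : (j : ℕ) + 1 = i)
    (k : Fin 3 → ℤ) (l : ℤ) :
    ∑ σ : Equiv.Perm (Fin 3), (qBr (wtd y i (k (σ 0))) (qBr (wtd y i (k (σ 1)))
      (qBr (wtd y i (k (σ 2))) (wtd y j l)))).val = 0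
  four (i j i' : Fin (m + n)) (hj : (j : ℕ) + 1 = n) (hi : (i : ℕ) + 1 = j)
    (hi' : (i' : ℕ) = j + 1) (r k l₁ l₂ : ℤ) :
    (sBr (qBr (qBr (wtd y i r) (wtd y j l₁)) (wtd y i' k)) (wtd y j l₂)).val
      + (sBr (qBr (qBr (wtd y i r) (wtd y j l₂)) (wtd y i' k)) (wtd y j l₁)).val = 0

/-- All terms of such a relation are products of the same modes in various orders, and
symmetrisation only permutes them. Hence a rescaling of the modes, with scalars depending
arbitrarily on k, multiplies the whole relation by one scalar. In particular the Serre relations do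
not notice the shifts by q^{ν_i}. -/
theorem SerreRel.scale {y : Fin (m + n) → ℤ → B} (h : SerreRel y) (u : Fin (m + n) → ℤ → K) :
    SerreRel fun i k => u i k • y i k := by
  have hw : ∀ i k, wtd (fun i k => u i k • y i k) i k = (wtd y i k).scale (u i k) := fun _ _ => rfl
  have hv : ∀ (a : K) (x : Weighted m n B), (x.scale a).val = a • x.val := fun _ _ => rfl
  constructor
  · intro i j hij k l
    rw [hw, hw, sBr_scale, hv, h.zero i j hij, smul_zero]
  · intro i j hn hl hij k₁ k₂ l
    simp only [hw, qBr_scale, hv]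
    rw [mul_left_comm, ← smul_add, h.two i j hn hl hij, smul_zero]
  · intro i j hi hj k l
    simp only [hw, qBr_scale, hv]
    have hp : ∀ σ : Equiv.Perm (Fin 3),
        u i (k (σ 0)) * (u i (k (σ 1)) * (u i (k (σ 2)) * u j l)) =
          u i (k 0) * u i (k 1) * u i (k 2) * u j l := by
      intro σ
      have := Equiv.prod_comp σ fun t => u i (k t)
      rw [Fin.prod_univ_three, Fin.prod_univ_three] at this
      rw [← this]; ring
    simp only [hp]
    rw [← smul_sum, h.three i j hi hj, smul_zero]
  · intro i j i' hj hi hi' r k l₁ l₂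
    simp only [hw, qBr_scale, sBr_scale, hv]
    rw [show u i r * u j l₂ * u i' k * u j l₁ = u i r * u j l₁ * u i' k * u j l₂ by ring,
      ← smul_add, h.four i j i' hj hi hi', smul_zero]

/-- The quadratic relations among currents for non-orthogonal roots. -/
def QuadRel (ε : ℤˣ) (y : Fin (m + n) → ℤ → B) : Prop :=
  ∀ i j : Fin (m + n), form (root i) (root j) ≠ 0 → ∀ k l : ℤ,
    y i (k + 1) * y j l - q ^ ((ε : ℤ) * form (root i) (root j)) • (y j l * y i (k + 1))
      + (y j (l + 1) * y i k - q ^ ((ε : ℤ) * form (root i) (root j)) • (y i k * y j (l + 1))) = 0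

/-- Here the terms involve different modes, (k+1, l) and (k, l+1), so only scalars independent of
the mode are harmless. This is why the relation is recorded for modes already rescaled by powers of
q^{-ν_i}. -/
theorem QuadRel.scale {ε : ℤˣ} {y : Fin (m + n) → ℤ → B} (h : QuadRel ε y) (u : Fin (m + n) → K) :
    QuadRel ε fun i k => u i • y i k := by
  intro i j hij k l
  have := congrArg (fun b => (u i * u j) • b) (h i j hij k l)
  simp only [smul_zero, smul_add, smul_sub] at this
  rw [← this]
  simp only [smul_mul_smul_comm, mul_comm (u j) (u i), smul_comm (u i * u j)]

theorem par_eps (j : ℕ) : par (eps m n j) = if j < n then 1 else 0 := by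
  rw [par]
  by_cases hj : j < n
  · rw [if_pos hj, sum_eq_single (⟨j, by omega⟩ : Fin (m + n))]
    · simp [eps, hj]
    · intro b _ hb
      have : (b : ℕ) ≠ j := fun h => hb (Fin.ext h)
      simp [eps, this]
    · simp
  · rw [if_neg hj]
    refine sum_eq_zero fun b _ => ?_
    by_cases hb : (b : ℕ) < n
    · rw [if_pos hb, eps, if_neg (by omega)]
    · rw [if_neg hb]

theorem par_root (i : Fin (m + n)) : par (root i) = if (i : ℕ) + 1 = n then 1 else 0 := by
  have h : par (root i) = par (eps m n i) - par (eps m n (i + 1)) := by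
    rw [par, par, par, ← sum_sub_distrib]
    refine sum_congr rfl fun a _ => ?_
    split_ifs <;> simp [root]
  rw [h, par_eps, par_eps]
  split_ifs <;> omega

/-- The only odd simple root is α_n, and it is isotropic since m > 0. Two non-orthogonal simple
roots are therefore never both odd. -/
theorem superSign_of_form_ne_zero (hm : 0 < m) {i j : Fin (m + n)}
    (h : form (root i) (root j) ≠ 0) : superSign (root i) (root j) = 1 := by
  rw [superSign, if_pos]
  rw [par_root, par_root]
  split_ifs with hi hj <;> try simp
  refine absurd ?_ h
  rw [form_root_root, if_pos (by omega), if_pos (by omega), dNorm, dNorm, if_pos (by omega),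
    if_neg (by omega)]
  rfl

theorem superSign_self_mul_self (i : Fin (m + n)) :
    superSign (root i) (root i) * superSign (root i) (root i) = 1 := by
  rw [superSign]
  split_ifs <;> norm_num

/-! ### The relations of `A_q` in logarithmic form -/

/-- The series `h_{i+1} h_i⁻¹`. -/
def hRat (h₀ : ℤˣ → Fin (m + n + 1) → B) (l : ℤˣ → Fin (m + n + 1) → PowerSeries B) (ε : ℤˣ)
    (i : Fin (m + n)) : PowerSeries B :=
  C (h₀ ε i.succ * h₀ (-ε) i.castSucc) * expL (l ε i.succ - l ε i.castSucc)

/-- Both sides have the same constant term, and the same logarithmic derivative because inversion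
changes the sign of the logarithm and all the series involved commute. -/
theorem HRel.hRat_eq {c : Bˣ} {h₀ : ℤˣ → Fin (m + n + 1) → B}
    {l : ℤˣ → Fin (m + n + 1) → PowerSeries B} {X : ℤˣ → Fin (m + n) → ℤ → B}
    (H : HRel c h₀ l X) (ε : ℤˣ) (i : Fin (m + n)) :
    hSer h₀ l ε i.succ * seriesInv (h₀ (-ε) i.castSucc) (hSer h₀ l ε i.castSucc) =
      hRat h₀ l ε i := by
  have hi : ∀ i, hSer h₀ l ε i * seriesInv (h₀ (-ε) i) (hSer h₀ l ε i) = 1 := fun i => by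
    simpa only [coeff_zero_hSer] using h_mul_inv H.zero_coeff ε i
  have hi' : ∀ i, seriesInv (h₀ (-ε) i) (hSer h₀ l ε i) * hSer h₀ l ε i = 1 := fun i => by
    simpa only [coeff_zero_hSer] using h_inv_mul H.zero_coeff ε i
  have hlog : ∀ i j p p', Commute (coeff p (l ε i)) (coeff p' (hSer h₀ l ε j)) :=
    fun i j p => commute_coeff_hSer (H.zero_log ε ε j i p).symm fun s => H.log_log ε i j p s
  have h1 : eulerD (hSer h₀ l ε i.succ *
      seriesInv (h₀ (-ε) i.castSucc) (hSer h₀ l ε i.castSucc)) =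
      (l ε i.succ - l ε i.castSucc) * (hSer h₀ l ε i.succ *
      seriesInv (h₀ (-ε) i.castSucc) (hSer h₀ l ε i.castSucc)) := by
    rw [eulerD_mul, H.euler, eulerD_inverse (hi _) (hi' _) (H.euler ε _)
      (commute_of_coeff fun a b => hlog _ _ a b), sub_mul, neg_mul, mul_neg, ← mul_assoc,
      (commute_of_coeff fun a b => (hlog i.castSucc i.succ b a).symm : Commute
        (hSer h₀ l ε i.succ) (l ε i.castSucc)).eq, sub_eq_add_neg, mul_assoc, mul_assoc]
  have hcz : coeff 0 (hSer h₀ l ε i.succ *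
      seriesInv (h₀ (-ε) i.castSucc) (hSer h₀ l ε i.castSucc)) =
      h₀ ε i.succ * h₀ (-ε) i.castSucc := by
    rw [coeff_mul]
    simp [coeff_zero_hSer, coeff_zero_seriesInv]
  rw [eq_C_mul_expL h1, hcz, hRat]
  · rw [map_sub, H.log_zero, H.log_zero, sub_zero]
  · intro r s
    rw [map_sub, map_sub]
    exact ((H.log_log ..).sub_left (H.log_log ..)).sub_right
      ((H.log_log ..).sub_left (H.log_log ..))
  · intro p
    have h0 : ∀ j, Commute (h₀ ε j) (coeff p (l ε i.succ - l ε i.castSucc)) := fun j => by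
      rw [map_sub]; exact (H.zero_log ..).sub_right (H.zero_log ..)
    have h0' : ∀ j, Commute (h₀ (-ε) j) (coeff p (l ε i.succ - l ε i.castSucc)) := fun j => by
      rw [map_sub]; exact (H.zero_log ..).sub_right (H.zero_log ..)
    rw [hcz]
    exact (h0 _).mul_left (h0' _)

/-- The relations of `A_q`, in terms of the constant terms and logarithmic derivatives of the
`h_i`. -/
structure AData (c : Bˣ) (h₀ : ℤˣ → Fin (m + n + 1) → B)
    (l : ℤˣ → Fin (m + n + 1) → PowerSeries B) (X : ℤˣ → Fin (m + n) → ℤ → B) : Prop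
    extends HRel c h₀ l X where
  serre (ε : ℤˣ) : SerreRel (X ε)
  quad (ε : ℤˣ) : QuadRel (-ε) fun i k => (q ^ (-nu n i)) ^ k • X ε i k
  plus_minus (i j : Fin (m + n)) (k p : ℤ) :
    (sBr (wtd (X 1) i k) (wtd (X (-1)) j p)).val =
      if i = j then (qNode i - (qNode i)⁻¹) •
        (((c ^ (p - k) : Bˣ) : B) * modes 1 (hRat h₀ l 1 i) (k + p)
          - ((c ^ (k - p) : Bˣ) : B) * modes (-1) (hRat h₀ l (-1) i) (k + p))
      else 0

/-- The two relations are proportional with factor -Q, where Q = q^{εf}, but Q is replaced by Q⁻¹ in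
the process. Thus X^ε satisfies the relations of x^{-ε}, which is why the isomorphism exchanges the
two signs. -/
theorem linMul_quad_iff (c : Bˣ) (ε : ℤˣ) (f : ℤ) (y z : ℤ → B) :
    (∀ k p, linMul c 1 (q ^ ((ε : ℤ) * f)) 0 0 (fun k p => y k * z p) k p =
      linMul c (q ^ ((ε : ℤ) * f)) 1 0 0 (fun k p => z p * y k) k p) ↔
    ∀ k p, y (k + 1) * z p - q ^ (((-ε : ℤˣ) : ℤ) * f) • (z p * y (k + 1))
      + (z (p + 1) * y k - q ^ (((-ε : ℤˣ) : ℤ) * f) • (y k * z (p + 1))) = 0 := by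
  have hQ : q ^ ((ε : ℤ) * f) ≠ 0 := zpow_ne_zero _ q_ne_zero
  rw [Units.val_neg, neg_mul, zpow_neg]
  set Q := q ^ ((ε : ℤ) * f)
  have key : ∀ k p, linMul c 1 Q 0 0 (fun k p => y k * z p) (k + 1) (p + 1) -
      linMul c Q 1 0 0 (fun k p => z p * y k) (k + 1) (p + 1) =
      (-Q) • (y (k + 1) * z p - Q⁻¹ • (z p * y (k + 1))
      + (z (p + 1) * y k - Q⁻¹ • (y k * z (p + 1)))) := by
    intro k p
    simp only [linMul, zpow_zero, Units.val_one, one_mul, one_smul, add_sub_cancel_right,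
      smul_add, smul_sub, smul_smul, neg_mul, mul_inv_cancel₀ hQ, neg_smul]
    abel
  constructor
  · intro h k p
    have := key k p
    rw [h, sub_self] at this
    exact (smul_eq_zero.mp this.symm).resolve_left (neg_ne_zero.mpr hQ)
  · intro h k p
    have := key (k - 1) (p - 1)
    rw [h, smul_zero, sub_add_cancel, sub_add_cancel, sub_eq_zero] at this
    exact this

section Eval

variable (c : Bˣ) (h : ℤˣ → Fin (m + n + 1) → PowerSeries B) (X : ℤˣ → Fin (m + n) → ℤ → B)

theorem aEval_Xw (ε : ℤˣ) (i : Fin (m + n)) (k : ℤ) :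
    (AFree.Xw ε i k).map (aEval c h X) = wtd (X ε) i k := by
  rw [AFree.Xw, Weighted.map, wtd, aEval_X]

theorem aEval_hRatio (ε : ℤˣ) (i : Fin (m + n)) (k : ℤ) :
    aEval c h X (AFree.hRatio ε i k) =
      modes ε (h ε i.succ * seriesInv (coeff 0 (h (-ε) i.castSucc)) (h ε i.castSucc)) k := by
  rw [AFree.hRatio, ← map_hPS c h X ε i.succ, ← map_hPS c h X ε i.castSucc]
  have h1 : coeff 0 (h (-ε) i.castSucc) =
      (aEval c h X : AFree m n →+* B) (FreeAlgebra.ι K (.h (-ε) i.castSucc 0)) := by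
    rw [RingHom.coe_coe, aEval_ι, aGenEval]
  rw [h1, ← map_seriesInv, ← map_mul]
  exact map_modes (aEval c h X : AFree m n →+* B) ε _ k

theorem aEval_zw_shift (u v : K) (ε : ℤˣ) (i j : Fin (m + n)) :
    (fun k l => aEval c h X (AFree.zw (AFree.shift u (AFree.X ε i)) (AFree.shift v (AFree.X ε j))
      k l)) = fun k l => (u ^ k • X ε i k) * (v ^ l • X ε j l) := by
  funext k l
  rw [AFree.zw, AFree.shift, AFree.shift, map_mul, map_smul, map_smul, aEval_X, aEval_X]

theorem aEval_wz_shift (u v : K) (ε : ℤˣ) (i j : Fin (m + n)) :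
    (fun k l => aEval c h X (AFree.wz (AFree.shift v (AFree.X ε j)) (AFree.shift u (AFree.X ε i))
      k l)) = fun k l => (v ^ l • X ε j l) * (u ^ k • X ε i k) := by
  funext k l
  rw [AFree.wz, AFree.shift, AFree.shift, map_mul, map_smul, map_smul, aEval_X, aEval_X]

end Eval

/-- The relations of `A_q` hold for values in logarithmic form. -/
theorem AData.aEval_eq {c : Bˣ} {h₀ : ℤˣ → Fin (m + n + 1) → B}
    {l : ℤˣ → Fin (m + n + 1) → PowerSeries B} {X : ℤˣ → Fin (m + n) → ℤ → B}
    (D : AData c h₀ l X) {a b : AFree m n} (hab : ARel m n a b) :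
    aEval c (hSer h₀ l) X a = aEval c (hSer h₀ l) X b := by
  have H := D.toHRel
  cases hab with
  | c_cInv => simp [aGenEval]
  | cInv_c => simp [aGenEval]
  | c_central y =>
    rw [map_mul, map_mul, aEval_ι, aEval_ι]
    exact H.central _
  | h_zero ε i =>
    rw [map_mul, aEval_h, aEval_h, modes_zero, modes_zero, H.zero_coeff, map_one]
  | h_h_same ε i j k p =>
    rw [map_mul, map_mul, aEval_h, aEval_h]
    revert k
    rw [forall_modes (P := fun b => b * _ = _ * b) (by simp)]
    intro r
    revert p
    rw [forall_modes (P := fun b => _ * b = b * _) (by simp)]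
    exact fun s => H.commute_hSer ε i j r s
  | h_h_odd ε i hi k p =>
    exact (h_h_odd_iff H.central H.zero_coeff H.euler H.log_zero ε hi).mpr (H.hBracket ε i i) k p
  | h_h_even ε i hi hi' k p =>
    exact (h_h_even_iff H.central H.zero_coeff H.euler H.log_zero ε hi hi').mpr
      (H.hBracket ε i i) k p
  | h_h_lt ε i j hij k p =>
    exact (h_h_lt_iff H.central H.zero_coeff H.euler H.log_zero ε hij).mpr (H.hBracket ε i j) k p
  | h_h_last ε k p =>
    exact (h_h_last_iff H.central H.zero_coeff H.euler H.log_zero ε).mpr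
      (H.hBracket ε (Fin.last _) (Fin.last _)) k p
  | h_X_minus ε i hi j k p =>
    exact (h_X_minus_iff H.central H.zero_coeff H.euler H.log_zero ε hi j).mpr
      (by simpa using H.xBracket (-1) ε i j) k p
  | h_X_plus ε i hi j k p =>
    exact (h_X_plus_iff H.central H.zero_coeff H.euler H.log_zero ε hi j).mpr
      (by simpa using H.xBracket 1 ε i j) k p
  | h_last_X_minus ε j hj k p =>
    exact (h_last_X_minus_iff H.central H.zero_coeff H.euler H.log_zero ε hj).mpr
      (by simpa [form_eps_last] using H.xBracket (-1) ε (Fin.last _) j) k p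
  | h_last_X_plus ε j hj k p =>
    exact (h_last_X_plus_iff H.central H.zero_coeff H.euler H.log_zero ε hj).mpr
      (by simpa [form_eps_last] using H.xBracket 1 ε (Fin.last _) j) k p
  | h_last_X_comm ε ε' j hj k p =>
    exact (h_last_X_comm_iff H.central H.euler ε ε' hj H.zero_coeff H.log_zero).mpr
      (by simpa [form_eps_last] using H.xBracket ε' ε (Fin.last _) j) k p
  | X_X ε i j hij k p =>
    rw [aEval_lin, aEval_lin, aEval_zw_shift, aEval_wz_shift]
    exact (linMul_quad_iff c ε _ _ _).mpr (D.quad ε i j hij) k p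
  | X_X_zero ε i j hij k p =>
    rw [Weighted.map_val, map_sBr, aEval_Xw, aEval_Xw, map_zero]
    exact (D.serre ε).zero i j hij k p
  | X_plus_minus i j k p =>
    rw [Weighted.map_val, map_sBr, aEval_Xw, aEval_Xw, D.plus_minus]
    split_ifs with hij
    · rw [map_smul, map_sub, map_mul, map_mul, aEval_cPow, aEval_cPow, aEval_hRatio,
        aEval_hRatio, coeff_zero_hSer, coeff_zero_hSer, H.hRat_eq, H.hRat_eq]
    · rw [map_zero]
  | serre_two ε i j hn hl hij k₁ k₂ p =>
    rw [map_add, Weighted.map_val, Weighted.map_val]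
    simp only [map_qBr, aEval_Xw, map_zero]
    exact (D.serre ε).two i j hn hl hij k₁ k₂ p
  | serre_three ε i j hi hj k p =>
    rw [map_sum]
    simp only [Weighted.map_val, map_qBr, aEval_Xw, map_zero]
    exact (D.serre ε).three i j hi hj k p
  | serre_four ε i j i' hj hi hi' r k l₁ l₂ =>
    rw [map_add, Weighted.map_val, Weighted.map_val]
    simp only [map_qBr, map_sBr, aEval_Xw, map_zero]
    exact (D.serre ε).four i j i' hj hi hi' r k l₁ l₂

/-- The homomorphism from `A_q` with given values in logarithmic form. -/
def AData.lift {c : Bˣ} {h₀ : ℤˣ → Fin (m + n + 1) → B}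
    {l : ℤˣ → Fin (m + n + 1) → PowerSeries B} {X : ℤˣ → Fin (m + n) → ℤ → B}
    (D : AData c h₀ l X) : Aq m n →ₐ[K] B :=
  RingQuot.liftAlgHom K ⟨aEval c (hSer h₀ l) X, fun _ _ h => D.aEval_eq h⟩

section Lift

variable {c : Bˣ} {h₀ : ℤˣ → Fin (m + n + 1) → B} {l : ℤˣ → Fin (m + n + 1) → PowerSeries B}
  {X : ℤˣ → Fin (m + n) → ℤ → B} (D : AData c h₀ l X)

theorem AData.lift_proj (a : AFree m n) : D.lift (Aq.proj m n a) = aEval c (hSer h₀ l) X a :=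
  RingQuot.liftAlgHom_mkAlgHom_apply K _ _ a

theorem AData.lift_hCoeff (ε : ℤˣ) (i : Fin (m + n + 1)) (p : ℕ) :
    D.lift (Aq.hCoeff ε i p) = coeff p (hSer h₀ l ε i) := by
  rw [Aq.hCoeff, D.lift_proj, aEval_ι, aGenEval]

theorem AData.lift_h (ε : ℤˣ) (i : Fin (m + n + 1)) :
    PowerSeries.map (D.lift : Aq m n →+* B) (Aq.h ε i) = hSer h₀ l ε i := by
  ext p
  rw [PowerSeries.coeff_map, Aq.h, coeff_mk]
  exact D.lift_hCoeff ε i p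

theorem AData.lift_X (ε : ℤˣ) (i : Fin (m + n)) (k : ℤ) : D.lift (Aq.X ε i k) = X ε i k := by
  rw [Aq.X, D.lift_proj, aEval_X]

theorem AData.lift_c : D.lift (Aq.c m n) = c := by
  rw [Aq.c, D.lift_proj, aEval_ι, aGenEval]

end Lift

/-! ### The tautological data in `A_q` -/

namespace Aq

theorem proj_rel {a b : AFree m n} (h : ARel m n a b) : proj m n a = proj m n b :=
  RingQuot.mkAlgHom_rel K h

/-- `q^{c/2}` as a unit. -/
def cUnit (m n : ℕ) : (Aq m n)ˣ where
  val := c m n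
  inv := proj m n (FreeAlgebra.ι K .cInv)
  val_inv := by rw [c, ← map_mul, proj_rel .c_cInv, map_one]
  inv_val := by rw [c, ← map_mul, proj_rel .cInv_c, map_one]

theorem val_cUnit : (cUnit m n : Aq m n) = c m n := rfl

/-- The quotient map is itself an evaluation, so the equivalences stated for arbitrary algebras
apply to A_q. -/
theorem proj_eq_aEval : proj m n = aEval (cUnit m n) h X := by
  refine FreeAlgebra.hom_ext (funext fun y => ?_)
  rw [Function.comp_apply, Function.comp_apply, aEval_ι]
  cases y with
  | h ε i p => rw [aGenEval, h, coeff_mk]; rfl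
  | X => rfl
  | c => rfl
  | cInv => rfl

theorem aEval_rel {a b : AFree m n} (hab : ARel m n a b) :
    aEval (cUnit m n) h X a = aEval (cUnit m n) h X b := by
  rw [← proj_eq_aEval, proj_rel hab]

/-- An induction principle for `A_q`. -/
theorem induction {P : Aq m n → Prop} (hK : ∀ r, P (algebraMap K _ r))
    (hg : ∀ y, P (proj m n (FreeAlgebra.ι K y))) (hmul : ∀ a b, P a → P b → P (a * b))
    (hadd : ∀ a b, P a → P b → P (a + b)) (a : Aq m n) : P a := by
  obtain ⟨b, rfl⟩ := RingQuot.mkAlgHom_surjective K (ARel m n) a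
  induction b using FreeAlgebra.induction with
  | grade0 r => rw [AlgHom.commutes]; exact hK r
  | grade1 y => exact hg y
  | mul a b ha hb => rw [map_mul]; exact hmul _ _ ha hb
  | add a b ha hb => rw [map_add]; exact hadd _ _ ha hb

theorem c_central (a : Aq m n) : Commute (cUnit m n : Aq m n) a := by
  induction a using Aq.induction with
  | hK r => exact (Algebra.commutes r _).symm
  | hg y =>
    rw [val_cUnit, c, Commute, SemiconjBy, ← map_mul, ← map_mul, proj_rel (.c_central y)]
  | hmul a b ha hb => exact ha.mul_right hb
  | hadd a b ha hb => exact ha.add_right hb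

theorem coeff_zero_mul (ε : ℤˣ) (i : Fin (m + n + 1)) :
    coeff 0 (h ε i) * coeff 0 (h (-ε) i) = (1 : Aq m n) := by
  have := aEval_rel (.h_zero ε i)
  rwa [map_mul, aEval_h, aEval_h, modes_zero, modes_zero, map_one] at this

theorem commute_coeff_h (ε : ℤˣ) (i j : Fin (m + n + 1)) (p p' : ℕ) :
    Commute (coeff p (h ε i)) (coeff p' (h ε j) : Aq m n) := by
  have := aEval_rel (.h_h_same ε i j (ε * p) (ε * p'))
  rwa [map_mul, map_mul, aEval_h, aEval_h, modes_natCast, modes_natCast] at this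

/-- The logarithmic derivative of `h_i`. -/
def logH (ε : ℤˣ) (i : Fin (m + n + 1)) : PowerSeries (Aq m n) :=
  eulerD (h ε i) * seriesInv (coeff 0 (h (-ε) i)) (h ε i)

/-- The constant term of `h_i`. -/
def hZero (ε : ℤˣ) (i : Fin (m + n + 1)) : Aq m n := coeff 0 (h ε i)

theorem hZero_eq (ε : ℤˣ) (i : Fin (m + n + 1)) : (hZero ε i : Aq m n) = hCoeff ε i 0 := by
  rw [hZero, h, coeff_mk]

theorem euler_h (ε : ℤˣ) (i : Fin (m + n + 1)) :
    eulerD (h ε i : PowerSeries (Aq m n)) = logH ε i * h ε i := by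
  rw [logH, mul_assoc, h_inv_mul coeff_zero_mul, mul_one]

theorem coeff_zero_logH (ε : ℤˣ) (i : Fin (m + n + 1)) :
    coeff 0 (logH ε i : PowerSeries (Aq m n)) = 0 := by
  rw [logH, coeff_mul]; simp

/-- The equivalences read from left to right, for each position of i relative to n and N + 1. For i
= N + 1 the scalar of the constant term is 1 because ε_{N+1} = 0. -/
theorem hRel : HRel (cUnit m n) hZero logH X := by
  refine HRel.of_relations c_central coeff_zero_mul commute_coeff_h (fun _ _ => rfl) ?_ ?_
  · intro ε i j hij
    rcases hij.lt_or_eq with hij | rfl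
    · exact (h_h_lt_iff c_central coeff_zero_mul euler_h coeff_zero_logH ε hij).mp
        fun k p => aEval_rel (.h_h_lt ε i j hij k p)
    by_cases hi : (i : ℕ) < n
    · exact (h_h_odd_iff c_central coeff_zero_mul euler_h coeff_zero_logH ε hi).mp
        fun k p => aEval_rel (.h_h_odd ε i hi k p)
    by_cases hi' : (i : ℕ) < m + n
    · exact (h_h_even_iff c_central coeff_zero_mul euler_h coeff_zero_logH ε (not_lt.mp hi) hi').mp
        fun k p => aEval_rel (.h_h_even ε i (not_lt.mp hi) hi' k p)
    · obtain rfl : i = Fin.last _ := Fin.ext (by have := i.2; simp only [Fin.val_last]; omega)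
      exact (h_h_last_iff c_central coeff_zero_mul euler_h coeff_zero_logH ε).mp
        fun k p => aEval_rel (.h_h_last ε k p)
  · intro s ε i j
    by_cases hi : i = Fin.last _
    · subst hi
      by_cases hj : (j : ℕ) + 1 = m + n
      · rcases Int.units_eq_one_or s with rfl | rfl
        · simpa [form_eps_last] using
            (h_last_X_plus_iff c_central coeff_zero_mul euler_h coeff_zero_logH ε hj).mp
            fun k p => aEval_rel (.h_last_X_plus ε j hj k p)
        · simpa [form_eps_last] using
            (h_last_X_minus_iff c_central coeff_zero_mul euler_h coeff_zero_logH ε hj).mp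
            fun k p => aEval_rel (.h_last_X_minus ε j hj k p)
      · simpa [form_eps_last] using
          (h_last_X_comm_iff c_central euler_h ε s hj coeff_zero_mul coeff_zero_logH).mp
          fun k p => aEval_rel (.h_last_X_comm ε s j hj k p)
    · rcases Int.units_eq_one_or s with rfl | rfl
      · simpa using (h_X_plus_iff c_central coeff_zero_mul euler_h coeff_zero_logH ε hi j).mp
          fun k p => aEval_rel (.h_X_plus ε i hi j k p)
      · simpa using (h_X_minus_iff c_central coeff_zero_mul euler_h coeff_zero_logH ε hi j).mp
          fun k p => aEval_rel (.h_X_minus ε i hi j k p)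

theorem hSer_hZero (ε : ℤˣ) (i : Fin (m + n + 1)) :
    hSer hZero logH ε i = (h ε i : PowerSeries (Aq m n)) :=
  (eq_C_mul_expL (euler_h ε i) (coeff_zero_logH ε i) (fun r s => hRel.log_log ε i i r s)
    (fun p => hRel.zero_log ε ε i i p)).symm

theorem aData : AData (cUnit m n) hZero logH X where
  __ := hRel
  serre ε := by
    constructor
    · intro i j hij k l
      have := aEval_rel (.X_X_zero ε i j hij k l)
      rwa [Weighted.map_val, map_sBr, aEval_Xw, aEval_Xw, map_zero] at this
    · intro i j hn hl hij k₁ k₂ p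
      have := aEval_rel (.serre_two ε i j hn hl hij k₁ k₂ p)
      rw [map_add, Weighted.map_val, Weighted.map_val] at this
      simpa only [map_qBr, aEval_Xw, map_zero] using this
    · intro i j hi hj k p
      have := aEval_rel (.serre_three ε i j hi hj k p)
      rw [map_sum] at this
      simpa only [Weighted.map_val, map_qBr, aEval_Xw, map_zero] using this
    · intro i j i' hj hi hi' r k l₁ l₂
      have := aEval_rel (.serre_four ε i j i' hj hi hi' r k l₁ l₂)
      rw [map_add, Weighted.map_val, Weighted.map_val] at this
      simpa only [map_qBr, map_sBr, aEval_Xw, map_zero] using this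
  quad ε := by
    intro i j hij
    refine (linMul_quad_iff (cUnit m n) ε (form (root i) (root j))
      (fun k => (q ^ (-nu n i)) ^ k • X ε i k) (fun k => (q ^ (-nu n j)) ^ k • X ε j k)).mp
      fun k p => ?_
    have := aEval_rel (.X_X ε i j hij k p)
    rwa [aEval_lin, aEval_lin, aEval_zw_shift, aEval_wz_shift] at this
  plus_minus i j k p := by
    have := aEval_rel (.X_plus_minus i j k p)
    rw [Weighted.map_val, map_sBr, aEval_Xw, aEval_Xw] at this
    rw [this]
    split_ifs with hij
    · rw [map_smul, map_sub, map_mul, map_mul, aEval_cPow, aEval_cPow, aEval_hRatio,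
        aEval_hRatio, ← hRel.hRat_eq, ← hRel.hRat_eq]
      simp only [hSer_hZero, hZero]
    · rw [map_zero]

end Aq

/-! ### The Drinfeld presentation in logarithmic form -/

/-- The sign of a nonzero integer as a unit. -/
def sgnUnit (r : ℤ) : ℤˣ := if 0 < r then 1 else -1

theorem sgnUnit_mul {ε : ℤˣ} {r : ℕ} (hr : r ≠ 0) : sgnUnit ((ε : ℤ) * r) = ε := by
  rw [sgnUnit]
  rcases Int.units_eq_one_or ε with rfl | rfl
  · rw [if_pos (by simpa using Nat.pos_of_ne_zero hr)]
  · rw [if_neg (by simp)]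

theorem exists_sign_natAbs {r : ℤ} (hr : r ≠ 0) : ∃ (ε : ℤˣ) (p : ℕ), p ≠ 0 ∧ r = (ε : ℤ) * p := by
  rcases lt_or_gt_of_ne hr with h | h
  · exact ⟨-1, r.natAbs, by omega, by simp only [Units.val_neg, Units.val_one]; omega⟩
  · exact ⟨1, r.natAbs, by omega, by simp only [Units.val_one]; omega⟩

theorem natAbs_sign_mul (ε : ℤˣ) (r : ℕ) : ((ε : ℤ) * r).natAbs = r := by
  rcases Int.units_eq_one_or ε with rfl | rfl <;> simp

theorem sign_cast_ne_zero (ε : ℤˣ) : ((ε : ℤ) : K) ≠ 0 := by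
  rcases Int.units_eq_one_or ε with rfl | rfl <;> simp

/-- The factor relating `a_{i,εr}` to the logarithmic derivative of `Φ_i^ε`. -/
def aFactor (i : Fin (m + n)) (ε : ℤˣ) (r : ℕ) : K :=
  (qNode i - (qNode i)⁻¹) * (((ε : ℤ) : K) * (r : K))

theorem aFactor_ne_zero (i : Fin (m + n)) (ε : ℤˣ) {r : ℕ} (hr : r ≠ 0) : aFactor i ε r ≠ 0 :=
  mul_ne_zero (qNode_sub_inv_ne_zero i)
    (mul_ne_zero (sign_cast_ne_zero ε) (Nat.cast_ne_zero.mpr hr))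

/-- The images of the generators of `U_q`. -/
def uGenEval (c : Bˣ) (κ : ℤˣ → Fin (m + n) → B) (ψ : ℤˣ → Fin (m + n) → PowerSeries B)
    (x : ℤˣ → Fin (m + n) → ℤ → B) : UGen m n → B
  | .x ε i k => x ε i k
  | .a i r => (aFactor i (sgnUnit r) (r : ℤ).natAbs)⁻¹ • coeff (r : ℤ).natAbs (ψ (sgnUnit r) i)
  | .k i => κ 1 i
  | .kInv i => κ (-1) i
  | .c => c
  | .cInv => ((c⁻¹ : Bˣ) : B)

/-- The homomorphism from the free algebra with given values on the generators of `U_q`. -/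
def uEval (c : Bˣ) (κ : ℤˣ → Fin (m + n) → B) (ψ : ℤˣ → Fin (m + n) → PowerSeries B)
    (x : ℤˣ → Fin (m + n) → ℤ → B) : UFree m n →ₐ[K] B :=
  FreeAlgebra.lift K (uGenEval c κ ψ x)

section Eval

variable (c : Bˣ) (κ : ℤˣ → Fin (m + n) → B) (ψ : ℤˣ → Fin (m + n) → PowerSeries B)
  (x : ℤˣ → Fin (m + n) → ℤ → B)

@[simp] theorem uEval_ι (y : UGen m n) :
    uEval c κ ψ x (FreeAlgebra.ι K y) = uGenEval c κ ψ x y :=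
  FreeAlgebra.lift_ι_apply _ _

theorem uEval_cPow (k : ℤ) : uEval c κ ψ x (UFree.cPow k) = ((c ^ k : Bˣ) : B) := by
  rw [UFree.cPow]
  split_ifs with hk
  · rw [map_pow, uEval_ι, uGenEval, ← Units.val_pow_eq_pow_val, ← zpow_natCast,
      Int.toNat_of_nonneg hk]
  · rw [map_pow, uEval_ι, uGenEval, ← Units.val_pow_eq_pow_val, inv_pow, ← zpow_natCast,
      Int.toNat_of_nonneg (by omega), ← zpow_neg, neg_neg]

/-- It also holds for r = 0: there a_{i,0} = 0, and the factor is 0, whose inverse is 0. -/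
theorem uEval_a (i : Fin (m + n)) (ε : ℤˣ) (r : ℕ) :
    uEval c κ ψ x (UFree.a i ((ε : ℤ) * r)) = (aFactor i ε r)⁻¹ • coeff r (ψ ε i) := by
  rw [UFree.a]
  split_ifs with hr
  · have hr' : r ≠ 0 := by rintro rfl; simp at hr
    simp only [uEval_ι, uGenEval, sgnUnit_mul hr', natAbs_sign_mul]
  · have hr' : r = 0 := by
      rcases Int.units_eq_one_or ε with rfl | rfl <;> simpa using hr
    subst hr'
    simp [aFactor]

theorem uEval_x (ε : ℤˣ) (i : Fin (m + n)) (k : ℤ) : uEval c κ ψ x (UFree.x ε i k) = x ε i k := by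
  rw [UFree.x, uEval_ι, uGenEval]

theorem uEval_k (i : Fin (m + n)) : uEval c κ ψ x (UFree.k i) = κ 1 i := by
  rw [UFree.k, uEval_ι, uGenEval]

theorem uEval_kInv (i : Fin (m + n)) : uEval c κ ψ x (UFree.kInv i) = κ (-1) i := by
  rw [UFree.kInv, uEval_ι, uGenEval]

theorem uEval_xw (ε : ℤˣ) (i : Fin (m + n)) (k : ℤ) :
    (UFree.xw ε i k).map (uEval c κ ψ x) = wtd (x ε) i k := by
  rw [UFree.xw, Weighted.map, wtd, uEval_x]

theorem map_Phi (ε : ℤˣ) (i : Fin (m + n)) :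
    PowerSeries.map (uEval c κ ψ x : UFree m n →+* B) (UFree.Phi ε i) =
      C (κ ε i) * expL (ψ ε i) := by
  rw [UFree.Phi, map_mul, map_fExp, expL, PowerSeries.map_C]
  congr 2
  · rcases Int.units_eq_one_or ε with rfl | rfl
    · rw [if_pos rfl]; exact uEval_k c κ ψ x i
    · rw [if_neg (by decide)]; exact uEval_kInv c κ ψ x i
  · ext r
    rw [PowerSeries.coeff_map, coeff_mk, coeff_mk, RingHom.coe_coe, map_smul, uEval_a, smul_smul]
    congr 1
    have h1 := qNode_sub_inv_ne_zero i
    have h2 := sign_cast_ne_zero ε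
    rw [aFactor, mul_inv, mul_inv]
    generalize qNode i - (qNode i)⁻¹ = β at h1
    generalize ((ε : ℤ) : K) = e at h2
    rw [mul_assoc, mul_inv_cancel_left₀ h1, mul_inv_cancel_left₀ h2]

theorem uEval_modes_Phi (ε : ℤˣ) (i : Fin (m + n)) (k : ℤ) :
    uEval c κ ψ x (modes ε (UFree.Phi ε i) k) = modes ε (C (κ ε i) * expL (ψ ε i)) k := by
  rw [← map_Phi]
  exact map_modes (uEval c κ ψ x : UFree m n →+* B) ε _ k

end Eval

/-- The relations of `U_q`, in terms of the constant terms `κ` and the logarithmic derivatives `ψ`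
of the `Φ_i`. -/
structure UData (c : Bˣ) (κ : ℤˣ → Fin (m + n) → B) (ψ : ℤˣ → Fin (m + n) → PowerSeries B)
    (x : ℤˣ → Fin (m + n) → ℤ → B) : Prop where
  central (b : B) : Commute (c : B) b
  zero (ε : ℤˣ) (i : Fin (m + n)) : κ ε i * κ (-ε) i = 1
  zero_zero (ε ε' : ℤˣ) (i j : Fin (m + n)) : Commute (κ ε i) (κ ε' j)
  zero_log (ε ε' : ℤˣ) (i j : Fin (m + n)) (p : ℕ) : Commute (κ ε i) (coeff p (ψ ε' j))
  log_zero (ε : ℤˣ) (i : Fin (m + n)) : coeff 0 (ψ ε i) = 0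
  log_log (ε : ℤˣ) (i j : Fin (m + n)) (r s : ℕ) : Commute (coeff r (ψ ε i)) (coeff s (ψ ε j))
  heis (ε : ℤˣ) (i j : Fin (m + n)) (r s : ℕ) :
    coeff r (ψ ε i) * coeff s (ψ (-ε) j) - coeff s (ψ (-ε) j) * coeff r (ψ ε i) =
      if r = s then (((ε : ℤ) : K) * (r : K) * (q ^ ((r : ℤ) * form (root i) (root j)) -
        q ^ (-((r : ℤ) * form (root i) (root j))))) •
        (((c ^ (-2 * (r : ℤ)) : Bˣ) : B) - ((c ^ (2 * (r : ℤ)) : Bˣ) : B)) else 0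
  zero_x (s ε : ℤˣ) (i j : Fin (m + n)) (k : ℤ) :
    κ ε i * x s j k = q ^ ((s : ℤ) * ε * form (root i) (root j)) • (x s j k * κ ε i)
  log_x (s ε : ℤˣ) (i j : Fin (m + n)) (r : ℕ) (k : ℤ) :
    coeff r (ψ ε i) * x s j k - x s j k * coeff r (ψ ε i) =
      (((s : ℤ) : K) * (q ^ ((ε : ℤ) * (r : ℤ) * form (root i) (root j)) -
        q ^ (-((ε : ℤ) * (r : ℤ) * form (root i) (root j))))) •
        (((c ^ (-((s : ℤ) * (r : ℤ))) : Bˣ) : B) * x s j (k + (r : ℤ) * ε))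
  serre (ε : ℤˣ) : SerreRel (x ε)
  quad (ε : ℤˣ) : QuadRel ε (x ε)
  plus_minus (i j : Fin (m + n)) (k p : ℤ) :
    (sBr (wtd (x 1) i k) (wtd (x (-1)) j p)).val =
      if i = j then (qNode i - (qNode i)⁻¹)⁻¹ •
        (((c ^ (k - p) : Bˣ) : B) * modes 1 (C (κ 1 i) * expL (ψ 1 i)) (k + p)
          - ((c ^ (p - k) : Bˣ) : B) * modes (-1) (C (κ (-1) i) * expL (ψ (-1) i)) (k + p))
      else 0

theorem qInt_mul_cartan (hm : 0 < m) (i j : Fin (m + n)) (r : ℤ) :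
    qInt i (r * cartan i j) = (q ^ (r * form (root i) (root j)) -
      q ^ (-(r * form (root i) (root j)))) / (qNode i - (qNode i)⁻¹) := by
  rw [qInt, qNode_zpow_cartan hm, ← neg_mul, qNode_zpow_cartan hm, neg_mul]

/-- The relations of `U_q` hold for values in logarithmic form. -/
theorem UData.uEval_eq (hm : 0 < m) {c : Bˣ} {κ : ℤˣ → Fin (m + n) → B}
    {ψ : ℤˣ → Fin (m + n) → PowerSeries B} {x : ℤˣ → Fin (m + n) → ℤ → B}
    (D : UData c κ ψ x) {a b : UFree m n} (hab : URel m n a b) :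
    uEval c κ ψ x a = uEval c κ ψ x b := by
  cases hab with
  | c_cInv => simp [uGenEval]
  | cInv_c => simp [uGenEval]
  | c_central y =>
    rw [map_mul, map_mul, uEval_ι, uEval_ι]
    exact D.central _
  | k_kInv i => rw [map_mul, uEval_k, uEval_kInv, D.zero, map_one]
  | kInv_k i => rw [map_mul, uEval_k, uEval_kInv, map_one]; simpa using D.zero (-1) i
  | k_k i j => rw [map_mul, map_mul, uEval_k, uEval_k]; exact D.zero_zero 1 1 i j
  | k_a i j r =>
    rcases eq_or_ne r 0 with rfl | hr
    · simp [UFree.a]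
    · obtain ⟨ε, p, hp, rfl⟩ := exists_sign_natAbs hr
      rw [map_mul, map_mul, uEval_k, uEval_a]
      exact (D.zero_log 1 ε i j p).smul_right _
  | k_x ε i j p =>
    rw [map_mul, map_mul, map_smul, uEval_k, uEval_kInv, uEval_x, D.zero_x, qNode_zpow_cartan hm,
      smul_mul_assoc, mul_assoc (x ε j p), D.zero, mul_one, Units.val_one, mul_one]
  | a_a i j r s hr hs =>
    obtain ⟨ε, p, hp, rfl⟩ := exists_sign_natAbs hr
    obtain ⟨ε', p', hp', rfl⟩ := exists_sign_natAbs hs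
    rw [map_sub, map_mul, map_mul, uEval_a, uEval_a]
    -- Modes of equal sign commute and never satisfy r = -s; for opposite signs this is the
    -- Heisenberg relation, which requires equal absolute values.
    rcases eq_or_ne ε' ε with rfl | he
    · rw [if_neg, map_zero, sub_eq_zero]
      · exact ((D.log_log _ i j p p').smul_left _).smul_right _
      · rcases Int.units_eq_one_or ε' with rfl | rfl <;> simp <;> omega
    · obtain rfl := Int.units_ne_iff_eq_neg.mp he
      have hpp : ((ε : ℤ) * (p : ℤ) = -(((-ε : ℤˣ) : ℤ) * (p' : ℤ))) ↔ p = p' := by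
        rcases Int.units_eq_one_or ε with rfl | rfl <;> simp
      rw [smul_mul_smul_comm, smul_mul_smul_comm, mul_comm ((aFactor j _ _)⁻¹), ← smul_sub, D.heis]
      simp only [hpp]
      split_ifs with h
      · subst h
        rw [map_smul, map_sub, uEval_cPow, uEval_cPow, smul_smul, qInt_mul_cartan hm]
        have hβi := qNode_sub_inv_ne_zero i
        have hβj := qNode_sub_inv_ne_zero j
        have hpK : (p : K) ≠ 0 := Nat.cast_ne_zero.mpr hp
        rw [aFactor, aFactor]
        generalize qNode i - (qNode i)⁻¹ = β at hβi
        generalize qNode j - (qNode j)⁻¹ = β' at hβj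
        rcases Int.units_eq_one_or ε with rfl | rfl
        · simp only [Units.val_one, Units.val_neg, one_mul, neg_mul, Int.cast_neg, Int.cast_one,
            Int.cast_natCast]
          rw [← neg_sub ((c ^ (2 * (p : ℤ)) : Bˣ) : B), smul_neg, ← neg_smul]
          congr 1
          field_simp
        · simp only [Units.val_one, Units.val_neg, one_mul, neg_mul, Int.cast_neg, Int.cast_one,
            Int.cast_natCast, neg_neg, mul_neg]
          congr 1
          field_simp
          try ring
      · rw [smul_zero, map_zero]
  | a_x ε i j r p hr =>
    obtain ⟨ε', r, hr', rfl⟩ := exists_sign_natAbs hr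
    rw [map_sub, map_mul, map_mul, uEval_a, uEval_x, smul_mul_assoc, mul_smul_comm, ← smul_sub,
      D.log_x, map_smul, map_mul, uEval_cPow, uEval_x, smul_smul, qInt_mul_cartan hm,
      show |(ε' : ℤ) * (r : ℤ)| = r by
        rw [Int.abs_eq_natAbs, natAbs_sign_mul], add_comm p, mul_comm (r : ℤ) (ε' : ℤ)]
    congr 1
    rw [aFactor, Int.cast_mul, Int.cast_natCast]
    have := qNode_sub_inv_ne_zero i
    have := sign_cast_ne_zero ε'
    have : (r : K) ≠ 0 := Nat.cast_ne_zero.mpr hr'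
    field_simp
  | x_plus_minus i j k p =>
    rw [Weighted.map_val, map_sBr, uEval_xw, uEval_xw, D.plus_minus]
    split_ifs with hij
    · rw [map_smul, map_sub, map_mul, map_mul, uEval_cPow, uEval_cPow, uEval_modes_Phi,
        uEval_modes_Phi]
    · rw [map_zero]
  | x_x ε i j k p h =>
    have hf : form (root i) (root j) ≠ 0 := fun h0 => h ((cartan_eq_zero_iff i j).mpr h0)
    simp only [superSign_of_form_ne_zero hm hf, one_mul, one_smul, qNode_zpow_cartan hm, map_add,
      map_sub, map_mul, map_smul, uEval_x, map_zero]
    exact D.quad ε i j hf k p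
  | x_x_zero ε i j k p h =>
    rw [Weighted.map_val, map_sBr, uEval_xw, uEval_xw, map_zero]
    exact (D.serre ε).zero i j ((cartan_eq_zero_iff i j).mp h) k p
  | serre_two ε i j hn hl hij k₁ k₂ p =>
    rw [map_add, Weighted.map_val, Weighted.map_val]
    simp only [map_qBr, uEval_xw, map_zero]
    exact (D.serre ε).two i j hn hl hij k₁ k₂ p
  | serre_three ε i j hi hj k p =>
    rw [map_sum]
    simp only [Weighted.map_val, map_qBr, uEval_xw, map_zero]
    exact (D.serre ε).three i j hi hj k p
  | serre_four ε i j i' hj hi hi' r k l₁ l₂ =>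
    rw [map_add, Weighted.map_val, Weighted.map_val]
    simp only [map_qBr, map_sBr, uEval_xw, map_zero]
    exact (D.serre ε).four i j i' hj hi hi' r k l₁ l₂

/-- The homomorphism from `U_q` with given values in logarithmic form. -/
def UData.lift (hm : 0 < m) {c : Bˣ} {κ : ℤˣ → Fin (m + n) → B}
    {ψ : ℤˣ → Fin (m + n) → PowerSeries B} {x : ℤˣ → Fin (m + n) → ℤ → B}
    (D : UData c κ ψ x) : Uq m n →ₐ[K] B :=
  RingQuot.liftAlgHom K ⟨uEval c κ ψ x, fun _ _ h => D.uEval_eq hm h⟩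

section Lift

variable (hm : 0 < m) {c : Bˣ} {κ : ℤˣ → Fin (m + n) → B}
  {ψ : ℤˣ → Fin (m + n) → PowerSeries B} {x : ℤˣ → Fin (m + n) → ℤ → B} (D : UData c κ ψ x)

theorem UData.lift_proj (a : UFree m n) : D.lift hm (Uq.proj m n a) = uEval c κ ψ x a :=
  RingQuot.liftAlgHom_mkAlgHom_apply K _ _ a

theorem UData.lift_x (ε : ℤˣ) (i : Fin (m + n)) (k : ℤ) : D.lift hm (Uq.x ε i k) = x ε i k := by
  rw [Uq.x, D.lift_proj, uEval_x]

theorem UData.lift_c : D.lift hm (Uq.c m n) = c := by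
  rw [Uq.c, D.lift_proj, uEval_ι, uGenEval]

theorem UData.lift_Phi (ε : ℤˣ) (i : Fin (m + n)) (p : ℕ) :
    D.lift hm (Uq.Phi ε i p) = coeff p (C (κ ε i) * expL (ψ ε i)) := by
  rw [Uq.Phi, D.lift_proj, ← map_Phi c κ ψ x, PowerSeries.coeff_map]
  rfl

end Lift

theorem smul_commutator (a : K) (x y : B) : a • x * y - y * a • x = a • (x * y - y * x) := by
  rw [smul_mul_assoc, mul_smul_comm, smul_sub]

theorem smul_smul_commutator (a b : K) (x y : B) :
    a • x * b • y - b • y * a • x = (a * b) • (x * y - y * x) := by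
  rw [smul_mul_smul_comm, smul_mul_smul_comm, mul_comm b a, smul_sub]

namespace Uq

theorem proj_rel {a b : UFree m n} (h : URel m n a b) : proj m n a = proj m n b :=
  RingQuot.mkAlgHom_rel K h

/-- `q^{c/2}` as a unit. -/
def cUnit (m n : ℕ) : (Uq m n)ˣ where
  val := c m n
  inv := proj m n (FreeAlgebra.ι K .cInv)
  val_inv := by rw [c, ← map_mul, proj_rel .c_cInv, map_one]
  inv_val := by rw [c, ← map_mul, proj_rel .cInv_c, map_one]

theorem val_cUnit : (cUnit m n : Uq m n) = c m n := rfl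

/-- The constant term of `Φ_i^ε`. -/
def kap (ε : ℤˣ) (i : Fin (m + n)) : Uq m n :=
  if ε = 1 then proj m n (UFree.k i) else proj m n (UFree.kInv i)

/-- The logarithmic derivative of `Φ_i^ε`. -/
def psi (ε : ℤˣ) (i : Fin (m + n)) : PowerSeries (Uq m n) :=
  PowerSeries.mk fun r => aFactor i ε r • proj m n (UFree.a i ((ε : ℤ) * r))

theorem kap_one (i : Fin (m + n)) : kap 1 i = proj m n (UFree.k i) := if_pos rfl

theorem kap_neg_one (i : Fin (m + n)) : kap (-1) i = proj m n (UFree.kInv i) :=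
  if_neg (by decide)

theorem coeff_psi (ε : ℤˣ) (i : Fin (m + n)) (r : ℕ) :
    coeff r (psi ε i) = aFactor i ε r • proj m n (UFree.a i ((ε : ℤ) * r)) := coeff_mk _ _

theorem proj_eq_uEval : proj m n = uEval (cUnit m n) kap psi x := by
  refine FreeAlgebra.hom_ext (funext fun y => ?_)
  rw [Function.comp_apply, Function.comp_apply, uEval_ι]
  cases y with
  | x => rfl
  | a i r =>
    obtain ⟨r, hr⟩ := r
    obtain ⟨ε, p, hp, rfl⟩ := exists_sign_natAbs hr
    simp only [uGenEval, sgnUnit_mul hp, natAbs_sign_mul, coeff_psi]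
    rw [smul_smul, inv_mul_cancel₀ (aFactor_ne_zero i ε hp), one_smul, UFree.a, dif_pos hr]
  | k i => rw [uGenEval, kap_one]; rfl
  | kInv i => rw [uGenEval, kap_neg_one]; rfl
  | c => rfl
  | cInv => rfl

theorem uEval_rel {a b : UFree m n} (hab : URel m n a b) :
    uEval (cUnit m n) kap psi x a = uEval (cUnit m n) kap psi x b := by
  rw [← proj_eq_uEval, proj_rel hab]

/-- An induction principle for `U_q`. -/
theorem induction {P : Uq m n → Prop} (hK : ∀ r, P (algebraMap K _ r))
    (hg : ∀ y, P (proj m n (FreeAlgebra.ι K y))) (hmul : ∀ a b, P a → P b → P (a * b))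
    (hadd : ∀ a b, P a → P b → P (a + b)) (a : Uq m n) : P a := by
  obtain ⟨b, rfl⟩ := RingQuot.mkAlgHom_surjective K (URel m n) a
  induction b using FreeAlgebra.induction with
  | grade0 r => rw [AlgHom.commutes]; exact hK r
  | grade1 y => exact hg y
  | mul a b ha hb => rw [map_mul]; exact hmul _ _ ha hb
  | add a b ha hb => rw [map_add]; exact hadd _ _ ha hb

theorem c_central (a : Uq m n) : Commute (cUnit m n : Uq m n) a := by
  induction a using Uq.induction with
  | hK r => exact (Algebra.commutes r _).symm
  | hg y =>
    rw [val_cUnit, c, Commute, SemiconjBy, ← map_mul, ← map_mul, proj_rel (.c_central y)]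
  | hmul a b ha hb => exact ha.mul_right hb
  | hadd a b ha hb => exact ha.add_right hb

theorem kap_mul (ε : ℤˣ) (i : Fin (m + n)) : kap ε i * kap (-ε) i = 1 := by
  rcases Int.units_eq_one_or ε with rfl | rfl
  · rw [kap_one, kap_neg_one, ← map_mul, proj_rel (.k_kInv i), map_one]
  · rw [neg_neg, kap_one, kap_neg_one, ← map_mul, proj_rel (.kInv_k i), map_one]

theorem commute_kap (b : Uq m n) (i : Fin (m + n)) (h : Commute (kap 1 i) b) (ε : ℤˣ) :
    Commute (kap ε i) b := by
  rcases Int.units_eq_one_or ε with rfl | rfl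
  · exact h
  · have : Commute ((⟨kap 1 i, kap (-1) i, kap_mul 1 i, kap_mul (-1) i⟩ : (Uq m n)ˣ) : Uq m n) b := h
    exact this.units_inv_left

/-- The relation of the a_{i,r} multiplied by the factors that turn them into coefficients of
logarithmic derivatives; one of these factors cancels the denominator of the quantum integer and the
r below it. -/
theorem psi_comm (i j : Fin (m + n)) {ε ε' : ℤˣ} {r s : ℕ} (hr : r ≠ 0) (hs : s ≠ 0)
    (hm : 0 < m) :
    coeff r (psi ε i) * coeff s (psi ε' j) - coeff s (psi ε' j) * coeff r (psi ε i) =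
      if (ε : ℤ) * (r : ℤ) = -((ε' : ℤ) * (s : ℤ)) then
        (aFactor j ε' s * ((q ^ ((ε : ℤ) * (r : ℤ) * form (root i) (root j)) -
            q ^ (-((ε : ℤ) * (r : ℤ) * form (root i) (root j)))) /
              (qNode j - (qNode j)⁻¹))) •
          (((cUnit m n ^ (2 * ((ε : ℤ) * (r : ℤ))) : (Uq m n)ˣ) : Uq m n) -
            ((cUnit m n ^ (-(2 * ((ε : ℤ) * (r : ℤ)))) : (Uq m n)ˣ) : Uq m n)) else 0 := by
  have hr' : (ε : ℤ) * (r : ℤ) ≠ 0 := by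
    rcases Int.units_eq_one_or ε with rfl | rfl <;> simpa using hr
  have hs' : (ε' : ℤ) * (s : ℤ) ≠ 0 := by
    rcases Int.units_eq_one_or ε' with rfl | rfl <;> simpa using hs
  have h1 := uEval_rel (.a_a i j _ _ hr' hs')
  have hi := aFactor_ne_zero i ε hr
  have hj := aFactor_ne_zero j ε' hs
  rw [map_sub, map_mul, map_mul, uEval_a, uEval_a, smul_smul_commutator, ← mul_inv,
    inv_smul_eq_iff₀ (mul_ne_zero hi hj)] at h1
  rw [h1]
  split_ifs with hrs
  · rw [map_smul, map_sub, uEval_cPow, uEval_cPow, smul_smul, qInt_mul_cartan hm]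
    congr 1
    rw [aFactor, Int.cast_mul, Int.cast_natCast]
    have h3 := qNode_sub_inv_ne_zero i
    have h4 := sign_cast_ne_zero ε
    have h5 : (r : K) ≠ 0 := Nat.cast_ne_zero.mpr hr
    generalize qNode i - (qNode i)⁻¹ = β at h3
    generalize qNode j - (qNode j)⁻¹ = β'
    field_simp
  · rw [map_zero, smul_zero]

theorem coeff_zero_psi (ε : ℤˣ) (i : Fin (m + n)) : coeff 0 (psi ε i) = 0 := by
  rw [coeff_psi, aFactor]; simp

theorem uData (hm : 0 < m) : UData (cUnit m n) kap psi x where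
  central := c_central
  zero := kap_mul
  zero_zero ε ε' i j := by
    refine commute_kap _ i (commute_kap _ j ?_ ε').symm ε
    rw [kap_one, kap_one, Commute, SemiconjBy, ← map_mul, ← map_mul, proj_rel (.k_k j i)]
  zero_log ε ε' i j p := by
    refine commute_kap _ i ?_ ε
    rw [coeff_psi]
    refine Commute.smul_right ?_ _
    rw [kap_one, Commute, SemiconjBy, ← map_mul, ← map_mul, proj_rel (.k_a i j _)]
  log_zero := coeff_zero_psi
  log_log ε i j r s := by
    rcases eq_or_ne r 0 with rfl | hr
    · rw [coeff_zero_psi]; exact Commute.zero_left _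
    rcases eq_or_ne s 0 with rfl | hs
    · rw [coeff_zero_psi]; exact Commute.zero_right _
    have := psi_comm i j (ε := ε) (ε' := ε) hr hs hm
    rw [if_neg, sub_eq_zero] at this
    · exact this
    · rcases Int.units_eq_one_or ε with rfl | rfl <;> simp <;> omega
  heis ε i j r s := by
    rcases eq_or_ne r 0 with rfl | hr
    · rw [coeff_zero_psi]; simp
    rcases eq_or_ne s 0 with rfl | hs
    · rw [coeff_zero_psi]; simp [hr]
    have hpp : ((ε : ℤ) * (r : ℤ) = -(((-ε : ℤˣ) : ℤ) * (s : ℤ))) ↔ r = s := by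
      rcases Int.units_eq_one_or ε with rfl | rfl <;> simp
    rw [psi_comm i j hr hs hm]
    simp only [hpp]
    split_ifs with hrs
    · subst hrs
      rw [aFactor]
      have hβ := qNode_sub_inv_ne_zero j
      generalize qNode j - (qNode j)⁻¹ = β at hβ
      rcases Int.units_eq_one_or ε with rfl | rfl
      · simp only [Units.val_one, Units.val_neg, one_mul, neg_mul, Int.cast_neg, Int.cast_one]
        rw [← neg_sub ((cUnit m n ^ (2 * (r : ℤ)) : (Uq m n)ˣ) : Uq m n), smul_neg, ← neg_smul]
        congr 1
        field_simp
      · simp only [Units.val_one, Units.val_neg, one_mul, neg_mul, Int.cast_neg, Int.cast_one,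
          neg_neg, mul_neg]
        congr 1
        field_simp
        try ring
    · rfl
  zero_x s ε i j k := by
    have h1 := uEval_rel (.k_x s i j k)
    rw [map_mul, map_mul, map_smul, uEval_k, uEval_kInv, uEval_x, qNode_zpow_cartan hm] at h1
    have h2 : kap 1 i * x s j k = q ^ ((s : ℤ) * form (root i) (root j)) • (x s j k * kap 1 i) := by
      rw [← smul_mul_assoc, ← h1, mul_assoc _ (kap (-1) i)]
      have := kap_mul (-1) i
      rw [neg_neg] at this
      rw [this, mul_one]
    rcases Int.units_eq_one_or ε with rfl | rfl
    · simpa using h2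
    · have h3 : x s j k * kap (-1) i =
          q ^ ((s : ℤ) * form (root i) (root j)) • (kap (-1) i * x s j k) := by
        calc x s j k * kap (-1) i = kap (-1) i * (kap 1 i * x s j k) * kap (-1) i := by
              have := kap_mul (-1) i
              rw [neg_neg] at this
              rw [← mul_assoc, this, one_mul]
          _ = _ := by
              rw [h2, mul_smul_comm, smul_mul_assoc, mul_assoc, mul_assoc, kap_mul 1 i, mul_one]
      rw [h3, smul_smul, ← zpow_add₀ q_ne_zero]
      simp
  log_x s ε i j r k := by
    rcases eq_or_ne r 0 with rfl | hr
    · rw [coeff_zero_psi]; simp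
    have hr' : (ε : ℤ) * (r : ℤ) ≠ 0 := by
      rcases Int.units_eq_one_or ε with rfl | rfl <;> simpa using hr
    have h1 := uEval_rel (.a_x s i j _ k hr')
    rw [map_sub, map_mul, map_mul, uEval_a, uEval_x, smul_commutator,
      inv_smul_eq_iff₀ (aFactor_ne_zero i ε hr)] at h1
    rw [h1, map_smul, map_mul, uEval_cPow, uEval_x, smul_smul, qInt_mul_cartan hm,
      show |(ε : ℤ) * (r : ℤ)| = r by
        rw [Int.abs_eq_natAbs, natAbs_sign_mul], add_comm k, mul_comm (r : ℤ) (ε : ℤ)]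
    congr 1
    rw [aFactor, Int.cast_mul, Int.cast_natCast]
    have h3 := qNode_sub_inv_ne_zero i
    have h4 := sign_cast_ne_zero ε
    have h5 : (r : K) ≠ 0 := Nat.cast_ne_zero.mpr hr
    generalize qNode i - (qNode i)⁻¹ = β at h3
    field_simp
  serre ε := by
    constructor
    · intro i j hij k l
      have := uEval_rel (.x_x_zero ε i j k l ((cartan_eq_zero_iff i j).mpr hij))
      rwa [Weighted.map_val, map_sBr, uEval_xw, uEval_xw, map_zero] at this
    · intro i j hn hl hij k₁ k₂ p
      have := uEval_rel (.serre_two ε i j hn hl hij k₁ k₂ p)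
      rw [map_add, Weighted.map_val, Weighted.map_val] at this
      simpa only [map_qBr, uEval_xw, map_zero] using this
    · intro i j hi hj k p
      have := uEval_rel (.serre_three ε i j hi hj k p)
      rw [map_sum] at this
      simpa only [Weighted.map_val, map_qBr, uEval_xw, map_zero] using this
    · intro i j i' hj hi hi' r k l₁ l₂
      have := uEval_rel (.serre_four ε i j i' hj hi hi' r k l₁ l₂)
      rw [map_add, Weighted.map_val, Weighted.map_val] at this
      simpa only [map_qBr, map_sBr, uEval_xw, map_zero] using this
  quad ε := by
    intro i j hij k l
    have := uEval_rel (.x_x ε i j k l fun h0 => hij ((cartan_eq_zero_iff i j).mp h0))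
    simpa only [superSign_of_form_ne_zero hm hij, one_mul, one_smul, qNode_zpow_cartan hm, map_add,
      map_sub, map_mul, map_smul, uEval_x, map_zero] using this
  plus_minus i j k p := by
    have := uEval_rel (.x_plus_minus i j k p)
    rw [Weighted.map_val, map_sBr, uEval_xw, uEval_xw] at this
    rw [this]
    split_ifs with hij
    · rw [map_smul, map_sub, map_mul, map_mul, uEval_cPow, uEval_cPow, uEval_modes_Phi,
        uEval_modes_Phi]
    · rw [map_zero]

end Uq

section Lift

variable (hm : 0 < m) {c : Bˣ} {κ : ℤˣ → Fin (m + n) → B}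
  {ψ : ℤˣ → Fin (m + n) → PowerSeries B} {x : ℤˣ → Fin (m + n) → ℤ → B} (D : UData c κ ψ x)

theorem UData.lift_kap (ε : ℤˣ) (i : Fin (m + n)) : D.lift hm (Uq.kap ε i) = κ ε i := by
  rcases Int.units_eq_one_or ε with rfl | rfl
  · rw [Uq.kap_one, D.lift_proj, uEval_k]
  · rw [Uq.kap_neg_one, D.lift_proj, uEval_kInv]

theorem UData.lift_psi (ε : ℤˣ) (i : Fin (m + n)) :
    PowerSeries.map (D.lift hm : Uq m n →+* B) (Uq.psi ε i) = ψ ε i := by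
  ext r
  rw [PowerSeries.coeff_map, Uq.coeff_psi, RingHom.coe_coe, map_smul, D.lift_proj, uEval_a]
  rcases eq_or_ne r 0 with rfl | hr
  · rw [D.log_zero, smul_zero, smul_zero]
  · rw [smul_smul, mul_inv_cancel₀ (aFactor_ne_zero i ε hr), one_smul]

/-- Homomorphisms from `U_q` are determined by their values in logarithmic form. -/
theorem Uq.algHom_ext {φ φ' : Uq m n →ₐ[K] B} (hc : φ (Uq.c m n) = φ' (Uq.c m n))
    (hk : ∀ ε i, φ (Uq.kap ε i) = φ' (Uq.kap ε i))
    (hp : ∀ ε i r, φ (coeff r (Uq.psi ε i)) = φ' (coeff r (Uq.psi ε i)))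
    (hx : ∀ ε i k, φ (Uq.x ε i k) = φ' (Uq.x ε i k)) : φ = φ' := by
  refine RingQuot.ringQuot_ext' K φ φ' (FreeAlgebra.hom_ext (funext fun y => ?_))
  change φ (Uq.proj m n (FreeAlgebra.ι K y)) = φ' (Uq.proj m n (FreeAlgebra.ι K y))
  cases y with
  | x ε i k => exact hx ε i k
  | a i r =>
    have h : Uq.proj m n (FreeAlgebra.ι K (.a i r)) =
        (aFactor i (sgnUnit r) (r : ℤ).natAbs)⁻¹ •
          coeff (r : ℤ).natAbs (Uq.psi (sgnUnit r) i) := by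
      rw [Uq.proj_eq_uEval, uEval_ι, uGenEval]
    rw [h, map_smul, map_smul, hp]
  | k i => exact Uq.kap_one i ▸ hk 1 i
  | kInv i => exact Uq.kap_neg_one i ▸ hk (-1) i
  | c => exact hc
  | cInv =>
    have h1 : φ (Uq.proj m n (FreeAlgebra.ι K .cInv)) * φ (Uq.c m n) = 1 := by
      rw [← map_mul, Uq.c, ← map_mul, Uq.proj_rel .cInv_c, map_one, map_one]
    have h2 : φ' (Uq.c m n) * φ' (Uq.proj m n (FreeAlgebra.ι K .cInv)) = 1 := by
      rw [← map_mul, Uq.c, ← map_mul, Uq.proj_rel .c_cInv, map_one, map_one]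
    exact left_inv_eq_right_inv h1 (hc ▸ h2)

end Lift

/-! ### Dilation -/

theorem dilate_pow (ε : ℤˣ) {u : K} (hu : u ≠ 0) (S : PowerSeries B) (r : ℕ) :
    dilate ε u (S ^ r) = dilate ε u S ^ r := by
  induction r with
  | zero =>
    ext p
    rw [pow_zero, pow_zero, coeff_dilate, PowerSeries.coeff_one]
    split_ifs with hp
    · rw [hp]; simp
    · rw [smul_zero]
  | succ r ih => rw [pow_succ, pow_succ, dilate_mul ε hu, ih]

/-- Rescaling the variable is multiplicative and commutes with taking coefficients of powers, hence
with the exponential. -/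
theorem expL_dilate (ε : ℤˣ) {u : K} (hu : u ≠ 0) (l : PowerSeries B) :
    expL (dilate ε u l) = dilate ε u (expL l) := by
  have h1 : (PowerSeries.mk fun r => ((r : ℕ) : K)⁻¹ • coeff r (dilate ε u l)) =
      dilate ε u (PowerSeries.mk fun r => ((r : ℕ) : K)⁻¹ • coeff r l) := by
    ext r
    rw [coeff_mk, coeff_dilate, coeff_dilate, coeff_mk, smul_comm]
  rw [expL, h1, expL]
  ext p
  rw [coeff_dilate, fExp, coeff_mk, fExp, coeff_mk, smul_sum]
  refine sum_congr rfl fun r _ => ?_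
  rw [← dilate_pow ε hu, coeff_dilate, smul_comm]

theorem dilate_C (ε : ℤˣ) (u : K) (b : B) : dilate ε u (C b) = C b := by
  ext p
  rw [coeff_dilate, PowerSeries.coeff_C]
  split_ifs with hp
  · rw [hp]; simp
  · rw [smul_zero]

theorem modes_dilate (ε : ℤˣ) (u : K) (S : PowerSeries B) (k : ℤ) :
    modes ε (dilate ε u S) k = u ^ k • modes ε S k := by
  rw [modes, modes]
  split_ifs with hk
  · rw [coeff_dilate]
    congr 2
    rcases Int.units_eq_one_or ε with rfl | rfl <;>
      simp only [Units.val_one, Units.val_neg, one_mul, neg_mul] at hk ⊢ <;> omega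
  · rw [smul_zero]

/-! ### Structure constants -/

theorem chiS_succ_sub (hm : 0 < m) (ε : ℤˣ) (i j : Fin (m + n)) (r : ℕ) :
    q ^ ((ε : ℤ) * (r : ℤ) * (nu n j - nu n i)) *
      (chiS m n ε i.succ j r - chiS m n ε i.castSucc j r) =
    -(q ^ ((ε : ℤ) * (r : ℤ) * form (root i) (root j)) -
      q ^ (-((ε : ℤ) * (r : ℤ) * form (root i) (root j)))) := by
  have h := chi_succ_sub_chi (t := q ^ ((ε : ℤ) * (r : ℤ))) (zpow_ne_zero _ q_ne_zero) hm i j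
  rw [← zpow_mul, ← zpow_mul, ← zpow_mul, mul_neg] at h
  exact h

theorem lamS_double_difference (hm : 0 < m) (ε : ℤˣ) (i j : Fin (m + n)) (r : ℕ) :
    q ^ ((ε : ℤ) * (r : ℤ) * (nu n j - nu n i)) *
      (lamS m n ε i.succ j.succ r - lamS m n ε i.castSucc j.succ r -
        (lamS m n ε i.succ j.castSucc r - lamS m n ε i.castSucc j.castSucc r)) =
    q ^ ((r : ℤ) * form (root i) (root j)) - q ^ (-((r : ℤ) * form (root i) (root j))) := by
  rcases Int.units_eq_one_or ε with rfl | rfl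
  · have h := lam_double_difference (t := q ^ (r : ℤ)) (zpow_ne_zero _ q_ne_zero) hm i j
    rw [← zpow_mul, ← zpow_mul, ← zpow_mul, mul_neg, zpow_natCast] at h
    simp only [lamS, if_true, Units.val_one, one_mul]
    exact h
  -- For ε = -1 the constants are those of the transposed pair, so the identity is used for (j, i)
  -- together with the symmetry of the form.
  · have h := lam_double_difference (t := q ^ (r : ℤ)) (zpow_ne_zero _ q_ne_zero) hm j i
    rw [← zpow_mul, ← zpow_mul, ← zpow_mul, mul_neg, zpow_natCast, form_root_comm j i] at h
    simp only [lamS, if_neg (show ¬(-1 : ℤˣ) = 1 by decide), Units.val_neg, Units.val_one]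
    rw [← h, show (-1 : ℤ) * (r : ℤ) * (nu n j - nu n i) = (r : ℤ) * (nu n i - nu n j) by ring]
    congr 1
    simp only [Fin.val_succ, Fin.val_castSucc]
    ring

/-! ### From `A_q` to `U_q` -/

/-- The scalar relating `x_i^s` and `X_i^{-s}`. -/
def xScale (s : ℤˣ) (i : Fin (m + n)) : K :=
  if s = 1 then (qNode i - (qNode i)⁻¹)⁻¹
  else -superSign (root i) (root i) * (qNode i - (qNode i)⁻¹)⁻¹

theorem xScale_ne_zero (s : ℤˣ) (i : Fin (m + n)) : xScale s i ≠ 0 := by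
  have h := inv_ne_zero (qNode_sub_inv_ne_zero i)
  rw [xScale]
  split_ifs
  · exact h
  · refine mul_ne_zero (neg_ne_zero.mpr fun h0 => ?_) h
    have := superSign_self_mul_self i
    rw [h0, zero_mul] at this
    exact zero_ne_one this

theorem xScale_mul (i : Fin (m + n)) : superSign (root i) (root i) *
    (xScale 1 i * xScale (-1) i) = -((qNode i - (qNode i)⁻¹)⁻¹ * (qNode i - (qNode i)⁻¹)⁻¹) := by
  rw [xScale, xScale, if_pos rfl, if_neg (by decide)]
  linear_combination (-((qNode i - (qNode i)⁻¹)⁻¹ * (qNode i - (qNode i)⁻¹)⁻¹)) *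
    superSign_self_mul_self i

theorem superSign_comm (x y : Wt m n) : superSign x y = superSign y x := by
  rw [superSign, superSign, mul_comm]

theorem superSign_mul_self (x y : Wt m n) : superSign x y * superSign x y = 1 := by
  rw [superSign]
  split_ifs <;> norm_num

/-- The super commutator of multiples, in the opposite order. -/
theorem sBr_smul_swap (α β : Wt m n) (a b : K) (x y : B) :
    (sBr ⟨α, a • x⟩ ⟨β, b • y⟩).val =
      (-(superSign α β * (a * b))) • (sBr ⟨β, y⟩ ⟨α, x⟩).val := by
  simp only [sBr, smul_mul_smul_comm, smul_sub, smul_smul]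
  rw [superSign_comm β α, mul_comm b a, neg_mul, mul_right_comm, superSign_mul_self, one_mul,
    neg_smul, neg_smul]
  abel

/-- The images of the constant terms of `Φ_i`. -/
def tauKap (h₀ : ℤˣ → Fin (m + n + 1) → B) (ε : ℤˣ) (i : Fin (m + n)) : B :=
  h₀ ε i.succ * h₀ (-ε) i.castSucc

/-- The images of the logarithmic derivatives of `Φ_i`. -/
def tauPsi (l : ℤˣ → Fin (m + n + 1) → PowerSeries B) (ε : ℤˣ) (i : Fin (m + n)) : PowerSeries B :=
  dilate ε (q ^ (-nu n i)) (l ε i.succ - l ε i.castSucc)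

/-- The images of the `x_i`. -/
def tauX (X : ℤˣ → Fin (m + n) → ℤ → B) (s : ℤˣ) (i : Fin (m + n)) (k : ℤ) : B :=
  (xScale s i * (q ^ (-nu n i)) ^ k) • X (-s) i k

theorem coeff_tauPsi (l : ℤˣ → Fin (m + n + 1) → PowerSeries B) (ε : ℤˣ) (i : Fin (m + n)) (r : ℕ) :
    coeff r (tauPsi l ε i) =
      (q ^ (-nu n i)) ^ ((ε : ℤ) * (r : ℤ)) • (coeff r (l ε i.succ) - coeff r (l ε i.castSucc)) := by
  rw [tauPsi, coeff_dilate, map_sub]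

theorem tau_Phi (h₀ : ℤˣ → Fin (m + n + 1) → B) (l : ℤˣ → Fin (m + n + 1) → PowerSeries B)
    (ε : ℤˣ) (i : Fin (m + n)) : C (tauKap h₀ ε i) * expL (tauPsi l ε i) =
      dilate ε (q ^ (-nu n i)) (hRat h₀ l ε i) := by
  have hu : q ^ (-nu n i) ≠ 0 := zpow_ne_zero _ q_ne_zero
  rw [hRat, dilate_mul ε hu, dilate_C, tauPsi, expL_dilate ε hu, tauKap]

/-- This is τ on the level of relations. Brackets of differences of logarithms have differences,
respectively double differences, of `chi` and `lam` as constants, and the dilation by q^{-ν_i}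
supplies the missing power of q. -/
theorem AData.uData (hm : 0 < m) {c : Bˣ} {h₀ : ℤˣ → Fin (m + n + 1) → B}
    {l : ℤˣ → Fin (m + n + 1) → PowerSeries B} {X : ℤˣ → Fin (m + n) → ℤ → B}
    (D : AData c h₀ l X) : UData c (tauKap h₀) (tauPsi l) (tauX X) where
  central := D.central
  zero ε i := by
    rw [tauKap, tauKap, neg_neg, mul_assoc, ← mul_assoc (h₀ (-ε) i.castSucc),
      (D.zero_zero (-ε) (-ε) i.castSucc i.succ).eq, mul_assoc (h₀ (-ε) i.succ),
      ← mul_assoc (h₀ ε i.succ), D.zero, one_mul]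
    simpa using D.zero (-ε) i.castSucc
  zero_zero ε ε' i j :=
    ((D.zero_zero ..).mul_left (D.zero_zero ..)).mul_right
      ((D.zero_zero ..).mul_left (D.zero_zero ..))
  zero_log ε ε' i j p := by
    rw [coeff_tauPsi]
    exact (((D.zero_log ..).mul_left (D.zero_log ..)).sub_right
      ((D.zero_log ..).mul_left (D.zero_log ..))).smul_right _
  log_zero ε i := by
    rw [coeff_tauPsi, D.log_zero, D.log_zero, sub_zero, smul_zero]
  log_log ε i j r s := by
    rw [coeff_tauPsi, coeff_tauPsi]
    exact ((((D.log_log ..).sub_left (D.log_log ..)).sub_right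
      ((D.log_log ..).sub_left (D.log_log ..))).smul_left _).smul_right _
  heis ε i j r s := by
    rw [coeff_tauPsi, coeff_tauPsi, smul_smul_commutator]
    have hdd : ∀ a a' b b' : B, (a - a') * (b - b') - (b - b') * (a - a') =
        (a * b - b * a) - (a' * b - b * a') - ((a * b' - b' * a) - (a' * b' - b' * a')) := by
      intro a a' b b'
      simp only [sub_mul, mul_sub]
      abel
    rw [hdd, D.heis, D.heis, D.heis, D.heis]
    by_cases hrs : r = s
    · subst hrs
      simp only [if_true]
      rw [← sub_smul, ← sub_smul, ← sub_smul, smul_smul, ← lamS_double_difference hm ε]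
      congr 1
      have : (q ^ (-nu n i)) ^ ((ε : ℤ) * (r : ℤ)) * (q ^ (-nu n j)) ^ (((-ε : ℤˣ) : ℤ) * (r : ℤ)) =
          q ^ ((ε : ℤ) * (r : ℤ) * (nu n j - nu n i)) := by
        rw [← zpow_mul, ← zpow_mul, ← zpow_add₀ q_ne_zero, Units.val_neg]
        congr 1; ring
      rw [this]; ring
    · simp only [if_neg hrs, sub_zero, smul_zero]
  zero_x s ε i j k := by
    rw [tauKap, tauX, mul_smul_comm, smul_mul_assoc, smul_comm (q ^ _), mul_assoc, D.zero_X,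
      mul_smul_comm, ← mul_assoc, D.zero_X, smul_mul_assoc, smul_smul, smul_smul, smul_smul,
      mul_assoc (X _ _ _), mul_assoc (xScale s j * _), ← zpow_add₀ q_ne_zero]
    congr 3
    rw [form_root_left]
    simp only [Units.val_neg, Fin.val_succ, Fin.val_castSucc]
    ring
  log_x s ε i j r k := by
    rw [coeff_tauPsi, tauX, smul_smul_commutator, tauX, mul_smul_comm, smul_smul]
    have hd : ∀ a a' b : B, (a - a') * b - b * (a - a') = (a * b - b * a) - (a' * b - b * a') := by
      intro a a' b
      simp only [sub_mul, mul_sub]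
      abel
    rw [hd, D.log_X, D.log_X, ← sub_smul, smul_smul]
    have h := chiS_succ_sub hm ε i j r
    have hq : ∀ z : ℤ, q ^ z ≠ 0 := fun z => zpow_ne_zero _ q_ne_zero
    have hu : (q ^ (-nu n i)) ^ ((ε : ℤ) * (r : ℤ)) =
        (q ^ (-nu n j)) ^ ((r : ℤ) * (ε : ℤ)) * q ^ ((ε : ℤ) * (r : ℤ) * (nu n j - nu n i)) := by
      rw [← zpow_mul, ← zpow_mul, ← zpow_add₀ q_ne_zero]
      congr 1; ring
    rw [Units.val_neg, neg_mul, zpow_add₀ (hq _), hu, Int.cast_neg]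
    congr 1
    linear_combination (-(q ^ (-nu n j)) ^ ((r : ℤ) * (ε : ℤ)) * xScale s j *
      (q ^ (-nu n j)) ^ k * ((s : ℤ) : K)) * h
  serre ε := (D.serre (-ε)).scale fun i k => xScale ε i * (q ^ (-nu n i)) ^ k
  quad ε := by
    have h := (D.quad (-ε)).scale (xScale ε)
    rw [neg_neg] at h
    simp only [smul_smul] at h
    exact h
  plus_minus i j k p := by
    have h1 := sBr_smul_swap (root i) (root j) (xScale 1 i * (q ^ (-nu n i)) ^ k)
      (xScale (-1) j * (q ^ (-nu n j)) ^ p) (X (-1) i k) (X 1 j p)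
    have h2 := D.plus_minus j i p k
    simp only [wtd] at h2 ⊢
    rw [tauX, tauX, neg_neg, h1, h2]
    by_cases hij : i = j
    · subst hij
      rw [if_pos rfl, if_pos rfl, tau_Phi, tau_Phi, modes_dilate, modes_dilate, mul_smul_comm,
        mul_smul_comm, ← smul_sub, smul_smul, smul_smul, add_comm p k,
        zpow_add₀ (zpow_ne_zero _ q_ne_zero)]
      congr 1
      -- Since x^+ and x^- go to multiples of X^- and X^+, the super commutator is reversed and
      -- acquires a sign -(-1)^{[α_i]}. The scalars `xScale` are normalised so that the total factor
      -- becomes (q_i - q_i⁻¹)⁻¹.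
      have h3 := xScale_mul i
      have h4 := mul_inv_cancel₀ (qNode_sub_inv_ne_zero i)
      generalize (qNode i - (qNode i)⁻¹)⁻¹ = b at h3 h4
      generalize qNode i - (qNode i)⁻¹ = β at h4
      linear_combination (-(q ^ (-nu n i)) ^ k * (q ^ (-nu n i)) ^ p * β) * h3 +
        ((q ^ (-nu n i)) ^ k * (q ^ (-nu n i)) ^ p * b) * h4
    · rw [if_neg hij, if_neg (Ne.symm hij), smul_zero]

/-! ### Weights of the central element -/

/-- The coefficients of the logarithmic derivative of `c^ε` in those of the `h_i^ε`. -/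
def wtS (m n : ℕ) (ε : ℤˣ) (i r : ℕ) : K := wt m n i (q ^ ((ε : ℤ) * (r : ℤ)))

theorem sum_wtS_ne_zero (m n : ℕ) (ε : ℤˣ) {r : ℕ} (hr : r ≠ 0) :
    ∑ i : Fin (m + n + 1), wtS m n ε i r ≠ 0 := by
  have hr' : (ε : ℤ) * (r : ℤ) ≠ 0 := by
    rcases Int.units_eq_one_or ε with rfl | rfl <;> simpa using hr
  have h := one_add_zeta_zpow_ne_zero m n hr'
  rw [zeta_zpow] at h
  rw [Fin.sum_univ_eq_sum_range fun i => wtS m n ε i r]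
  simp only [wtS]
  rw [sum_wt (zpow_ne_zero _ q_ne_zero)]
  exact h

theorem sum_wtS_mul_chiS (hm : 0 < m) (ε : ℤˣ) (j : Fin (m + n)) (r : ℕ) :
    ∑ i : Fin (m + n + 1), wtS m n ε i r * chiS m n ε i j r = 0 := by
  rw [Fin.sum_univ_eq_sum_range fun i => wtS m n ε i r * chiS m n ε i j r]
  exact sum_wt_mul_chi (zpow_ne_zero _ q_ne_zero) hm j.2

theorem one_add_zetaT_pow_ne_zero (m n : ℕ) {r : ℕ} (hr : r ≠ 0) : 1 + zetaT m n (q ^ r) ≠ 0 := by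
  have h := one_add_zeta_zpow_ne_zero m n (Int.natCast_ne_zero.mpr hr)
  rw [zeta_zpow, zpow_natCast q] at h
  exact h

theorem sum_wtS_mul_lamS (hm : 0 < m) (ε : ℤˣ) (j : Fin (m + n + 1)) {r : ℕ} (hr : r ≠ 0) :
    ∑ i : Fin (m + n + 1), wtS m n ε i r * lamS m n ε i j r = 0 := by
  rw [Fin.sum_univ_eq_sum_range fun i => wtS m n ε i r * lamS m n ε i j r]
  have hj : (j : ℕ) ≤ m + n := Nat.lt_succ_iff.mp j.2
  rcases Int.units_eq_one_or ε with rfl | rfl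
  · simp only [wtS, lamS, if_true, Units.val_one, one_mul, zpow_natCast]
    exact sum_wt_mul_lam (pow_ne_zero _ q_ne_zero) hm (one_add_zetaT_pow_ne_zero m n hr) hj
  · simp only [wtS, lamS, if_neg (show ¬(-1 : ℤˣ) = 1 by decide), Units.val_neg, Units.val_one,
      neg_mul, one_mul, zpow_neg, zpow_natCast]
    exact sum_wt_inv_mul_lam (pow_ne_zero _ q_ne_zero) hm (one_add_zetaT_pow_ne_zero m n hr) hj

theorem sum_wtS_neg_mul_lamS (hm : 0 < m) (ε : ℤˣ) (i : Fin (m + n + 1)) {r : ℕ} (hr : r ≠ 0) :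
    ∑ j : Fin (m + n + 1), wtS m n (-ε) j r * lamS m n ε i j r = 0 := by
  have h := sum_wtS_mul_lamS hm (-ε) i hr
  simpa only [lamS_neg] using h

/-- A family of vectors that is constant and has vanishing weighted sum vanishes. -/
theorem eq_zero_of_wtS {M : Type*} [AddCommGroup M] [Module K M] (ε : ℤˣ) {r : ℕ} (hr : r ≠ 0)
    {f : Fin (m + n + 1) → M} (h1 : ∀ i : Fin (m + n), f i.succ = f i.castSucc)
    (h2 : ∑ i : Fin (m + n + 1), wtS m n ε i r • f i = 0) (i : Fin (m + n + 1)) : f i = 0 := by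
  have h3 : ∀ i, f i = f 0 := by
    intro i
    induction i using Fin.induction with
    | zero => rfl
    | succ i ih => rw [h1, ih]
  simp only [h3] at h2 ⊢
  rw [← sum_smul (s := univ) (f := fun i : Fin (m + n + 1) => wtS m n ε i r)] at h2
  exact (smul_eq_zero.mp h2).resolve_left (sum_wtS_ne_zero m n ε hr)

/-! ### From `U_q` to `A_q` -/

theorem xScale_inv_mul (i : Fin (m + n)) :
    superSign (root i) (root i) * ((xScale (-1) i)⁻¹ * (xScale 1 i)⁻¹) =
      -((qNode i - (qNode i)⁻¹) * (qNode i - (qNode i)⁻¹)) := by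
  have hs : -superSign (root i) (root i) * -superSign (root i) (root i) = 1 := by
    rw [neg_mul_neg, superSign_mul_self]
  rw [xScale, xScale, if_pos rfl, if_neg (by decide), mul_inv, inv_inv,
    inv_eq_of_mul_eq_one_right hs]
  linear_combination (-((qNode i - (qNode i)⁻¹) * (qNode i - (qNode i)⁻¹))) *
    superSign_self_mul_self i

/-- The images of the `X_i`. -/
def sigX (x : ℤˣ → Fin (m + n) → ℤ → B) (s : ℤˣ) (i : Fin (m + n)) (k : ℤ) : B :=
  ((xScale (-s) i)⁻¹ * (q ^ nu n i) ^ k) • x (-s) i k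

/-- Constant terms and logarithms of the `h_i` that are compatible with values in logarithmic form
for `U_q`. -/
structure Extends (κ : ℤˣ → Fin (m + n) → B) (ψ : ℤˣ → Fin (m + n) → PowerSeries B)
    (h₀ : ℤˣ → Fin (m + n + 1) → B) (l : ℤˣ → Fin (m + n + 1) → PowerSeries B) : Prop where
  log_zero (ε : ℤˣ) (i : Fin (m + n + 1)) : coeff 0 (l ε i) = 0
  diff (ε : ℤˣ) (i : Fin (m + n)) (r : ℕ) : coeff r (l ε i.succ) - coeff r (l ε i.castSucc) =
    (q ^ nu n i) ^ ((ε : ℤ) * (r : ℤ)) • coeff r (ψ ε i)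
  sum (ε : ℤˣ) (r : ℕ) (b : B) : Commute (∑ i : Fin (m + n + 1), wtS m n ε i r • coeff r (l ε i)) b
  last_mul (ε : ℤˣ) : h₀ ε (Fin.last _) * h₀ (-ε) (Fin.last _) = 1
  last (ε : ℤˣ) (b : B) : Commute (h₀ ε (Fin.last _)) b
  castSucc (ε : ℤˣ) (i : Fin (m + n)) : h₀ ε i.castSucc = κ (-ε) i * h₀ ε i.succ

theorem smul_commutator_right (a : K) (x y : B) : x * a • y - a • y * x = a • (x * y - y * x) := by
  rw [smul_mul_assoc, mul_smul_comm, smul_sub]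

omit [Algebra K B] in
theorem commutator_sub (a a' b : B) :
    (a - a') * b - b * (a - a') = (a * b - b * a) - (a' * b - b * a') := by
  simp only [sub_mul, mul_sub]
  abel

theorem sum_smul_commutator {ι : Type*} (s : Finset ι) (w : ι → K) (f : ι → B) (b : B) :
    ∑ i ∈ s, w i • (f i * b - b * f i) =
      (∑ i ∈ s, w i • f i) * b - b * ∑ i ∈ s, w i • f i := by
  simp only [sum_mul, mul_sum, smul_sub, sum_sub_distrib, smul_mul_assoc, mul_smul_comm]

section Extends

variable {c : Bˣ} {κ : ℤˣ → Fin (m + n) → B} {ψ : ℤˣ → Fin (m + n) → PowerSeries B}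
  {x : ℤˣ → Fin (m + n) → ℤ → B} {h₀ : ℤˣ → Fin (m + n + 1) → B}
  {l : ℤˣ → Fin (m + n + 1) → PowerSeries B}

/-- Brackets with the logarithms of the `h_i` are determined by those with the logarithms of the
`Φ_i`. -/
theorem Extends.bracket_eq (E : Extends κ ψ h₀ l) (ε : ℤˣ) {r : ℕ} (hr : r ≠ 0) (b : B)
    {v : Fin (m + n + 1) → B}
    (h1 : ∀ i : Fin (m + n), v i.succ - v i.castSucc =
      (q ^ nu n i) ^ ((ε : ℤ) * (r : ℤ)) • (coeff r (ψ ε i) * b - b * coeff r (ψ ε i)))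
    (h2 : ∑ i : Fin (m + n + 1), wtS m n ε i r • v i = 0) (i : Fin (m + n + 1)) :
    coeff r (l ε i) * b - b * coeff r (l ε i) = v i := by
  rw [← sub_eq_zero]
  -- The difference of the two sides does not depend on i and has vanishing weighted sum, since the
  -- weighted sum of the logarithms is central.
  refine eq_zero_of_wtS ε hr
    (f := fun i => coeff r (l ε i) * b - b * coeff r (l ε i) - v i) (fun i => ?_) ?_ i
  · rw [← sub_eq_zero, sub_sub_sub_comm, h1, ← commutator_sub, E.diff, smul_commutator, sub_self]
  · simp only [smul_sub (_ : K) (_ - _) (v _), sum_sub_distrib]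
    rw [sum_smul_commutator, h2, sub_zero, sub_eq_zero]
    exact E.sum ε r b

/-- The case v = 0 of `Extends.bracket_eq`: to commute with the logarithms of all Φ_i is to commute
with those of all h_i. -/
theorem Extends.commute_log (E : Extends κ ψ h₀ l) {ε : ℤˣ} {r : ℕ} {b : B}
    (h : ∀ i, Commute (coeff r (ψ ε i)) b) (i : Fin (m + n + 1)) : Commute (coeff r (l ε i)) b := by
  rcases eq_or_ne r 0 with rfl | hr
  · rw [E.log_zero]; exact Commute.zero_left _
  · exact sub_eq_zero.mp (E.bracket_eq ε hr b (v := 0) (fun i => by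
      rw [(h i).eq, sub_self, smul_zero]; simp) (by simp) i)

/-- Downward from the central element h_{N+1,0}, each constant term arises from the next by a factor
κ. -/
theorem Extends.commute_zero (E : Extends κ ψ h₀ l) {ε : ℤˣ} {b : B}
    (h : ∀ i, Commute (κ (-ε) i) b) (i : Fin (m + n + 1)) : Commute (h₀ ε i) b := by
  induction i using Fin.reverseInduction with
  | last => exact E.last ε b
  | cast i ih => rw [E.castSucc]; exact (h i).mul_left ih

theorem Extends.zero_mul (hκ : ∀ ε i, κ ε i * κ (-ε) i = 1)
    (E : Extends κ ψ h₀ l) (hc : ∀ ε i ε' j, Commute (h₀ ε i) (κ ε' j)) (ε : ℤˣ)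
    (i : Fin (m + n + 1)) : h₀ ε i * h₀ (-ε) i = 1 := by
  induction i using Fin.reverseInduction with
  | last => exact E.last_mul ε
  | cast i ih =>
    rw [E.castSucc, E.castSucc, neg_neg, mul_assoc, ← mul_assoc (h₀ ε i.succ), (hc ε _ ε i).eq,
      mul_assoc (κ ε i), ih, mul_one]
    simpa using hκ (-ε) i

theorem Extends.hRat_eq (hκ : ∀ ε i, κ ε i * κ (-ε) i = 1)
    (E : Extends κ ψ h₀ l) (hc : ∀ ε i ε' j, Commute (h₀ ε i) (κ ε' j)) (ε : ℤˣ) (i : Fin (m + n)) :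
    hRat h₀ l ε i = dilate ε (q ^ nu n i) (C (κ ε i) * expL (ψ ε i)) := by
  have hu : q ^ nu n i ≠ 0 := zpow_ne_zero _ q_ne_zero
  have h1 : l ε i.succ - l ε i.castSucc = dilate ε (q ^ nu n i) (ψ ε i) := by
    ext r
    rw [map_sub, E.diff, coeff_dilate]
  rw [hRat, h1, expL_dilate ε hu, dilate_mul ε hu, dilate_C, E.castSucc, neg_neg, ← mul_assoc,
    (hc ε _ ε i).eq, mul_assoc (κ ε i), E.zero_mul hκ hc, mul_one]

/-- Values in logarithmic form for `U_q` and compatible ones for the `h_i` give values in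
logarithmic form for `A_q`. -/
theorem UData.aData (hm : 0 < m) (D : UData c κ ψ x) (E : Extends κ ψ h₀ l) :
    AData c h₀ l (sigX x) := by
  have hκ : ∀ ε i ε' j, Commute (h₀ ε i) (κ ε' j) := fun ε i ε' j =>
    E.commute_zero (fun i' => D.zero_zero (-ε) ε' i' j) i
  have hzl : ∀ ε ε' i j p, Commute (h₀ ε i) (coeff p (l ε' j)) := fun ε ε' i j p =>
    E.commute_zero (fun i' => (E.commute_log (fun j' => (D.zero_log (-ε) ε' i' j' p).symm) j).symm) i
  refine
    { central := D.central
      zero := E.zero_mul D.zero hκ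
      zero_zero := fun ε ε' i j => (E.commute_zero (fun j' => (hκ ε i (-ε') j').symm) j).symm
      zero_log := hzl
      log_zero := E.log_zero
      log_log := fun ε i j r s => ?_
      heis := fun ε i j r s => ?_
      zero_X := fun s ε i j k => ?_
      log_X := fun s ε i j r k => ?_
      serre := fun ε => (D.serre (-ε)).scale fun i k => (xScale (-ε) i)⁻¹ * (q ^ nu n i) ^ k
      quad := fun ε => ?_
      plus_minus := fun i j k p => ?_ }
  · exact E.commute_log (fun i' => (E.commute_log (fun j' => D.log_log ε j' i' s r) j).symm) i
  · rcases eq_or_ne r 0 with rfl | hr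
    · rw [E.log_zero]; simp
    rcases eq_or_ne s 0 with rfl | hs
    · rw [E.log_zero]; simp [hr]
    set V : Fin (m + n + 1) → Fin (m + n + 1) → B := fun i j =>
      if r = s then (((ε : ℤ) : K) * (r : K) * lamS m n ε i j r) •
        (((c ^ (-2 * (r : ℤ)) : Bˣ) : B) - ((c ^ (2 * (r : ℤ)) : Bˣ) : B)) else 0 with hV
    have hVc : ∀ (a : K) (w : Fin (m + n + 1) → K) (μ : Fin (m + n + 1) → K) (Z : B),
        ∑ i, w i • (if r = s then (a * μ i) • Z else 0) =
          if r = s then (a * ∑ i, w i * μ i) • Z else 0 := by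
      intro a w μ Z
      split_ifs
      · rw [mul_sum, sum_smul]
        exact sum_congr rfl fun i _ => by rw [smul_smul]; congr 1; ring
      · simp
    -- The bracket of two logarithms is determined in two rounds: the differences in i need the
    -- brackets of ψ_i with l_j, and these are found in the same way from the differences in j. The
    -- vanishing weighted sums of `lam` in its rows and columns provide the normalisation in both
    -- rounds.
    refine E.bracket_eq ε hr (coeff s (l (-ε) j)) (v := fun i => V i j) (fun i => ?_) ?_ i
    · have key := E.bracket_eq (-ε) hs (coeff r (ψ ε i))
        (v := fun j => -((q ^ nu n i) ^ (-((ε : ℤ) * (r : ℤ))) • (V i.succ j - V i.castSucc j)))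
        (fun j' => ?_) ?_ j
      · rw [← neg_sub (coeff s (l (-ε) j) * coeff r (ψ ε i)), key, neg_neg, smul_smul, ← zpow_add₀ (zpow_ne_zero _ q_ne_zero),
          add_neg_cancel, zpow_zero, one_smul]
      · rw [← neg_sub (coeff r (ψ ε i) * coeff s (ψ (-ε) j')), D.heis, neg_sub_neg, ← neg_sub,
          ← smul_sub, smul_neg]
        congr 1
        simp only [hV]
        by_cases hrs : r = s
        · subst hrs
          simp only [if_true]
          rw [← sub_smul, ← sub_smul, ← sub_smul, smul_smul, smul_smul,
            ← lamS_double_difference hm ε i j' r, ← mul_sub, ← mul_sub, ← mul_sub]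
          congr 1
          have : (q ^ nu n j') ^ (((-ε : ℤˣ) : ℤ) * (r : ℤ)) *
              q ^ ((ε : ℤ) * (r : ℤ) * (nu n j' - nu n i)) =
              (q ^ nu n i) ^ (-((ε : ℤ) * (r : ℤ))) := by
            rw [← zpow_mul, ← zpow_mul, ← zpow_add₀ q_ne_zero, Units.val_neg]
            congr 1; ring
          rw [← this]; ring
        · simp only [if_neg hrs, sub_zero, smul_zero]
      · simp only [smul_neg, sum_neg_distrib, smul_sub, sum_sub_distrib, smul_comm (wtS _ _ _ _ _)]
        rw [← smul_sum, ← smul_sum, hV]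
        by_cases hrs : r = s
        · subst hrs
          rw [hVc _ _ (fun j => lamS m n ε _ j r), hVc _ _ (fun j => lamS m n ε _ j r),
            sum_wtS_neg_mul_lamS hm ε _ hr, sum_wtS_neg_mul_lamS hm ε _ hr]
          simp
        · simp [hrs]
    · simp only [hV]
      rw [hVc _ _ (fun i => lamS m n ε i j r), sum_wtS_mul_lamS hm ε j hr]
      simp
  · rw [sigX, mul_smul_comm, smul_mul_assoc, smul_comm (q ^ _)]
    congr 1
    -- At N + 1 the constant term is central and the vector is zero; each step down adds α_i,
    -- because ε_i = ε_{i+1} + α_i.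
    induction i using Fin.reverseInduction with
    | last =>
      rw [Fin.val_last, form_eps_last, mul_zero, zpow_zero, one_smul]
      exact E.last ε _
    | cast i ih =>
      rw [E.castSucc, mul_assoc, ih, mul_smul_comm, ← mul_assoc, D.zero_x, smul_mul_assoc,
        smul_smul, ← zpow_add₀ q_ne_zero, mul_assoc (x _ _ _)]
      congr 2
      rw [form_root_left]
      simp only [Units.val_neg, Fin.val_succ, Fin.val_castSucc]
      ring
  · rcases eq_or_ne r 0 with rfl | hr
    · rw [E.log_zero, chiS, chi]; simp
    refine E.bracket_eq ε hr (sigX x s j k)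
      (v := fun i => (((s : ℤ) : K) * chiS m n ε i j r) •
        (((c ^ ((s : ℤ) * (r : ℤ)) : Bˣ) : B) * sigX x s j (k + (r : ℤ) * ε)))
      (fun i => ?_) ?_ i
    · rw [sigX, sigX, mul_smul_comm, smul_commutator_right, D.log_x, smul_smul, smul_smul, smul_smul,
        smul_smul, ← sub_smul]
      have h := chiS_succ_sub hm ε i j r
      have hu : (q ^ nu n i) ^ ((ε : ℤ) * (r : ℤ)) * q ^ ((ε : ℤ) * (r : ℤ) * (nu n j - nu n i)) =
          (q ^ nu n j) ^ ((r : ℤ) * (ε : ℤ)) := by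
        rw [← zpow_mul, ← zpow_mul, ← zpow_add₀ q_ne_zero]
        congr 1; ring
      rw [Units.val_neg, neg_mul, neg_neg, zpow_add₀ (zpow_ne_zero _ q_ne_zero), ← hu, Int.cast_neg]
      congr 1
      linear_combination ((q ^ nu n i) ^ ((ε : ℤ) * (r : ℤ)) * (xScale (-s) j)⁻¹ *
        (q ^ nu n j) ^ k * ((s : ℤ) : K)) * h
    · simp only [smul_smul, ← sum_smul]
      simp only [mul_left_comm _ ((s : ℤ) : K), ← mul_sum]
      rw [sum_wtS_mul_chiS hm ε j r, mul_zero, zero_smul]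
  -- The powers of q^{ν_i} and q^{-ν_i} cancel and leave a rescaling that does not depend on the
  -- mode.
  · have h := (D.quad (-ε)).scale fun i => (xScale (-ε) i)⁻¹
    convert h using 3 with i k
    rw [sigX, smul_smul, mul_left_comm, ← mul_zpow, ← zpow_add₀ q_ne_zero, neg_add_cancel,
      zpow_zero, one_zpow, mul_one]
  · have h1 := sBr_smul_swap (root i) (root j) ((xScale (-1) i)⁻¹ * (q ^ nu n i) ^ k)
      ((xScale 1 j)⁻¹ * (q ^ nu n j) ^ p) (x (-1) i k) (x 1 j p)
    have h2 := D.plus_minus j i p k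
    simp only [wtd] at h2 ⊢
    rw [sigX, sigX, neg_neg, h1, h2]
    by_cases hij : i = j
    · subst hij
      rw [if_pos rfl, if_pos rfl, E.hRat_eq D.zero hκ, E.hRat_eq D.zero hκ, modes_dilate,
        modes_dilate, mul_smul_comm,
        mul_smul_comm, ← smul_sub, smul_smul, smul_smul, add_comm p k,
        zpow_add₀ (zpow_ne_zero _ q_ne_zero)]
      congr 1
      have h3 := xScale_inv_mul i
      have h4 := mul_inv_cancel₀ (qNode_sub_inv_ne_zero i)
      generalize (qNode i - (qNode i)⁻¹)⁻¹ = b at h3 h4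
      generalize qNode i - (qNode i)⁻¹ = β at h3 h4
      linear_combination (-(q ^ nu n i) ^ k * (q ^ nu n i) ^ p * b) * h3 +
        ((q ^ nu n i) ^ k * (q ^ nu n i) ^ p * β) * h4
    · rw [if_neg hij, if_neg (Ne.symm hij), smul_zero]

end Extends

/-! ### A free commutative algebra -/

/-- The commutative algebra freely generated by an invertible element and by elements indexed by
a sign and a positive integer. -/
abbrev ZRing : Type := LaurentPolynomial (MvPolynomial (ℤˣ × ℕ) K)

/-- The invertible generator and its inverse. -/
def zT (ε : ℤˣ) : ZRing := LaurentPolynomial.T (ε : ℤ)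

/-- The other generators; the one of degree zero is zero. -/
def zG (ε : ℤˣ) : ℕ → ZRing
  | 0 => 0
  | p + 1 => LaurentPolynomial.C (MvPolynomial.X (ε, p))

theorem zT_mul (ε : ℤˣ) : zT ε * zT (-ε) = 1 := by
  rw [zT, zT, ← LaurentPolynomial.T_add, Units.val_neg, add_neg_cancel, LaurentPolynomial.T_zero]

/-- Central elements that satisfy the relations of the generators of `ZRing`. -/
structure CentralData (t : ℤˣ → B) (g : ℤˣ → ℕ → B) : Prop where
  mul (ε : ℤˣ) : t ε * t (-ε) = 1
  comm_t (ε : ℤˣ) (b : B) : Commute (t ε) b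
  comm_g (ε : ℤˣ) (r : ℕ) (b : B) : Commute (g ε r) b
  zero (ε : ℤˣ) : g ε 0 = 0

section CentralData

variable {t : ℤˣ → B} {g : ℤˣ → ℕ → B} (Z : CentralData t g)

theorem mem_center_of_commute {x : B} (h : ∀ b, Commute x b) : x ∈ Subalgebra.center K B :=
  Subalgebra.mem_center_iff.mpr fun b => (h b).eq.symm

/-- The invertible central element as a unit of the centre. -/
def CentralData.unit : (Subalgebra.center K B)ˣ where
  val := ⟨t 1, mem_center_of_commute (Z.comm_t 1)⟩
  inv := ⟨t (-1), mem_center_of_commute (Z.comm_t (-1))⟩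
  val_inv := Subtype.ext (Z.mul 1)
  inv_val := Subtype.ext (by simpa using Z.mul (-1))

/-- The homomorphism from polynomials to the centre. -/
def CentralData.polyHom : MvPolynomial (ℤˣ × ℕ) K →ₐ[K] Subalgebra.center K B :=
  -- The variable with index p stands for the element of degree p + 1, as degree 0 is not free.
  MvPolynomial.aeval fun s => ⟨g s.1 (s.2 + 1), mem_center_of_commute (Z.comm_g s.1 (s.2 + 1))⟩

/-- The homomorphism with given central values on the generators. -/
def CentralData.hom : ZRing →ₐ[K] B :=
  -- The evaluation is carried out in the centre, which is commutative.
  (Subalgebra.center K B).val.comp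
    { LaurentPolynomial.eval₂ (Z.polyHom : _ →+* Subalgebra.center K B) Z.unit with
      commutes' := fun r => by
        change LaurentPolynomial.eval₂ _ _ (LaurentPolynomial.C (MvPolynomial.C r)) = _
        rw [LaurentPolynomial.eval₂_C]
        exact Z.polyHom.commutes r }

theorem CentralData.hom_apply (z : ZRing) : Z.hom z =
    (LaurentPolynomial.eval₂ (Z.polyHom : _ →+* Subalgebra.center K B) Z.unit z : B) := rfl

theorem CentralData.hom_comm (z : ZRing) (b : B) : Commute (Z.hom z) b := by
  rw [Z.hom_apply]
  exact (Subalgebra.mem_center_iff.mp (Subtype.prop _) b).symm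

theorem CentralData.hom_zT (ε : ℤˣ) : Z.hom (zT ε) = t ε := by
  rw [Z.hom_apply, zT, LaurentPolynomial.eval₂_T]
  rcases Int.units_eq_one_or ε with rfl | rfl
  · rw [Units.val_one, zpow_one]; rfl
  · rw [Units.val_neg, Units.val_one, zpow_neg_one]; rfl

theorem CentralData.hom_zG (ε : ℤˣ) (r : ℕ) : Z.hom (zG ε r) = g ε r := by
  cases r with
  | zero => rw [zG, map_zero, Z.zero]
  | succ r =>
    rw [Z.hom_apply, zG, LaurentPolynomial.eval₂_C]
    change ((Z.polyHom (MvPolynomial.X (ε, r)) : Subalgebra.center K B) : B) = _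
    rw [CentralData.polyHom, MvPolynomial.aeval_X]

end CentralData

theorem ZRing.algHom_ext {φ φ' : ZRing →ₐ[K] B} (ht : ∀ ε, φ (zT ε) = φ' (zT ε))
    (hg : ∀ ε r, φ (zG ε r) = φ' (zG ε r)) : φ = φ' := by
  let ι : MvPolynomial (ℤˣ × ℕ) K →ₐ[K] ZRing :=
    { (LaurentPolynomial.C : MvPolynomial (ℤˣ × ℕ) K →+* ZRing) with commutes' := fun _ => rfl }
  have hC : φ.comp ι = φ'.comp ι := MvPolynomial.algHom_ext fun s => hg s.1 (s.2 + 1)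
  have h1 := ht 1
  have h2 := ht (-1)
  rw [zT, Units.val_one] at h1
  rw [zT, Units.val_neg, Units.val_one] at h2
  refine AlgHom.ext fun z => ?_
  induction z using LaurentPolynomial.induction_on with
  | h_C a => exact DFunLike.congr_fun hC a
  | h_add hp hq => rw [map_add, map_add, hp, hq]
  | h_C_mul_T r a ih =>
    rw [LaurentPolynomial.T_add, ← mul_assoc, map_mul φ (_ * _), map_mul φ' (_ * _), ih, h1]
  | h_C_mul_T_Z r a ih =>
    rw [LaurentPolynomial.T_sub, ← mul_assoc, map_mul φ (_ * _), map_mul φ' (_ * _), ih, h2]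

/-- The squaring of the invertible generator is injective. -/
theorem exists_squaring : ∃ φ : ZRing →ₐ[K] ZRing, Function.Injective φ ∧
    (∀ ε, φ (zT ε) = zT ε ^ 2) ∧ ∀ ε r, φ (zG ε r) = zG ε r := by
  refine ⟨AddMonoidAlgebra.mapDomainAlgHom K (MvPolynomial (ℤˣ × ℕ) K)
    (AddMonoidHom.mulLeft (2 : ℤ)), ?_, fun ε => ?_, fun ε r => ?_⟩
  · exact AddMonoidAlgebra.mapDomain_injective fun a b h => by
      have : 2 * a = 2 * b := h
      omega
  · rw [zT, LaurentPolynomial.T_pow]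
    exact AddMonoidAlgebra.mapDomain_single
  · cases r with
    | zero => rw [zG, map_zero]
    | succ r => exact AddMonoidAlgebra.mapDomain_single

/-! ### Construction of the `h_i` -/

/-- The partial sums of the logarithms of the `Φ_i`. -/
def preLog (ψ : ℤˣ → Fin (m + n) → PowerSeries B) (ε : ℤˣ) (r : ℕ) (i : Fin (m + n + 1)) : B :=
  ∑ j : Fin (m + n), if (j : ℕ) < i then (q ^ nu n j) ^ ((ε : ℤ) * (r : ℤ)) • coeff r (ψ ε j) else 0

theorem preLog_succ (ψ : ℤˣ → Fin (m + n) → PowerSeries B) (ε : ℤˣ) (r : ℕ) (i : Fin (m + n)) :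
    preLog ψ ε r i.succ - preLog ψ ε r i.castSucc =
      (q ^ nu n i) ^ ((ε : ℤ) * (r : ℤ)) • coeff r (ψ ε i) := by
  rw [preLog, preLog, ← sum_sub_distrib, sum_eq_single i]
  · simp
  · intro j _ hj
    have hj' : (j : ℕ) ≠ i := fun h => hj (Fin.ext h)
    rw [Fin.val_succ, Fin.val_castSucc]
    by_cases h : (j : ℕ) < i
    · rw [if_pos h, if_pos (by omega), sub_self]
    · rw [if_neg h, if_neg (by omega), sub_self]
  · simp

/-- The logarithms of the `h_i`. -/
def extLog (ψ : ℤˣ → Fin (m + n) → PowerSeries B) (g : ℤˣ → ℕ → B) (ε : ℤˣ)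
    (i : Fin (m + n + 1)) : PowerSeries B :=
  -- The first summand does not depend on i, so the differences are those of `preLog`; its value is
  -- solved from the requirement that the weighted sum be g.
  PowerSeries.mk fun r => (∑ j : Fin (m + n + 1), wtS m n ε j r)⁻¹ •
    (g ε r - ∑ j : Fin (m + n + 1), wtS m n ε j r • preLog ψ ε r j) + preLog ψ ε r i

theorem extLog_succ (ψ : ℤˣ → Fin (m + n) → PowerSeries B) (g : ℤˣ → ℕ → B) (ε : ℤˣ)
    (i : Fin (m + n)) (r : ℕ) :
    coeff r (extLog ψ g ε i.succ) - coeff r (extLog ψ g ε i.castSucc) =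
      (q ^ nu n i) ^ ((ε : ℤ) * (r : ℤ)) • coeff r (ψ ε i) := by
  rw [extLog, extLog, coeff_mk, coeff_mk, add_sub_add_left_eq_sub, preLog_succ]

/-- The weighted sum of the logarithms of the `h_i`. -/
def wtLog (l : ℤˣ → Fin (m + n + 1) → PowerSeries B) (ε : ℤˣ) (r : ℕ) : B :=
  ∑ i : Fin (m + n + 1), wtS m n ε i r • coeff r (l ε i)

theorem wtLog_extLog (ψ : ℤˣ → Fin (m + n) → PowerSeries B) (g : ℤˣ → ℕ → B) (ε : ℤˣ) {r : ℕ}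
    (hr : r ≠ 0) : wtLog (extLog ψ g) ε r = g ε r := by
  rw [wtLog]
  simp only [extLog, coeff_mk, smul_add, sum_add_distrib]
  rw [← sum_smul, smul_smul, mul_inv_cancel₀ (sum_wtS_ne_zero m n ε hr), one_smul, sub_add_cancel]

theorem coeff_zero_extLog (ψ : ℤˣ → Fin (m + n) → PowerSeries B) (hψ : ∀ ε i, coeff 0 (ψ ε i) = 0)
    (g : ℤˣ → ℕ → B) (hg : ∀ ε, g ε 0 = 0) (ε : ℤˣ) (i : Fin (m + n + 1)) :
    coeff 0 (extLog ψ g ε i) = 0 := by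
  have h : ∀ i, preLog ψ ε 0 i = 0 := fun i => sum_eq_zero fun j _ => by rw [hψ, smul_zero, ite_self]
  rw [extLog, coeff_mk]
  simp only [h, hg, smul_zero, sum_const_zero, sub_zero, add_zero]

/-- The constant terms of the `h_i`. -/
def extZero (κ : ℤˣ → Fin (m + n) → B) (t : ℤˣ → B) (ε : ℤˣ) (i : Fin (m + n + 1)) : B :=
  Fin.reverseInduction (motive := fun _ => B) (t ε) (fun i b => κ (-ε) i * b) i

omit [Algebra K B] in
theorem extZero_last (κ : ℤˣ → Fin (m + n) → B) (t : ℤˣ → B) (ε : ℤˣ) :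
    extZero κ t ε (Fin.last _) = t ε := Fin.reverseInduction_last ..

omit [Algebra K B] in
theorem extZero_castSucc (κ : ℤˣ → Fin (m + n) → B) (t : ℤˣ → B) (ε : ℤˣ) (i : Fin (m + n)) :
    extZero κ t ε i.castSucc = κ (-ε) i * extZero κ t ε i.succ := Fin.reverseInduction_castSucc ..

/-- Any central elements may be prescribed as the constant term of h_{N+1} and as the weighted sum
of the logarithms; this freedom is what the second tensor factor accounts for. -/
theorem extends_ext {κ : ℤˣ → Fin (m + n) → B} {ψ : ℤˣ → Fin (m + n) → PowerSeries B}
    (hψ : ∀ ε i, coeff 0 (ψ ε i) = 0) {t : ℤˣ → B} {g : ℤˣ → ℕ → B} (Z : CentralData t g) :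
    Extends κ ψ (extZero κ t) (extLog ψ g) where
  log_zero := coeff_zero_extLog ψ hψ g Z.zero
  diff := extLog_succ ψ g
  sum ε r b := by
    rcases eq_or_ne r 0 with rfl | hr
    · simp only [coeff_zero_extLog ψ hψ g Z.zero, smul_zero, sum_const_zero]
      exact Commute.zero_left b
    · have := wtLog_extLog ψ g ε hr
      rw [wtLog] at this
      rw [this]
      exact Z.comm_g ε r b
  last_mul ε := by rw [extZero_last, extZero_last, Z.mul]
  last ε b := by rw [extZero_last]; exact Z.comm_t ε b
  castSucc := extZero_castSucc κ t

/-- The logarithms of the `h_i` are determined by their differences and their weighted sum. -/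
theorem log_unique {l l' : ℤˣ → Fin (m + n + 1) → PowerSeries B}
    (h0 : ∀ ε i, coeff 0 (l ε i) = 0) (h0' : ∀ ε i, coeff 0 (l' ε i) = 0)
    (hd : ∀ ε (i : Fin (m + n)) r, coeff r (l ε i.succ) - coeff r (l ε i.castSucc) =
      coeff r (l' ε i.succ) - coeff r (l' ε i.castSucc))
    (hs : ∀ ε r, r ≠ 0 → wtLog l ε r = wtLog l' ε r) (ε : ℤˣ) (i : Fin (m + n + 1)) :
    l ε i = l' ε i := by
  ext r
  rcases eq_or_ne r 0 with rfl | hr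
  · rw [h0, h0']
  rw [← sub_eq_zero]
  refine eq_zero_of_wtS ε hr (f := fun i => coeff r (l ε i) - coeff r (l' ε i)) (fun i => ?_) ?_ i
  · rw [← sub_eq_zero, sub_sub_sub_comm, hd ε i r, sub_self]
  · have := hs ε r hr
    simp only [smul_sub, sum_sub_distrib]
    rw [sub_eq_zero]
    exact this

omit [Algebra K B] in
theorem zero_unique {κ : ℤˣ → Fin (m + n) → B} {h₀ h₀' : ℤˣ → Fin (m + n + 1) → B}
    (h : ∀ ε (i : Fin (m + n)), h₀ ε i.castSucc = κ (-ε) i * h₀ ε i.succ)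
    (h' : ∀ ε (i : Fin (m + n)), h₀' ε i.castSucc = κ (-ε) i * h₀' ε i.succ)
    (hl : ∀ ε, h₀ ε (Fin.last _) = h₀' ε (Fin.last _)) (ε : ℤˣ) (i : Fin (m + n + 1)) :
    h₀ ε i = h₀' ε i := by
  induction i using Fin.reverseInduction with
  | last => exact hl ε
  | cast i ih => rw [h, h', ih]

/-! ### Central elements of `A_q` -/

section HRel

variable {c : Bˣ} {h₀ : ℤˣ → Fin (m + n + 1) → B} {l : ℤˣ → Fin (m + n + 1) → PowerSeries B}
  {X : ℤˣ → Fin (m + n) → ℤ → B} (H : HRel c h₀ l X)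
include H

theorem HRel.wtLog_zero (ε : ℤˣ) : wtLog l ε 0 = 0 :=
  sum_eq_zero fun i _ => by rw [H.log_zero, smul_zero]

theorem HRel.commute_wtLog_zero (ε ε' : ℤˣ) (r : ℕ) (i : Fin (m + n + 1)) :
    Commute (wtLog l ε r) (h₀ ε' i) :=
  Commute.sum_left _ _ _ fun j _ => (H.zero_log ε' ε i j r).symm.smul_left _

/-- Logarithms of equal sign commute anyway. For opposite signs the bracket is a multiple of ∑_j w_j
λ_{ji}, which is zero. -/
theorem HRel.commute_wtLog_log (hm : 0 < m) (ε ε' : ℤˣ) (r s : ℕ) (i : Fin (m + n + 1)) :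
    Commute (wtLog l ε r) (coeff s (l ε' i)) := by
  rcases eq_or_ne r 0 with rfl | hr
  · rw [H.wtLog_zero]; exact Commute.zero_left _
  rcases eq_or_ne ε' ε with rfl | he
  · exact Commute.sum_left _ _ _ fun j _ => (H.log_log ..).smul_left _
  · obtain rfl := Int.units_ne_iff_eq_neg.mp he
    rw [Commute, SemiconjBy, ← sub_eq_zero, wtLog, ← sum_smul_commutator]
    simp only [H.heis]
    split_ifs with hrs
    · simp only [smul_smul, ← sum_smul, mul_left_comm (wtS _ _ _ _ _), ← mul_sum]
      rw [sum_wtS_mul_lamS hm ε i hr, mul_zero, zero_smul]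
    · simp

theorem HRel.commute_wtLog_X (hm : 0 < m) (ε s : ℤˣ) (r : ℕ) (j : Fin (m + n)) (k : ℤ) :
    Commute (wtLog l ε r) (X s j k) := by
  rw [Commute, SemiconjBy, ← sub_eq_zero, wtLog, ← sum_smul_commutator]
  simp only [H.log_X]
  simp only [smul_smul, ← sum_smul, mul_left_comm (wtS _ _ _ _ _), ← mul_sum]
  rw [sum_wtS_mul_chiS hm ε j r, mul_zero, zero_smul]

end HRel

namespace Aq

theorem commute_of_generators {b : Aq m n} (hh : ∀ ε i p, Commute b (coeff p (h ε i)))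
    (hX : ∀ ε i k, Commute b (X ε i k)) (a : Aq m n) : Commute b a := by
  induction a using Aq.induction with
  | hK r => exact (Algebra.commutes r _).symm
  | hg y =>
    cases y with
    | h ε i p =>
      have := hh ε i p
      rwa [h, coeff_mk] at this
    | X ε i k => exact hX ε i k
    | c => exact (c_central b).symm
    | cInv => exact (c_central b).symm.units_inv_right
  | hmul a b ha hb => exact ha.mul_right hb
  | hadd a b ha hb => exact ha.add_right hb

/-- The weighted sums commute with the h_i and the X_j by the vanishing of ∑ w_i λ_{ij} and ∑ w_i
χ_{ij}. The constant term of h_{N+1} is central since it commutes with the h_i and ε_{N+1} = 0. -/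
theorem centralData (hm : 0 < m) :
    CentralData (fun ε => hZero ε (Fin.last (m + n))) (wtLog (m := m) (n := n) logH) where
  mul ε := hRel.zero ε _
  comm_t ε := commute_of_generators
    (fun ε' i p => by
      rw [← hSer_hZero]
      exact commute_coeff_hSer (hRel.zero_zero ..) (fun _ => hRel.zero_log ..) p)
    (fun s j k => by
      have := hRel.zero_X s ε (Fin.last (m + n)) j k
      rwa [Fin.val_last, form_eps_last, mul_zero, zpow_zero, one_smul] at this)
  comm_g ε r := commute_of_generators
    (fun ε' i p => by
      rw [← hSer_hZero]
      exact commute_coeff_hSer (hRel.commute_wtLog_zero ε ε' r i)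
        (fun s => hRel.commute_wtLog_log hm ε ε' r s i) p)
    (fun s j k => hRel.commute_wtLog_X hm ε s r j k)
  zero := hRel.wtLog_zero

theorem diff_logH (ε : ℤˣ) (i : Fin (m + n)) (r : ℕ) :
    coeff r (logH ε i.succ) - coeff r (logH ε i.castSucc) =
      (q ^ nu n i) ^ ((ε : ℤ) * (r : ℤ)) • (coeff r (tauPsi logH ε i) : Aq m n) := by
  rw [coeff_tauPsi, smul_smul, ← mul_zpow, ← zpow_add₀ q_ne_zero, add_neg_cancel, zpow_zero,
    one_zpow, one_smul]

theorem hZero_castSucc (ε : ℤˣ) (i : Fin (m + n)) :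
    (hZero ε i.castSucc : Aq m n) = tauKap hZero (-ε) i * hZero ε i.succ := by
  have h1 : (hZero (-ε) i.succ * hZero ε i.succ : Aq m n) = 1 := by
    simpa using hRel.zero (-ε) i.succ
  rw [tauKap, neg_neg, mul_assoc, (hRel.zero_zero ε ε i.castSucc i.succ).eq, ← mul_assoc, h1,
    one_mul]

end Aq

/-! ### Images of values in logarithmic form -/

theorem val_units_map_zpow (φ : B →ₐ[K] A) (c : Bˣ) (k : ℤ) :
    (((Units.map (φ : B →* A) c) ^ k : Aˣ) : A) = φ ((c ^ k : Bˣ) : B) := by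
  rw [← map_zpow]
  rfl

theorem SerreRel.map (φ : B →ₐ[K] A) {y : Fin (m + n) → ℤ → B} (h : SerreRel y) :
    SerreRel fun i k => φ (y i k) := by
  have hw : ∀ i k, wtd (fun i k => φ (y i k)) i k = (wtd y i k).map φ := fun _ _ => rfl
  constructor
  · intro i j hij k l
    rw [hw, hw, ← map_sBr, ← Weighted.map_val, h.zero i j hij, map_zero]
  · intro i j hn hl hij k₁ k₂ l
    simp only [hw, ← map_qBr, ← Weighted.map_val]
    rw [← map_add, h.two i j hn hl hij, map_zero]
  · intro i j hi hj k l
    simp only [hw, ← map_qBr, ← Weighted.map_val]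
    rw [← map_sum, h.three i j hi hj, map_zero]
  · intro i j i' hj hi hi' r k l₁ l₂
    simp only [hw, ← map_qBr, ← map_sBr, ← Weighted.map_val]
    rw [← map_add, h.four i j i' hj hi hi', map_zero]

theorem QuadRel.map (φ : B →ₐ[K] A) {ε : ℤˣ} {y : Fin (m + n) → ℤ → B} (h : QuadRel ε y) :
    QuadRel ε fun i k => φ (y i k) := by
  intro i j hij k l
  have := congrArg φ (h i j hij k l)
  simpa only [map_add, map_sub, map_mul, map_smul, map_zero] using this

theorem map_C_mul_expL (φ : B →ₐ[K] A) (b : B) (l : PowerSeries B) :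
    PowerSeries.map (φ : B →+* A) (C b * expL l) =
      C (φ b) * expL (PowerSeries.map (φ : B →+* A) l) := by
  rw [map_mul, map_expL, PowerSeries.map_C]
  rfl

theorem UData.map (φ : B →ₐ[K] A) {c : Bˣ} {κ : ℤˣ → Fin (m + n) → B}
    {ψ : ℤˣ → Fin (m + n) → PowerSeries B} {x : ℤˣ → Fin (m + n) → ℤ → B} (D : UData c κ ψ x)
    (hc : ∀ a, Commute (φ c) a) :
    UData (Units.map (φ : B →* A) c) (fun ε i => φ (κ ε i))
      (fun ε i => PowerSeries.map (φ : B →+* A) (ψ ε i)) (fun ε i k => φ (x ε i k)) where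
  central := hc
  zero ε i := by rw [← map_mul, D.zero, map_one]
  zero_zero ε ε' i j := (D.zero_zero ε ε' i j).map φ
  zero_log ε ε' i j p := (D.zero_log ε ε' i j p).map φ
  log_zero ε i := by rw [PowerSeries.coeff_map, D.log_zero, map_zero]
  log_log ε i j r s := (D.log_log ε i j r s).map φ
  heis ε i j r s := by
    have := congrArg φ (D.heis ε i j r s)
    simp only [val_units_map_zpow, PowerSeries.coeff_map, RingHom.coe_coe]
    rw [map_sub, map_mul, map_mul] at this
    rw [this]
    split_ifs
    · rw [map_smul, map_sub]
    · rw [map_zero]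
  zero_x s ε i j k := by
    rw [← map_mul, D.zero_x, map_smul, map_mul]
  log_x s ε i j r k := by
    have := congrArg φ (D.log_x s ε i j r k)
    rw [map_sub, map_mul, map_mul, map_smul, map_mul] at this
    simp only [val_units_map_zpow, PowerSeries.coeff_map, RingHom.coe_coe]
    exact this
  serre ε := (D.serre ε).map φ
  quad ε := (D.quad ε).map φ
  plus_minus i j k p := by
    have := congrArg φ (D.plus_minus i j k p)
    rw [Weighted.map_val, map_sBr] at this
    change (sBr (wtd (x 1) i k |>.map φ) (wtd (x (-1)) j p |>.map φ)).val = _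
    rw [this]
    split_ifs
    · rw [map_smul, map_sub, map_mul, map_mul, val_units_map_zpow, val_units_map_zpow,
        ← map_C_mul_expL, ← map_C_mul_expL]
      congr 3
      · exact map_modes (φ : B →+* A) 1 _ _
      · exact map_modes (φ : B →+* A) (-1) _ _
    · rw [map_zero]

theorem map_extLog (φ : B →ₐ[K] A) (ψ : ℤˣ → Fin (m + n) → PowerSeries B) (g : ℤˣ → ℕ → B) (ε : ℤˣ)
    (i : Fin (m + n + 1)) : PowerSeries.map (φ : B →+* A) (extLog ψ g ε i) =
      extLog (fun ε i => PowerSeries.map (φ : B →+* A) (ψ ε i)) (fun ε r => φ (g ε r)) ε i := by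
  have hp : ∀ r i, φ (preLog ψ ε r i) =
      preLog (fun ε i => PowerSeries.map (φ : B →+* A) (ψ ε i)) ε r i := by
    intro r i
    rw [preLog, preLog, map_sum]
    refine sum_congr rfl fun j _ => ?_
    split_ifs
    · rw [map_smul]; rfl
    · rw [map_zero]
  ext r
  rw [PowerSeries.coeff_map, extLog, extLog, coeff_mk, coeff_mk, RingHom.coe_coe, map_add, map_smul,
    map_sub, map_sum, hp]
  simp only [map_smul, hp]

theorem map_extZero (φ : B →ₐ[K] A) (κ : ℤˣ → Fin (m + n) → B) (t : ℤˣ → B) (ε : ℤˣ)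
    (i : Fin (m + n + 1)) : φ (extZero κ t ε i) =
      extZero (fun ε i => φ (κ ε i)) (fun ε => φ (t ε)) ε i := by
  induction i using Fin.reverseInduction with
  | last => rw [extZero_last, extZero_last]
  | cast i ih => rw [extZero_castSucc, extZero_castSucc, map_mul, ih]

theorem map_wtLog (φ : B →ₐ[K] A) (l : ℤˣ → Fin (m + n + 1) → PowerSeries B) (ε : ℤˣ) (r : ℕ) :
    φ (wtLog l ε r) = wtLog (fun ε i => PowerSeries.map (φ : B →+* A) (l ε i)) ε r := by
  rw [wtLog, wtLog, map_sum]
  simp only [map_smul]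
  rfl

theorem map_tauPsi (φ : B →ₐ[K] A) (l : ℤˣ → Fin (m + n + 1) → PowerSeries B) (ε : ℤˣ)
    (i : Fin (m + n)) : PowerSeries.map (φ : B →+* A) (tauPsi l ε i) =
      tauPsi (fun ε i => PowerSeries.map (φ : B →+* A) (l ε i)) ε i := by
  rw [tauPsi, map_dilate, map_sub, tauPsi]

section Extends

variable {κ : ℤˣ → Fin (m + n) → B} {ψ : ℤˣ → Fin (m + n) → PowerSeries B}
  {h₀ : ℤˣ → Fin (m + n + 1) → B} {l : ℤˣ → Fin (m + n + 1) → PowerSeries B}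

theorem Extends.tauPsi_eq (E : Extends κ ψ h₀ l) (ε : ℤˣ) (i : Fin (m + n)) :
    tauPsi l ε i = ψ ε i := by
  ext r
  rw [coeff_tauPsi, E.diff, smul_smul, ← mul_zpow, ← zpow_add₀ q_ne_zero, neg_add_cancel,
    zpow_zero, one_zpow, one_smul]

theorem Extends.tauKap_eq (E : Extends κ ψ h₀ l) (hz : ∀ ε i, h₀ ε i * h₀ (-ε) i = 1)
    (hκ : ∀ ε i ε' j, Commute (h₀ ε i) (κ ε' j)) (ε : ℤˣ) (i : Fin (m + n)) :
    tauKap h₀ ε i = κ ε i := by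
  rw [tauKap, E.castSucc, neg_neg, ← mul_assoc, (hκ ..).eq, mul_assoc, hz, mul_one]

end Extends

theorem tauX_sigX (x : ℤˣ → Fin (m + n) → ℤ → B) (s : ℤˣ) (i : Fin (m + n)) (k : ℤ) :
    tauX (sigX x) s i k = x s i k := by
  rw [tauX, sigX, neg_neg, smul_smul, mul_mul_mul_comm, mul_inv_cancel₀ (xScale_ne_zero s i),
    one_mul, ← mul_zpow, ← zpow_add₀ q_ne_zero, neg_add_cancel, zpow_zero, one_zpow, one_smul]

theorem sigX_tauX (X : ℤˣ → Fin (m + n) → ℤ → B) (s : ℤˣ) (i : Fin (m + n)) (k : ℤ) :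
    sigX (tauX X) s i k = X s i k := by
  rw [sigX, tauX, neg_neg, smul_smul, mul_mul_mul_comm,
    inv_mul_cancel₀ (xScale_ne_zero (-s) i),
    one_mul, ← mul_zpow, ← zpow_add₀ q_ne_zero, add_neg_cancel, zpow_zero, one_zpow, one_smul]

theorem map_sigX (φ : B →ₐ[K] A) (x : ℤˣ → Fin (m + n) → ℤ → B) (s : ℤˣ) (i : Fin (m + n)) (k : ℤ) :
    φ (sigX x s i k) = sigX (fun s i k => φ (x s i k)) s i k := by
  rw [sigX, map_smul, sigX]

theorem map_tauX (φ : B →ₐ[K] A) (X : ℤˣ → Fin (m + n) → ℤ → B) (s : ℤˣ) (i : Fin (m + n)) (k : ℤ) :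
    φ (tauX X s i k) = tauX (fun s i k => φ (X s i k)) s i k := by
  rw [tauX, map_smul, tauX]

section Lift

variable {c : Bˣ} {h₀ : ℤˣ → Fin (m + n + 1) → B} {l : ℤˣ → Fin (m + n + 1) → PowerSeries B}
  {X : ℤˣ → Fin (m + n) → ℤ → B} (D : AData c h₀ l X)

theorem AData.lift_hZero (ε : ℤˣ) (i : Fin (m + n + 1)) : D.lift (Aq.hZero ε i) = h₀ ε i := by
  rw [Aq.hZero_eq, D.lift_hCoeff, coeff_zero_hSer]

theorem AData.lift_logH (ε : ℤˣ) (i : Fin (m + n + 1)) :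
    PowerSeries.map (D.lift : Aq m n →+* B) (Aq.logH ε i) = l ε i := by
  have h : (D.lift : Aq m n →+* B) (coeff 0 (Aq.h (-ε) i)) = coeff 0 (hSer h₀ l (-ε) i) := by
    rw [coeff_zero_hSer]
    exact D.lift_hZero (-ε) i
  rw [Aq.logH, map_mul, eulerD_map, map_seriesInv, D.lift_h, h, D.euler, mul_assoc,
    h_mul_inv D.zero_coeff, mul_one]

theorem Aq.algHom_ext {φ φ' : Aq m n →ₐ[K] B} (hc : φ (Aq.c m n) = φ' (Aq.c m n))
    (hh : ∀ ε i p, φ (Aq.hCoeff ε i p) = φ' (Aq.hCoeff ε i p))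
    (hX : ∀ ε i k, φ (Aq.X ε i k) = φ' (Aq.X ε i k)) : φ = φ' := by
  refine RingQuot.ringQuot_ext' K φ φ' (FreeAlgebra.hom_ext (funext fun y => ?_))
  change φ (Aq.proj m n (FreeAlgebra.ι K y)) = φ' (Aq.proj m n (FreeAlgebra.ι K y))
  cases y with
  | h ε i p => exact hh ε i p
  | X ε i k => exact hX ε i k
  | c => exact hc
  | cInv =>
    have h1 : φ (Aq.proj m n (FreeAlgebra.ι K .cInv)) * φ (Aq.c m n) = 1 := by
      rw [← map_mul, Aq.c, ← map_mul, Aq.proj_rel .cInv_c, map_one, map_one]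
    have h2 : φ' (Aq.c m n) * φ' (Aq.proj m n (FreeAlgebra.ι K .cInv)) = 1 := by
      rw [← map_mul, Aq.c, ← map_mul, Aq.proj_rel .c_cInv, map_one, map_one]
    exact left_inv_eq_right_inv h1 (hc ▸ h2)

end Lift

/-! ### The mutually inverse homomorphisms -/

theorem commute_tmul_of_central {x : B} (hx : ∀ b, Commute x b) {R : Type*} [CommRing R]
    [Algebra K R] (r : R) (z : B ⊗[K] R) : Commute (x ⊗ₜ[K] r) z := by
  induction z using TensorProduct.induction_on with
  | zero => exact Commute.zero_right _
  | tmul b s =>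
    rw [Commute, SemiconjBy, Algebra.TensorProduct.tmul_mul_tmul,
      Algebra.TensorProduct.tmul_mul_tmul, (hx b).eq, mul_comm r]
  | add y z hy hz => exact hy.add_right hz

/-- The tensor product of `U_q` with a free commutative algebra. -/
def UZ (m n : ℕ) : Type := Uq m n ⊗[K] ZRing

namespace UZ

instance : Ring (UZ m n) := inferInstanceAs (Ring (Uq m n ⊗[K] ZRing))

instance : Algebra K (UZ m n) := inferInstanceAs (Algebra K (Uq m n ⊗[K] ZRing))

/-- The embedding of the first factor. -/
def inl (m n : ℕ) : Uq m n →ₐ[K] UZ m n :=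
  (Algebra.TensorProduct.includeLeft : Uq m n →ₐ[K] Uq m n ⊗[K] ZRing)

/-- The embedding of the second factor. -/
def inr (m n : ℕ) : ZRing →ₐ[K] UZ m n :=
  (Algebra.TensorProduct.includeRight : ZRing →ₐ[K] Uq m n ⊗[K] ZRing)

theorem commute_inl {u : Uq m n} (hu : ∀ b, Commute u b) (z : UZ m n) : Commute (inl m n u) z :=
  commute_tmul_of_central (R := ZRing) hu 1 z

theorem commute_inr (r : ZRing) (z : UZ m n) : Commute (inr m n r) z :=
  commute_tmul_of_central (R := ZRing) (fun b : Uq m n => Commute.one_left b) r z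

/-- Homomorphisms from the factors with commuting images give one from the tensor product. -/
def lift (φ : Uq m n →ₐ[K] B) (χ : ZRing →ₐ[K] B) (h : ∀ u z, Commute (φ u) (χ z)) :
    UZ m n →ₐ[K] B :=
  (Algebra.TensorProduct.lift φ χ h : Uq m n ⊗[K] ZRing →ₐ[K] B)

theorem lift_inl (φ : Uq m n →ₐ[K] B) (χ : ZRing →ₐ[K] B) (h : ∀ u z, Commute (φ u) (χ z))
    (u : Uq m n) : lift φ χ h (inl m n u) = φ u :=
  DFunLike.congr_fun (Algebra.TensorProduct.lift_comp_includeLeft φ χ h) u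

theorem lift_inr (φ : Uq m n →ₐ[K] B) (χ : ZRing →ₐ[K] B) (h : ∀ u z, Commute (φ u) (χ z))
    (z : ZRing) : lift φ χ h (inr m n z) = χ z :=
  DFunLike.congr_fun (Algebra.TensorProduct.lift_comp_includeRight φ χ h) z

theorem algHom_ext {φ φ' : UZ m n →ₐ[K] B} (hl : φ.comp (inl m n) = φ'.comp (inl m n))
    (hr : φ.comp (inr m n) = φ'.comp (inr m n)) : φ = φ' :=
  Algebra.TensorProduct.ext (A := Uq m n) (B := ZRing) hl hr

theorem uData (hm : 0 < m) : UData (Units.map (inl m n : Uq m n →* UZ m n) (Uq.cUnit m n))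
    (fun ε i => inl m n (Uq.kap ε i))
    (fun ε i => PowerSeries.map (inl m n : Uq m n →+* UZ m n) (Uq.psi ε i))
    (fun ε i k => inl m n (Uq.x ε i k)) :=
  (Uq.uData hm).map (inl m n) (commute_inl Uq.c_central)

theorem centralData : CentralData (fun ε => inr m n (zT ε)) (fun ε r => inr m n (zG ε r)) where
  mul ε := by rw [← map_mul, zT_mul, map_one]
  comm_t ε := commute_inr _
  comm_g ε r := commute_inr _
  zero ε := by rw [zG, map_zero]

/-- The images of the constant terms of the `h_i`. -/
def hZero : ℤˣ → Fin (m + n + 1) → UZ m n :=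
  extZero (fun ε i => inl m n (Uq.kap ε i)) (fun ε => inr m n (zT ε))

/-- The images of the logarithmic derivatives of the `h_i`. -/
def logH : ℤˣ → Fin (m + n + 1) → PowerSeries (UZ m n) :=
  extLog (fun ε i => PowerSeries.map (inl m n : Uq m n →+* UZ m n) (Uq.psi ε i))
    (fun ε r => inr m n (zG ε r))

theorem isExtends (hm : 0 < m) : Extends (fun ε i => inl m n (Uq.kap ε i))
    (fun ε i => PowerSeries.map (inl m n : Uq m n →+* UZ m n) (Uq.psi ε i)) hZero logH :=
  extends_ext (uData hm).log_zero centralData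

theorem aData (hm : 0 < m) : AData (Units.map (inl m n : Uq m n →* UZ m n) (Uq.cUnit m n))
    hZero logH (sigX fun ε i k => inl m n (Uq.x ε i k)) :=
  (uData hm).aData hm (isExtends hm)

end UZ

/-- The homomorphism from `A_q` to the tensor product. -/
def sigma (hm : 0 < m) : Aq m n →ₐ[K] UZ m n := (UZ.aData hm).lift

/-- The homomorphism from `U_q` to `A_q`. -/
def tau (hm : 0 < m) : Uq m n →ₐ[K] Aq m n := (Aq.aData.uData hm).lift hm

/-- The homomorphism from the free commutative algebra to the centre of `A_q`. -/
def zHom (hm : 0 < m) : ZRing →ₐ[K] Aq m n := (Aq.centralData hm).hom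

/-- The homomorphism from the tensor product to `A_q`. -/
def thetaHom (hm : 0 < m) : UZ m n →ₐ[K] Aq m n :=
  UZ.lift (tau hm) (zHom hm) fun u z => ((Aq.centralData hm).hom_comm z (tau hm u)).symm

theorem thetaHom_inl (hm : 0 < m) (u : Uq m n) : thetaHom hm (UZ.inl m n u) = tau hm u :=
  UZ.lift_inl ..

theorem thetaHom_inr (hm : 0 < m) (z : ZRing) : thetaHom hm (UZ.inr m n z) = zHom hm z :=
  UZ.lift_inr ..

theorem thetaHom_hZero (hm : 0 < m) (ε : ℤˣ) (i : Fin (m + n + 1)) :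
    thetaHom hm (UZ.hZero ε i) = Aq.hZero ε i := by
  rw [UZ.hZero, map_extZero]
  refine zero_unique (κ := tauKap Aq.hZero) (fun ε i => ?_) Aq.hZero_castSucc (fun ε => ?_) ε i
  · rw [extZero_castSucc, thetaHom_inl, tau, UData.lift_kap]
  · rw [extZero_last, thetaHom_inr, zHom, CentralData.hom_zT]

/-- Both families have the same differences, since τ sends ψ to `tauPsi`, and the same weighted sum,
since the generators of `ZRing` go to `wtLog`. Hence `log_unique` applies. -/
theorem thetaHom_logH (hm : 0 < m) (ε : ℤˣ) (i : Fin (m + n + 1)) :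
    PowerSeries.map (thetaHom (n := n) hm : UZ m n →+* Aq m n) (UZ.logH ε i) = Aq.logH ε i := by
  have hψ : (fun ε i => PowerSeries.map (thetaHom (n := n) hm : UZ m n →+* Aq m n)
      (PowerSeries.map (UZ.inl m n : Uq m n →+* UZ m n) (Uq.psi ε i))) = tauPsi Aq.logH := by
    funext ε i
    rw [← UData.lift_psi hm (Aq.aData.uData hm) ε i]
    ext r
    simp only [PowerSeries.coeff_map, RingHom.coe_coe]
    exact thetaHom_inl hm _
  have hg : (fun ε r => thetaHom hm (UZ.inr m n (zG ε r))) = wtLog (m := m) (n := n) Aq.logH := by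
    funext ε r
    rw [thetaHom_inr, zHom, CentralData.hom_zG]
  rw [UZ.logH, map_extLog, hψ, hg]
  refine log_unique (fun ε i => ?_) Aq.hRel.log_zero (fun ε i r => ?_) (fun ε r hr => ?_) ε i
  · exact coeff_zero_extLog _ (Aq.aData.uData hm).log_zero _ (Aq.centralData hm).zero ε i
  · rw [extLog_succ, Aq.diff_logH]
  · rw [wtLog_extLog _ _ _ hr]

theorem map_hSer (φ : B →ₐ[K] A) (h₀ : ℤˣ → Fin (m + n + 1) → B)
    (l : ℤˣ → Fin (m + n + 1) → PowerSeries B) (ε : ℤˣ) (i : Fin (m + n + 1)) :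
    PowerSeries.map (φ : B →+* A) (hSer h₀ l ε i) =
      hSer (fun ε i => φ (h₀ ε i)) (fun ε i => PowerSeries.map (φ : B →+* A) (l ε i)) ε i :=
  map_C_mul_expL φ _ _

theorem thetaHom_comp_sigma (hm : 0 < m) : (thetaHom hm).comp (sigma hm) = AlgHom.id K (Aq m n) := by
  refine Aq.algHom_ext ?_ (fun ε i p => ?_) fun ε i k => ?_
  · rw [AlgHom.comp_apply, sigma, AData.lift_c]
    change thetaHom hm (UZ.inl m n (Uq.c m n)) = _
    rw [thetaHom_inl, tau, UData.lift_c]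
    rfl
  · rw [AlgHom.comp_apply, sigma, AData.lift_hCoeff]
    have := congrArg (coeff p) (map_hSer (thetaHom hm) UZ.hZero UZ.logH ε i)
    simp only [thetaHom_hZero, thetaHom_logH] at this
    rw [PowerSeries.coeff_map] at this
    refine this.trans ?_
    rw [Aq.hSer_hZero, Aq.h, coeff_mk]
    rfl
  · rw [AlgHom.comp_apply, sigma, AData.lift_X, map_sigX]
    simp only [thetaHom_inl, tau, UData.lift_x]
    rw [sigX_tauX]
    rfl

/-- Taking differences of the constructed logarithms gives back those of the Φ_i, and the two
rescalings of the currents are inverse to each other. -/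
theorem sigma_comp_tau (hm : 0 < m) : (sigma hm).comp (tau hm) = UZ.inl m n := by
  have D := UZ.uData (n := n) hm
  have E := UZ.isExtends (n := n) hm
  refine Uq.algHom_ext ?_ (fun ε i => ?_) (fun ε i r => ?_) fun ε i k => ?_
  · rw [AlgHom.comp_apply, tau, UData.lift_c, Aq.val_cUnit, sigma, AData.lift_c]
    rfl
  · rw [AlgHom.comp_apply, tau, UData.lift_kap, tauKap, map_mul, sigma, AData.lift_hZero,
      AData.lift_hZero]
    exact E.tauKap_eq (UZ.aData hm).zero
      (fun ε i ε' j => E.commute_zero (fun i' => D.zero_zero (-ε) ε' i' j) i) ε i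
  · have h1 := congrArg (coeff r) (UData.lift_psi hm (Aq.aData.uData hm) ε i)
    have h2 := congrArg (coeff r) (map_tauPsi (sigma hm) Aq.logH ε i)
    simp only [sigma, AData.lift_logH] at h2
    rw [E.tauPsi_eq, PowerSeries.coeff_map, PowerSeries.coeff_map] at h2
    rw [PowerSeries.coeff_map] at h1
    rw [AlgHom.comp_apply]
    exact (congrArg (sigma hm) h1).trans h2
  · rw [AlgHom.comp_apply, tau, UData.lift_x, map_tauX]
    simp only [sigma, AData.lift_X]
    exact tauX_sigX _ ε i k

/-- The logarithms were constructed so that their weighted sum is the prescribed generator of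
`ZRing`; in degree 0 both sides vanish. -/
theorem sigma_comp_zHom (hm : 0 < m) : (sigma hm).comp (zHom hm) = UZ.inr m n := by
  refine ZRing.algHom_ext (fun ε => ?_) fun ε r => ?_
  · rw [AlgHom.comp_apply, zHom, CentralData.hom_zT, sigma, AData.lift_hZero]
    exact extZero_last ..
  · rw [AlgHom.comp_apply, zHom, CentralData.hom_zG, map_wtLog]
    simp only [sigma, AData.lift_logH]
    rcases eq_or_ne r 0 with rfl | hr
    · rw [(UZ.aData hm).wtLog_zero, zG, map_zero]
    · exact wtLog_extLog _ _ _ hr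

theorem sigma_comp_thetaHom (hm : 0 < m) : (sigma hm).comp (thetaHom hm) = AlgHom.id K (UZ m n) := by
  refine UZ.algHom_ext ?_ ?_
  · refine AlgHom.ext fun u => ?_
    change sigma hm (thetaHom hm (UZ.inl m n u)) = UZ.inl m n u
    rw [thetaHom_inl]
    exact DFunLike.congr_fun (sigma_comp_tau hm) u
  · refine AlgHom.ext fun z => ?_
    change sigma hm (thetaHom hm (UZ.inr m n z)) = UZ.inr m n z
    rw [thetaHom_inr]
    exact DFunLike.congr_fun (sigma_comp_zHom hm) z

/-- The tensor product of `U_q` and the free commutative algebra is isomorphic to `A_q`. -/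
def thetaEquiv (hm : 0 < m) : UZ m n ≃ₐ[K] Aq m n :=
  AlgEquiv.ofAlgHom (thetaHom hm) (sigma hm) (thetaHom_comp_sigma hm) (sigma_comp_thetaHom hm)

/-! ### Products of series with commuting coefficients -/

/-- Both sides have constant term 1 and logarithmic derivative l + l', because everything commutes.
-/
theorem expL_add {l l' : PowerSeries B} (h0 : coeff 0 l = 0) (h0' : coeff 0 l' = 0)
    (hc : ∀ a b, Commute (coeff a l) (coeff b l)) (hc' : ∀ a b, Commute (coeff a l') (coeff b l'))
    (hcc : ∀ a b, Commute (coeff a l) (coeff b l')) : expL (l + l') = expL l * expL l' := by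
  refine eq_of_eulerD (M := l + l') (eulerD_expL ?_ ?_) ?_ ?_ ?_
  · rw [map_add, h0, h0', add_zero]
  · intro a b
    rw [map_add, map_add]
    exact ((hc a b).add_right (hcc a b)).add_left ((hcc b a).symm.add_right (hc' a b))
  · rw [eulerD_mul, eulerD_expL h0 hc, eulerD_expL h0' hc', add_mul, mul_assoc, ← mul_assoc (expL l),
      ← mul_assoc l' (expL l)]
    congr 2
    exact (commute_of_coeff fun a b => (commute_coeff_expL (fun p => (hcc p a).symm) b)).eq.symm
  · rw [map_add, h0, h0', add_zero]
  · rw [coeff_mul]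
    simp [coeff_zero_expL]

/-- A series with constant term `a` and logarithmic derivative `L`, and coefficients in `M`. -/
structure IsExp (M : Subalgebra K B) (S : PowerSeries B) (a : B) (L : PowerSeries B) : Prop where
  eq : S = C a * expL L
  mem : a ∈ M
  log_mem (r : ℕ) : coeff r L ∈ M
  log_zero : coeff 0 L = 0

namespace IsExp

variable {M : Subalgebra K B} (hM : ∀ x ∈ M, ∀ y ∈ M, Commute x y) {S S' L L' : PowerSeries B}
  {a a' : B}

theorem one (M : Subalgebra K B) : IsExp M 1 1 0 where
  eq := by
    rw [map_one, one_mul]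
    refine eq_of_eulerD (M := 0) ?_ (eulerD_expL (map_zero _) fun a b => ?_) (map_zero _) ?_
    · rw [zero_mul, ← map_one C, eulerD_C]
    · rw [map_zero]; exact Commute.zero_left _
    · rw [coeff_zero_expL, PowerSeries.coeff_zero_one]
  mem := M.one_mem
  log_mem r := by rw [map_zero]; exact M.zero_mem
  log_zero := map_zero _

include hM in
theorem mul (h : IsExp M S a L) (h' : IsExp M S' a' L') :
    IsExp M (S * S') (a * a') (L + L') where
  eq := by
    have hc : Commute (C a') (expL L) :=
      commute_C_of_coeff (commute_coeff_expL fun p => hM _ h'.mem _ (h.log_mem p))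
    rw [expL_add h.log_zero h'.log_zero (fun r s => hM _ (h.log_mem r) _ (h.log_mem s))
      (fun r s => hM _ (h'.log_mem r) _ (h'.log_mem s))
      (fun r s => hM _ (h.log_mem r) _ (h'.log_mem s)), h.eq, h'.eq, map_mul, mul_assoc, mul_assoc,
      ← mul_assoc (expL L), ← hc.eq, mul_assoc (C a')]
  mem := M.mul_mem h.mem h'.mem
  log_mem r := by rw [map_add]; exact M.add_mem (h.log_mem r) (h'.log_mem r)
  log_zero := by rw [map_add, h.log_zero, h'.log_zero, add_zero]

theorem dilate (h : IsExp M S a L) (ε : ℤˣ) {u : K} (hu : u ≠ 0) :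
    IsExp M (dilate ε u S) a (OspAffine.dilate ε u L) where
  eq := by rw [h.eq, dilate_mul ε hu, dilate_C, expL_dilate ε hu]
  mem := h.mem
  log_mem r := by rw [coeff_dilate]; exact M.smul_mem (h.log_mem r) _
  log_zero := by rw [coeff_zero_dilate, h.log_zero]

include hM in
-- The series with inverse constant term and opposite logarithm is a left inverse by `IsExp.mul`,
-- hence equal to the given right inverse.
theorem seriesInv (h : IsExp M S a L) {b : B} (hb : b ∈ M) (hab : a * b = 1) :
    IsExp M (seriesInv b S) b (-L) := by
  have hba : b * a = 1 := (hM a h.mem b hb).eq ▸ hab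
  have hN : IsExp M (C b * expL (-L)) b (-L) :=
    ⟨rfl, hb, fun r => by rw [map_neg]; exact M.neg_mem (h.log_mem r),
      by rw [map_neg, h.log_zero, neg_zero]⟩
  have h1 := (hN.mul hM h).eq
  rw [hba, neg_add_cancel, ← (one M).eq] at h1
  have h0 : coeff 0 S = a := by rw [h.eq, coeff_C_mul, coeff_zero_expL, mul_one]
  refine ⟨?_, hN.mem, hN.log_mem, hN.log_zero⟩
  exact (left_inv_eq_right_inv h1 (mul_seriesInv (by rw [h0, hab]) (by rw [h0, hba]))).symm

include hM in
theorem list_prod {ι : Type*} {F G : ι → PowerSeries B} (h : ∀ i, IsExp M (F i) 1 (G i))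
    (l : List ι) : IsExp M (l.map F).prod 1 (l.map G).sum := by
  induction l with
  | nil => exact one M
  | cons i l ih =>
    have := (h i).mul hM ih
    rwa [mul_one] at this

end IsExp

/-! ### The central series -/

namespace Aq

/-- The subalgebra generated by the constant terms and the logarithmic derivatives of the
`h_i^ε`. -/
def cartanPart (m n : ℕ) (ε : ℤˣ) : Subalgebra K (Aq m n) :=
  Algebra.adjoin K ({b | ∃ ε' i, b = hZero ε' i} ∪ {b | ∃ i r, b = coeff r (logH ε i)})

theorem cartanPart_comm (ε : ℤˣ) : ∀ x ∈ cartanPart m n ε, ∀ y ∈ cartanPart m n ε, Commute x y := by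
  intro x hx y hy
  refine Algebra.commute_of_mem_adjoin_of_forall_mem_commute hy fun b hb => ?_
  refine (Algebra.commute_of_mem_adjoin_of_forall_mem_commute hx fun a ha => ?_).symm
  rcases hb with ⟨ε₁, i, rfl⟩ | ⟨i, r, rfl⟩ <;> rcases ha with ⟨ε₂, j, rfl⟩ | ⟨j, s, rfl⟩
  · exact hRel.zero_zero ..
  · exact hRel.zero_log ..
  · exact (hRel.zero_log ..).symm
  · exact hRel.log_log ..

theorem hZero_mem_cartanPart (ε ε' : ℤˣ) (i : Fin (m + n + 1)) :
    hZero ε' i ∈ cartanPart m n ε := Algebra.subset_adjoin (Or.inl ⟨ε', i, rfl⟩)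

theorem isExp_h (ε : ℤˣ) (i : Fin (m + n + 1)) :
    IsExp (cartanPart m n ε) (h ε i) (hZero ε i) (logH ε i) where
  eq := (hSer_hZero ε i).symm
  mem := hZero_mem_cartanPart ε _ i
  log_mem r := Algebra.subset_adjoin (Or.inr ⟨i, r, rfl⟩)
  log_zero := coeff_zero_logH ..

theorem isExp_hInv (ε : ℤˣ) (i : Fin (m + n + 1)) :
    IsExp (cartanPart m n ε) (hInv ε i) (hZero (-ε) i) (-logH ε i) := by
  rw [hInv, ← hZero_eq]
  exact (isExp_h ε i).seriesInv (cartanPart_comm ε) (hZero_mem_cartanPart ε _ i) (hRel.zero ε i)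

theorem isExp_ratio (ε : ℤˣ) {u v : K} (hu : u ≠ 0) (hv : v ≠ 0) (i : Fin (m + n + 1)) :
    IsExp (cartanPart m n ε) (dilate ε u (h ε i) * dilate ε v (hInv ε i)) 1
      (dilate ε u (logH ε i) + dilate ε v (-logH ε i)) := by
  rw [← hRel.zero ε i]
  exact ((isExp_h ε i).dilate ε hu).mul (cartanPart_comm ε) ((isExp_hInv ε i).dilate ε hv)

theorem zeta_ne_zero (m n : ℕ) : zeta m n ≠ 0 := zpow_ne_zero _ q_ne_zero

theorem coeff_ratio_log (ε : ℤˣ) (u v : K) (l : PowerSeries B) (r : ℕ) :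
    coeff r (dilate ε u l + dilate ε v (-l)) =
      (u ^ ((ε : ℤ) * (r : ℤ)) - v ^ ((ε : ℤ) * (r : ℤ))) • coeff r l := by
  rw [map_add, coeff_dilate, coeff_dilate, map_neg, smul_neg, sub_smul, sub_eq_add_neg]

omit [Algebra K B] in
theorem sum_split (f : Fin (m + n + 1) → B) : ∑ i, f i =
    ∑ i : Fin n, f ⟨i, by omega⟩ + ∑ i : Fin m, f ⟨n + i, by omega⟩ + f (Fin.last _) := by
  let g : ℕ → B := fun k => if hk : k < m + n + 1 then f ⟨k, hk⟩ else 0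
  have h1 : ∀ i : Fin (m + n + 1), f i = g i := fun i => by simp only [g, i.2, dif_pos]
  have h2 : ∀ i : Fin n, f ⟨i, by omega⟩ = g i := fun i => h1 ⟨i, by omega⟩
  have h3 : ∀ i : Fin m, f ⟨n + i, by omega⟩ = g (n + i) := fun i => h1 ⟨n + i, by omega⟩
  simp only [h2, h3]
  rw [sum_congr rfl fun i _ => h1 i, Fin.sum_univ_eq_sum_range g, Fin.sum_univ_eq_sum_range g,
    Fin.sum_univ_eq_sum_range fun k => g (n + k), sum_range_succ, h1 (Fin.last _),
    Fin.val_last, ← sum_range_add, add_comm n m]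

/-- Each ratio of values of the same h_i has constant term 1, and the last factor contains h_{N+1}
twice, whence the square. The logarithms add up, and rescaling z by u multiplies degree r by u^{εr};
collecting these powers gives exactly the weights `wt`. -/
theorem cSer_eq (ε : ℤˣ) : cSer m n ε =
    C (hZero ε (Fin.last _) ^ 2) * expL (PowerSeries.mk (wtLog logH ε)) := by
  have hM := cartanPart_comm (m := m) (n := n) ε
  have hz := zeta_ne_zero m n
  have hq : ∀ k : ℤ, q ^ k ≠ 0 := fun k => zpow_ne_zero _ q_ne_zero
  have h1 := IsExp.list_prod hM (fun i : Fin n => isExp_ratio ε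
    (mul_ne_zero hz (hq (2 * (i : ℤ)))) (mul_ne_zero hz (hq (2 * (i : ℤ) + 2)))
    (⟨i, by omega⟩ : Fin (m + n + 1))) (List.finRange n)
  have h2 := IsExp.list_prod hM (fun i : Fin m => isExp_ratio ε
    (hq (2 * (m : ℤ) - 2 * (i : ℤ) - 1)) (hq (2 * (m : ℤ) - 2 * (i : ℤ) - 3))
    (⟨n + i, by omega⟩ : Fin (m + n + 1))) (List.finRange m)
  have hl := isExp_h (m := m) (n := n) ε (Fin.last _)
  have h3 := (h1.mul hM h2).mul hM (hl.mul hM (hl.dilate ε (inv_ne_zero q_ne_zero)))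
  rw [cSer, h3.eq, one_mul, one_mul, pow_two]
  congr 2
  ext r
  rw [coeff_mk, wtLog, sum_split, ← List.ofFn_eq_map, List.sum_ofFn, ← List.ofFn_eq_map,
    List.sum_ofFn, map_add, map_add, map_add, map_sum, map_sum]
  congr 1
  · congr 1
    · refine sum_congr rfl fun i _ => ?_
      rw [coeff_ratio_log, wtS, wt, if_pos i.2, zetaT, ← zeta_zpow, mul_zpow, mul_zpow, ← zpow_mul,
        ← zpow_mul, ← zpow_mul, ← zpow_mul, mul_comm (2 * ((i : ℕ) : ℤ)),
        mul_comm (2 * ((i : ℕ) : ℤ) + 2)]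
    · refine sum_congr rfl fun i _ => ?_
      rw [coeff_ratio_log, wtS, wt, if_neg (by simp), if_pos (by simp; omega), ← zpow_mul,
        ← zpow_mul, ← zpow_mul, ← zpow_mul]
      congr 2
      · congr 1; push_cast; ring
      · congr 1; push_cast; ring
  · rw [coeff_dilate, wtS, wt, if_neg (by simp), if_neg (by simp), add_smul, one_smul, inv_zpow]

end Aq

/-! ### Series with coefficients in a subalgebra -/

section Subalgebra

variable (M : Subalgebra K B)

theorem exists_map_val {S : PowerSeries B} (h : ∀ p, coeff p S ∈ M) :
    ∃ S' : PowerSeries M, PowerSeries.map (M.val : M →+* B) S' = S :=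
  ⟨PowerSeries.mk fun p => ⟨coeff p S, h p⟩, by ext p; simp⟩

theorem coeff_mul_mem {S S' : PowerSeries B} (h : ∀ p, coeff p S ∈ M) (h' : ∀ p, coeff p S' ∈ M)
    (p : ℕ) : coeff p (S * S') ∈ M := by
  rw [coeff_mul]
  exact M.sum_mem fun x _ => M.mul_mem (h _) (h' _)

theorem coeff_expL_mem {l : PowerSeries B} (h : ∀ p, coeff p l ∈ M) (p : ℕ) :
    coeff p (expL l) ∈ M := by
  obtain ⟨l', rfl⟩ := exists_map_val M h
  rw [← map_expL, PowerSeries.coeff_map]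
  exact (coeff p (expL l')).2

theorem coeff_seriesInv_mem {b : B} (hb : b ∈ M) {S : PowerSeries B} (h : ∀ p, coeff p S ∈ M)
    (p : ℕ) : coeff p (seriesInv b S) ∈ M := by
  obtain ⟨S', rfl⟩ := exists_map_val M h
  have := map_seriesInv (M.val : M →+* B) ⟨b, hb⟩ S'
  change _ = seriesInv b _ at this
  rw [← this, PowerSeries.coeff_map]
  exact (coeff p (seriesInv _ S')).2

end Subalgebra

/-! ### The subalgebra generated by the coefficients of the central series -/

/-- The element of the free commutative algebra that corresponds to a coefficient of `c^ε`. -/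
def zCoeff (ε : ℤˣ) (p : ℕ) : ZRing :=
  coeff p (C (zT ε) * expL (PowerSeries.mk (zG ε)))

theorem CentralData.hom_zCoeff {t : ℤˣ → B} {g : ℤˣ → ℕ → B}
    (Z : CentralData t g) (ε : ℤˣ) (p : ℕ) :
    Z.hom (zCoeff ε p) = coeff p (C (t ε) * expL (PowerSeries.mk (g ε))) := by
  have h : PowerSeries.map (Z.hom : ZRing →+* B) (PowerSeries.mk (zG ε)) =
      PowerSeries.mk (g ε) := by
    ext r
    rw [PowerSeries.coeff_map, coeff_mk, coeff_mk]
    exact Z.hom_zG ε r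
  have := congrArg (coeff p) (map_C_mul_expL Z.hom (zT ε) (PowerSeries.mk (zG ε)))
  rw [PowerSeries.coeff_map, Z.hom_zT, h] at this
  exact this

namespace Aq

theorem coeff_cSer_mem (ε : ℤˣ) (p : ℕ) : coeff p (cSer m n ε) ∈ cAlg m n :=
  (cCoeff m n ε p).2

theorem coeff_zero_cSer (ε : ℤˣ) : coeff 0 (cSer m n ε) = hZero ε (Fin.last _) ^ 2 := by
  rw [cSer_eq, coeff_C_mul, coeff_zero_expL, mul_one]

theorem coeff_zero_cSer_mul (ε : ℤˣ) :
    coeff 0 (cSer m n ε) * coeff 0 (cSer m n (-ε)) = 1 := by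
  rw [coeff_zero_cSer, coeff_zero_cSer, ← (hRel.zero_zero ..).mul_pow, hRel.zero, one_pow]

theorem eulerD_cSer (hm : 0 < m) (ε : ℤˣ) :
    eulerD (cSer m n ε) = PowerSeries.mk (wtLog logH ε) * cSer m n ε := by
  have Z := centralData (n := n) hm
  rw [cSer_eq, eulerD_mul, eulerD_C, zero_mul, zero_add, eulerD_expL, ← mul_assoc, ← mul_assoc]
  · congr 1
    exact commute_C_of_coeff fun p => by
      rw [coeff_mk]
      exact (Z.comm_g ε p _).symm
  · rw [coeff_mk]
    exact Z.zero ε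
  · intro a b
    rw [coeff_mk]
    exact Z.comm_g ε a _

/-- It is the logarithmic derivative of c^ε. The inverse of c^ε has coefficients in 𝔠 because the
inverse of its constant term is the constant term of c^{-ε}. -/
theorem wtLog_mem_cAlg (hm : 0 < m) (ε : ℤˣ) (r : ℕ) : wtLog logH ε r ∈ cAlg m n := by
  have h : PowerSeries.mk (wtLog logH ε) =
      eulerD (cSer m n ε) * seriesInv (coeff 0 (cSer m n (-ε))) (cSer m n ε) := by
    rw [eulerD_cSer hm, mul_assoc, h_mul_inv (h := fun ε (_ : Fin (m + n + 1)) => cSer m n ε)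
      (fun ε _ => coeff_zero_cSer_mul ε) ε (Fin.last _), mul_one]
  have := congrArg (coeff r) h
  rw [coeff_mk] at this
  rw [this]
  refine coeff_mul_mem _ (fun p => ?_)
    (coeff_seriesInv_mem _ (coeff_cSer_mem _ _) (coeff_cSer_mem _)) r
  rw [coeff_eulerD]
  exact (cAlg m n).nsmul_mem (coeff_cSer_mem _ _) _

/-- The invertible element chosen here is the constant term of c^ε, the square of that of h_{N+1}^ε,
whereas `Aq.centralData` uses h_{N+1,0} itself. The logarithms are the same. -/
theorem centralData_cAlg (hm : 0 < m) : CentralData (fun ε => cCoeff m n ε 0)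
    (fun ε r => (⟨wtLog logH ε r, wtLog_mem_cAlg hm ε r⟩ : cAlg m n)) where
  mul ε := Subtype.ext (coeff_zero_cSer_mul ε)
  comm_t ε b := Subtype.ext (by
    change coeff 0 (cSer m n ε) * (b : Aq m n) = b * coeff 0 (cSer m n ε)
    rw [coeff_zero_cSer]
    exact ((centralData hm).comm_t ε (b : Aq m n)).pow_left 2)
  comm_g ε r b := Subtype.ext ((centralData hm).comm_g ε r (b : Aq m n)).eq
  zero ε := Subtype.ext ((centralData hm).zero ε)

/-- The homomorphism from the free commutative algebra to the subalgebra generated by the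
coefficients of `c^±`. -/
def cHom (hm : 0 < m) : ZRing →ₐ[K] cAlg m n := (centralData_cAlg hm).hom

theorem cHom_zCoeff (hm : 0 < m) (ε : ℤˣ) (p : ℕ) : cHom hm (zCoeff ε p) = cCoeff m n ε p := by
  refine Subtype.ext ?_
  have h := congrArg (coeff p) (map_C_mul_expL (cAlg m n).val (cCoeff m n ε 0)
    (PowerSeries.mk fun r => ⟨wtLog logH ε r, wtLog_mem_cAlg hm ε r⟩))
  rw [PowerSeries.coeff_map] at h
  rw [cHom, CentralData.hom_zCoeff]
  refine h.trans ?_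
  change _ = coeff p (cSer m n ε)
  rw [cSer_eq]
  congr 3
  exact coeff_zero_cSer ε

/-- One element of `ZRing` represents c^ε in 𝔠, where the invertible generator is h², and its
multiple by h⁻¹ in A_q, where the generator is h, for h the constant term of h_{N+1}^ε. This is the
origin of the normalising factor in the theorem. -/
theorem zHom_zCoeff (hm : 0 < m) (ε : ℤˣ) (p : ℕ) :
    zHom hm (zCoeff ε p) = hCoeff (-ε) (Fin.last _) 0 * (cCoeff m n ε p : Aq m n) := by
  change _ = _ * coeff p (cSer m n ε)
  have h1 : (hZero (-ε) (Fin.last _) * hZero ε (Fin.last _) : Aq m n) = 1 := by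
    simpa using hRel.zero (-ε) (Fin.last _)
  rw [zHom, CentralData.hom_zCoeff, cSer_eq, coeff_C_mul, coeff_C_mul, ← mul_assoc, pow_two,
    ← mul_assoc, ← hZero_eq, h1, one_mul]

theorem cHom_surjective (hm : 0 < m) : Function.Surjective (cHom (n := n) hm) := by
  have h : cAlg m n ≤ ((cAlg m n).val.comp (cHom hm)).range := by
    refine Algebra.adjoin_le ?_
    rintro _ ⟨ε, p, rfl⟩
    exact ⟨zCoeff ε p, congrArg Subtype.val (cHom_zCoeff hm ε p)⟩
  intro y
  obtain ⟨z, hz⟩ := h y.2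
  exact ⟨z, Subtype.ext hz⟩

end Aq

/-! ### Injectivity -/

omit [Algebra K B] in
theorem modes_one (ε : ℤˣ) (k : ℤ) : modes ε (1 : PowerSeries B) k = if k = 0 then 1 else 0 := by
  rw [modes, PowerSeries.coeff_one]
  rcases Int.units_eq_one_or ε with rfl | rfl <;> split_ifs <;> simp_all

/-- The one-dimensional module with q^{c/2} = k_i = 1 and all other generators zero. The bracket of
x^+ and x^- is consistent, because Φ^+ and Φ^- are both the constant 1. -/
theorem uData_trivial : UData (m := m) (n := n) (1 : Kˣ) (fun _ _ => 1) (fun _ _ => 0)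
    (fun _ _ _ => 0) where
  central b := Commute.one_left b
  zero _ _ := one_mul 1
  zero_zero _ _ _ _ := Commute.one_left _
  zero_log _ _ _ _ _ := Commute.one_left _
  log_zero _ _ := map_zero _
  log_log _ _ _ _ _ := mul_comm _ _
  heis _ _ _ _ _ := by simp
  zero_x _ _ _ _ _ := by simp
  log_x _ _ _ _ _ _ := by simp
  serre ε := by
    constructor
    · intros; simp [sBr, wtd]
    · intros; simp [qBr, wtd]
    · intros; simp [qBr, wtd]
    · intros; simp [qBr, sBr, wtd]
  quad _ := by intro i j _ k l; simp
  plus_minus i j k p := by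
    have h := (IsExp.one (⊤ : Subalgebra K K)).eq.symm
    rw [map_one, one_mul] at h
    simp [sBr, wtd, h, modes_one]

theorem nontrivial_Uq (hm : 0 < m) : Nontrivial (Uq m n) :=
  (UData.lift hm (uData_trivial (m := m) (n := n)) : Uq m n →+* K).domain_nontrivial

/-- As U_q is not zero, K embeds in it, and over a field this is preserved by tensoring with
`ZRing`. -/
theorem UZ.inr_injective (hm : 0 < m) : Function.Injective (UZ.inr m n) := by
  have := nontrivial_Uq (n := n) hm
  exact Algebra.TensorProduct.includeRight_injective (R := K) (A := Uq m n) (B := ZRing)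
    (FaithfulSMul.algebraMap_injective K (Uq m n))

theorem zHom_injective (hm : 0 < m) : Function.Injective (zHom (n := n) hm) := by
  have h : ⇑(zHom (n := n) hm) = thetaEquiv hm ∘ UZ.inr m n :=
    funext fun z => (thetaHom_inr hm z).symm
  rw [h]
  exact (thetaEquiv hm).injective.comp (UZ.inr_injective hm)

/-- Followed by the inclusion into A_q, this is squaring of the invertible generator followed by
`zHom`, a composition of two injective maps. -/
theorem Aq.cHom_injective (hm : 0 < m) : Function.Injective (Aq.cHom (n := n) hm) := by
  obtain ⟨φ, hφ, ht, hg⟩ := exists_squaring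
  have h : (Aq.cAlg m n).val.comp (Aq.cHom hm) = (zHom hm).comp φ := by
    refine ZRing.algHom_ext (fun ε => ?_) fun ε r => ?_
    · rw [AlgHom.comp_apply, AlgHom.comp_apply, ht, map_pow, Aq.cHom, zHom, CentralData.hom_zT,
        CentralData.hom_zT]
      exact Aq.coeff_zero_cSer ε
    · rw [AlgHom.comp_apply, AlgHom.comp_apply, hg, Aq.cHom, zHom, CentralData.hom_zG,
        CentralData.hom_zG]
      rfl
  refine Function.Injective.of_comp (f := (Aq.cAlg m n).val) ?_
  have h' : ⇑(Aq.cAlg m n).val ∘ ⇑(Aq.cHom (n := n) hm) = zHom hm ∘ φ :=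
    congrArg (fun f : ZRing →ₐ[K] Aq m n => ⇑f) h
  rw [h']
  exact (zHom_injective hm).comp hφ

/-- The free commutative algebra is isomorphic to the subalgebra generated by the coefficients of
`c^±`. -/
def cEquiv (hm : 0 < m) : ZRing ≃ₐ[K] Aq.cAlg m n :=
  AlgEquiv.ofBijective (Aq.cHom hm) ⟨Aq.cHom_injective hm, Aq.cHom_surjective hm⟩

theorem cEquiv_symm_cCoeff (hm : 0 < m) (ε : ℤˣ) (p : ℕ) :
    (cEquiv hm).symm (Aq.cCoeff m n ε p) = zCoeff ε p := by
  rw [AlgEquiv.symm_apply_eq]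
  exact (Aq.cHom_zCoeff hm ε p).symm

/-- The isomorphism of the tensor product of `U_q` with the central subalgebra to `A_q`. -/
def psiEquiv (hm : 0 < m) : (Uq m n ⊗[K] Aq.cAlg m n) ≃ₐ[K] Aq m n :=
  (Algebra.TensorProduct.congr AlgEquiv.refl (cEquiv hm).symm :
    (Uq m n ⊗[K] Aq.cAlg m n) ≃ₐ[K] UZ m n).trans (thetaEquiv hm)

theorem psiEquiv_tmul (hm : 0 < m) (u : Uq m n) (y : Aq.cAlg m n) :
    psiEquiv hm (u ⊗ₜ[K] y) = tau hm u * zHom hm ((cEquiv hm).symm y) :=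
  Algebra.TensorProduct.lift_tmul
    (hfg := fun u z => ((Aq.centralData hm).hom_comm z (tau hm u)).symm) ..

theorem psiEquiv_tmul_one (hm : 0 < m) (u : Uq m n) : psiEquiv hm (u ⊗ₜ[K] 1) = tau hm u := by
  rw [psiEquiv_tmul, map_one, map_one, mul_one]

theorem tau_Phi_eq (hm : 0 < m) (ε : ℤˣ) (i : Fin (m + n)) (p : ℕ) :
    tau hm (Uq.Phi ε i p) = coeff p
      (dilate ε (q ^ (-nu n i)) (Aq.h ε i.succ * Aq.hInv ε i.castSucc)) := by
  rw [tau, UData.lift_Phi, tau_Phi, ← Aq.hRel.hRat_eq, Aq.hSer_hZero, Aq.hSer_hZero, Aq.hZero_eq]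
  rfl

/-! ### Parity -/

/-- A family of subspaces compatible with the multiplication. -/
structure IsGraded (P : ZMod 2 → Submodule K B) : Prop where
  one : 1 ∈ P 0
  mul {p p' : ZMod 2} {a b : B} (ha : a ∈ P p) (hb : b ∈ P p') : a * b ∈ P (p + p')

namespace IsGraded

variable {P : ZMod 2 → Submodule K B} (hP : IsGraded P)

/-- The subalgebra of even elements. -/
def even : Subalgebra K B where
  carrier := P 0
  mul_mem' ha hb := by simpa using hP.mul ha hb
  add_mem' := (P 0).add_mem
  algebraMap_mem' r := by
    rw [Algebra.algebraMap_eq_smul_one]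
    exact (P 0).smul_mem r hP.one

theorem mem_even {b : B} : b ∈ hP.even ↔ b ∈ P 0 := Iff.rfl

include hP

theorem comap (φ : A →ₐ[K] B) : IsGraded fun p => (P p).comap φ.toLinearMap where
  one := by simpa using hP.one
  mul ha hb := by
    simp only [Submodule.mem_comap, AlgHom.toLinearMap_apply, map_mul] at ha hb ⊢
    exact hP.mul ha hb

theorem superPart_le {Y : Type*} {gen : Y → B} {deg : Y → ℤ} (h : ∀ y, gen y ∈ P (deg y : ℤ))
    (p : ZMod 2) : superPart gen deg p ≤ P p := by
  refine Submodule.span_le.mpr ?_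
  rintro _ ⟨l, rfl, rfl⟩
  induction l with
  | nil => simpa using hP.one
  | cons y l ih =>
    simp only [List.map_cons, List.prod_cons, List.sum_cons, Int.cast_add]
    exact hP.mul (h y) ih

theorem superPart_le_comap {Y : Type*} {gen : Y → A} {deg : Y → ℤ} (φ : A →ₐ[K] B)
    (h : ∀ y, φ (gen y) ∈ P (deg y : ℤ)) {p : ZMod 2} {a : A} (ha : a ∈ superPart gen deg p) :
    φ a ∈ P p :=
  (hP.comap φ).superPart_le h p ha

end IsGraded

theorem isGraded_span {S : ZMod 2 → Set B} (h1 : 1 ∈ S 0)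
    (hm : ∀ p p', ∀ a ∈ S p, ∀ b ∈ S p', a * b ∈ S (p + p')) :
    IsGraded fun p => Submodule.span K (S p) where
  one := Submodule.subset_span h1
  mul {p p' a b} ha hb := by
    have h := Submodule.mul_mem_mul ha hb
    rw [Submodule.span_mul_span] at h
    refine Submodule.span_mono ?_ h
    rintro _ ⟨x, hx, y, hy, rfl⟩
    exact hm p p' x hx y hy

theorem isGraded_superPart {Y : Type*} (gen : Y → B) (deg : Y → ℤ) :
    IsGraded (superPart gen deg) := by
  refine isGraded_span ⟨[], by simp, by simp⟩ ?_
  rintro p p' _ ⟨l, rfl, rfl⟩ _ ⟨l', rfl, rfl⟩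
  exact ⟨l ++ l', by simp, by simp⟩

theorem gen_mem_superPart {Y : Type*} (gen : Y → B) (deg : Y → ℤ) (y : Y) :
    gen y ∈ superPart gen deg (deg y : ℤ) :=
  Submodule.subset_span ⟨[y], by simp, by simp⟩

/-! ### Subalgebras that contain values in logarithmic form -/

section Subalgebra

variable (M : Subalgebra K B)

/-- The construction can be repeated inside the subalgebra, and by uniqueness it gives the same
homomorphism. -/
theorem CentralData.hom_mem {t : ℤˣ → B} {g : ℤˣ → ℕ → B} (Z : CentralData t g)
    (ht : ∀ ε, t ε ∈ M) (hg : ∀ ε r, g ε r ∈ M) (z : ZRing) : Z.hom z ∈ M := by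
  have Z' : CentralData (fun ε => (⟨t ε, ht ε⟩ : M)) (fun ε r => ⟨g ε r, hg ε r⟩) :=
    ⟨fun ε => Subtype.ext (Z.mul ε), fun ε b => Subtype.ext (Z.comm_t ε (b : B)).eq,
      fun ε r b => Subtype.ext (Z.comm_g ε r (b : B)).eq, fun ε => Subtype.ext (Z.zero ε)⟩
  have h : M.val.comp Z'.hom = Z.hom := by
    refine ZRing.algHom_ext (fun ε => ?_) fun ε r => ?_
    · rw [AlgHom.comp_apply, Z'.hom_zT, Z.hom_zT]; rfl
    · rw [AlgHom.comp_apply, Z'.hom_zG, Z.hom_zG]; rfl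
  rw [← h]
  exact (Z'.hom z).2

theorem coeff_C_mul_expL_mem {b : B} (hb : b ∈ M) {l : PowerSeries B} (h : ∀ p, coeff p l ∈ M)
    (p : ℕ) : coeff p (C b * expL l) ∈ M := by
  rw [coeff_C_mul]
  exact M.mul_mem hb (coeff_expL_mem M h p)

theorem extZero_mem {κ : ℤˣ → Fin (m + n) → B} {t : ℤˣ → B} (hκ : ∀ ε i, κ ε i ∈ M)
    (ht : ∀ ε, t ε ∈ M) (ε : ℤˣ) (i : Fin (m + n + 1)) : extZero κ t ε i ∈ M := by
  induction i using Fin.reverseInduction with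
  | last => rw [extZero_last]; exact ht ε
  | cast i ih => rw [extZero_castSucc]; exact M.mul_mem (hκ _ _) ih

theorem coeff_extLog_mem {ψ : ℤˣ → Fin (m + n) → PowerSeries B} {g : ℤˣ → ℕ → B}
    (hψ : ∀ ε i r, coeff r (ψ ε i) ∈ M) (hg : ∀ ε r, g ε r ∈ M) (ε : ℤˣ) (i : Fin (m + n + 1))
    (r : ℕ) : coeff r (extLog ψ g ε i) ∈ M := by
  have hp : ∀ j, preLog ψ ε r j ∈ M := fun j => by
    refine M.sum_mem fun k _ => ?_
    split_ifs
    · exact M.smul_mem (hψ _ _ _) _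
    · exact M.zero_mem
  rw [extLog, coeff_mk]
  exact M.add_mem (M.smul_mem (M.sub_mem (hg _ _) (M.sum_mem fun j _ => M.smul_mem (hp j) _)) _)
    (hp i)

end Subalgebra

/-! ### Parity of the isomorphism -/

theorem Uq.isGraded (m n : ℕ) : IsGraded (Uq.part m n) := isGraded_superPart _ _

theorem Uq.gen_mem (y : UGen m n) :
    Uq.proj m n (FreeAlgebra.ι K y) ∈ Uq.part m n (Uq.deg y : ℤ) := gen_mem_superPart _ _ y

theorem Uq.gen_mem_zero {y : UGen m n} (hy : Uq.deg y = 0) :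
    Uq.proj m n (FreeAlgebra.ι K y) ∈ Uq.part m n 0 := by
  have := Uq.gen_mem y
  rwa [hy, Int.cast_zero] at this

theorem Uq.kap_mem (ε : ℤˣ) (i : Fin (m + n)) : Uq.kap ε i ∈ Uq.part m n 0 := by
  rcases Int.units_eq_one_or ε with rfl | rfl
  · rw [Uq.kap_one]
    exact Uq.gen_mem_zero rfl
  · rw [Uq.kap_neg_one]
    exact Uq.gen_mem_zero rfl

theorem Uq.coeff_psi_mem (ε : ℤˣ) (i : Fin (m + n)) (r : ℕ) :
    coeff r (Uq.psi ε i) ∈ Uq.part m n 0 := by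
  rw [Uq.coeff_psi, UFree.a]
  refine Submodule.smul_mem _ _ ?_
  split_ifs with hr
  · exact Uq.gen_mem_zero rfl
  · rw [map_zero]
    exact Submodule.zero_mem _

namespace Aq

theorem isGraded (m n : ℕ) : IsGraded (part m n) := isGraded_superPart _ _

theorem gen_mem (y : AGen m n) :
    proj m n (FreeAlgebra.ι K y) ∈ part m n (deg y : ℤ) := gen_mem_superPart _ _ y

theorem gen_mem_zero {y : AGen m n} (hy : deg y = 0) :
    proj m n (FreeAlgebra.ι K y) ∈ part m n 0 := by
  have := gen_mem y
  rwa [hy, Int.cast_zero] at this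

theorem coeff_h_mem (ε : ℤˣ) (i : Fin (m + n + 1)) (p : ℕ) :
    coeff p (h ε i) ∈ (isGraded m n).even := by
  rw [IsGraded.mem_even, h, coeff_mk]
  exact gen_mem_zero rfl

theorem coeff_logH_mem (ε : ℤˣ) (i : Fin (m + n + 1)) (r : ℕ) :
    coeff r (logH ε i) ∈ (isGraded m n).even := by
  rw [logH]
  refine coeff_mul_mem _ (fun p => ?_)
    (coeff_seriesInv_mem _ (coeff_h_mem _ _ _) (coeff_h_mem ε i)) r
  rw [coeff_eulerD]
  exact Subalgebra.nsmul_mem _ (coeff_h_mem _ _ _) _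

theorem zHom_mem (hm : 0 < m) (z : ZRing) : zHom hm z ∈ part m n 0 :=
  CentralData.hom_mem (isGraded m n).even (centralData hm) (fun ε => coeff_h_mem ε _ 0)
    (fun ε r => Subalgebra.sum_mem _ fun i _ => Subalgebra.smul_mem _ (coeff_logH_mem ε i r) _) z

/-- It suffices to look at generators: x_i^± goes to a multiple of a mode of X_i^∓, which has the
same parity, and the even generators go to expressions in the even coefficients of the h_i^±, or to
q^{±c/2}. -/
theorem tau_mem (hm : 0 < m) {p : ZMod 2} {u : Uq m n} (hu : u ∈ Uq.part m n p) :
    tau hm u ∈ part m n p := by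
  have hψ : ∀ ε i r, coeff r (tauPsi logH ε i) ∈ (isGraded m n).even := fun ε i r => by
    rw [coeff_tauPsi]
    exact Subalgebra.smul_mem _ (Subalgebra.sub_mem _ (coeff_logH_mem ε _ r) (coeff_logH_mem ε _ r)) _
  have hκ : ∀ ε i, tauKap hZero ε i ∈ (isGraded m n).even := fun ε i =>
    Subalgebra.mul_mem _ (coeff_h_mem ε _ 0) (coeff_h_mem (-ε) _ 0)
  refine (isGraded m n).superPart_le_comap (tau hm) (fun y => ?_) hu
  rw [tau, UData.lift_proj, uEval_ι]
  cases y with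
  | x ε i k => exact Submodule.smul_mem _ _ (gen_mem (.X (-ε) i k))
  | a i r =>
    change _ ∈ part m n ((0 : ℤ) : ZMod 2)
    rw [Int.cast_zero]
    exact Submodule.smul_mem _ _ (hψ _ _ _)
  | k i =>
    change _ ∈ part m n ((0 : ℤ) : ZMod 2)
    rw [Int.cast_zero]
    exact hκ 1 i
  | kInv i =>
    change _ ∈ part m n ((0 : ℤ) : ZMod 2)
    rw [Int.cast_zero]
    exact hκ (-1) i
  | c => exact gen_mem .c
  | cInv => exact gen_mem .cInv

end Aq

namespace UZ

/-- The even and odd parts of the tensor product. -/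
def part (m n : ℕ) (p : ZMod 2) : Submodule K (UZ m n) :=
  Submodule.span K {b | ∃ u ∈ Uq.part m n p, ∃ z, b = inl m n u * inr m n z}

theorem isGraded (m n : ℕ) : IsGraded (part m n) := by
  refine isGraded_span ⟨1, (Uq.isGraded m n).one, 1, by simp⟩ ?_
  rintro p p' _ ⟨u, hu, z, rfl⟩ _ ⟨u', hu', z', rfl⟩
  refine ⟨u * u', (Uq.isGraded m n).mul hu hu', z * z', ?_⟩
  rw [map_mul, map_mul, mul_assoc, mul_assoc, ← mul_assoc (inr m n z), (commute_inr z _).eq,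
    mul_assoc]

theorem inl_mem {p : ZMod 2} {u : Uq m n} (hu : u ∈ Uq.part m n p) : inl m n u ∈ part m n p :=
  Submodule.subset_span ⟨u, hu, 1, by rw [map_one, mul_one]⟩

theorem inr_mem (z : ZRing) : inr m n z ∈ part m n 0 :=
  Submodule.subset_span ⟨1, (Uq.isGraded m n).one, z, by rw [map_one, one_mul]⟩

theorem sigma_mem (hm : 0 < m) {p : ZMod 2} {a : Aq m n} (ha : a ∈ Aq.part m n p) :
    sigma hm a ∈ part m n p := by
  refine (isGraded m n).superPart_le_comap (sigma hm) (fun y => ?_) ha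
  rw [sigma, AData.lift_proj, aEval_ι]
  cases y with
  | h ε i r =>
    have h1 : UZ.hZero ε i ∈ (isGraded m n).even :=
      extZero_mem _ (fun ε i => inl_mem (Uq.kap_mem ε i)) (fun ε => inr_mem (zT ε)) ε i
    have h2 : ∀ r, coeff r (UZ.logH ε i) ∈ (isGraded m n).even := fun r =>
      coeff_extLog_mem _ (fun ε i r => by
        rw [PowerSeries.coeff_map]
        exact inl_mem (Uq.coeff_psi_mem ε i r)) (fun ε r => inr_mem (zG ε r)) ε i r
    have h3 := coeff_C_mul_expL_mem (isGraded m n).even h1 h2 r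
    change _ ∈ part m n ((0 : ℤ) : ZMod 2)
    rw [Int.cast_zero]
    exact h3
  | X ε i k => exact Submodule.smul_mem _ _ (inl_mem (Uq.gen_mem (.x (-ε) i k)))
  | c => exact inl_mem (Uq.gen_mem .c)
  | cInv => exact inl_mem (Uq.gen_mem .cInv)

end UZ

/-- One inclusion holds because τ preserves parity and `zHom` has even values. For the other, a
homogeneous element of A_q is the image under `thetaHom` of its image under `sigma`, which is
homogeneous of the same parity. -/
theorem map_psiEquiv (hm : 0 < m) (p : ZMod 2) :
    Submodule.map (psiEquiv hm).toLinearMap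
      (Submodule.span K {t | ∃ u ∈ Uq.part m n p, ∃ y : Aq.cAlg m n, t = u ⊗ₜ[K] y}) =
        Aq.part m n p := by
  refine le_antisymm ?_ fun a ha => ?_
  · rw [Submodule.map_le_iff_le_comap, Submodule.span_le]
    rintro _ ⟨u, hu, y, rfl⟩
    change psiEquiv hm (u ⊗ₜ[K] y) ∈ Aq.part m n p
    have h := (Aq.isGraded m n).mul (Aq.tau_mem hm hu) (Aq.zHom_mem hm ((cEquiv hm).symm y))
    rwa [add_zero, ← psiEquiv_tmul] at h
  · have h : UZ.part m n p ≤ Submodule.comap (thetaHom hm).toLinearMap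
        (Submodule.map (psiEquiv hm).toLinearMap
          (Submodule.span K {t | ∃ u ∈ Uq.part m n p, ∃ y : Aq.cAlg m n, t = u ⊗ₜ[K] y})) := by
      refine Submodule.span_le.mpr ?_
      rintro _ ⟨u, hu, z, rfl⟩
      refine ⟨u ⊗ₜ[K] cEquiv hm z, Submodule.subset_span ⟨u, hu, _, rfl⟩, ?_⟩
      change psiEquiv hm _ = thetaHom hm _
      rw [psiEquiv_tmul, map_mul, thetaHom_inl, thetaHom_inr, AlgEquiv.symm_apply_apply]
    have h2 := h (UZ.sigma_mem hm ha)
    rw [Submodule.mem_comap] at h2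
    rwa [AlgHom.toLinearMap_apply, ← AlgHom.comp_apply, thetaHom_comp_sigma, AlgHom.id_apply] at h2

end OspAffine

end

/-! ### The isomorphism Ψ -/

open OspAffine in
theorem proposition6 (m n : ℕ) (hm : 0 < m) :
    ∃ Ψ : (Uq m n ⊗[K] Aq.cAlg m n) ≃ₐ[K] Aq m n,
      -- `Ψ` respects the parity (the algebra `𝔠` is even)
      (∀ p : ZMod 2,
        Submodule.map Ψ.toLinearMap
          (Submodule.span K {t | ∃ u ∈ Uq.part m n p, ∃ y : Aq.cAlg m n, t = u ⊗ₜ[K] y})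
            = Aq.part m n p) ∧
      -- the restriction of `Ψ` to the first factor
      Ψ (Uq.c m n ⊗ₜ[K] 1) = Aq.c m n ∧
      (∀ (i : Fin (m + n)) (k : ℤ),
        Ψ (Uq.x 1 i k ⊗ₜ[K] 1) =
          ((qNode i - (qNode i)⁻¹)⁻¹ * (q ^ (-nu n i)) ^ k) • Aq.X (-1) i k) ∧
      (∀ (i : Fin (m + n)) (k : ℤ),
        Ψ (Uq.x (-1) i k ⊗ₜ[K] 1) =
          (-superSign (root i) (root i) * (qNode i - (qNode i)⁻¹)⁻¹ * (q ^ (-nu n i)) ^ k) •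
            Aq.X 1 i k) ∧
      (∀ (ε : ℤˣ) (i : Fin (m + n)) (p : ℕ),
        Ψ (Uq.Phi ε i p ⊗ₜ[K] 1) =
          PowerSeries.coeff p
            (dilate ε (q ^ (-nu n i)) (Aq.h ε i.succ * Aq.hInv ε i.castSucc))) ∧
      -- the restriction of `Ψ` to the second factor
      (∀ (ε : ℤˣ) (p : ℕ),
        Ψ (1 ⊗ₜ[K] Aq.cCoeff m n ε p) =
          Aq.hCoeff (-ε) (Fin.last _) 0 * (Aq.cCoeff m n ε p : Aq m n)) := by
  refine ⟨psiEquiv hm, map_psiEquiv hm, ?_, fun i k => ?_, fun i k => ?_, fun ε i p => ?_,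
    fun ε p => ?_⟩
  · rw [psiEquiv_tmul_one, tau, UData.lift_c, Aq.val_cUnit]
  · rw [psiEquiv_tmul_one, tau, UData.lift_x, tauX, xScale, if_pos rfl]
  · rw [psiEquiv_tmul_one, tau, UData.lift_x, tauX, xScale, if_neg (by decide), neg_neg]
  · rw [psiEquiv_tmul_one, tau_Phi_eq]
  · rw [psiEquiv_tmul, map_one, one_mul, cEquiv_symm_cCoeff, Aq.zHom_zCoeff]
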